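/- Let $G$ be a simple simply connected complex algebraic group of rank $r$, with opposite Borel subgroups $B_\pm$ containing a maximal torus $H=B_+\cap B_-$, unipotent radicals $N_\pm\subset B_\pm$, Chevalley generators $\{e_i,f_i,\check\alpha_i\}_{i=1,\dots,r}$ (numbered in an arbitrary fixed order), and simple reflections $w_i$ with arbitrary lifts $s_i\in N_G(H)\subset G$. For a closed subgroup $K\subset G$ write $K(z)=K(\mathbb{C}(z))$; all products $\prod_i$ are taken in the fixed order. Let $\hbar\in\mathbb{C}^\times$ and $M_\hbar:u\mapsto\hbar u$ on $\mathbb{P}^1$. A meromorphic $(G,\hbar)$-connection on a principal $G$-bundle $\mathcal{F}_G$ on $\mathbb{P}^1$ (Zariski topology) is a section $A$ of $\mathrm{Hom}(\mathcal{F}_G,M_\hbar^*\mathcal{F}_G)$ over a Zariski open dense subset. A Miura $(G,\hbar)$-oper is a quadruple $(\mathcal{F}_G,A,\mathcal{F}_{B_-},\mathcal{F}_{B_+})$, where $A$ is a meromorphic $(G,\hbar)$-connection on $\mathcal{F}_G$, $\mathcal{F}_{B_+}$ is a reduction of $\mathcal{F}_G$ to $B_+$ preserved by $A$, and $\mathcal{F}_{B_-}$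 is a reduction of $\mathcal{F}_G$ to $B_-$ such that for some Zariski open dense $U\subset\mathbb{P}^1$ and some trivialization of $\mathcal{F}_{B_-}$ over $U$ the connection, restricted to $U'=U\cap M_\hbar^{-1}(U)$, lies in $B_-(\mathbb{C}[U'])\,c\,B_-(\mathbb{C}[U'])$ with $c=\prod_i s_i$. (i) For every Miura $(G,\hbar)$-oper there are $\phi_1,\dots,\phi_r\in\mathbb{C}(z)^\times$ and a trivialization of $\mathcal{F}_{B_-}$ over an open dense subset of $\mathbb{P}^1$ in which the connection lies in $N_-(z)\prod_i(\phi_i(z)^{\check\alpha_i}s_i)N_-(z)$. Moreover, for every such $(\phi_i)$ there is a trivialization of $\mathcal{F}_G$ over an open dense subset of $\mathbb{P}^1$, compatible with both reductions $\mathcal{F}_{B_-}$ and $\mathcal{F}_{B_+}$, in which the connection has the form $$A(z)\in N_-(z)\prod_i\big(\phi_i(z)^{\check\alpha_i}s_i\big)N_-(z)\;\cap\;B_+(z).$$ (ii) There are constants $t_1,\dots,t_r\in\mathbb{C}^\times$, determined by the ordered family of lifts $(s_i)$, such that for all $\phi_1,\dots,\phi_r\in\mathbb{C}(z)^\times$ every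 element of this intersection can be written as $$\prod_i g_i(z)^{\check\alpha_i}\exp\!\Big(\frac{t_i\,\phi_i(z)}{g_i(z)}\,e_i\Big),\qquad g_1,\dots,g_r\in\mathbb{C}(z)^\times .$$ If each $s_i$ lies in the $SL_2$-subgroup of $G$ generated by the root subgroups of $\pm\alpha_i$, then $t_i$ depends only on $i$ and $s_i$, not on the other lifts or on the order. -/

import Mathlib

open scoped Polynomial

/- The commutator bracket on matrices. -/
attribute [local instance 100] LieRing.ofAssociativeRing

noncomputable section

namespace HOper

universe u

/-! ### The projective line: regular functions and regular maps to matrix groups -/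

/-- The complex projective line (its set of closed points). -/
abbrev P1 : Type := OnePoint ℂ

/-- The nonempty Zariski open subsets of the projective line are the sets with finite complement;
each of them is dense. -/
def IsOpenDense (U : Set P1) : Prop := Uᶜ.Finite

/-- The rational function `r` is regular at the point `x` and takes the value `v` there. -/
def HasValueAt (r : RatFunc ℂ) : P1 → ℂ → Prop
  | OnePoint.some z, v => ∃ p q : ℂ[X], q.eval z ≠ 0 ∧
      r = algebraMap ℂ[X] (RatFunc ℂ) p / algebraMap ℂ[X] (RatFunc ℂ) q ∧
      v = p.eval z / q.eval z
  | OnePoint.infty, v => ∃ p q : ℂ[X], q ≠ 0 ∧ p.natDegree ≤ q.natDegree ∧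
      r = algebraMap ℂ[X] (RatFunc ℂ) p / algebraMap ℂ[X] (RatFunc ℂ) q ∧
      v = p.coeff q.natDegree / q.leadingCoeff

/-- `f` restricts to a regular function on the open set `V` (its values off `V` are irrelevant). -/
def IsRegularOn (V : Set P1) (f : P1 → ℂ) : Prop :=
  ∃ r : RatFunc ℂ, ∀ x ∈ V, HasValueAt r x (f x)

/-- The map `u ↦ ħ u` of the projective line. -/
def scale (ħ : ℂˣ) : P1 → P1 := OnePoint.map (fun u => (ħ : ℂ) * u)

section Groups

variable {n : ℕ}

/-- `a` restricts to a regular map from the open set `V` to the algebraic group `K`. -/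
def IsRegularMap (K : Subgroup (GL (Fin n) ℂ)) (V : Set P1) (a : P1 → GL (Fin n) ℂ) : Prop :=
  (∀ i j, IsRegularOn V (fun x => (a x : Matrix (Fin n) (Fin n) ℂ) i j)) ∧ ∀ x ∈ V, a x ∈ K

/-- `K(R)`: the `R`-points of a Zariski closed subgroup `K` of `GL_n` over `ℂ`, i.e. the invertible
matrices over `R` that satisfy all the polynomial equations satisfied by `K`. -/
def points (K : Subgroup (GL (Fin n) ℂ)) (R : Type*) [CommRing R] [Algebra ℂ R] :
    Set (Matrix (Fin n) (Fin n) R) :=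
  {M | IsUnit M ∧ ∀ p : MvPolynomial (Fin n × Fin n) ℂ,
    (∀ g ∈ K, MvPolynomial.eval
      (fun ij => (g : Matrix (Fin n) (Fin n) ℂ) ij.1 ij.2) p = 0) →
    MvPolynomial.aeval (fun ij => M ij.1 ij.2) p = 0}

end Groups

/-! ### Principal bundles on the projective line, reductions, `ħ`-connections -/

section Bundles

variable {n : ℕ}

/-- An algebraic principal `G`-bundle on the projective line, locally trivial in the Zariski
topology: a family of right `G`-torsors with an atlas of local trivializing sections whose
transition functions are regular. -/
structure PrincipalBundle (G : Subgroup (GL (Fin n) ℂ)) where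
  Total : Type u
  proj : Total → P1
  act : Total → G → Total
  act_one : ∀ p, act p 1 = p
  act_mul : ∀ p g h, act (act p g) h = act p (g * h)
  proj_act : ∀ p g, proj (act p g) = proj p
  torsor : ∀ p q, proj p = proj q → ∃! g : G, act p g = q
  /-- Pairs of a nonempty open set and a section over it. -/
  charts : Set (Set P1 × (P1 → Total))
  chart_open : ∀ c ∈ charts, IsOpenDense c.1
  chart_section : ∀ c ∈ charts, ∀ x ∈ c.1, proj (c.2 x) = x
  chart_cover : ∀ x, ∃ c ∈ charts, x ∈ c.1
  transition : ∀ c ∈ charts, ∀ d ∈ charts, ∃ a : P1 → G,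
    IsRegularMap G (c.1 ∩ d.1) (fun x => (a x : GL (Fin n) ℂ)) ∧
    ∀ x ∈ c.1 ∩ d.1, d.2 x = act (c.2 x) (a x)

variable {G : Subgroup (GL (Fin n) ℂ)}

/-- `s` restricts to a regular section of the bundle over the open set `V`; this is the same thing
as a trivialization of the bundle over `V`. -/
def PrincipalBundle.IsSection (F : PrincipalBundle.{u} G) (V : Set P1) (s : P1 → F.Total) : Prop :=
  (∀ x ∈ V, F.proj (s x) = x) ∧
  ∀ c ∈ F.charts, ∃ a : P1 → G,
    IsRegularMap G (V ∩ c.1) (fun x => (a x : GL (Fin n) ℂ)) ∧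
    ∀ x ∈ V ∩ c.1, s x = F.act (c.2 x) (a x)

/-- A meromorphic `(G, ħ)`-connection on `F`: a section over an open dense set `dom` of
`Hom(F, F^ħ)`, where `F^ħ` is the pullback of `F` under `u ↦ ħ u`. Since the fibre of `F^ħ` at `u`
is the fibre of `F` at `ħ u`, it is given by `G`-equivariant maps from the fibre of `F` at `u` to the
fibre at `ħ u` (values of `toFun` over points off `dom` are irrelevant). -/
structure Connection (ħ : ℂˣ) (F : PrincipalBundle.{u} G) where
  dom : Set P1
  dom_open : IsOpenDense dom
  toFun : F.Total → F.Total
  proj_toFun : ∀ p, F.proj p ∈ dom → F.proj (toFun p) = scale ħ (F.proj p)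
  equivariant : ∀ p g, F.proj p ∈ dom → toFun (F.act p g) = F.act (toFun p) g
  regular : ∀ c ∈ F.charts, ∀ d ∈ F.charts, ∃ a : P1 → G,
    IsRegularMap G {x | x ∈ c.1 ∧ x ∈ dom ∧ scale ħ x ∈ d.1} (fun x => (a x : GL (Fin n) ℂ)) ∧
    ∀ x, x ∈ c.1 → x ∈ dom → scale ħ x ∈ d.1 →
      toFun (c.2 x) = F.act (d.2 (scale ħ x)) (a x)

/-- A reduction of the `G`-bundle `F` to the subgroup `K`: a subset of the total space which is,
locally in the Zariski topology, the `K`-orbit of a regular section. -/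
structure Reduction (F : PrincipalBundle.{u} G) (K : Subgroup (GL (Fin n) ℂ)) where
  carrier : Set F.Total
  locally_trivial : ∀ x, ∃ V : Set P1, IsOpenDense V ∧ x ∈ V ∧ ∃ s, F.IsSection V s ∧
    ∀ p, F.proj p ∈ V →
      (p ∈ carrier ↔ ∃ k : G, (k : GL (Fin n) ℂ) ∈ K ∧ p = F.act (s (F.proj p)) k)

/-- `s` trivializes the reduction over the open dense set `U`. -/
def Reduction.IsTrivialization {F : PrincipalBundle.{u} G} {K : Subgroup (GL (Fin n) ℂ)}
    (E : Reduction F K) (U : Set P1) (s : P1 → F.Total) : Prop :=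
  F.IsSection U s ∧ ∀ x ∈ U, s x ∈ E.carrier

/-- The oper condition: for some trivialization of the `B₋`-reduction over an open dense `U`, the
matrix of the connection on `U ∩ M_ħ⁻¹(U)` is the product `b c b'` of regular maps
`b, b' : U ∩ M_ħ⁻¹(U) → B₋` and the fixed element `c`. -/
def IsOper {ħ : ℂˣ} {F : PrincipalBundle.{u} G} (A : Connection ħ F)
    {Bminus : Subgroup (GL (Fin n) ℂ)} (Fminus : Reduction F Bminus) (c : GL (Fin n) ℂ) : Prop :=
  ∃ (U : Set P1) (s : P1 → F.Total), IsOpenDense U ∧ Fminus.IsTrivialization U s ∧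
    ∃ b b' : P1 → GL (Fin n) ℂ,
      IsRegularMap Bminus (U ∩ scale ħ ⁻¹' U) b ∧ IsRegularMap Bminus (U ∩ scale ħ ⁻¹' U) b' ∧
      ∀ x ∈ U ∩ scale ħ ⁻¹' U, x ∈ A.dom ∧
        ∃ g : G, (g : GL (Fin n) ℂ) = b x * c * b' x ∧
          A.toFun (s x) = F.act (s (scale ħ x)) g

/-- A Miura `(G, ħ)`-oper, for Borel subgroups `B₋`, `B₊` and a representative `c` of the Coxeter
element. -/
structure MiuraOper (ħ : ℂˣ) (G Bminus Bplus : Subgroup (GL (Fin n) ℂ)) (c : GL (Fin n) ℂ) where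
  bundle : PrincipalBundle.{u} G
  conn : Connection ħ bundle
  minus : Reduction bundle Bminus
  oper : IsOper conn minus c
  plus : Reduction bundle Bplus
  preserved : ∀ p ∈ plus.carrier, bundle.proj p ∈ conn.dom → conn.toFun p ∈ plus.carrier

/-- In the trivialization of `F` over `U` given by the section `s`, the connection is written as
the matrix `M` of rational functions. -/
def IsConnectionMatrix {ħ : ℂˣ} {F : PrincipalBundle.{u} G} (A : Connection ħ F)
    (U : Set P1) (s : P1 → F.Total) (M : Matrix (Fin n) (Fin n) (RatFunc ℂ)) : Prop :=
  ∀ x ∈ U ∩ scale ħ ⁻¹' U, x ∈ A.dom ∧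
    ∃ g : G, A.toFun (s x) = F.act (s (scale ħ x)) g ∧
      ∀ i j, HasValueAt (M i j) x (((g : GL (Fin n) ℂ) : Matrix (Fin n) (Fin n) ℂ) i j)

end Bundles

/-! ### The simple simply connected group

`L` is a simple complex Lie algebra, `H` a Cartan subalgebra, `b` a base of the root system, and
`ρ` a finite-dimensional representation of `L`. The group `chevalleyGroup H ρ` generated by the
`exp (ρ x)`, `x` a root vector, is the connected simple algebraic subgroup of `GL_n` with Lie algebra
`ρ(L)`. Every simple complex algebraic group arises in this way, and the group is simply connected
exactly when the weights of `ρ` generate the weight lattice. -/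

section Chevalley

open LieAlgebra LieAlgebra.IsKilling

variable {n : ℕ} {L : Type*} [LieRing L] [LieAlgebra ℂ L] [FiniteDimensional ℂ L]
  [LieAlgebra.IsSimple ℂ L] (H : LieSubalgebra ℂ L) [H.IsCartanSubalgebra]
  (ρ : L →ₗ⁅ℂ⁆ Matrix (Fin n) (Fin n) ℂ)

/-- `μ` is a weight of the Cartan subalgebra on `ℂⁿ`. -/
def IsWeight (μ : Module.Dual ℂ H) : Prop :=
  ∃ v : Fin n → ℂ, v ≠ 0 ∧ ∀ h : H, (ρ (h : L)).mulVec v = μ h • v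

/-- Simple connectedness: the character lattice of the maximal torus (spanned by the weights
of `ρ`) contains the whole weight lattice. -/
def IsSimplyConnected : Prop :=
  ∀ μ : Module.Dual ℂ H, (∀ α : H.root, ∃ k : ℤ, μ ((rootSystem H).coroot α) = k) →
    μ ∈ AddSubgroup.closure {ν | IsWeight H ρ ν}

/-- The subgroup of `GL_n(ℂ)` generated by the root subgroups of the roots in `S`. -/
def rootSubgroup (S : Set H.root) : Subgroup (GL (Fin n) ℂ) :=
  Subgroup.closure {g | ∃ α ∈ S, ∃ x ∈ rootSpace H (α : LieModule.Weight ℂ H L),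
    (g : Matrix (Fin n) (Fin n) ℂ) = IsNilpotent.exp (ρ x)}

/-- The group `G`. -/
def chevalleyGroup : Subgroup (GL (Fin n) ℂ) := rootSubgroup H ρ Set.univ

variable {H} (b : (rootSystem H).Base)

/-- The subgroup `N₊`. -/
def Nplus : Subgroup (GL (Fin n) ℂ) := rootSubgroup H ρ {α | b.IsPos α}

/-- The subgroup `N₋`. -/
def Nminus : Subgroup (GL (Fin n) ℂ) := rootSubgroup H ρ {α | ¬ b.IsPos α}

/-- The `SL₂`-subgroup of a simple root. -/
def simpleSL2 (i : b.support) : Subgroup (GL (Fin n) ℂ) :=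
  rootSubgroup H ρ {α | (rootSystem H).root α = (rootSystem H).root i ∨
    (rootSystem H).root α = -(rootSystem H).root i}

/-- Chevalley generators `e_i`, `f_i`, `α̌_i`, where `α̌_i` is the simple coroot. -/
structure ChevalleyGenerators where
  e : b.support → L
  f : b.support → L
  e_mem : ∀ i : b.support, e i ∈ rootSpace H (i.1 : LieModule.Weight ℂ H L)
  f_mem : ∀ i : b.support, f i ∈ rootSpace H (-(i.1 : LieModule.Weight ℂ H L))
  sl2 : ∀ i : b.support, IsSl2Triple (((rootSystem H).coroot i : H) : L) (e i) (f i)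

variable {b}

/-- The one-parameter subgroup `exp (a x)` of a nilpotent element, over a field containing `ℂ`. -/
def expElt (K : Type*) [Field K] [CharZero K] [Algebra ℂ K] (x : L) (a : K) :
    Matrix (Fin n) (Fin n) K :=
  IsNilpotent.exp (a • (ρ x).map (algebraMap ℂ K))

variable (C : ChevalleyGenerators b)

/-- `w_i(a) = exp (a e_i) exp (-a⁻¹ f_i) exp (a e_i)`, i.e. the image of `(0, a; -a⁻¹, 0)` under
the homomorphism from `SL₂` given by the `i`-th Chevalley generators. -/
def weylElt {K : Type*} [Field K] [CharZero K] [Algebra ℂ K] (i : b.support) (a : Kˣ) :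
    Matrix (Fin n) (Fin n) K :=
  expElt ρ K (C.e i) (a : K) * expElt ρ K (C.f i) (-(a : K)⁻¹) * expElt ρ K (C.e i) (a : K)

/-- The cocharacter `a ↦ a^{α̌_i}`, given by the formula `w_i(a) w_i(-1)`, i.e. the image of
`diag(a, a⁻¹)` under the homomorphism from `SL₂`. -/
def corootPow {K : Type*} [Field K] [CharZero K] [Algebra ℂ K] (i : b.support) (a : Kˣ) :
    Matrix (Fin n) (Fin n) K :=
  weylElt ρ C i a * weylElt ρ C i (-1 : Kˣ)

/-- The maximal torus, generated by the images of the simple coroots. -/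
def torus : Subgroup (GL (Fin n) ℂ) :=
  Subgroup.closure {g | ∃ (i : b.support) (a : ℂˣ),
    (g : Matrix (Fin n) (Fin n) ℂ) = corootPow ρ C i a}

/-- The Borel subgroup `B₊`. -/
def Bplus : Subgroup (GL (Fin n) ℂ) := torus ρ C ⊔ Nplus ρ b

/-- The Borel subgroup `B₋`. -/
def Bminus : Subgroup (GL (Fin n) ℂ) := torus ρ C ⊔ Nminus ρ b

variable (b) in
/-- `s` is a lift to `G` of the simple reflection `w_i`: an element of `G` which normalizes the
maximal torus and acts on its Lie algebra as `w_i`. -/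
def IsReflectionLift (i : b.support) (s : GL (Fin n) ℂ) : Prop :=
  s ∈ chevalleyGroup H ρ ∧ ∀ h : H,
    (s : Matrix (Fin n) (Fin n) ℂ) * ρ (h : L) =
      ρ (((rootSystem H).coreflection i h : H) : L) * (s : Matrix (Fin n) (Fin n) ℂ)

/-- The product `s_1 ⋯ s_r` in the chosen order, which represents the Coxeter element. -/
def coxeterLift {r : ℕ} (ord : Fin r ≃ b.support) (s : b.support → GL (Fin n) ℂ) :
    GL (Fin n) ℂ :=
  (List.ofFn fun k => s (ord k)).prod

/-- The set `N₋(z) ∏_i (φ_i^{α̌_i} s_i) N₋(z)`. -/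
def operCell {r : ℕ} (ord : Fin r ≃ b.support) (s : b.support → GL (Fin n) ℂ)
    (φ : b.support → (RatFunc ℂ)ˣ) : Set (Matrix (Fin n) (Fin n) (RatFunc ℂ)) :=
  {M | ∃ m' ∈ points (Nminus ρ b) (RatFunc ℂ), ∃ m ∈ points (Nminus ρ b) (RatFunc ℂ),
    M = m' * (List.ofFn fun k => corootPow ρ C (ord k) (φ (ord k)) *
      (s (ord k) : Matrix (Fin n) (Fin n) ℂ).map (algebraMap ℂ (RatFunc ℂ))).prod * m}

/-- The product `∏_i g_i^{α̌_i} exp ((t_i φ_i / g_i) e_i)`. -/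
def miuraForm {r : ℕ} (ord : Fin r ≃ b.support) (t : b.support → ℂˣ)
    (φ g : b.support → (RatFunc ℂ)ˣ) : Matrix (Fin n) (Fin n) (RatFunc ℂ) :=
  (List.ofFn fun k => corootPow ρ C (ord k) (g (ord k)) *
    expElt ρ (RatFunc ℂ) (C.e (ord k))
      (algebraMap ℂ (RatFunc ℂ) (t (ord k)) * (φ (ord k) : RatFunc ℂ) /
        (g (ord k) : RatFunc ℂ))).prod

end Chevalley

end HOper

end

noncomputable section

namespace HOper

/-! Everything is reduced to statements about complex matrices at all but finitely many values of z;
an identity between rational functions that holds at infinitely many points holds identically. The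
group is handled through a basis of weight vectors.

The basic move takes place in SL₂. Let x_i, y_i be the root subgroups of ±α_i and let s_i first be
the standard lift. For a ≠ 0 one has s_i y_i(a) = y_i(-1/a) a^{α̌_i} x_i(1/a) (`Frame.s_mul_y_eq`).
Given ∏ φ_i^{α̌_i} s_i · m with m in N₋, write m = ν y_k(a), where k is the last index and ν lies in
the part of N₋ that s_k normalizes. If a ≠ 0, the move splits the last factor into a negative part,
which joins m for the next step, and g_k^{α̌_k} exp(φ_k/g_k e_k), which stays. Another lift of w_k
brings in a torus element, whose effect is a constant. If a ≠ 0 at every step, the product is an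
element of N₋ times one of B₊ of the required shape; if the whole lies in B₊, the N₋ factor is 1.
Collecting the torus elements gives the constants t_i, and with lifts in the SL₂-subgroups this is
done factor by factor (`Frame.normalForm_of_cp`).

That a ≠ 0 is detected by ranks. In the weight basis take the block of rows whose degree for the
coweight ω_k exceeds q and of columns whose degree for h0 is at least p. Its rank (`Frame.rk`) does
not change under left multiplication by N₋, by the torus and by the lifts of w_i for i ≠ k, nor
under right multiplication by B₊. Since w_k occurs once in the Coxeter element, only its lift can
change the ranks attached to k, and it does: u and s_k u never have the same ranks, for u a lift of
a Weyl group element (`Frame.not_rk_eq`). So if the ranks are known not to change, a cannot vanish.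
`Frame.exists_upProd` runs this induction with such a u standing on the right, and obtains in
addition that u⁻¹ keeps the simple roots positive, so that u lies in the torus.

For u = 1 this is (ii). For (i), a section of the B₊-reduction, expressed in a trivialization of the
B₋-reduction, is a rational matrix g(z), and invariance says A(z) g(z) = g(ħz) β(z) with β in B₊.
Ranks of a rational matrix are generically constant, so g(z) and g(ħz) have the same ranks; with the
Bruhat decomposition g = m u m' the induction shows u in the torus, so g(z) is in N₋B₊ for almost
all z (`Frame.exists_factor`). The N₋ factor solves a linear system, hence is rational
(`Frame.exists_rat_factor`), and changing the trivialization by it makes it compatible with both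
reductions without leaving the cell. The first half of (i) moves the torus parts of B₋ c B₋ together
and absorbs them in c (`Frame.exists_coxProd`); simple connectedness makes the torus coordinates
monomials in the diagonal entries, so the φ_i are rational (`WeightBasis.exists_fundamental`).

The structure theory is proved by hand from two facts. A torus element t = a^{α̌_i} solves the
equation a dt/da = h t, with h the matrix of the coroot, which gives integral weights and diagonal
tori (`MatSl2.exists_laurent_corootMat`). And a matrix that is unipotent triangular for a grading
and carries ρ(L) to itself is a product of root subgroup elements (`WeightBasis.mem_negSubgroup`),
which makes N₋ closed and yields the normality statements behind the Bruhat decomposition. -/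

/-- Square complex matrices. -/
abbrev Mat (n : ℕ) : Type := Matrix (Fin n) (Fin n) ℂ

/-! ### Exponentials of nilpotent elements -/

section Exp

theorem semiconjBy_exp {A : Type*} [Ring A] [Module ℚ A] [SMulCommClass ℚ A A] [IsScalarTower ℚ A A] {g a b : A} (ha : IsNilpotent a)
    (hb : IsNilpotent b) (h : SemiconjBy g a b) :
    SemiconjBy g (IsNilpotent.exp a) (IsNilpotent.exp b) := by
  obtain ⟨k, hk⟩ := ha
  obtain ⟨l, hl⟩ := hb
  have ha' : a ^ (k + l) = 0 := by rw [pow_add, hk, zero_mul]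
  have hb' : b ^ (k + l) = 0 := by rw [pow_add, hl, mul_zero]
  rw [IsNilpotent.exp_eq_sum ha', IsNilpotent.exp_eq_sum hb']
  simp only [SemiconjBy, Finset.mul_sum, Finset.sum_mul]
  refine Finset.sum_congr rfl fun i _ => ?_
  rw [mul_smul_comm, smul_mul_assoc, (h.pow_right i).eq]

variable {n : ℕ}


/-- `ad a` is left minus right multiplication, two commuting nilpotent operators, so its exponential
is the product of theirs. -/
theorem exp_ad {a : (Mat n)} (ha : IsNilpotent a) (y : (Mat n)) :
    IsNilpotent.exp (LieAlgebra.ad ℂ (Mat n) a) y = IsNilpotent.exp a * y * IsNilpotent.exp (-a) := by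
  have hL : IsNilpotent (LinearMap.mulLeft ℂ a) := (LinearMap.isNilpotent_mulLeft_iff ℂ a).2 ha
  have hR : IsNilpotent (-LinearMap.mulRight ℂ a) :=
    IsNilpotent.neg ((LinearMap.isNilpotent_mulRight_iff ℂ a).2 ha)
  have h1 : LieAlgebra.ad ℂ (Mat n) a = LinearMap.mulLeft ℂ a + -LinearMap.mulRight ℂ a := by
    rw [LieAlgebra.ad_eq_lmul_left_sub_lmul_right]; simp [sub_eq_add_neg]
  have hc : Commute (LinearMap.mulLeft ℂ a) (-LinearMap.mulRight ℂ a) :=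
    (LinearMap.commute_mulLeft_right (R := ℂ) a a).neg_right
  rw [h1, IsNilpotent.exp_add_of_commute hc hL hR]
  have e1 : IsNilpotent.exp (LinearMap.mulLeft ℂ a) = LinearMap.mulLeft ℂ (IsNilpotent.exp a) :=
    (IsNilpotent.map_exp ha (Algebra.lmul ℂ (Mat n))).symm
  have e2 : IsNilpotent.exp (-LinearMap.mulRight ℂ a)
      = LinearMap.mulRight ℂ (IsNilpotent.exp (-a)) := by
    obtain ⟨k, hk⟩ := ha
    have hk' : (-a) ^ k = 0 := by rw [neg_pow, hk, mul_zero]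
    have h2 : -LinearMap.mulRight ℂ a = LinearMap.mulRight ℂ (-a) := by
      ext; simp
    have hk2 : (LinearMap.mulRight ℂ (-a)) ^ k = 0 := by
      rw [LinearMap.pow_mulRight, hk', LinearMap.mulRight_zero_eq_zero]
    rw [h2, IsNilpotent.exp_eq_sum hk2, IsNilpotent.exp_eq_sum hk']
    ext y
    simp [LinearMap.pow_mulRight, Finset.mul_sum]
  rw [e1, e2]
  simp [mul_assoc]

/-- Through `exp (ad a)` the conjugate becomes a finite sum of iterated brackets, each of which
stays in `S`. -/
theorem exp_ad_mem {a : (Mat n)} (ha : IsNilpotent a) (S : Submodule ℂ (Mat n))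
    (hS : ∀ y ∈ S, a * y - y * a ∈ S) {y : (Mat n)} (hy : y ∈ S) :
    IsNilpotent.exp a * y * IsNilpotent.exp (-a) ∈ S := by
  rw [← exp_ad ha]
  obtain ⟨k, hk⟩ := LieAlgebra.ad_nilpotent_of_nilpotent (R := ℂ) ha
  rw [IsNilpotent.exp_eq_sum hk, LinearMap.sum_apply]
  refine Submodule.sum_mem _ fun i _ => ?_
  have : ∀ i : ℕ, ((LieAlgebra.ad ℂ (Mat n) a) ^ i) y ∈ S := by
    intro i
    induction i with
    | zero => simpa using hy
    | succ i ih => rw [pow_succ']; exact hS _ ih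
  have h2 : (((i.factorial : ℚ)⁻¹) • (LieAlgebra.ad ℂ (Mat n) a) ^ i) y
      = ((i.factorial : ℂ)⁻¹) • ((LieAlgebra.ad ℂ (Mat n) a) ^ i) y := by
    rw [LinearMap.smul_apply, ← Rat.cast_smul_eq_qsmul ℂ]
    simp
  rw [h2]
  exact S.smul_mem _ (this i)

/-- The series of `exp (ad a)` at `y` stops after the quadratic term, whose 1/2! cancels the factor
2 in `h2`. The conjugation formulas in an `sl₂`-triple are instances. -/
theorem semiconjBy_exp_of_ad {a y z w : (Mat n)} (ha : IsNilpotent a)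
    (h1 : a * y - y * a = z) (h2 : a * z - z * a = (2 : ℂ) • w) (h3 : a * w - w * a = 0) :
    SemiconjBy (IsNilpotent.exp a) y (y + z + w) := by
  have hn := LieAlgebra.ad_nilpotent_of_nilpotent (R := ℂ) ha
  have e1 : (LieAlgebra.ad ℂ (Mat n) a) y = z := h1
  have e2 : (LieAlgebra.ad ℂ (Mat n) a) z = (2 : ℂ) • w := h2
  have e3 : (LieAlgebra.ad ℂ (Mat n) a) w = 0 := h3
  have key : IsNilpotent.exp (LieAlgebra.ad ℂ (Mat n) a) y = y + z + w := by
    have h0 : ((LieAlgebra.ad ℂ (Mat n) a) ^ 3) • y = 0 := by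
      change ((LieAlgebra.ad ℂ (Mat n) a) ^ 3) y = 0
      rw [pow_succ, pow_succ, pow_one, Module.End.mul_apply, Module.End.mul_apply, e1, e2,
        map_smul, e3, smul_zero]
    have := IsNilpotent.exp_smul_eq_sum h0 hn
    change IsNilpotent.exp (LieAlgebra.ad ℂ (Mat n) a) y = _ at this
    rw [this]
    simp only [Finset.sum_range_succ, Finset.sum_range_zero, Module.End.smul_def, pow_zero,
      Module.End.one_apply, pow_one, e1, pow_two, Module.End.mul_apply, e2]
    simp only [Nat.factorial, ← Rat.cast_smul_eq_qsmul ℂ, smul_smul]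
    norm_num
  rw [exp_ad ha] at key
  rw [SemiconjBy, ← key, mul_assoc _ (IsNilpotent.exp (-a)), IsNilpotent.exp_neg_mul_exp_self ha,
    mul_one]

end Exp

section NilpotentMatrix

variable {n : ℕ}

/-- The power `e ^ k` is an eigenvector of `ad h` for `k * c`; if no power vanished there would be
infinitely many eigenvalues. -/
theorem isNilpotent_of_ad_eigen {h e : Mat n} {c : ℂ} (hc : c ≠ 0)
    (he : h * e - e * h = c • e) : IsNilpotent e := by
  by_contra hne
  have hpow : ∀ k : ℕ, h * e ^ k - e ^ k * h = (k * c) • e ^ k := by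
    intro k
    induction k with
    | zero => simp
    | succ k ih =>
      have : h * e ^ (k + 1) - e ^ (k + 1) * h
          = (h * e ^ k - e ^ k * h) * e + e ^ k * (h * e - e * h) := by
        rw [pow_succ]; noncomm_ring
      rw [this, ih, he, smul_mul_assoc, mul_smul_comm, ← pow_succ, ← add_smul]
      push_cast; ring_nf
  have hfin := Module.End.finite_hasEigenvalue (LieAlgebra.ad ℂ (Mat n) h)
  refine Set.infinite_of_injective_forall_mem (f := fun k : ℕ => (k : ℂ) * c) ?_ ?_ hfin
  · intro a b hab
    simpa [hc] using hab
  · intro k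
    refine Module.End.hasEigenvalue_of_hasEigenvector (x := e ^ k) ⟨?_, ?_⟩
    · rw [Module.End.mem_eigenspace_iff]; exact hpow k
    · intro h0; exact hne ⟨k, h0⟩

end NilpotentMatrix

end HOper

end

noncomputable section

namespace HOper

/-! ### `SL₂` inside the matrices -/

section MatSl2

variable {n : ℕ}

/-- An `sl₂`-triple of matrices. -/
structure MatSl2 (h e f : Mat n) : Prop where
  he : h * e - e * h = (2 : ℂ) • e
  hf : h * f - f * h = -((2 : ℂ) • f)
  ef : e * f - f * e = h

/-- `exp (a e) exp (-a⁻¹ f) exp (a e)`. -/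
def weylMat (e f : Mat n) (a : ℂ) : Mat n :=
  IsNilpotent.exp (a • e) * IsNilpotent.exp ((-a⁻¹) • f) * IsNilpotent.exp (a • e)

/-- The image of `diag (a, a⁻¹)`. -/
def corootMat (e f : Mat n) (a : ℂ) : Mat n := weylMat e f a * weylMat e f (-1)

theorem exp_smul_add {e : Mat n} (he : IsNilpotent e) (a b : ℂ) :
    IsNilpotent.exp ((a + b) • e) = IsNilpotent.exp (a • e) * IsNilpotent.exp (b • e) := by
  rw [add_smul]
  exact IsNilpotent.exp_add_of_commute (((Commute.refl e).smul_left a).smul_right b)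
    (he.smul a) (he.smul b)

theorem exp_smul_mul_neg {e : Mat n} (he : IsNilpotent e) (a : ℂ) :
    IsNilpotent.exp (a • e) * IsNilpotent.exp ((-a) • e) = 1 := by
  rw [← exp_smul_add he, add_neg_cancel, zero_smul, IsNilpotent.exp_zero]

theorem semiconjBy_smul {g a b : Mat n} (h : SemiconjBy g a b) (c : ℂ) :
    SemiconjBy g (c • a) (c • b) := by
  simp only [SemiconjBy, mul_smul_comm, smul_mul_assoc, h.eq]

theorem semiconjBy_of_inv {g g' a b : Mat n} (h : SemiconjBy g a b) (h1 : g * g' = 1)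
    (h2 : g' * g = 1) : SemiconjBy g' b a := by
  have := congrArg (fun M => g' * M * g') h.eq
  simp only [SemiconjBy]
  simp only [← mul_assoc] at this
  rw [h2, one_mul, mul_assoc (g' * b), h1, mul_one] at this
  exact this.symm

namespace MatSl2

variable {h e f : Mat n} (S : MatSl2 h e f)
include S

theorem nilp_e : IsNilpotent e := isNilpotent_of_ad_eigen two_ne_zero S.he

theorem nilp_f : IsNilpotent f :=
  isNilpotent_of_ad_eigen (h := h) (c := -2) (by norm_num) (by rw [S.hf, neg_smul])

theorem symm : MatSl2 (-h) f e where
  he := by have := S.hf; rw [← neg_eq_iff_eq_neg] at this; rw [← this]; noncomm_ring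
  hf := by rw [← S.he]; noncomm_ring
  ef := by rw [← S.ef]; noncomm_ring

theorem x_e (c : ℂ) : SemiconjBy (IsNilpotent.exp (c • e)) e e := by
  have := semiconjBy_exp_of_ad (S.nilp_e.smul c) (y := e) (z := 0) (w := 0)
    (by simp) (by simp) (by simp)
  simpa using this

theorem x_h (c : ℂ) : SemiconjBy (IsNilpotent.exp (c • e)) h (h - (2 * c) • e) := by
  have := semiconjBy_exp_of_ad (S.nilp_e.smul c) (y := h) (z := -((2 * c) • e)) (w := 0)
    (by have := S.he; rw [sub_eq_iff_eq_add] at this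
        rw [mul_smul_comm, this, smul_mul_assoc, smul_add]; module)
    (by rw [mul_neg, neg_mul, mul_smul_comm, smul_mul_assoc, mul_smul_comm, smul_mul_assoc]
        module) (by simp)
  simpa [sub_eq_add_neg] using this

theorem x_f (c : ℂ) : SemiconjBy (IsNilpotent.exp (c • e)) f (f + c • h - (c ^ 2) • e) := by
  have := semiconjBy_exp_of_ad (S.nilp_e.smul c) (y := f) (z := c • h) (w := -((c ^ 2) • e))
    (by rw [← S.ef, smul_mul_assoc, mul_smul_comm, smul_sub])
    (by have := S.he; rw [sub_eq_iff_eq_add] at this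
        simp only [smul_mul_assoc, mul_smul_comm, this]
        module)
    (by rw [mul_neg, neg_mul, mul_smul_comm, smul_mul_assoc, mul_smul_comm, smul_mul_assoc]
        module)
  simpa [sub_eq_add_neg, add_assoc] using this

theorem y_f (d : ℂ) : SemiconjBy (IsNilpotent.exp (d • f)) f f := S.symm.x_e d

theorem y_h (d : ℂ) : SemiconjBy (IsNilpotent.exp (d • f)) h (h + (2 * d) • f) := by
  have := (S.symm.x_h d).neg_right
  rwa [neg_neg, neg_sub, sub_neg_eq_add, add_comm] at this

theorem y_e (d : ℂ) : SemiconjBy (IsNilpotent.exp (d • f)) e (e - d • h - (d ^ 2) • f) := by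
  have := S.symm.x_f d
  rwa [smul_neg, ← sub_eq_add_neg] at this

/-- The last factor of `weylMat` commutes with `e`, so this already contains `weyl_e`. It is stated
apart because the derivative of `weylMat` has `e` directly behind these two factors. -/
theorem x_y_e {c : ℂ} (hc : c ≠ 0) :
    SemiconjBy (IsNilpotent.exp (c • e) * IsNilpotent.exp ((-c⁻¹) • f)) e
      (-((c⁻¹ ^ 2) • f)) := by
  refine SemiconjBy.mul_left ?_ (S.y_e _)
  have := ((S.x_e c).sub_right (semiconjBy_smul (S.x_h c) (-c⁻¹))).sub_right
    (semiconjBy_smul (S.x_f c) ((-c⁻¹) ^ 2))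
  have e2 : e - (-c⁻¹) • (h - (2 * c) • e) - ((-c⁻¹) ^ 2) • (f + c • h - (c ^ 2) • e)
      = -((c⁻¹ ^ 2) • f) := by
    match_scalars <;> field_simp <;> ring
  rwa [e2] at this

theorem weyl_e {c : ℂ} (hc : c ≠ 0) : SemiconjBy (weylMat e f c) e (-((c⁻¹ ^ 2) • f)) := by
  exact SemiconjBy.mul_left (S.x_y_e hc) (S.x_e _)

theorem weyl_f {c : ℂ} (hc : c ≠ 0) : SemiconjBy (weylMat e f c) f (-((c ^ 2) • e)) := by
  have h1 := ((S.y_f (-c⁻¹)).add_right (semiconjBy_smul (S.y_h (-c⁻¹)) c)).sub_right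
    (semiconjBy_smul (S.y_e (-c⁻¹)) (c ^ 2))
  have e1 : f + c • (h + (2 * -c⁻¹) • f) - (c ^ 2) • (e - (-c⁻¹) • h - ((-c⁻¹) ^ 2) • f)
      = -((c ^ 2) • e) := by
    match_scalars <;> field_simp <;> ring
  rw [e1] at h1
  have h2 := (semiconjBy_smul (S.x_e c) (c ^ 2)).neg_right
  exact SemiconjBy.mul_left (SemiconjBy.mul_left h2 h1) (S.x_f c)

theorem weyl_h {c : ℂ} (hc : c ≠ 0) : SemiconjBy (weylMat e f c) h (-h) := by
  have := ((S.weyl_e hc).mul_right (S.weyl_f hc)).sub_right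
    ((S.weyl_f hc).mul_right (S.weyl_e hc))
  rw [S.ef] at this
  have e1 : -(c⁻¹ ^ 2 • f) * -(c ^ 2 • e) - -(c ^ 2 • e) * -(c⁻¹ ^ 2 • f) = -h := by
    rw [← S.ef]
    simp only [neg_mul_neg, smul_mul_assoc, mul_smul_comm, smul_smul]
    have : c⁻¹ ^ 2 * c ^ 2 = 1 := by field_simp
    rw [this, mul_comm (c ^ 2), this]; simp
  rwa [e1] at this

theorem weyl_mul_neg {c : ℂ} : weylMat e f c * weylMat e f (-c) = 1 := by
  have h1 := exp_smul_mul_neg S.nilp_e c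
  have h2 := exp_smul_mul_neg S.nilp_f (-c⁻¹)
  simp only [weylMat, inv_neg]
  calc _ = IsNilpotent.exp (c • e) * (IsNilpotent.exp ((-c⁻¹) • f) *
        (IsNilpotent.exp (c • e) * IsNilpotent.exp ((-c) • e)) *
        IsNilpotent.exp ((- -c⁻¹) • f)) * IsNilpotent.exp ((-c) • e) := by
        simp only [mul_assoc]
    _ = 1 := by rw [h1, mul_one, h2, mul_one, h1]

theorem corootMat_one : corootMat e f 1 = 1 := S.weyl_mul_neg

theorem corootMat_e {c : ℂ} (hc : c ≠ 0) : SemiconjBy (corootMat e f c) e ((c ^ 2) • e) := by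
  have h1 := S.weyl_e (c := -1) (by norm_num)
  have h2 := (semiconjBy_smul (S.weyl_f hc) ((-1)⁻¹ ^ 2)).neg_right
  have : SemiconjBy (corootMat e f c) _ _ := SemiconjBy.mul_left h2 h1
  simpa using this

theorem corootMat_f {c : ℂ} (hc : c ≠ 0) :
    SemiconjBy (corootMat e f c) f ((c⁻¹ ^ 2) • f) := by
  have h1 := S.weyl_f (c := -1) (by norm_num)
  have h2 := (semiconjBy_smul (S.weyl_e hc) ((-1) ^ 2)).neg_right
  have : SemiconjBy (corootMat e f c) _ _ := SemiconjBy.mul_left h2 h1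
  simpa using this

/-! #### The torus element as a Laurent polynomial -/

omit S in
/-- Entrywise derivative of a matrix of polynomials. -/
theorem map_derivative_mul (M N : Matrix (Fin n) (Fin n) ℂ[X]) :
    (M * N).map Polynomial.derivative =
      M.map Polynomial.derivative * N + M * N.map Polynomial.derivative := by
  ext1 i j
  simp [Matrix.mul_apply, Finset.sum_add_distrib]

omit S in
theorem map_derivative_map_C (M : Mat n) :
    (M.map (Polynomial.C : ℂ →+* ℂ[X])).map Polynomial.derivative = 0 := by
  ext1 i j; simp

omit S in
/-- `exp (X e)` as a matrix of polynomials. -/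
theorem exists_exp_polynomial {e : Mat n} (he : IsNilpotent e) :
    ∃ E : Matrix (Fin n) (Fin n) ℂ[X],
      (∀ c : ℂ, E.map (Polynomial.eval c) = IsNilpotent.exp (c • e)) ∧
      E.map Polynomial.derivative = e.map Polynomial.C * E := by
  obtain ⟨N, hN⟩ := he
  refine ⟨∑ k ∈ Finset.range (N + 1),
    (Polynomial.C ((k.factorial : ℂ)⁻¹) * Polynomial.X ^ k) • (e ^ k).map Polynomial.C, ?_, ?_⟩
  · intro c
    have : (c • e) ^ (N + 1) = 0 := by rw [smul_pow, pow_succ e, hN, zero_mul, smul_zero]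
    rw [IsNilpotent.exp_eq_sum this]
    ext1 i j
    simp only [Matrix.map_apply, Matrix.sum_apply, Polynomial.eval_finsetSum, Matrix.smul_apply,
      smul_eq_mul, Polynomial.eval_mul, Polynomial.eval_C, Polynomial.eval_pow, Polynomial.eval_X,
      smul_pow, ← Rat.cast_smul_eq_qsmul ℂ]
    refine Finset.sum_congr rfl fun k _ => ?_
    push_cast; ring
  · have hl : (∑ k ∈ Finset.range (N + 1), (Polynomial.C ((k.factorial : ℂ)⁻¹) * Polynomial.X ^ k)
          • (e ^ k).map (Polynomial.C : ℂ →+* ℂ[X])).map Polynomial.derivative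
        = ∑ k ∈ Finset.range (N + 1), (Polynomial.C ((k.factorial : ℂ)⁻¹ * k) *
          Polynomial.X ^ (k - 1)) • (e ^ k).map (Polynomial.C : ℂ →+* ℂ[X]) := by
      ext1 i j
      simp only [Matrix.map_apply, Matrix.sum_apply, Polynomial.derivative_sum, Matrix.smul_apply,
        smul_eq_mul]
      refine Finset.sum_congr rfl fun k _ => ?_
      simp only [Polynomial.derivative_mul, Polynomial.derivative_C, Polynomial.derivative_X_pow,
        map_mul, Polynomial.C_eq_natCast]
      ring
    have hmul : ∀ k, e.map (Polynomial.C : ℂ →+* ℂ[X]) * (e ^ k).map Polynomial.C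
        = (e ^ (k + 1)).map Polynomial.C := by
      intro k; rw [pow_succ', Matrix.map_mul]
    rw [hl, Finset.mul_sum, Finset.sum_range_succ', Finset.sum_range_succ _ N]
    simp only [mul_smul_comm, hmul]
    rw [pow_succ' e N, hN, mul_zero]
    simp only [Nat.cast_zero, mul_zero, map_zero, zero_mul, zero_smul, add_zero]
    rw [Matrix.map_zero _ (map_zero _), smul_zero, add_zero]
    refine Finset.sum_congr rfl fun k _ => ?_
    rw [Nat.factorial_succ, Nat.add_sub_cancel]
    congr 3
    push_cast
    have : (k : ℂ) + 1 ≠ 0 := Nat.cast_add_one_ne_zero k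
    field_simp

omit S in
/-- `X ^ N exp (-X⁻¹ f)` as a matrix of polynomials. -/
theorem exists_exp_inv_polynomial {f : Mat n} (hf : IsNilpotent f) :
    ∃ (N : ℕ) (F : Matrix (Fin n) (Fin n) ℂ[X]),
      (∀ c : ℂ, c ≠ 0 → F.map (Polynomial.eval c) = c ^ N • IsNilpotent.exp ((-c⁻¹) • f)) ∧
      (Polynomial.X ^ 2 : ℂ[X]) • F.map Polynomial.derivative =
        ((N : ℂ[X]) * Polynomial.X) • F + f.map Polynomial.C * F := by
  obtain ⟨N, hN⟩ := hf
  refine ⟨N, ∑ k ∈ Finset.range N,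
    (Polynomial.C ((-1) ^ k * (k.factorial : ℂ)⁻¹) * Polynomial.X ^ (N - k)) •
      (f ^ k).map Polynomial.C, ?_, ?_⟩
  · intro c hc
    have : ((-c⁻¹) • f) ^ N = 0 := by rw [smul_pow, hN, smul_zero]
    rw [IsNilpotent.exp_eq_sum this, Finset.smul_sum]
    ext1 i j
    simp only [Matrix.map_apply, Matrix.sum_apply, Polynomial.eval_finsetSum, Matrix.smul_apply,
      smul_eq_mul, Polynomial.eval_mul, Polynomial.eval_C, Polynomial.eval_pow, Polynomial.eval_X,
      smul_pow, ← Rat.cast_smul_eq_qsmul ℂ]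
    refine Finset.sum_congr rfl fun k hk => ?_
    rw [pow_sub₀ c hc (Finset.mem_range.1 hk).le]
    push_cast; rw [neg_pow c⁻¹, inv_pow]; ring
  · have hl : (∑ k ∈ Finset.range N, (Polynomial.C ((-1) ^ k * (k.factorial : ℂ)⁻¹) *
          Polynomial.X ^ (N - k)) • (f ^ k).map (Polynomial.C : ℂ →+* ℂ[X])).map
          Polynomial.derivative
        = ∑ k ∈ Finset.range N, (Polynomial.C ((-1) ^ k * (k.factorial : ℂ)⁻¹ * (N - k : ℕ)) *
          Polynomial.X ^ (N - k - 1)) • (f ^ k).map (Polynomial.C : ℂ →+* ℂ[X]) := by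
      ext1 i j
      simp only [Matrix.map_apply, Matrix.sum_apply, Polynomial.derivative_sum, Matrix.smul_apply,
        smul_eq_mul]
      refine Finset.sum_congr rfl fun k _ => ?_
      simp only [Polynomial.derivative_mul, Polynomial.derivative_C, Polynomial.derivative_X_pow,
        map_mul, Polynomial.C_eq_natCast]
      ring
    have hmul : ∀ k, f.map (Polynomial.C : ℂ →+* ℂ[X]) * (f ^ k).map Polynomial.C
        = (f ^ (k + 1)).map Polynomial.C := by
      intro k; rw [pow_succ', Matrix.map_mul]
    rw [hl, Finset.mul_sum, Finset.smul_sum, Finset.smul_sum]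
    simp only [mul_smul_comm, hmul, smul_smul]
    -- Shift of the index by one: the term for `k = N` may be added because `f ^ N = 0`, and the one
    -- for `k = 0` carries the factor `k`.
    have hshift : ∑ k ∈ Finset.range N, (Polynomial.C ((-1) ^ k * (k.factorial : ℂ)⁻¹) *
          Polynomial.X ^ (N - k)) • (f ^ (k + 1)).map (Polynomial.C : ℂ →+* ℂ[X])
        = ∑ k ∈ Finset.range N, (Polynomial.C (-((-1) ^ k * (k.factorial : ℂ)⁻¹ * k)) *
          Polynomial.X ^ (N - k + 1)) • (f ^ k).map (Polynomial.C : ℂ →+* ℂ[X]) := by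
      have h1 := Finset.sum_range_succ (fun k : ℕ =>
        (Polynomial.C (-((-1) ^ k * (k.factorial : ℂ)⁻¹ * k)) *
          (Polynomial.X : ℂ[X]) ^ (N - k + 1)) • (f ^ k).map (Polynomial.C : ℂ →+* ℂ[X])) N
      rw [hN, Matrix.map_zero _ (map_zero _), smul_zero, add_zero] at h1
      rw [← h1, Finset.sum_range_succ']
      simp only [Nat.cast_zero, mul_zero, neg_zero, map_zero, zero_mul, zero_smul, add_zero]
      refine Finset.sum_congr rfl fun k hk => ?_
      have hk' := Finset.mem_range.1 hk
      rw [show N - (k + 1) + 1 = N - k by omega, Nat.factorial_succ]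
      congr 3
      push_cast
      have : (k : ℂ) + 1 ≠ 0 := Nat.cast_add_one_ne_zero k
      field_simp
      ring
    rw [hshift, ← Finset.sum_add_distrib]
    refine Finset.sum_congr rfl fun k hk => ?_
    have hk' := Finset.mem_range.1 hk
    rw [← add_smul]
    congr 1
    have e1 : (Polynomial.X : ℂ[X]) ^ 2 * (Polynomial.C ((-1) ^ k * (k.factorial : ℂ)⁻¹ *
        (N - k : ℕ)) * Polynomial.X ^ (N - k - 1)) = Polynomial.C ((-1) ^ k *
        (k.factorial : ℂ)⁻¹ * (N - k : ℕ)) * Polynomial.X ^ (N - k + 1) := by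
      rw [mul_left_comm, ← pow_add]; congr 2; omega
    rw [e1, Nat.cast_sub hk'.le, pow_succ]
    simp only [map_mul, map_neg, map_sub, Polynomial.C_eq_natCast]
    ring

/-- The left side is the value at `c` of X² times the derivative of the polynomial matrix used
below. Moving `e` and `f` to the front by `x_f` and `x_y_e` cancels their contributions, and only
the one of `h` remains. -/
theorem laurent_identity {c : ℂ} (hc : c ≠ 0) (w : Mat n) (N : ℕ) :
    (c ^ 2) • (e * IsNilpotent.exp (c • e) * (c ^ N • IsNilpotent.exp ((-c⁻¹) • f)) *
        IsNilpotent.exp (c • e) * w) +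
      IsNilpotent.exp (c • e) * ((N * c : ℂ) • (c ^ N • IsNilpotent.exp ((-c⁻¹) • f)) +
        f * (c ^ N • IsNilpotent.exp ((-c⁻¹) • f))) * IsNilpotent.exp (c • e) * w +
      (c ^ 2) • (IsNilpotent.exp (c • e) * (c ^ N • IsNilpotent.exp ((-c⁻¹) • f)) *
        (e * IsNilpotent.exp (c • e)) * w) =
    (N * c : ℂ) • (c ^ N • (weylMat e f c * w)) + c • (h * (c ^ N • (weylMat e f c * w))) := by
  have h1 := (S.x_f c).eq
  have h2 := (S.x_y_e hc).eq
  simp only [weylMat]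
  generalize IsNilpotent.exp (c • e) = x at *
  generalize IsNilpotent.exp ((-c⁻¹) • f) = y at *
  have t1 : x * (c ^ N • y) * (e * x) * w = c ^ N • (-((c⁻¹ ^ 2) • (f * x * y * x * w))) := by
    rw [mul_smul_comm, smul_mul_assoc, smul_mul_assoc, ← mul_assoc (x * y), h2]
    simp only [neg_mul, smul_mul_assoc, mul_assoc]
  have t2 : x * ((N * c : ℂ) • (c ^ N • y) + f * (c ^ N • y)) * x * w
      = c ^ N • ((N * c : ℂ) • (x * y * x * w) + (f * x * y * x * w +
        c • (h * x * y * x * w) - (c ^ 2) • (e * x * y * x * w))) := by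
    have : x * ((N * c : ℂ) • (c ^ N • y) + f * (c ^ N • y))
        = c ^ N • ((N * c : ℂ) • (x * y) + x * f * y) := by
      simp only [mul_add, mul_smul_comm, smul_add, mul_assoc]
      module
    rw [this, h1]
    simp only [add_mul, sub_mul, smul_mul_assoc, mul_assoc]
  have t3 : e * x * (c ^ N • y) * x * w = c ^ N • (e * x * y * x * w) := by
    simp only [mul_smul_comm, smul_mul_assoc]
  have t4 : h * (c ^ N • (x * y * x * w)) = c ^ N • (h * x * y * x * w) := by
    simp only [mul_smul_comm, mul_assoc]
  rw [t1, t2, t3, t4]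
  generalize e * x * y * x * w = A
  generalize f * x * y * x * w = B
  generalize h * x * y * x * w = D
  generalize x * y * x * w = E
  have hcc : c ^ 2 * c ^ N * c⁻¹ ^ 2 = c ^ N := by field_simp
  have : (c ^ 2) • (c ^ N • (-((c⁻¹ ^ 2) • B))) = -((c ^ N) • B) := by
    rw [smul_neg, smul_neg, smul_smul, smul_smul, hcc]
  rw [this]
  module

/-- The torus element is a Laurent polynomial in its parameter whose coefficients are eigenvectors
of left multiplication by `h`. -/
theorem exists_laurent_corootMat :
    ∃ (N D : ℕ) (Q : ℕ → Mat n),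
      (∀ c : ℂ, c ≠ 0 → c ^ N • corootMat e f c = ∑ k ∈ Finset.range D, c ^ k • Q k) ∧
      ∀ k, h * Q k = ((k : ℂ) - N) • Q k := by
  obtain ⟨E, hE, hE'⟩ := exists_exp_polynomial S.nilp_e
  obtain ⟨N, F, hF, hF'⟩ := exists_exp_inv_polynomial S.nilp_f
  let W : Matrix (Fin n) (Fin n) ℂ[X] := (weylMat e f (-1)).map Polynomial.C
  let P := E * F * E * W
  have hev : ∀ (c : ℂ) (M M' : Matrix (Fin n) (Fin n) ℂ[X]),
      (M * M').map (Polynomial.eval c) = M.map (Polynomial.eval c) * M'.map (Polynomial.eval c) :=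
    fun c M M' => Matrix.map_mul (f := Polynomial.evalRingHom c)
  have hC : ∀ (c : ℂ) (M : Mat n), (M.map Polynomial.C).map (Polynomial.eval c) = M := by
    intro c M; ext1 i j; simp
  have hsm : ∀ (c : ℂ) (p : ℂ[X]) (M : Matrix (Fin n) (Fin n) ℂ[X]),
      (p • M).map (Polynomial.eval c) = p.eval c • M.map (Polynomial.eval c) := by
    intro c p M; ext1 i j; simp
  have hadd : ∀ (c : ℂ) (M M' : Matrix (Fin n) (Fin n) ℂ[X]),
      (M + M').map (Polynomial.eval c) = M.map (Polynomial.eval c) + M'.map (Polynomial.eval c) := by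
    intro c M M'; ext1 i j; simp
  have hP : ∀ c : ℂ, c ≠ 0 → P.map (Polynomial.eval c) = c ^ N • corootMat e f c := by
    intro c hc
    simp only [P, W, hev, hE, hF c hc, hC, corootMat, weylMat, mul_smul_comm, smul_mul_assoc]
  -- This is the differential equation `c d/dc = h` for the torus element, with denominators cleared
  -- by powers of `X`.
  have hder : (Polynomial.X ^ 2 : ℂ[X]) • P.map Polynomial.derivative =
      ((N : ℂ[X]) * Polynomial.X) • P + (Polynomial.X : ℂ[X]) • (h.map Polynomial.C * P) := by
    have hW : W.map Polynomial.derivative = 0 := map_derivative_map_C _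
    have hD : P.map Polynomial.derivative = e.map Polynomial.C * E * F * E * W +
        E * F.map Polynomial.derivative * E * W + E * F * (e.map Polynomial.C * E) * W := by
      simp only [P, map_derivative_mul, hW, hE', mul_zero, add_zero]
      noncomm_ring
    have hD2 : (Polynomial.X ^ 2 : ℂ[X]) • P.map Polynomial.derivative =
        (Polynomial.X ^ 2 : ℂ[X]) • (e.map Polynomial.C * E * F * E * W) +
        E * (((N : ℂ[X]) * Polynomial.X) • F + f.map Polynomial.C * F) * E * W +
        (Polynomial.X ^ 2 : ℂ[X]) • (E * F * (e.map Polynomial.C * E) * W) := by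
      rw [hD, smul_add, smul_add, ← hF']
      simp only [mul_smul_comm, smul_mul_assoc]
    rw [hD2]
    have key : ∀ c : ℂ, c ≠ 0 →
        ((Polynomial.X ^ 2 : ℂ[X]) • (e.map Polynomial.C * E * F * E * W) +
        E * (((N : ℂ[X]) * Polynomial.X) • F + f.map Polynomial.C * F) * E * W +
        (Polynomial.X ^ 2 : ℂ[X]) • (E * F * (e.map Polynomial.C * E) * W)).map
          (Polynomial.eval c) =
        (((N : ℂ[X]) * Polynomial.X) • P + (Polynomial.X : ℂ[X]) •
          (h.map Polynomial.C * P)).map (Polynomial.eval c) := by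
      intro c hc
      have e1 : Polynomial.eval c (Polynomial.X ^ 2 : ℂ[X]) = c ^ 2 := by simp
      have e2 : Polynomial.eval c ((N : ℂ[X]) * Polynomial.X) = N * c := by simp
      have e3 : Polynomial.eval c (Polynomial.X : ℂ[X]) = c := by simp
      simp only [hadd, hsm, hev, hP c hc, hE, hF c hc, hC, W, e1, e2, e3]
      exact S.laurent_identity hc (weylMat e f (-1)) N
    ext1 i j
    -- Both sides are polynomial, so it suffices to evaluate off `0`, where `c⁻¹` has its meaning.
    refine Polynomial.eq_of_infinite_eval_eq _ _ ?_
    refine (Set.finite_singleton (0 : ℂ)).infinite_compl.mono fun c hc => ?_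
    exact congrFun (congrFun (key c hc) i) j
  have hder2 : (Polynomial.X : ℂ[X]) • P.map Polynomial.derivative =
      (N : ℂ[X]) • P + h.map Polynomial.C * P := by
    ext1 i j
    have := congrFun (congrFun hder i) j
    simp only [Matrix.smul_apply, Matrix.add_apply, smul_eq_mul] at this ⊢
    refine mul_left_cancel₀ Polynomial.X_ne_zero ?_
    linear_combination this
  obtain ⟨D, hDd⟩ : ∃ D : ℕ, ∀ i j, (P i j).natDegree < D := by
    obtain ⟨D, hD⟩ := (Set.finite_range fun ij : Fin n × Fin n => (P ij.1 ij.2).natDegree).bddAbove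
    exact ⟨D + 1, fun i j => Nat.lt_succ_of_le (hD ⟨(i, j), rfl⟩)⟩
  refine ⟨N, D,
    fun k => Matrix.of fun i j => (P i j).coeff k, ?_, ?_⟩
  · intro c hc
    rw [← hP c hc]
    ext1 i j
    rw [Matrix.map_apply, Polynomial.eval_eq_sum_range' (hDd i j)]
    simp [Matrix.sum_apply, mul_comm]
  · intro k
    ext1 i j
    have := congrArg (fun p => Polynomial.coeff p k) (congrFun (congrFun hder2 i) j)
    simp only [Matrix.smul_apply, Matrix.add_apply, smul_eq_mul, Matrix.mul_apply,
      Matrix.map_apply, Polynomial.coeff_add, Polynomial.finsetSum_coeff,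
      Polynomial.coeff_C_mul, ← Polynomial.C_eq_natCast] at this
    simp only [Matrix.mul_apply, Matrix.of_apply, Matrix.smul_apply, smul_eq_mul]
    have h2 : (Polynomial.X * Polynomial.derivative (P i j)).coeff k = k * (P i j).coeff k := by
      cases k with
      | zero => simp
      | succ k => rw [Polynomial.coeff_X_mul, Polynomial.coeff_derivative]; push_cast; ring
    rw [h2] at this
    linear_combination -this


end MatSl2

end MatSl2

end HOper

end

/-! ### Weight vectors, integrality of the weights, and the diagonal form of the torus. -/

noncomputable section

set_option linter.unusedSectionVars false

namespace HOper

/-- At the parameter 1 the Laurent expansion writes the identity as a sum of eigenvectors of left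
multiplication by `h` with distinct eigenvalues, so a product of distinct linear factors kills `h`.
-/
theorem corootMat_semisimple {n : ℕ} {h e f : Mat n} (S : MatSl2 h e f) :
    Module.End.IsSemisimple (Matrix.toLin' h) := by
  obtain ⟨N, D, Q, h1, h2⟩ := S.exists_laurent_corootMat
  have hone : (1 : Mat n) = ∑ k ∈ Finset.range D, Q k := by
    have := h1 1 one_ne_zero
    simpa [S.corootMat_one] using this
  let p : ℂ[X] := ∏ k ∈ Finset.range D, (Polynomial.X - Polynomial.C ((k : ℂ) - N))
  have hp : p.Separable := by
    refine Polynomial.separable_prod_X_sub_C_iff'.2 ?_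
    intro a _ b _ hab
    simpa using hab
  have hm : Polynomial.aeval h p = 0 := by
    have hk : ∀ k ∈ Finset.range D, Polynomial.aeval h p * Q k = 0 := by
      intro k hk
      have hp' : p = (∏ j ∈ (Finset.range D).erase k, (Polynomial.X - Polynomial.C ((j : ℂ) - N))) *
          (Polynomial.X - Polynomial.C ((k : ℂ) - N)) := by
        rw [mul_comm]; exact (Finset.mul_prod_erase _ _ hk).symm
      rw [hp', map_mul, mul_assoc]
      have : Polynomial.aeval h (Polynomial.X - Polynomial.C ((k : ℂ) - N)) * Q k = 0 := by
        rw [map_sub, Polynomial.aeval_X, Polynomial.aeval_C, sub_mul, h2 k, Algebra.smul_def,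
          sub_self]
      rw [this, mul_zero]
    rw [← mul_one (Polynomial.aeval h p), hone, Finset.mul_sum, Finset.sum_eq_zero hk]
  refine Module.End.isSemisimple_of_squarefree_aeval_eq_zero hp.squarefree (p := p) ?_
  have := congrArg (Matrix.toLinAlgEquiv' (R := ℂ) (n := Fin n)) hm
  rw [map_zero, ← AlgEquiv.coe_toAlgHom, ← Polynomial.aeval_algHom_apply] at this
  exact this

theorem expElt_complex {n : ℕ} {L : Type*} [LieRing L] [LieAlgebra ℂ L]
    (ρ : L →ₗ⁅ℂ⁆ Mat n) (x : L) (a : ℂ) : expElt ρ ℂ x a = IsNilpotent.exp (a • ρ x) := by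
  have : (ρ x).map (algebraMap ℂ ℂ) = ρ x := by ext; simp
  rw [expElt, this]

open LieAlgebra LieAlgebra.IsKilling

variable {n : ℕ} {L : Type*} [LieRing L] [LieAlgebra ℂ L] [FiniteDimensional ℂ L]
  [LieAlgebra.IsSimple ℂ L] {H : LieSubalgebra ℂ L} [H.IsCartanSubalgebra]
  {b : (rootSystem H).Base} (C : ChevalleyGenerators b) (ρ : L →ₗ⁅ℂ⁆ Mat n)

theorem map_lie_eq (x y : L) : ρ ⁅x, y⁆ = ρ x * ρ y - ρ y * ρ x := LieHom.map_lie ρ x y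

theorem matSl2 (i : b.support) :
    MatSl2 (ρ (((rootSystem H).coroot i : H) : L)) (ρ (C.e i)) (ρ (C.f i)) where
  he := by rw [← map_lie_eq, (C.sl2 i).lie_h_e_nsmul, map_nsmul, two_smul, two_smul]
  hf := by rw [← map_lie_eq, (C.sl2 i).lie_h_f_nsmul, map_neg, map_nsmul, two_smul, two_smul]
  ef := by rw [← map_lie_eq, (C.sl2 i).lie_e_f]

theorem weylElt_complex (i : b.support) (a : ℂˣ) :
    weylElt ρ C i a = weylMat (ρ (C.e i)) (ρ (C.f i)) a := by
  simp only [weylElt, expElt_complex, weylMat]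

theorem corootPow_complex (i : b.support) (a : ℂˣ) :
    corootPow ρ C i a = corootMat (ρ (C.e i)) (ρ (C.f i)) a := by
  simp only [corootPow, weylElt_complex, corootMat]
  simp

theorem coroot_eq_sum (h : H) : ∃ c : b.support → ℂ, h = ∑ i, c i • (rootSystem H).coroot i :=
  ⟨fun i => b.toCoweightBasis.repr h i, by
    conv_lhs => rw [← b.toCoweightBasis.sum_repr h]
    simp⟩

theorem map_cartan_commute (h h' : H) : ρ (h : L) * ρ (h' : L) = ρ (h' : L) * ρ (h : L) := by
  have h0 : ⁅h, h'⁆ = 0 := trivial_lie_zero H H h h'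
  have : ⁅(h : L), (h' : L)⁆ = 0 := by
    rw [← LieSubalgebra.coe_bracket, h0]; rfl
  have h2 := map_lie_eq ρ (h : L) (h' : L)
  rw [this, map_zero] at h2
  exact (sub_eq_zero.1 h2.symm)

/-- A basis of `ℂⁿ` consisting of weight vectors. -/
structure WeightBasis (H : LieSubalgebra ℂ L) [H.IsCartanSubalgebra] (ρ : L →ₗ⁅ℂ⁆ Mat n) where
  P : GL (Fin n) ℂ
  wt : Fin n → Module.Dual ℂ H
  diag : ∀ h : H, ρ (h : L) * (P : Mat n) = P * Matrix.diagonal fun j => wt j h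

include C in
-- The simple coroots act by commuting diagonalizable matrices, so their common eigenvectors span;
-- since the simple coroots span `H`, these are weight vectors.
theorem exists_weightBasis : Nonempty (WeightBasis H ρ) := by
  let f : b.support → Module.End ℂ (Fin n → ℂ) := fun i =>
    Matrix.toLin' (ρ (((rootSystem H).coroot i : H) : L))
  have hss : ∀ i, (f i).IsSemisimple := fun i => corootMat_semisimple (matSl2 C ρ i)
  have htop := Module.End.iSup_iInf_maxGenEigenspace_eq_top_of_iSup_maxGenEigenspace_eq_top_of_commute
    f (by
      intro i j _
      have := map_cartan_commute ρ ((rootSystem H).coroot i) ((rootSystem H).coroot j)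
      simp only [Commute, SemiconjBy, f, Module.End.mul_eq_comp, ← Matrix.toLin'_mul, this])
    (fun i => by
      simp_rw [(hss i).isFinitelySemisimple.maxGenEigenspace_eq_eigenspace]
      exact (hss i).iSup_eigenspace_eq_top)
  let s : Set (Fin n → ℂ) := {v | ∃ χ : b.support → ℂ, ∀ i, f i v = χ i • v}
  have hs : ⊤ ≤ Submodule.span ℂ s := by
    rw [← htop]
    refine iSup_le fun χ => ?_
    intro v hv
    refine Submodule.subset_span ⟨χ, fun i => ?_⟩
    have := (Submodule.mem_iInf _).1 hv i
    rw [(hss i).isFinitelySemisimple.maxGenEigenspace_eq_eigenspace,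
      Module.End.mem_eigenspace_iff] at this
    exact this
  let B := Module.Basis.ofSpan hs
  have : Finite _ := Module.Finite.finite_basis B
  have : Fintype _ := Fintype.ofFinite ((linearIndepOn_empty ℂ id).extend (Set.empty_subset s))
  have hcard : Fintype.card ((linearIndepOn_empty ℂ id).extend (Set.empty_subset s)) = n := by
    rw [← Module.finrank_eq_card_basis B, Module.finrank_fin_fun]
  let B' := B.reindex (Fintype.equivFinOfCardEq hcard)
  have hB' : ∀ j, ∃ χ : b.support → ℂ, ∀ i, f i (B' j) = χ i • B' j := by
    intro j
    rw [Module.Basis.reindex_apply]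
    exact Module.Basis.ofSpan_subset hs ⟨_, rfl⟩
  choose χ hχ using hB'
  let M : Mat n := (Pi.basisFun ℂ (Fin n)).toMatrix B'
  have hM : IsUnit M := by
    have := (Pi.basisFun ℂ (Fin n)).invertibleToMatrix B'
    exact isUnit_of_invertible M
  -- The weight of a basis vector is the functional with the observed eigenvalues on the basis of
  -- simple coroots.
  refine ⟨⟨hM.unit, fun j => b.toCoweightBasis.constr ℂ (χ j), fun h => ?_⟩⟩
  obtain ⟨c, rfl⟩ := coroot_eq_sum (b := b) h
  rw [IsUnit.unit_spec]
  ext i j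
  rw [Matrix.mul_diagonal]
  have e1 : (ρ ((∑ i, c i • (rootSystem H).coroot i : H) : L) * M) i j
      = (Matrix.toLin' (ρ ((∑ i, c i • (rootSystem H).coroot i : H) : L)) (B' j)) i := by
    rw [Matrix.toLin'_apply, Matrix.mul_apply, Matrix.mulVec, dotProduct]
    rfl
  have e2 : Matrix.toLin' (ρ ((∑ i, c i • (rootSystem H).coroot i : H) : L))
      = ∑ i, c i • f i := by
    simp only [f, ← map_smul, ← map_sum]
    congr 2
    simp
  rw [e1, e2, LinearMap.sum_apply]
  have e3 : b.toCoweightBasis.constr ℂ (χ j) (∑ i, c i • (rootSystem H).coroot i)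
      = ∑ i, c i * χ j i := by
    rw [map_sum]
    refine Finset.sum_congr rfl fun i _ => ?_
    rw [map_smul, ← b.toCoweightBasis_apply, Module.Basis.constr_basis, smul_eq_mul]
  rw [e3]
  simp only [LinearMap.smul_apply, hχ, smul_smul, ← Finset.sum_smul]
  rw [Pi.smul_apply, smul_eq_mul, mul_comm]
  rfl

variable {ρ}

namespace WeightBasis

variable (W : WeightBasis H ρ)

/-- The matrix in the weight basis. -/
def hat : Mat n →ₐ[ℂ] Mat n where
  toFun M := (W.P⁻¹ : GL (Fin n) ℂ) * M * W.P
  map_one' := by rw [mul_one, ← Units.val_mul, inv_mul_cancel, Units.val_one]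
  map_mul' M N := by
    have : (W.P : Mat n) * (W.P⁻¹ : GL (Fin n) ℂ) = 1 := by
      rw [← Units.val_mul, mul_inv_cancel, Units.val_one]
    calc _ = (W.P⁻¹ : GL (Fin n) ℂ) * M * ((W.P : Mat n) * (W.P⁻¹ : GL (Fin n) ℂ)) * N * W.P := by
          rw [this]; simp only [mul_assoc, one_mul]
      _ = _ := by simp only [mul_assoc]
  map_zero' := by simp
  map_add' M N := by rw [mul_add, add_mul]
  commutes' r := by
    rw [← Algebra.commutes r ((W.P⁻¹ : GL (Fin n) ℂ) : Mat n), mul_assoc, ← Units.val_mul,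
      inv_mul_cancel, Units.val_one, mul_one]

theorem hat_apply (M : Mat n) : W.hat M = (W.P⁻¹ : GL (Fin n) ℂ) * M * W.P := rfl

/-- The inverse of `hat`. -/
def unhat (M : Mat n) : Mat n := W.P * M * (W.P⁻¹ : GL (Fin n) ℂ)

theorem hat_unhat (M : Mat n) : W.hat (W.unhat M) = M := by
  have : ((W.P⁻¹ : GL (Fin n) ℂ) : Mat n) * W.P = 1 := by
    rw [← Units.val_mul, inv_mul_cancel, Units.val_one]
  rw [hat_apply, unhat]
  calc _ = (((W.P⁻¹ : GL (Fin n) ℂ) : Mat n) * W.P) * M * (((W.P⁻¹ : GL (Fin n) ℂ) : Mat n) * W.P)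
        := by simp only [mul_assoc]
    _ = M := by rw [this, one_mul, mul_one]

theorem unhat_hat (M : Mat n) : W.unhat (W.hat M) = M := by
  have : (W.P : Mat n) * (W.P⁻¹ : GL (Fin n) ℂ) = 1 := by
    rw [← Units.val_mul, mul_inv_cancel, Units.val_one]
  rw [hat_apply, unhat]
  calc _ = ((W.P : Mat n) * (W.P⁻¹ : GL (Fin n) ℂ)) * M * ((W.P : Mat n) * (W.P⁻¹ : GL (Fin n) ℂ))
        := by simp only [mul_assoc]
    _ = M := by rw [this, one_mul, mul_one]

theorem hat_injective : Function.Injective W.hat :=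
  Function.LeftInverse.injective W.unhat_hat

theorem hat_cartan (h : H) : W.hat (ρ (h : L)) = Matrix.diagonal fun j => W.wt j h := by
  rw [hat_apply, mul_assoc, W.diag, ← mul_assoc, ← Units.val_mul, inv_mul_cancel, Units.val_one,
    one_mul]

theorem hat_semiconj {X Y Z : Mat n} (h : X * Y = Z * X) :
    W.hat X * W.hat Y = W.hat Z * W.hat X := by rw [← map_mul, h, map_mul]

/-- With diagonal matrices on both sides, a non-zero entry forces the two weights to agree. This
governs the supports of the torus, of the lifts of Weyl group elements and of everything commuting
with a coweight. -/
theorem hat_of_intertwine {X : Mat n} {h h' : H} (e : X * ρ (h : L) = ρ (h' : L) * X) (i j : Fin n) :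
    W.hat X i j * W.wt j h = W.wt i h' * W.hat X i j := by
  have := congrFun (congrFun (W.hat_semiconj e) i) j
  rwa [hat_cartan, hat_cartan, Matrix.mul_diagonal, Matrix.diagonal_mul] at this

theorem hat_of_eigen {X : Mat n} {h : H} {c : ℂ} (e : ρ (h : L) * X - X * ρ (h : L) = c • X)
    (i j : Fin n) : (W.wt i h - W.wt j h - c) * W.hat X i j = 0 := by
  have := congrArg (fun M => W.hat M i j) e
  simp only [map_sub, map_mul, map_smul, hat_cartan, Matrix.sub_apply, Matrix.mul_diagonal,
    Matrix.diagonal_mul, Matrix.smul_apply, smul_eq_mul] at this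
  linear_combination this

theorem hat_rootVector {α : H → ℂ} {x : L} (hx : x ∈ rootSpace H α) (i j : Fin n)
    (hne : W.hat (ρ x) i j ≠ 0) (h : H) : W.wt i h = W.wt j h + α h := by
  have e : ρ (h : L) * ρ x - ρ x * ρ (h : L) = α h • ρ x := by
    rw [← map_lie_eq, ← map_smul]
    congr 1
    exact lie_eq_smul_of_mem_rootSpace hx h
  have := (mul_eq_zero.1 (W.hat_of_eigen e i j)).resolve_right hne
  linear_combination this

/-- Row `j` of the coefficient `Q k` vanishes unless the weight equals `k - N`. These rows add up to
a row of the identity, so one `k` does occur; it makes the weight an integer and leaves a single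
power of `c`. -/
theorem exists_int_laurent (C : ChevalleyGenerators b) (i : b.support) (j : Fin n) :
    ∃ m : ℤ, W.wt j ((rootSystem H).coroot i) = m ∧ ∀ (c : ℂ), c ≠ 0 → ∀ k,
      W.hat (corootMat (ρ (C.e i)) (ρ (C.f i)) c) j k = if j = k then c ^ m else 0 := by
  have S := matSl2 C ρ i
  obtain ⟨N, D, Q, h1, h2⟩ := S.exists_laurent_corootMat
  have h3 : ∀ (k : ℕ) l, (W.wt j ((rootSystem H).coroot i) - ((k : ℂ) - N)) * W.hat (Q k) j l = 0 := by
    intro k l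
    have := congrArg (fun M => W.hat M j l) (h2 k)
    simp only [map_mul, map_smul, hat_cartan, Matrix.diagonal_mul, Matrix.smul_apply,
      smul_eq_mul] at this
    linear_combination this
  have h4 : ∀ c : ℂ, c ≠ 0 → ∀ l, c ^ N * W.hat (corootMat (ρ (C.e i)) (ρ (C.f i)) c) j l =
      ∑ k ∈ Finset.range D, c ^ k * W.hat (Q k) j l := by
    intro c hc l
    have := congrArg (fun M => W.hat M j l) (h1 c hc)
    simpa [map_sum, Matrix.sum_apply] using this
  have h5 : ∀ l, (1 : Mat n) j l = ∑ k ∈ Finset.range D, W.hat (Q k) j l := by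
    intro l
    have := h4 1 one_ne_zero l
    simpa [S.corootMat_one] using this
  obtain ⟨k, hk, hne⟩ : ∃ k ∈ Finset.range D, W.hat (Q k) j j ≠ 0 := by
    by_contra! hcon
    have := h5 j
    rw [Finset.sum_eq_zero hcon] at this
    simp at this
  have hw := sub_eq_zero.1 ((mul_eq_zero.1 (h3 k j)).resolve_right hne)
  have hother : ∀ k' l, k' ≠ k → W.hat (Q k') j l = 0 := by
    intro k' l hk'
    refine (mul_eq_zero.1 (h3 k' l)).resolve_left ?_
    rw [hw]
    intro h0
    apply hk'
    have : (k : ℂ) = k' := by linear_combination h0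
    exact_mod_cast this.symm
  refine ⟨(k : ℤ) - N, by rw [hw]; push_cast; ring, fun c hc l => ?_⟩
  have h6 := h5 l
  have h7 := h4 c hc l
  rw [Finset.sum_eq_single_of_mem k hk (fun k' _ hk' => hother k' l hk')] at h6
  rw [Finset.sum_eq_single_of_mem k hk
    (fun k' _ hk' => by rw [hother k' l hk', mul_zero]), ← h6] at h7
  rw [zpow_sub₀ hc, zpow_natCast, zpow_natCast]
  rw [Matrix.one_apply] at h7
  have hcN : c ^ N ≠ 0 := pow_ne_zero _ hc
  split_ifs with hjl
  · rw [if_pos hjl, mul_one] at h7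
    field_simp
    linear_combination h7
  · rw [if_neg hjl, mul_zero] at h7
    exact (mul_eq_zero.1 h7).resolve_left hcN

/-- The integer `⟨μ_j, α̌_i⟩`. -/
def m (C : ChevalleyGenerators b) (i : b.support) (j : Fin n) : ℤ :=
  (W.exists_int_laurent C i j).choose

theorem wt_coroot (C : ChevalleyGenerators b) (i : b.support) (j : Fin n) :
    W.wt j ((rootSystem H).coroot i) = W.m C i j := (W.exists_int_laurent C i j).choose_spec.1

theorem hat_corootMat (C : ChevalleyGenerators b) (i : b.support) {c : ℂ} (hc : c ≠ 0) :
    W.hat (corootMat (ρ (C.e i)) (ρ (C.f i)) c) = Matrix.diagonal fun j => c ^ W.m C i j := by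
  ext j k
  rw [(W.exists_int_laurent C i j).choose_spec.2 c hc k, Matrix.diagonal_apply]
  rfl

end WeightBasis

end HOper

end

/-! ### Consequences of simple connectedness; integral coweights and signs of roots. -/

noncomputable section

set_option linter.unusedSectionVars false

namespace HOper

open LieAlgebra LieAlgebra.IsKilling
open scoped Classical

variable {n : ℕ} {L : Type*} [LieRing L] [LieAlgebra ℂ L] [FiniteDimensional ℂ L]
  [LieAlgebra.IsSimple ℂ L] {H : LieSubalgebra ℂ L} [H.IsCartanSubalgebra]
  {b : (rootSystem H).Base} (C : ChevalleyGenerators b) {ρ : L →ₗ⁅ℂ⁆ Mat n}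

theorem root_apply_coroot_int (α β : H.root) :
    ∃ k : ℤ, (rootSystem H).root α ((rootSystem H).coroot β) = k := by
  obtain ⟨k, hk⟩ := (rootSystem H).exists_value (S := ℤ) α β
  exact ⟨k, by rw [← (rootSystem H).root_coroot_eq_pairing] at hk; simpa using hk.symm⟩

namespace WeightBasis

variable (W : WeightBasis H ρ)

theorem exists_of_isWeight {ν : Module.Dual ℂ H} (hν : IsWeight H ρ ν) : ∃ j, ν = W.wt j := by
  obtain ⟨v, hv, h⟩ := hν
  let c : Fin n → ℂ := ((W.P⁻¹ : GL (Fin n) ℂ) : Mat n).mulVec v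
  have hc : (W.P : Mat n).mulVec c = v := by
    rw [Matrix.mulVec_mulVec, ← Units.val_mul, mul_inv_cancel, Units.val_one, Matrix.one_mulVec]
  have hc0 : c ≠ 0 := by
    rintro h0
    rw [h0, Matrix.mulVec_zero] at hc
    exact hv hc.symm
  obtain ⟨j, hj⟩ := Function.ne_iff.1 hc0
  refine ⟨j, LinearMap.ext fun x => ?_⟩
  have e := h x
  have e2 : (Matrix.diagonal fun j => W.wt j x).mulVec c = ν x • c := by
    rw [← W.hat_cartan, hat_apply, ← Matrix.mulVec_mulVec, hc, ← Matrix.mulVec_mulVec, e,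
      Matrix.mulVec_smul]
  have e3 := congrFun e2 j
  rw [Matrix.mulVec_diagonal, Pi.smul_apply, smul_eq_mul] at e3
  exact (mul_right_cancel₀ hj e3).symm

theorem exists_int_comb {μ : Module.Dual ℂ H}
    (hμ : μ ∈ AddSubgroup.closure {ν | IsWeight H ρ ν}) :
    ∃ k : Fin n → ℤ, μ = ∑ j, k j • W.wt j := by
  induction hμ using AddSubgroup.closure_induction with
  | mem x hx =>
    obtain ⟨j, rfl⟩ := W.exists_of_isWeight hx
    exact ⟨Pi.single j 1, by simp [Pi.single_apply]⟩
  | zero => exact ⟨0, by simp⟩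
  | add x y _ _ hx hy =>
    obtain ⟨k, rfl⟩ := hx
    obtain ⟨l, rfl⟩ := hy
    exact ⟨k + l, by simp [add_smul, Finset.sum_add_distrib]⟩
  | neg x _ hx =>
    obtain ⟨k, rfl⟩ := hx
    exact ⟨-k, by simp⟩

/-- Otherwise the simple root, being an integral combination of weights, would vanish on its own
coroot, where its value is 2. -/
theorem exists_m_ne_zero (hsc : IsSimplyConnected H ρ) (i : b.support) : ∃ j, W.m C i j ≠ 0 := by
  by_contra! hcon
  obtain ⟨k, hk⟩ := W.exists_int_comb (hsc ((rootSystem H).root i)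
    (root_apply_coroot_int i.1))
  have := congrArg (fun f => f ((rootSystem H).coroot i)) hk
  simp only [LinearMap.sum_apply, LinearMap.smul_apply, W.wt_coroot C, hcon] at this
  rw [show (rootSystem H).root i ((rootSystem H).coroot i) = 2 from
    (rootSystem H).root_coroot_two i] at this
  simp at this

/-- The fundamental weight is integral on coroots, hence by simple connectedness an integral
combination of weights of `ρ`. It follows that each simple coroot coordinate of a torus element is a
Laurent monomial in the diagonal entries. -/
theorem exists_fundamental (hsc : IsSimplyConnected H ρ) (i : b.support) :
    ∃ k : Fin n → ℤ, ∀ i', ∑ j, k j * W.m C i' j = if i' = i then 1 else 0 := by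
  let μ : Module.Dual ℂ H := b.toCoweightBasis.coord i
  have hμ : ∀ i' : b.support, μ ((rootSystem H).coroot i') = if i' = i then 1 else 0 := by
    intro i'
    rw [← b.toCoweightBasis_apply, Module.Basis.coord_apply, Module.Basis.repr_self,
      Finsupp.single_apply]
  obtain ⟨k, hk⟩ := W.exists_int_comb (hsc μ (by
    intro α
    have := b.coroot_mem_span_int α
    generalize (rootSystem H).coroot α = c at this ⊢
    induction this using Submodule.span_induction with
    | mem x hx =>
      obtain ⟨i', hi', rfl⟩ := hx
      refine ⟨if (⟨i', hi'⟩ : b.support) = i then 1 else 0, ?_⟩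
      rw [hμ ⟨i', hi'⟩]
      split_ifs <;> simp
    | zero => exact ⟨0, by simp⟩
    | add x y _ _ hx hy =>
      obtain ⟨k, hk⟩ := hx
      obtain ⟨l, hl⟩ := hy
      exact ⟨k + l, by rw [map_add, hk, hl]; simp⟩
    | smul a x _ hx =>
      obtain ⟨k, hk⟩ := hx
      exact ⟨a * k, by rw [map_zsmul, hk]; simp⟩))
  refine ⟨k, fun i' => ?_⟩
  have := congrArg (fun f => f ((rootSystem H).coroot i')) hk
  simp only [LinearMap.sum_apply, LinearMap.smul_apply, W.wt_coroot C] at this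
  rw [hμ] at this
  have h2 : (((∑ j, k j * W.m C i' j : ℤ)) : ℂ) = ((if i' = i then 1 else 0 : ℤ) : ℂ) := by
    push_cast
    rw [this]
    simp
  exact_mod_cast h2

end WeightBasis

include C in
theorem map_coroot_ne_zero (hsc : IsSimplyConnected H ρ) (i : b.support) :
    ρ (((rootSystem H).coroot i : H) : L) ≠ 0 := by
  obtain ⟨W⟩ := exists_weightBasis C ρ
  intro h0
  obtain ⟨j, hj⟩ := W.exists_m_ne_zero C hsc i
  have := congrFun (congrFun (W.hat_cartan ((rootSystem H).coroot i)) j) j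
  rw [h0, map_zero, Matrix.diagonal_apply_eq, W.wt_coroot C, Matrix.zero_apply] at this
  exact hj (by exact_mod_cast this.symm)

variable (b) in
theorem support_nonempty_of_simple : Nonempty b.support := by
  have : Nonempty H.root := by
    by_contra hcon
    have hH : ∀ y : L, y ∈ H := by
      intro y
      have hy : y ∈ (⊤ : LieSubmodule ℂ H L) := LieSubmodule.mem_top y
      rw [← cartan_sup_iSup_rootSpace_eq_top H] at hy
      have h0 : (⨆ α : LieModule.Weight ℂ H L, ⨆ (_ : α.IsNonZero), rootSpace H α) = ⊥ := by
        simp only [iSup_eq_bot]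
        intro α hα
        exact absurd ⟨α, by simpa using hα⟩ hcon
      rw [h0, sup_bot_eq] at hy
      exact hy
    have : IsLieAbelian L := ⟨fun x y => by
      have := trivial_lie_zero H H ⟨x, hH x⟩ ⟨y, hH y⟩
      exact congrArg Subtype.val this⟩
    exact LieAlgebra.IsSimple.non_abelian (R := ℂ) (L := L) this
  exact b.support_nonempty.to_subtype

include C in
-- The kernel is an ideal of a simple Lie algebra, and it does not contain the simple coroots.
theorem rep_injective (hsc : IsSimplyConnected H ρ) : Function.Injective ρ := by
  obtain ⟨i⟩ := support_nonempty_of_simple b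
  rw [← LieHom.coe_toLinearMap, ← LinearMap.ker_eq_bot]
  rcases LieAlgebra.IsSimple.eq_bot_or_eq_top (R := ℂ) (L := L) ρ.ker with h | h
  · rw [← LieHom.ker_toSubmodule, h]; rfl
  · exfalso
    refine map_coroot_ne_zero C hsc i ?_
    have : (((rootSystem H).coroot i : H) : L) ∈ ρ.ker := by rw [h]; trivial
    exact LieHom.mem_ker.1 this

theorem exists_weight_decomp (y : L) :
    ∃ x : LieModule.Weight ℂ H L → L, (∀ χ : LieModule.Weight ℂ H L, x χ ∈ rootSpace H χ) ∧ y = ∑ χ, x χ := by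
  have hy : y ∈ (⨆ χ : LieModule.Weight ℂ H L, (rootSpace H χ).toSubmodule) := by
    rw [← LieSubmodule.iSup_toSubmodule, LieModule.iSup_genWeightSpace_eq_top']
    trivial
  obtain ⟨f, hf, h⟩ := (Submodule.mem_iSup_iff_exists_finsupp _ _).1 hy
  refine ⟨f, hf, ?_⟩
  rw [← h, Finsupp.sum_fintype _ _ (by simp)]

/-- Integral coweights that are proportional to the fundamental ones. -/
structure Coweights (b : (rootSystem H).Base) where
  D : ℤ
  D_pos : 0 < D
  ω : b.support → H
  root_ω : ∀ i k : b.support, (rootSystem H).root i (ω k) = if i = k then (D : ℂ) else 0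
  int : ∀ k, ∃ c : b.support → ℤ, ω k = ∑ i, c i • (rootSystem H).coroot i

variable (b) in
-- The Cartan matrix is inverted up to an integer factor. The adjugate is multiplied once more by
-- the determinant so that this factor is a square and hence positive.
theorem exists_coweights : Nonempty (Coweights b) := by
  let A := b.cartanMatrix
  have hA : A.det ≠ 0 := Matrix.nondegenerate_iff_det_ne_zero.1 b.cartanMatrix_nondegenerate
  have hm : A * (A.det • A.adjugate) = (A.det * A.det) • 1 := by
    rw [Matrix.mul_smul, Matrix.mul_adjugate, smul_smul]
  refine ⟨⟨A.det * A.det, mul_self_pos.2 hA, fun k => ∑ j, (A.det • A.adjugate) j k •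
    (rootSystem H).coroot j, fun i k => ?_, fun k => ⟨_, rfl⟩⟩⟩
  have := congrArg (fun M : Matrix b.support b.support ℤ => ((M i k : ℤ) : ℂ)) hm
  rw [map_sum]
  simp only [map_zsmul]
  have e : ∀ j : b.support, (rootSystem H).root i ((rootSystem H).coroot j) = ((A i j : ℤ) : ℂ) := by
    intro j
    exact ((rootSystem H).root_coroot_eq_pairing i j).trans
      (b.algebraMap_cartanMatrixIn_apply ℤ i j).symm
  simp only [e, Matrix.mul_apply] at this ⊢
  push_cast at this
  rw [show (∑ j, (A.det • A.adjugate) j k • ((A i j : ℤ) : ℂ)) =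
    ∑ j, ((A i j : ℤ) : ℂ) * (((A.det • A.adjugate) j k : ℤ) : ℂ) from
      Finset.sum_congr rfl fun j _ => by rw [zsmul_eq_mul, mul_comm], this]
  simp only [Matrix.smul_apply, Matrix.one_apply]
  split_ifs <;> simp

namespace Coweights

variable (Ω : Coweights b)

/-- The sum of all the chosen coweights. -/
def h0 : H := ∑ k, Ω.ω k

/-- The sum of all the chosen coweights but one. -/
def h' (i : b.support) : H := Ω.h0 - Ω.ω i

theorem simple_h0 (i : b.support) : (rootSystem H).root i Ω.h0 = Ω.D := by
  simp [h0, map_sum, Ω.root_ω, -rootSystem_root_apply]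

theorem simple_h' (i k : b.support) :
    (rootSystem H).root i (Ω.h' k) = if i = k then 0 else (Ω.D : ℂ) := by
  rw [h', map_sub, simple_h0, root_ω]
  split_ifs <;> simp

theorem root_h0 (α : H.root) : (rootSystem H).root α Ω.h0 = ((Ω.D * b.height α : ℤ) : ℂ) := by
  obtain ⟨f, hf, -, hf2⟩ := b.exists_root_eq_sum_int α
  rw [RootPairing.Base.height_eq_sum hf2, hf2, LinearMap.sum_apply]
  push_cast
  rw [Finset.mul_sum]
  refine Finset.sum_congr rfl fun j hj => ?_
  rw [LinearMap.smul_apply, Ω.simple_h0 ⟨j, hj⟩, zsmul_eq_mul, mul_comm]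

theorem isPos_iff (α : H.root) :
    b.IsPos α ↔ ∃ d : ℤ, 0 < d ∧ (rootSystem H).root α Ω.h0 = d := by
  rw [RootPairing.Base.isPos_iff, Ω.root_h0]
  constructor
  · intro h
    exact ⟨_, mul_pos Ω.D_pos h, rfl⟩
  · rintro ⟨d, hd, h⟩
    have : Ω.D * b.height α = d := by exact_mod_cast h
    rw [← this] at hd
    exact (mul_pos_iff_of_pos_left Ω.D_pos).1 hd

theorem not_isPos_iff (α : H.root) :
    ¬ b.IsPos α ↔ ∃ d : ℤ, d < 0 ∧ (rootSystem H).root α Ω.h0 = d := by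
  rw [Ω.isPos_iff]
  have hne : Ω.D * b.height α ≠ 0 := mul_ne_zero Ω.D_pos.ne' (b.height_ne_zero α)
  constructor
  · intro h
    refine ⟨_, ?_, Ω.root_h0 α⟩
    by_contra hcon
    exact h ⟨_, by omega, Ω.root_h0 α⟩
  · rintro ⟨d, hd, h⟩ ⟨d', hd', h'⟩
    rw [h] at h'
    have : d = d' := by exact_mod_cast h'
    omega

/-- A root vanishing on the reduced coweight is plus or minus the omitted simple root; the sign of
the value of any other root is that of the root. -/
theorem root_h' (α : H.root) (i : b.support) :
    (∃ d : ℤ, 0 < d ∧ (rootSystem H).root α (Ω.h' i) = d ∧ b.IsPos α) ∨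
    (∃ d : ℤ, d < 0 ∧ (rootSystem H).root α (Ω.h' i) = d ∧ ¬ b.IsPos α) ∨
    ((rootSystem H).root α = (rootSystem H).root i ∧ b.IsPos α) ∨
    ((rootSystem H).root α = -(rootSystem H).root i ∧ ¬ b.IsPos α) := by
  obtain ⟨f, hf, hs, hf2⟩ := b.exists_root_eq_sum_int α
  have hv : (rootSystem H).root α (Ω.h' i) =
      ((Ω.D * ∑ j ∈ b.support.erase i, f j : ℤ) : ℂ) := by
    rw [hf2, LinearMap.sum_apply, ← Finset.add_sum_erase _ _ i.2, LinearMap.smul_apply,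
      Ω.simple_h' i i, if_pos rfl, smul_zero, zero_add]
    push_cast
    rw [Finset.mul_sum]
    refine Finset.sum_congr rfl fun j hj => ?_
    rw [LinearMap.smul_apply, Ω.simple_h' ⟨j, Finset.mem_of_mem_erase hj⟩ i, zsmul_eq_mul, mul_comm,
      if_neg]
    intro h
    rw [← h] at hj
    simp at hj
  have hht : b.height α = f i + ∑ j ∈ b.support.erase i, f j := by
    rw [RootPairing.Base.height_eq_sum hf2, Finset.add_sum_erase _ _ i.2]
  have hne := b.height_ne_zero α
  have hzero : (∑ j ∈ b.support.erase i, f j = 0) → ((∀ j, 0 ≤ f j) ∨ (∀ j, f j ≤ 0)) →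
      (rootSystem H).root α = f i • (rootSystem H).root i := by
    intro h0 hsg
    have hz : ∀ j ∈ b.support.erase i, f j = 0 := by
      rcases hsg with h | h
      · exact (Finset.sum_eq_zero_iff_of_nonneg fun j _ => h j).1 h0
      · exact (Finset.sum_eq_zero_iff_of_nonpos fun j _ => h j).1 h0
    rw [hf2, ← Finset.add_sum_erase _ _ i.2, Finset.sum_eq_zero, add_zero]
    intro j hj
    rw [hz j hj, zero_smul]
  have hone : (rootSystem H).root α = f i • (rootSystem H).root i → f i = 1 ∨ f i = -1 := by
    intro h
    have h1 : (rootSystem H).root α = ((f i : ℤ) : ℂ) • (rootSystem H).root i := by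
      rw [h, Int.cast_smul_eq_zsmul]
    have : IsAddTorsionFree (Module.Dual ℂ H) := .of_isTorsionFree ℂ _
    have : IsAddTorsionFree H := .of_isTorsionFree ℂ _
    have h2 := b.eq_one_or_neg_one_of_mem_support_of_smul_mem i i.2 ((f i : ℤ) : ℂ)
      (by rw [← h1]; exact ⟨α, rfl⟩)
    rcases h2 with h2 | h2
    · left; exact_mod_cast h2
    · right; exact_mod_cast h2
  have hD := Ω.D_pos
  rcases hs with hs | hs
  · have hnn : ∀ j, 0 ≤ f j := hs.le
    have hS : 0 ≤ ∑ j ∈ b.support.erase i, f j := Finset.sum_nonneg fun j _ => hnn j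
    have hpos : b.IsPos α := by
      rw [RootPairing.Base.isPos_iff]
      have := hnn i
      omega
    rcases hS.eq_or_lt with h0 | h0
    · have h1 := hzero h0.symm (Or.inl hnn)
      rcases hone h1 with h2 | h2
      · right; right; left
        exact ⟨by rw [h1, h2, one_smul], hpos⟩
      · have := hnn i
        omega
    · left
      exact ⟨_, mul_pos hD h0, hv, hpos⟩
  · have hnn : ∀ j, f j ≤ 0 := hs.le
    have hS : ∑ j ∈ b.support.erase i, f j ≤ 0 := Finset.sum_nonpos fun j _ => hnn j
    have hpos : ¬ b.IsPos α := by
      rw [RootPairing.Base.isPos_iff]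
      have := hnn i
      omega
    rcases hS.eq_or_lt with h0 | h0
    · have h1 := hzero h0 (Or.inr hnn)
      rcases hone h1 with h2 | h2
      · have := hnn i
        omega
      · right; right; right
        exact ⟨by rw [h1, h2, neg_one_smul], hpos⟩
    · right; left
      exact ⟨_, mul_neg_of_pos_of_neg hD h0, hv, hpos⟩

theorem exists_int_wt (W : WeightBasis H ρ) (C : ChevalleyGenerators b) (k : b.support)
    (j : Fin n) : ∃ a : ℤ, W.wt j (Ω.ω k) = a := by
  obtain ⟨c, hc⟩ := Ω.int k
  refine ⟨∑ i, c i * W.m C i j, ?_⟩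
  rw [hc, map_sum]
  push_cast
  refine Finset.sum_congr rfl fun i _ => ?_
  rw [map_zsmul, W.wt_coroot C, zsmul_eq_mul]

end Coweights

end HOper

end

/-! ### Unipotent subgroups described by a filtration of the matrix algebra. -/

noncomputable section

set_option linter.unusedSectionVars false

namespace HOper

open LieAlgebra LieAlgebra.IsKilling
open scoped Classical

section Filtration

variable {n : ℕ} {a : Fin n → ℤ} {d e : ℤ} {M N : Mat n}

/-- The filtration of the matrix algebra by the degree `a j - a i`. -/
def Fil (a : Fin n → ℤ) (d : ℤ) : Submodule ℂ (Mat n) where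
  carrier := {M | ∀ i j, a j - a i < d → M i j = 0}
  zero_mem' := fun _ _ _ => rfl
  add_mem' := fun hM hN i j h => by rw [Matrix.add_apply, hM i j h, hN i j h, add_zero]
  smul_mem' := fun c M hM i j h => by rw [Matrix.smul_apply, hM i j h, smul_zero]

theorem mul_mem_Fil (hM : M ∈ Fil a d) (hN : N ∈ Fil a e) : M * N ∈ Fil a (d + e) := by
  intro i k h
  rw [Matrix.mul_apply]
  refine Finset.sum_eq_zero fun j _ => ?_
  by_cases h1 : a j - a i < d
  · rw [hM i j h1, zero_mul]
  · rw [hN j k (by omega), mul_zero]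

theorem Fil_mono (h : d ≤ e) : Fil a e ≤ Fil a d := fun _ hM i j hij => hM i j (hij.trans_le h)

theorem one_mem_Fil : (1 : Mat n) ∈ Fil a 0 := by
  intro i j h
  rw [Matrix.one_apply_ne]
  rintro rfl
  omega

theorem mul_mem_Fil_zero (hM : M ∈ Fil a 0) (hN : N ∈ Fil a 0) : M * N ∈ Fil a 0 := by
  simpa using mul_mem_Fil hM hN

theorem exists_degree_bound (a : Fin n → ℤ) : ∃ B : ℕ, ∀ i j, a j - a i < B ∧ -(B : ℤ) < a j - a i := by
  refine ⟨(∑ i, (a i).natAbs) + (∑ i, (a i).natAbs) + 1, fun i j => ?_⟩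
  have h1 := Finset.single_le_sum (f := fun i => (a i).natAbs) (fun _ _ => Nat.zero_le _)
    (Finset.mem_univ i)
  have h2 := Finset.single_le_sum (f := fun i => (a i).natAbs) (fun _ _ => Nat.zero_le _)
    (Finset.mem_univ j)
  generalize ∑ i, (a i).natAbs = S at *
  omega

theorem mem_Fil_zero_of_sub_one (h : M - 1 ∈ Fil a 1) : M ∈ Fil a 0 := by
  have := (Fil a 0).add_mem (Fil_mono (by norm_num) h) one_mem_Fil
  simpa using this

theorem pow_mem_Fil (hM : M ∈ Fil a d) (k : ℕ) : M ^ k ∈ Fil a (k * d) := by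
  induction k with
  | zero => simpa using one_mem_Fil
  | succ k ih =>
    rw [pow_succ]
    have := mul_mem_Fil ih hM
    rwa [show ((k + 1 : ℕ) : ℤ) * d = k * d + d by push_cast; ring]

theorem exp_sub_mem_Fil (hM : IsNilpotent M) (h : M ∈ Fil a d) (hd : 0 ≤ d) :
    IsNilpotent.exp M - 1 - M ∈ Fil a (2 * d) := by
  obtain ⟨k, hk⟩ := hM
  have hk2 : M ^ (k + 2) = 0 := by rw [pow_add, hk, zero_mul]
  rw [IsNilpotent.exp_eq_sum hk2, Finset.sum_range_succ', Finset.sum_range_succ']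
  simp only [pow_zero, Nat.factorial, zero_add, pow_one, Nat.cast_one, inv_one, one_smul, mul_one]
  rw [add_sub_cancel_right, add_sub_cancel_right]
  refine Submodule.sum_mem _ fun l _ => ?_
  have h1 : M ^ (l + 1 + 1) ∈ Fil a (2 * d) := by
    refine Fil_mono ?_ (pow_mem_Fil h (l + 1 + 1))
    push_cast
    nlinarith
  exact ((Fil a (2 * d)).restrictScalars ℚ).smul_mem _ h1

theorem exp_sub_one_mem_Fil (hM : IsNilpotent M) (h : M ∈ Fil a d) (hd : 0 ≤ d) :
    IsNilpotent.exp M - 1 ∈ Fil a d := by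
  have := (Fil a d).add_mem (Fil_mono (by omega) (exp_sub_mem_Fil hM h hd)) h
  simpa using this

/-- Substituting `M = 1 - M * (N - 1)` repeatedly raises the degree known for `M`, from the trivial
bound `-B` up to 0; one last substitution gives the claim. -/
theorem inv_sub_one_mem_Fil (h : M * N = 1) (hN : N - 1 ∈ Fil a 1) : M - 1 ∈ Fil a 1 := by
  have key : M - 1 = -(M * (N - 1)) := by rw [mul_sub, h, mul_one, neg_sub]
  obtain ⟨B, hB⟩ := exists_degree_bound a
  have hstep : ∀ k : ℕ, M ∈ Fil a (min 0 (-(B : ℤ) + k)) := by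
    intro k
    induction k with
    | zero =>
      intro i j hij
      have := (hB i j).2
      push_cast at hij
      omega
    | succ k ih =>
      have h1 : M = 1 - M * (N - 1) := by rw [mul_sub, h, mul_one]; abel
      rw [h1]
      refine Submodule.sub_mem _ (Fil_mono (by omega) one_mem_Fil) (Fil_mono ?_ (mul_mem_Fil ih hN))
      push_cast
      omega
  have h0 := hstep B
  rw [neg_add_cancel, min_self] at h0
  rw [key]
  simpa using Submodule.neg_mem _ (mul_mem_Fil h0 hN)

end Filtration

variable {n : ℕ} {L : Type*} [LieRing L] [LieAlgebra ℂ L] [FiniteDimensional ℂ L]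
  [LieAlgebra.IsSimple ℂ L] {H : LieSubalgebra ℂ L} [H.IsCartanSubalgebra]
  {b : (rootSystem H).Base} (C : ChevalleyGenerators b) {ρ : L →ₗ⁅ℂ⁆ Mat n}

/-- The exponential of a nilpotent matrix as an invertible matrix. -/
def expU (x : Mat n) : GL (Fin n) ℂ :=
  if h : IsNilpotent x then
    ⟨IsNilpotent.exp x, IsNilpotent.exp (-x), IsNilpotent.exp_mul_exp_neg_self h,
      IsNilpotent.exp_neg_mul_exp_self h⟩ else 1

theorem coe_expU {x : Mat n} (h : IsNilpotent x) : (expU x : Mat n) = IsNilpotent.exp x := by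
  rw [expU, dif_pos h]

theorem expU_mul_neg {x : Mat n} (h : IsNilpotent x) : expU x * expU (-x) = 1 :=
  Units.ext (by rw [Units.val_mul, coe_expU h, coe_expU h.neg, Units.val_one,
    IsNilpotent.exp_mul_exp_neg_self h])

theorem inv_expU {x : Mat n} (h : IsNilpotent x) : (expU x)⁻¹ = expU (-x) :=
  inv_eq_of_mul_eq_one_right (expU_mul_neg h)

theorem conj_expU {g : GL (Fin n) ℂ} {x y : Mat n} (hx : IsNilpotent x) (hy : IsNilpotent y)
    (h : (g : Mat n) * x = y * g) : g * expU x = expU y * g :=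
  Units.ext (by
    rw [Units.val_mul, Units.val_mul, coe_expU hx, coe_expU hy]
    exact semiconjBy_exp hx hy h)

theorem isNilpotent_rootVector {α : H.root} {x : L}
    (hx : x ∈ rootSpace H (α : LieModule.Weight ℂ H L)) : IsNilpotent (ρ x) := by
  refine isNilpotent_of_ad_eigen (h := ρ (((rootSystem H).coroot α : H) : L)) two_ne_zero ?_
  rw [← map_lie_eq, ← map_smul]
  congr 1
  have := lie_eq_smul_of_mem_rootSpace hx ((rootSystem H).coroot α)
  refine this.trans ?_
  congr 1
  exact (rootSystem H).root_coroot_two α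

theorem expU_mem_rootSubgroup {S : Set H.root} {α : H.root} (hα : α ∈ S) {x : L}
    (hx : x ∈ rootSpace H (α : LieModule.Weight ℂ H L)) : expU (ρ x) ∈ rootSubgroup H ρ S :=
  Subgroup.subset_closure ⟨α, hα, x, hx, coe_expU (isNilpotent_rootVector hx)⟩

/-- An induction principle for the subgroups generated by root subgroups. -/
theorem rootSubgroup_induction {S : Set H.root} {p : GL (Fin n) ℂ → Prop}
    (h1 : p 1) (hmul : ∀ g q, p g → p q → p (g * q))
    (hexp : ∀ α ∈ S, ∀ x ∈ rootSpace H (α : LieModule.Weight ℂ H L), p (expU (ρ x)))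
    {g : GL (Fin n) ℂ} (hg : g ∈ rootSubgroup H ρ S) : p g := by
  have hgen : ∀ g : GL (Fin n) ℂ, (∃ α ∈ S, ∃ x ∈ rootSpace H (α : LieModule.Weight ℂ H L),
      (g : Mat n) = IsNilpotent.exp (ρ x)) → ∃ α ∈ S,
      ∃ x ∈ rootSpace H (α : LieModule.Weight ℂ H L), g = expU (ρ x) := by
    rintro g ⟨α, hα, x, hx, h⟩
    exact ⟨α, hα, x, hx, Units.ext (by rw [h, coe_expU (isNilpotent_rootVector hx)])⟩
  have hg' : g ∈ Subgroup.closure {g : GL (Fin n) ℂ | ∃ α ∈ S,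
      ∃ x ∈ rootSpace H (α : LieModule.Weight ℂ H L), (g : Mat n) = IsNilpotent.exp (ρ x)} := hg
  rw [← Subgroup.mem_toSubmonoid, Subgroup.closure_toSubmonoid] at hg'
  induction hg' using Submonoid.closure_induction with
  | one => exact h1
  | mul x y _ _ hx hy => exact hmul x y (hx (by
      rename_i h _; rw [← Subgroup.closure_toSubmonoid] at h; exact h)) (hy (by
      rename_i _ h; rw [← Subgroup.closure_toSubmonoid] at h; exact h))
  | mem x hx =>
    rcases hx with hx | hx
    · obtain ⟨α, hα, y, hy, rfl⟩ := hgen x hx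
      exact hexp α hα y hy
    · obtain ⟨α, hα, y, hy, h⟩ := hgen _ hx
      rw [← inv_inv x, h, inv_expU (isNilpotent_rootVector hy), ← map_neg]
      exact hexp α hα _ (Submodule.neg_mem _ hy)

/-- `g ρ(L) ⊆ ρ(L) g`. -/
def Intertwines (ρ : L →ₗ⁅ℂ⁆ Mat n) (g : Mat n) : Prop := ∀ y, ∃ y', g * ρ y = ρ y' * g

theorem Intertwines.mul {g q : Mat n} (hg : Intertwines ρ g) (hq : Intertwines ρ q) :
    Intertwines ρ (g * q) := by
  intro y
  obtain ⟨y', h'⟩ := hq y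
  obtain ⟨y'', h''⟩ := hg y'
  exact ⟨y'', by rw [mul_assoc, h', ← mul_assoc, h'', mul_assoc]⟩

theorem intertwines_exp {x : L} (hx : IsNilpotent (ρ x)) :
    Intertwines ρ (IsNilpotent.exp (ρ x)) := by
  intro y
  have := exp_ad_mem hx (LinearMap.range (ρ : L →ₗ[ℂ] Mat n)) (by
    rintro _ ⟨z, rfl⟩
    exact ⟨⁅x, z⁆, by simpa using map_lie_eq ρ x z⟩) (y := ρ y) ⟨y, rfl⟩
  obtain ⟨y', h'⟩ := this
  refine ⟨y', ?_⟩
  have h2 : ρ y' = IsNilpotent.exp (ρ x) * ρ y * IsNilpotent.exp (-ρ x) := h'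
  rw [h2, mul_assoc (_ * _), IsNilpotent.exp_neg_mul_exp_self hx, mul_one]

theorem intertwines_of_mem {S : Set H.root} {g : GL (Fin n) ℂ} (hg : g ∈ rootSubgroup H ρ S) :
    Intertwines ρ g := by
  refine rootSubgroup_induction (p := fun g => Intertwines ρ g) (fun y => ⟨y, by simp⟩)
    (fun g q hg hq => hg.mul hq) (fun α _ x hx => ?_) hg
  rw [coe_expU (isNilpotent_rootVector hx)]
  exact intertwines_exp (isNilpotent_rootVector hx)

theorem rootSubgroup_mono {S T : Set H.root} (h : S ⊆ T) :
    rootSubgroup H ρ S ≤ rootSubgroup H ρ T := by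
  refine Subgroup.closure_mono ?_
  rintro g ⟨α, hα, r⟩
  exact ⟨α, h hα, r⟩

/-- The subgroup generated by the root subgroups of the roots negative on `h`. -/
def negSubgroup (ρ : L →ₗ⁅ℂ⁆ Mat n) (h : H) : Subgroup (GL (Fin n) ℂ) :=
  rootSubgroup H ρ {α | ∃ d : ℤ, d < 0 ∧ (rootSystem H).root α h = d}

namespace WeightBasis

variable (W : WeightBasis H ρ) {h : H} {a : Fin n → ℤ}

theorem hat_rootVector_mem (ha : ∀ j, W.wt j h = a j) {α : H → ℂ} {x : L}
    (hx : x ∈ rootSpace H α) {d : ℤ} (hd : α h = -d) : W.hat (ρ x) ∈ Fil a d := by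
  intro i j hij
  by_contra hne
  have := W.hat_rootVector hx i j hne h
  rw [ha, ha, hd] at this
  have : a i = a j + -d := by exact_mod_cast this
  omega

theorem hat_inv_mul (g : GL (Fin n) ℂ) : W.hat ((g⁻¹ : GL (Fin n) ℂ) : Mat n) * W.hat g = 1 := by
  rw [← map_mul, ← Units.val_mul, inv_mul_cancel, Units.val_one, map_one]

theorem hat_mul_inv (g : GL (Fin n) ℂ) : W.hat g * W.hat ((g⁻¹ : GL (Fin n) ℂ) : Mat n) = 1 := by
  rw [← map_mul, ← Units.val_mul, mul_inv_cancel, Units.val_one, map_one]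

theorem hat_sub_one_mem (ha : ∀ j, W.wt j h = a j) {g : GL (Fin n) ℂ} (hg : g ∈ negSubgroup ρ h) :
    W.hat g - 1 ∈ Fil a 1 := by
  rw [negSubgroup] at hg
  refine rootSubgroup_induction (p := fun g : GL (Fin n) ℂ => W.hat g - 1 ∈ Fil a 1)
    (by rw [Units.val_one, map_one, sub_self]; exact Submodule.zero_mem _)
    (fun g q hg hq => ?_) (fun α hα x hx => ?_) hg
  · have e : W.hat ((g * q : GL (Fin n) ℂ) : Mat n) - 1 =
        (W.hat g - 1) * (W.hat q) + (W.hat q - 1) := by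
      rw [Units.val_mul, map_mul]; noncomm_ring
    rw [e]
    refine Submodule.add_mem _ ?_ hq
    simpa using mul_mem_Fil hg (mem_Fil_zero_of_sub_one hq)
  · obtain ⟨d, hd, hα⟩ := hα
    have hn := isNilpotent_rootVector (ρ := ρ) hx
    have hm : W.hat (ρ x) ∈ Fil a (-d) := W.hat_rootVector_mem ha hx (by push_cast; rw [neg_neg]; exact hα)
    have e : W.hat (IsNilpotent.exp (ρ x)) = IsNilpotent.exp (W.hat (ρ x)) :=
      IsNilpotent.map_exp hn (W.hat : Mat n →+* Mat n)
    rw [coe_expU hn, e]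
    exact Fil_mono (by omega) (exp_sub_one_mem_Fil (hn.map W.hat) hm (by omega))

/-- Write g ρ(h) g⁻¹ = ρ(y). Comparing g ρ(h) - ρ(h) g = ρ(y - h) g in degree `d` shows that the
leading part of g - 1 is 1/d times the component of y - h of eigenvalue -d under `h`. It therefore
lies in ρ(L) and can be removed by root subgroup elements taken with the factor -1/d. -/
theorem exists_step (ha : ∀ j, W.wt j h = a j) {g : GL (Fin n) ℂ} {d : ℤ} (hd : 1 ≤ d)
    (hg : W.hat g - 1 ∈ Fil a d) (hI : Intertwines ρ g) :
    ∃ q ∈ negSubgroup ρ h, W.hat ((g * q : GL (Fin n) ℂ) : Mat n) - 1 ∈ Fil a (d + 1) := by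
  obtain ⟨y, hy⟩ := hI h
  obtain ⟨x, hx, hyx⟩ := exists_weight_decomp (H := H) (y - (h : L))
  have hdC : (d : ℂ) ≠ 0 := by
    have : d ≠ 0 := by omega
    exact_mod_cast this
  let c : ℂ := -(d : ℂ)⁻¹
  let X : LieModule.Weight ℂ H L → Mat n := fun χ => W.hat (ρ (x χ))
  have hX : ∀ χ : LieModule.Weight ℂ H L, χ h = -d → X χ ∈ Fil a d := fun χ hχ =>
    W.hat_rootVector_mem ha (hx χ) hχ
  -- a product of exponentials with prescribed leading term
  have hprod : ∀ S : Finset (LieModule.Weight ℂ H L), (∀ χ ∈ S, χ h = -d) →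
      ∃ q ∈ negSubgroup ρ h, W.hat q - 1 - c • ∑ χ ∈ S, X χ ∈ Fil a (d + 1) := by
    intro S
    induction S using Finset.induction_on with
    | empty => exact fun _ => ⟨1, Subgroup.one_mem _, by simp⟩
    | insert χ S hχS ih =>
      intro hS
      obtain ⟨q, hq, hq2⟩ := ih fun χ' h' => hS χ' (Finset.mem_insert_of_mem h')
      have hχ := hS χ (Finset.mem_insert_self _ _)
      have hnz : χ.IsNonZero := by
        intro h0
        have h00 : χ h = 0 := by
          have : (χ : H → ℂ) = 0 := h0
          rw [this]; rfl
        rw [h00] at hχ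
        exact hdC (by simpa using hχ.symm)
      let α : H.root := ⟨χ, by simpa using hnz⟩
      have hcx : c • x χ ∈ rootSpace H (α : LieModule.Weight ℂ H L) :=
        Submodule.smul_mem _ c (hx χ)
      have hn := isNilpotent_rootVector (ρ := ρ) hcx
      have hα : ∃ d' : ℤ, d' < 0 ∧ (rootSystem H).root α h = d' :=
        ⟨-d, by omega, by rw [Int.cast_neg]; exact hχ⟩
      refine ⟨expU (ρ (c • x χ)) * q, Subgroup.mul_mem _
        (expU_mem_rootSubgroup hα hcx) hq, ?_⟩
      have e : W.hat (IsNilpotent.exp (ρ (c • x χ))) = IsNilpotent.exp (W.hat (ρ (c • x χ))) :=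
        IsNilpotent.map_exp hn (W.hat : Mat n →+* Mat n)
      have hA : W.hat (ρ (c • x χ)) = c • X χ := by rw [map_smul, map_smul]
      have hAm : c • X χ ∈ Fil a d := Submodule.smul_mem _ _ (hX χ hχ)
      rw [Finset.sum_insert hχS, Units.val_mul, map_mul, coe_expU hn, e, hA]
      have hn' : IsNilpotent (c • X χ) := hA ▸ hn.map W.hat
      have h1 := exp_sub_mem_Fil hn' hAm (by omega)
      have h2 := exp_sub_one_mem_Fil hn' hAm (by omega)
      have h3 : W.hat q - 1 ∈ Fil a d := by
        have hsum : c • ∑ χ ∈ S, X χ ∈ Fil a d := Submodule.smul_mem _ _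
          (Submodule.sum_mem _ fun χ' h' => hX χ' (hS χ' (Finset.mem_insert_of_mem h')))
        have := Submodule.add_mem _ (Fil_mono (by omega) hq2) hsum
        simpa using this
      have e2 : IsNilpotent.exp (c • X χ) * W.hat q - 1 - c • (X χ + ∑ χ ∈ S, X χ) =
          (IsNilpotent.exp (c • X χ) - 1 - c • X χ) +
          (IsNilpotent.exp (c • X χ) - 1) * (W.hat q - 1) +
          (W.hat q - 1 - c • ∑ χ ∈ S, X χ) := by
        rw [smul_add]; noncomm_ring
      rw [e2]
      refine Submodule.add_mem _ (Submodule.add_mem _ (Fil_mono (by omega) h1)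
        (Fil_mono (by omega) (mul_mem_Fil h2 h3))) hq2
  obtain ⟨q, hq, hq2⟩ := hprod (Finset.univ.filter fun χ => χ h = -d) (by simp)
  refine ⟨q, hq, ?_⟩
  set G := W.hat g - 1 with hG
  set Z := W.hat (ρ (y - (h : L))) with hZ
  have hZg : Z * W.hat g = W.hat g * Matrix.diagonal (fun j => W.wt j h) -
      Matrix.diagonal (fun j => W.wt j h) * W.hat g := by
    rw [hZ, map_sub, map_sub, sub_mul, ← W.hat_cartan, ← map_mul, ← map_mul, ← map_mul, hy]
  have hcomm : ∀ i j, (Z * W.hat g) i j = ((a j - a i : ℤ) : ℂ) * G i j := by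
    intro i j
    rw [hZg, Matrix.sub_apply, Matrix.mul_diagonal, Matrix.diagonal_mul, ha, ha, hG,
      Matrix.sub_apply]
    by_cases hij : i = j
    · subst hij; push_cast; ring
    · rw [Matrix.one_apply_ne hij]; push_cast; ring
  have hZgm : Z * W.hat g ∈ Fil a d := by
    intro i j hij
    rw [hcomm, hg i j hij, mul_zero]
  have hgi : W.hat ((g⁻¹ : GL (Fin n) ℂ) : Mat n) ∈ Fil a 0 :=
    mem_Fil_zero_of_sub_one (inv_sub_one_mem_Fil (W.hat_inv_mul g) (Fil_mono hd hg))
  have hZm : Z ∈ Fil a d := by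
    have := mul_mem_Fil hZgm hgi
    rwa [mul_assoc, W.hat_mul_inv, mul_one, add_zero] at this
  have hZG : Z * G ∈ Fil a (d + 1) := Fil_mono (by omega) (mul_mem_Fil hZm hg)
  set Y := ∑ χ ∈ Finset.univ.filter (fun χ : LieModule.Weight ℂ H L => χ h = -d), X χ with hY
  have hYm : Y ∈ Fil a d := Submodule.sum_mem _ fun χ hχ => hX χ (by simpa using hχ)
  -- In degree exactly `d` the matrix `Z` equals `d * G`, since `Z * G` has higher degree, and it
  -- equals `Y`, since the other weight components of `y - h` have other degrees.
  have hGY : G + c • Y ∈ Fil a (d + 1) := by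
    intro i j hij
    rcases (show a j - a i ≤ d by omega).lt_or_eq with h1 | h1
    · rw [Matrix.add_apply, Matrix.smul_apply, hg i j h1, hYm i j h1]; simp
    · have h2 : Z i j = d * G i j := by
        have h3 := hcomm i j
        rw [h1] at h3
        rw [← h3]
        have h4 : Z * W.hat g = Z + Z * G := by rw [hG]; noncomm_ring
        rw [h4, Matrix.add_apply, hZG i j hij, add_zero]
      have h5 : Z i j = Y i j := by
        rw [hZ, hyx, map_sum, map_sum, hY, Matrix.sum_apply, Matrix.sum_apply]
        symm
        refine Finset.sum_subset (Finset.subset_univ _) fun χ _ hχ => ?_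
        by_contra hne
        refine hχ ?_
        have := W.hat_rootVector (hx χ) i j hne h
        rw [ha, ha] at this
        simp only [Finset.mem_filter, Finset.mem_univ, true_and]
        have h6 : χ h = ((a i - a j : ℤ) : ℂ) := by push_cast; linear_combination -this
        rw [h6]
        have : a i - a j = -d := by omega
        rw [this]; push_cast; ring
      rw [Matrix.add_apply, Matrix.smul_apply, ← h5, h2, smul_eq_mul]
      simp only [c]
      field_simp
      ring
  have e3 : W.hat ((g * q : GL (Fin n) ℂ) : Mat n) - 1 =
      (G + c • Y) + (W.hat q - 1 - c • Y) + G * (W.hat q - 1) := by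
    rw [Units.val_mul, map_mul, hG]; noncomm_ring
  rw [e3]
  exact Submodule.add_mem _ (Submodule.add_mem _ hGY hq2)
    (Fil_mono (by omega) (mul_mem_Fil hg (W.hat_sub_one_mem ha hq)))

/-- `exists_step` is repeated until the degree exceeds all differences. Both hypotheses survive
conjugation by suitable elements commuting with `h`, and the passage to the Zariski closure; the
subgroup itself is defined by generators, for which neither is visible. -/
theorem mem_negSubgroup (ha : ∀ j, W.wt j h = a j) {g : GL (Fin n) ℂ}
    (hg : W.hat g - 1 ∈ Fil a 1) (hI : Intertwines ρ g) : g ∈ negSubgroup ρ h := by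
  obtain ⟨B, hB⟩ := exists_degree_bound a
  have key : ∀ (k : ℕ) (d : ℤ) (g : GL (Fin n) ℂ), 1 ≤ d → (B : ℤ) ≤ d + k →
      W.hat g - 1 ∈ Fil a d → Intertwines ρ g → g ∈ negSubgroup ρ h := by
    intro k
    induction k with
    | zero =>
      intro d g hd hB' hg _
      have h0 : W.hat g - 1 = 0 := by
        ext i j
        exact hg i j (by have := (hB i j).1; push_cast at hB'; omega)
      have : g = 1 := Units.ext (W.hat_injective (by rw [sub_eq_zero.1 h0, Units.val_one, map_one]))
      rw [this]
      exact Subgroup.one_mem _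
    | succ k ih =>
      intro d g hd hB' hg hI
      obtain ⟨q, hq, hq2⟩ := W.exists_step ha hd hg hI
      have := ih (d + 1) (g * q) (by omega) (by push_cast at hB'; omega) hq2
        (hI.mul (intertwines_of_mem hq))
      exact (Subgroup.mul_mem_cancel_right _ hq).1 this
  exact key B 1 g le_rfl (by omega) hg hI

/-- A matrix commuting with `h` normalizes the subgroup attached to `h`. -/
theorem conj_mem_negSubgroup (ha : ∀ j, W.wt j h = a j) {g u : GL (Fin n) ℂ}
    (hg : g ∈ negSubgroup ρ h) (hu : Intertwines ρ u)
    (hu' : Intertwines ρ ((u⁻¹ : GL (Fin n) ℂ) : Mat n))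
    (hc : (u : Mat n) * ρ (h : L) = ρ (h : L) * u) : u * g * u⁻¹ ∈ negSubgroup ρ h := by
  have hcu : W.hat u ∈ Fil a 0 := by
    intro i j hij
    have := W.hat_of_intertwine hc i j
    rw [ha, ha] at this
    have h2 : ((a j - a i : ℤ) : ℂ) * W.hat u i j = 0 := by push_cast; linear_combination this
    refine (mul_eq_zero.1 h2).resolve_left ?_
    have : a j - a i ≠ 0 := by omega
    exact_mod_cast this
  have hci : ((u⁻¹ : GL (Fin n) ℂ) : Mat n) * ρ (h : L) = ρ (h : L) * ((u⁻¹ : GL (Fin n) ℂ) : Mat n) := by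
    have h1 : ((u⁻¹ : GL (Fin n) ℂ) : Mat n) * u = 1 := by
      rw [← Units.val_mul, inv_mul_cancel, Units.val_one]
    have h2 : (u : Mat n) * ((u⁻¹ : GL (Fin n) ℂ) : Mat n) = 1 := by
      rw [← Units.val_mul, mul_inv_cancel, Units.val_one]
    exact semiconjBy_of_inv hc.symm.symm h2 h1
  have hcu' : W.hat ((u⁻¹ : GL (Fin n) ℂ) : Mat n) ∈ Fil a 0 := by
    intro i j hij
    have := W.hat_of_intertwine hci i j
    rw [ha, ha] at this
    have h2 : ((a j - a i : ℤ) : ℂ) * W.hat ((u⁻¹ : GL (Fin n) ℂ) : Mat n) i j = 0 := by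
      rw [Int.cast_sub]; linear_combination this
    refine (mul_eq_zero.1 h2).resolve_left ?_
    have : a j - a i ≠ 0 := by omega
    exact_mod_cast this
  refine W.mem_negSubgroup ha ?_ ?_
  · have e : W.hat ((u * g * u⁻¹ : GL (Fin n) ℂ) : Mat n) - 1 =
        W.hat u * (W.hat g - 1) * W.hat ((u⁻¹ : GL (Fin n) ℂ) : Mat n) := by
      rw [Units.val_mul, Units.val_mul, map_mul, map_mul, mul_sub, sub_mul, mul_one, W.hat_mul_inv]
    rw [e]
    simpa using mul_mem_Fil (mul_mem_Fil hcu (W.hat_sub_one_mem ha hg)) hcu'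
  · rw [Units.val_mul, Units.val_mul]
    exact (hu.mul (intertwines_of_mem hg)).mul hu'

end WeightBasis

end HOper

end

/-! ### Action on the Cartan subalgebra, and the relations in the simple `SL₂`-subgroups. -/

noncomputable section

set_option linter.unusedSectionVars false

namespace HOper

open LieAlgebra LieAlgebra.IsKilling
open scoped Classical

variable {n : ℕ} {L : Type*} [LieRing L] [LieAlgebra ℂ L] [FiniteDimensional ℂ L]
  [LieAlgebra.IsSimple ℂ L] {H : LieSubalgebra ℂ L} [H.IsCartanSubalgebra]
  {b : (rootSystem H).Base} {ρ : L →ₗ⁅ℂ⁆ Mat n}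

theorem semiconj_inv {u : GL (Fin n) ℂ} {A B : Mat n} (h : (u : Mat n) * A = B * u) :
    ((u⁻¹ : GL (Fin n) ℂ) : Mat n) * B = A * ((u⁻¹ : GL (Fin n) ℂ) : Mat n) := by
  have h1 : ((u⁻¹ : GL (Fin n) ℂ) : Mat n) * u = 1 := by
    rw [← Units.val_mul, inv_mul_cancel, Units.val_one]
  have h2 : (u : Mat n) * ((u⁻¹ : GL (Fin n) ℂ) : Mat n) = 1 := by
    rw [← Units.val_mul, mul_inv_cancel, Units.val_one]
  exact semiconjBy_of_inv h h2 h1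

/-- `u ρ(h) u⁻¹ = ρ(w h)` for `h` in the Cartan subalgebra. -/
def Acts (ρ : L →ₗ⁅ℂ⁆ Mat n) (u : GL (Fin n) ℂ) (w : H ≃ₗ[ℂ] H) : Prop :=
  ∀ h : H, (u : Mat n) * ρ (h : L) = ρ ((w h : H) : L) * u

theorem Acts.mul {u v : GL (Fin n) ℂ} {w z : H ≃ₗ[ℂ] H} (hu : Acts ρ u w) (hv : Acts ρ v z) :
    Acts ρ (u * v) (w * z) := by
  intro h
  rw [Units.val_mul, mul_assoc, hv h, ← mul_assoc, hu, mul_assoc]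
  rfl

theorem Acts.one : Acts ρ 1 (1 : H ≃ₗ[ℂ] H) := fun h => by
  rw [Units.val_one, one_mul, mul_one]; rfl

theorem Acts.inv {u : GL (Fin n) ℂ} {w : H ≃ₗ[ℂ] H} (hu : Acts ρ u w) : Acts ρ u⁻¹ w⁻¹ := by
  intro h
  have := semiconj_inv (hu (w⁻¹ h))
  rwa [show w (w⁻¹ h) = h from w.apply_symm_apply h] at this

theorem Acts.ext_of_injective (hρ : Function.Injective ρ) {u : GL (Fin n) ℂ} {w z : H ≃ₗ[ℂ] H}
    (hw : Acts ρ u w) (hz : Acts ρ u z) : w = z := by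
  ext h
  have : ρ ((w h : H) : L) * u = ρ ((z h : H) : L) * u := (hw h).symm.trans (hz h)
  exact hρ (u.isUnit.mul_left_injective this)

/-- Conjugation by `u` permutes the root spaces. -/
theorem Acts.exists_root (hρ : Function.Injective ρ) {u : GL (Fin n) ℂ} {w : H ≃ₗ[ℂ] H}
    (hu : Acts ρ u w) (hI : Intertwines ρ u) (α : H.root) :
    ∃ β : H.root, (∀ h, (rootSystem H).root β (w h) = (rootSystem H).root α h) ∧
      ∀ x ∈ rootSpace H (α : LieModule.Weight ℂ H L),
        ∃ x' ∈ rootSpace H (β : LieModule.Weight ℂ H L), (u : Mat n) * ρ x = ρ x' * u := by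
  let β : Module.Dual ℂ H := (rootSystem H).root α ∘ₗ (w.symm : H →ₗ[ℂ] H)
  have key : ∀ x ∈ rootSpace H (α : LieModule.Weight ℂ H L),
        ∃ x' ∈ rootSpace H β, (u : Mat n) * ρ x = ρ x' * u := by
    intro x hx
    obtain ⟨x', hx'⟩ := hI x
    refine ⟨x', LieModule.weightSpace_le_genWeightSpace L β ?_, hx'⟩
    rw [LieModule.mem_weightSpace]
    intro h
    apply hρ
    apply u.isUnit.mul_left_injective
    have e1 := hu (w.symm h)
    rw [w.apply_symm_apply] at e1
    have e2 : ⁅((w.symm h : H) : L), x⁆ = (rootSystem H).root α (w.symm h) • x :=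
      lie_eq_smul_of_mem_rootSpace hx (w.symm h)
    have e3 := map_lie_eq ρ ((w.symm h : H) : L) x
    rw [e2, map_smul] at e3
    change ρ ⁅(h : L), x'⁆ * u = ρ (β h • x') * u
    rw [map_lie_eq, map_smul, sub_mul, mul_assoc, ← hx', ← mul_assoc, ← e1, mul_assoc,
      mul_assoc, ← e1, ← mul_assoc (ρ x'), ← hx', smul_mul_assoc, ← hx', mul_assoc, ← mul_sub,
      ← e3, mul_smul_comm]
    rfl
  have hne : rootSpace H β ≠ ⊥ := by
    obtain ⟨x, hx, hx0⟩ := (α : LieModule.Weight ℂ H L).exists_ne_zero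
    obtain ⟨x', hx', e⟩ := key x hx
    intro hbot
    rw [hbot] at hx'
    have h0 : x' = 0 := hx'
    rw [h0, map_zero, zero_mul] at e
    have : ρ x = 0 := by
      have h1 : (u : Mat n) * ρ x = u * 0 := by rw [e, mul_zero]
      exact u.isUnit.mul_right_injective h1
    exact hx0 (hρ (by rw [this, map_zero]))
  let βw : LieModule.Weight ℂ H L := ⟨β, hne⟩
  have hnz : βw.IsNonZero := by
    intro h0
    have h1 : (β : H → ℂ) = 0 := h0
    have h2 := congrFun h1 (w ((rootSystem H).coroot α))
    have h3 : (rootSystem H).root α (w.symm (w ((rootSystem H).coroot α))) = 0 := h2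
    rw [w.symm_apply_apply] at h3
    exact two_ne_zero (((rootSystem H).root_coroot_two α).symm.trans h3)
  refine ⟨⟨βw, by simpa using hnz⟩, fun h => ?_, fun x hx => key x hx⟩
  change (rootSystem H).root α (w.symm (w h)) = _
  rw [w.symm_apply_apply]

/-- The data used to describe the group by matrices. -/
structure Frame (b : (rootSystem H).Base) (ρ : L →ₗ⁅ℂ⁆ Mat n) where
  C : ChevalleyGenerators b
  W : WeightBasis H ρ
  Ω : Coweights b
  hsc : IsSimplyConnected H ρ

theorem Frame.nonempty (C : ChevalleyGenerators b) (hsc : IsSimplyConnected H ρ) :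
    ∃ F : Frame b ρ, F.C = C := by
  obtain ⟨W⟩ := exists_weightBasis C ρ
  obtain ⟨Ω⟩ := exists_coweights b
  exact ⟨⟨C, W, Ω, hsc⟩, rfl⟩

namespace Frame

variable (F : Frame b ρ)

include F in
theorem inj : Function.Injective ρ := rep_injective F.C F.hsc

/-- The degrees of the basis vectors with respect to a coweight. -/
def dω (k : b.support) (j : Fin n) : ℤ := (F.Ω.exists_int_wt F.W F.C k j).choose

theorem wt_ω (k : b.support) (j : Fin n) : F.W.wt j (F.Ω.ω k) = F.dω k j :=
  (F.Ω.exists_int_wt F.W F.C k j).choose_spec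

/-- The degrees of the basis vectors with respect to `h0`. -/
def d0 (j : Fin n) : ℤ := ∑ k, F.dω k j

theorem wt_h0 (j : Fin n) : F.W.wt j F.Ω.h0 = F.d0 j := by
  rw [Coweights.h0, map_sum, d0]
  push_cast
  exact Finset.sum_congr rfl fun k _ => F.wt_ω k j

theorem wt_neg_h0 (j : Fin n) : F.W.wt j (-F.Ω.h0) = ((-F.d0 j : ℤ) : ℂ) := by
  rw [map_neg, wt_h0, Int.cast_neg]

theorem wt_h' (i : b.support) (j : Fin n) :
    F.W.wt j (F.Ω.h' i) = ((F.d0 j - F.dω i j : ℤ) : ℂ) := by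
  rw [Coweights.h', map_sub, wt_h0, wt_ω, Int.cast_sub]

theorem wt_neg_h' (i : b.support) (j : Fin n) :
    F.W.wt j (-F.Ω.h' i) = ((-(F.d0 j - F.dω i j) : ℤ) : ℂ) := by
  rw [map_neg, wt_h', ← Int.cast_neg]

theorem Nminus_eq : Nminus ρ b = negSubgroup ρ F.Ω.h0 := by
  rw [Nminus, negSubgroup]
  congr 1
  ext α
  exact F.Ω.not_isPos_iff α

theorem Nplus_eq : Nplus ρ b = negSubgroup ρ (-F.Ω.h0) := by
  rw [Nplus, negSubgroup]
  congr 1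
  ext α
  refine (F.Ω.isPos_iff α).trans ?_
  rw [Set.mem_ofPred_eq, map_neg]
  constructor
  · rintro ⟨d, hd, h⟩
    exact ⟨-d, by omega, by rw [h, Int.cast_neg]⟩
  · rintro ⟨d, hd, h⟩
    exact ⟨-d, by omega, by rw [Int.cast_neg, ← h, neg_neg]⟩

/-- The root `-α_i`. -/
def negRoot (i : b.support) : H.root := (rootSystem H).reflectionPerm i i

theorem root_negRoot (i : b.support) :
    (rootSystem H).root (negRoot i) = -(rootSystem H).root i := by
  rw [negRoot, RootPairing.root_reflectionPerm, RootPairing.reflection_apply_self]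

theorem e_mem (i : b.support) : F.C.e i ∈ rootSpace H (i.1 : LieModule.Weight ℂ H L) :=
  F.C.e_mem i

theorem f_mem (i : b.support) :
    F.C.f i ∈ rootSpace H ((negRoot i : H.root) : LieModule.Weight ℂ H L) := by
  have h1 := F.C.f_mem i
  have h2 : (((negRoot i : H.root) : LieModule.Weight ℂ H L) : H → ℂ) =
      -((i.1 : LieModule.Weight ℂ H L) : H → ℂ) := by
    ext h
    exact LinearMap.congr_fun (root_negRoot i) h
  rw [h2]
  simpa using h1

theorem smul_e_mem (i : b.support) (a : ℂ) :
    a • F.C.e i ∈ rootSpace H (i.1 : LieModule.Weight ℂ H L) := Submodule.smul_mem _ a (F.e_mem i)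

theorem smul_f_mem (i : b.support) (a : ℂ) :
    a • F.C.f i ∈ rootSpace H ((negRoot i : H.root) : LieModule.Weight ℂ H L) :=
  Submodule.smul_mem _ a (F.f_mem i)

/-- The root subgroup of `α_i`. -/
def x (i : b.support) (a : ℂ) : GL (Fin n) ℂ := expU (ρ (a • F.C.e i))

/-- The root subgroup of `-α_i`. -/
def y (i : b.support) (a : ℂ) : GL (Fin n) ℂ := expU (ρ (a • F.C.f i))

/-- The Weyl group representatives. -/
def w (i : b.support) (a : ℂ) : GL (Fin n) ℂ := F.x i a * F.y i (-a⁻¹) * F.x i a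

/-- The simple cocharacters. -/
def cp (i : b.support) (a : ℂ) : GL (Fin n) ℂ := F.w i a * F.w i (-1)

/-- The standard lift of a simple reflection. -/
def s (i : b.support) : GL (Fin n) ℂ := F.w i 1

theorem nilp_e (i : b.support) (a : ℂ) : IsNilpotent (ρ (a • F.C.e i)) :=
  isNilpotent_rootVector (F.smul_e_mem i a)

theorem nilp_f (i : b.support) (a : ℂ) : IsNilpotent (ρ (a • F.C.f i)) :=
  isNilpotent_rootVector (F.smul_f_mem i a)

theorem coe_x (i : b.support) (a : ℂ) : (F.x i a : Mat n) = IsNilpotent.exp (a • ρ (F.C.e i)) := by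
  rw [x, coe_expU (F.nilp_e i a), map_smul]

theorem coe_y (i : b.support) (a : ℂ) : (F.y i a : Mat n) = IsNilpotent.exp (a • ρ (F.C.f i)) := by
  rw [y, coe_expU (F.nilp_f i a), map_smul]

theorem coe_w (i : b.support) (a : ℂ) :
    (F.w i a : Mat n) = weylMat (ρ (F.C.e i)) (ρ (F.C.f i)) a := by
  rw [w, Units.val_mul, Units.val_mul, coe_x, coe_y, weylMat]

theorem coe_cp (i : b.support) (a : ℂ) :
    (F.cp i a : Mat n) = corootMat (ρ (F.C.e i)) (ρ (F.C.f i)) a := by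
  rw [cp, Units.val_mul, coe_w, coe_w, corootMat]

theorem coe_cp_units (i : b.support) (a : ℂˣ) : (F.cp i a : Mat n) = corootPow ρ F.C i a := by
  rw [coe_cp, corootPow_complex]

theorem sl2 (i : b.support) : MatSl2 (ρ (((rootSystem H).coroot i : H) : L))
    (ρ (F.C.e i)) (ρ (F.C.f i)) := matSl2 F.C ρ i

theorem x_add (i : b.support) (a c : ℂ) : F.x i (a + c) = F.x i a * F.x i c :=
  Units.ext (by rw [Units.val_mul, coe_x, coe_x, coe_x, exp_smul_add (F.sl2 i).nilp_e])

theorem y_add (i : b.support) (a c : ℂ) : F.y i (a + c) = F.y i a * F.y i c :=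
  Units.ext (by rw [Units.val_mul, coe_y, coe_y, coe_y, exp_smul_add (F.sl2 i).nilp_f])

theorem x_zero (i : b.support) : F.x i 0 = 1 :=
  Units.ext (by rw [coe_x, zero_smul, IsNilpotent.exp_zero, Units.val_one])

theorem y_zero (i : b.support) : F.y i 0 = 1 :=
  Units.ext (by rw [coe_y, zero_smul, IsNilpotent.exp_zero, Units.val_one])

theorem x_inv (i : b.support) (a : ℂ) : (F.x i a)⁻¹ = F.x i (-a) :=
  inv_eq_of_mul_eq_one_right (by rw [← x_add, add_neg_cancel, x_zero])

theorem w_inv (i : b.support) (a : ℂ) : (F.w i a)⁻¹ = F.w i (-a) :=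
  inv_eq_of_mul_eq_one_right (Units.ext (by
    rw [Units.val_mul, coe_w, coe_w, (F.sl2 i).weyl_mul_neg, Units.val_one]))

theorem cp_mul_s (i : b.support) (a : ℂ) : F.cp i a * F.s i = F.w i a := by
  rw [cp, s, mul_assoc, ← w_inv, inv_mul_cancel, mul_one]

/-- Conjugation by an element that scales the root vectors. -/
theorem conj_x {g : GL (Fin n) ℂ} {i j : b.support} {c : ℂ}
    (h : (g : Mat n) * ρ (F.C.e i) = c • ρ (F.C.e j) * g) (a : ℂ) :
    g * F.x i a = F.x j (c * a) * g := by
  refine conj_expU (F.nilp_e i a) (F.nilp_e j _) ?_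
  rw [map_smul, map_smul, mul_smul_comm, h, mul_smul, smul_mul_assoc, smul_mul_assoc,
    smul_mul_assoc, smul_comm]

theorem conj_y {g : GL (Fin n) ℂ} {i j : b.support} {c : ℂ}
    (h : (g : Mat n) * ρ (F.C.f i) = c • ρ (F.C.f j) * g) (a : ℂ) :
    g * F.y i a = F.y j (c * a) * g := by
  refine conj_expU (F.nilp_f i a) (F.nilp_f j _) ?_
  rw [map_smul, map_smul, mul_smul_comm, h, mul_smul, smul_mul_assoc, smul_mul_assoc,
    smul_mul_assoc, smul_comm]

theorem w_mul_x (i : b.support) {c : ℂ} (hc : c ≠ 0) (a : ℂ) :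
    F.w i c * F.x i a = F.y i (-(c⁻¹ ^ 2) * a) * F.w i c := by
  refine conj_expU (F.nilp_e i a) (F.nilp_f i _) ?_
  have := (F.sl2 i).weyl_e hc
  rw [coe_w, map_smul, map_smul, mul_smul_comm, this.eq, mul_comm, mul_smul, neg_smul,
    smul_mul_assoc]

theorem w_mul_y (i : b.support) {c : ℂ} (hc : c ≠ 0) (a : ℂ) :
    F.w i c * F.y i a = F.x i (-(c ^ 2) * a) * F.w i c := by
  refine conj_expU (F.nilp_f i a) (F.nilp_e i _) ?_
  have := (F.sl2 i).weyl_f hc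
  rw [coe_w, map_smul, map_smul, mul_smul_comm, this.eq, mul_comm, mul_smul, neg_smul,
    smul_mul_assoc]

theorem s_mul_x (i : b.support) (a : ℂ) : F.s i * F.x i a = F.y i (-a) * F.s i := by
  have := F.w_mul_x i one_ne_zero a
  simpa [s] using this

theorem s_mul_y (i : b.support) (a : ℂ) : F.s i * F.y i a = F.x i (-a) * F.s i := by
  have := F.w_mul_y i one_ne_zero a
  simpa [s] using this

theorem cp_e (i : b.support) {c : ℂ} (hc : c ≠ 0) :
    (F.cp i c : Mat n) * ρ (F.C.e i) = (c ^ 2) • ρ (F.C.e i) * F.cp i c := by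
  rw [coe_cp]; exact (F.sl2 i).corootMat_e hc

theorem cp_f (i : b.support) {c : ℂ} (hc : c ≠ 0) :
    (F.cp i c : Mat n) * ρ (F.C.f i) = (c⁻¹ ^ 2) • ρ (F.C.f i) * F.cp i c := by
  rw [coe_cp]; exact (F.sl2 i).corootMat_f hc

/-- Conjugation by the Weyl representative fixes it and exchanges the two root subgroups, so it
turns the defining product into the opposite one. -/
theorem w_eq (i : b.support) {a : ℂ} (ha : a ≠ 0) :
    F.w i a = F.y i (-a⁻¹) * F.x i a * F.y i (-a⁻¹) := by
  have h : F.w i a * F.w i a = F.y i (-a⁻¹) * F.x i a * F.y i (-a⁻¹) * F.w i a := by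
    have e1 : -(a⁻¹ ^ 2) * a = -a⁻¹ := by field_simp
    have e2 : -(a ^ 2) * -a⁻¹ = a := by field_simp
    have h1 := F.w_mul_x i ha a
    have h2 := F.w_mul_y i ha (-a⁻¹)
    rw [e1] at h1
    rw [e2] at h2
    calc F.w i a * F.w i a = F.w i a * F.x i a * F.y i (-a⁻¹) * F.x i a := by
          conv_lhs => rw [w]
          simp only [w, mul_assoc]
      _ = F.y i (-a⁻¹) * (F.w i a * F.y i (-a⁻¹)) * F.x i a := by rw [h1]; simp only [mul_assoc]
      _ = F.y i (-a⁻¹) * F.x i a * (F.w i a * F.x i a) := by rw [h2]; simp only [mul_assoc]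
      _ = _ := by rw [h1]; simp only [mul_assoc]
  exact mul_right_cancel h

theorem s_mul_w (i : b.support) {a : ℂ} (ha : a ≠ 0) : F.s i * F.w i a = F.w i a⁻¹ * F.s i := by
  rw [F.w_eq i (inv_ne_zero ha), w, ← mul_assoc, ← mul_assoc, s_mul_x, mul_assoc (F.y i _) (F.s i),
    s_mul_y, mul_assoc, mul_assoc (F.x i _) (F.s i), s_mul_x, inv_inv, neg_neg]
  simp only [mul_assoc]

/-- In the weight basis the element is diagonal with integral powers of the parameter, which makes
multiplicativity evident. -/
theorem cp_mul (i : b.support) {a c : ℂ} (ha : a ≠ 0) (hc : c ≠ 0) :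
    F.cp i a * F.cp i c = F.cp i (a * c) := by
  refine Units.ext (F.W.hat_injective ?_)
  rw [Units.val_mul, map_mul, coe_cp, coe_cp, coe_cp, F.W.hat_corootMat F.C i ha,
    F.W.hat_corootMat F.C i hc, F.W.hat_corootMat F.C i (mul_ne_zero ha hc),
    Matrix.diagonal_mul_diagonal]
  congr 1
  ext j
  rw [mul_zpow]

theorem cp_one (i : b.support) : F.cp i 1 = 1 :=
  Units.ext (by rw [coe_cp, (F.sl2 i).corootMat_one, Units.val_one])

theorem cp_inv (i : b.support) {a : ℂ} (ha : a ≠ 0) : (F.cp i a)⁻¹ = F.cp i a⁻¹ :=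
  inv_eq_of_mul_eq_one_right (by rw [F.cp_mul i ha (inv_ne_zero ha), mul_inv_cancel₀ ha, cp_one])

theorem w_mul_w (i : b.support) {a : ℂ} (ha : a ≠ 0) : F.w i a * F.w i a = F.s i * F.s i := by
  have h1 := F.cp_mul i ha (inv_ne_zero ha)
  rw [mul_inv_cancel₀ ha, cp_one] at h1
  have h2 : F.cp i a * F.cp i a⁻¹ * (F.s i * F.s i) = F.w i a * F.w i a := by
    calc _ = F.cp i a * (F.cp i a⁻¹ * F.s i) * F.s i := by simp only [mul_assoc]
      _ = F.cp i a * (F.s i * F.w i a) := by rw [cp_mul_s, mul_assoc, F.s_mul_w i ha]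
      _ = _ := by rw [← mul_assoc, cp_mul_s]
  rw [← h2, h1, one_mul]

/-- The relation behind the Bruhat decomposition of `SL₂`. -/
theorem s_mul_y_eq (i : b.support) {a : ℂ} (ha : a ≠ 0) :
    F.s i * F.y i a = F.y i (-a⁻¹) * F.cp i a * F.x i a⁻¹ := by
  have e1 : -(a⁻¹ ^ 2) * a = -a⁻¹ := by field_simp
  have h1 : F.y i (-a⁻¹) * F.w i a = F.w i a * F.x i a := by rw [F.w_mul_x i ha, e1]
  have h2 : F.x i a⁻¹ * F.s i = F.s i * F.y i (-a⁻¹) := by rw [s_mul_y, neg_neg]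
  have h3 : F.x i a * F.y i (-a⁻¹) = F.w i a * F.x i (-a) := by
    rw [w, mul_assoc, ← x_add, add_neg_cancel, x_zero, mul_one]
  have h4 : F.w i a * F.w i a * F.x i (-a) = F.x i (-a) * (F.w i a * F.w i a) := by
    rw [mul_assoc, F.w_mul_x i ha, ← mul_assoc, F.w_mul_y i ha, mul_assoc]
    congr 2
    field_simp
  -- Multiplying by the Weyl representative turns the torus factor into `F.w i a`, which can be
  -- moved past the root subgroups; its square does not depend on `a`.
  have key : F.s i * F.y i a * F.s i = F.y i (-a⁻¹) * F.cp i a * F.x i a⁻¹ * F.s i := by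
    symm
    calc _ = F.y i (-a⁻¹) * (F.cp i a * F.s i) * F.y i (-a⁻¹) := by
          rw [mul_assoc _ (F.x i _), h2]; simp only [mul_assoc]
      _ = F.w i a * (F.x i a * F.y i (-a⁻¹)) := by rw [cp_mul_s, h1, mul_assoc]
      _ = F.x i (-a) * (F.s i * F.s i) := by rw [h3, ← mul_assoc, h4, F.w_mul_w i ha]
      _ = _ := by rw [s_mul_y, mul_assoc]
  exact mul_right_cancel key

theorem x_mul_s_eq (i : b.support) {a : ℂ} (ha : a ≠ 0) :
    F.x i a * F.s i = F.y i a⁻¹ * F.cp i (-a) * F.x i (-a⁻¹) := by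
  have h := F.s_mul_y_eq i (neg_ne_zero.2 ha)
  rw [s_mul_y, neg_neg, inv_neg, neg_neg] at h
  exact h

theorem s_mul_s (i : b.support) : F.s i * F.s i = F.cp i (-1) := by
  have h3 := F.w_mul_w i (a := -1) (by norm_num)
  rw [cp, ← h3]

theorem x_mem_Nplus (i : b.support) (a : ℂ) : F.x i a ∈ Nplus ρ b :=
  expU_mem_rootSubgroup (RootPairing.Base.isPos_of_mem_support i.2) (F.smul_e_mem i a)

include F in
theorem not_isPos_negRoot (i : b.support) : ¬ b.IsPos (negRoot i) := by
  rw [F.Ω.not_isPos_iff, root_negRoot]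
  refine ⟨-F.Ω.D, neg_lt_zero.2 F.Ω.D_pos, ?_⟩
  rw [LinearMap.neg_apply, F.Ω.simple_h0, Int.cast_neg]

theorem y_mem_Nminus (i : b.support) (a : ℂ) : F.y i a ∈ Nminus ρ b :=
  expU_mem_rootSubgroup (F.not_isPos_negRoot i) (F.smul_f_mem i a)

theorem Nplus_le : Nplus ρ b ≤ chevalleyGroup H ρ := rootSubgroup_mono (Set.subset_univ _)

theorem Nminus_le : Nminus ρ b ≤ chevalleyGroup H ρ := rootSubgroup_mono (Set.subset_univ _)

theorem x_mem (i : b.support) (a : ℂ) : F.x i a ∈ chevalleyGroup H ρ :=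
  Nplus_le (F.x_mem_Nplus i a)

theorem y_mem (i : b.support) (a : ℂ) : F.y i a ∈ chevalleyGroup H ρ :=
  Nminus_le (F.y_mem_Nminus i a)

theorem w_mem (i : b.support) (a : ℂ) : F.w i a ∈ chevalleyGroup H ρ :=
  mul_mem (mul_mem (F.x_mem i _) (F.y_mem i _)) (F.x_mem i _)

theorem s_mem (i : b.support) : F.s i ∈ chevalleyGroup H ρ := F.w_mem i 1

theorem cp_mem (i : b.support) (a : ℂ) : F.cp i a ∈ chevalleyGroup H ρ :=
  mul_mem (F.w_mem i _) (F.w_mem i _)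

/-- Split `h` into a multiple of the coroot and a part `h1` killed by the root. The second commutes
with both root vectors, hence with the Weyl representative; the first is negated by `weyl_h`. -/
theorem w_acts (i : b.support) {c : ℂ} (hc : c ≠ 0) :
    Acts ρ (F.w i c) ((rootSystem H).coreflection i) := by
  intro h
  set α := (rootSystem H).root i with hα
  set hv := (rootSystem H).coroot i with hhv
  let h1 : H := h - (α h / 2) • hv
  have h2 : α h1 = 0 := by
    simp only [h1, map_sub, map_smul, smul_eq_mul]
    rw [show α hv = 2 from (rootSystem H).root_coroot_two i]
    ring
  have he : ρ (h1 : L) * ρ (F.C.e i) = ρ (F.C.e i) * ρ (h1 : L) := by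
    have h3 : ⁅(h1 : L), F.C.e i⁆ = α h1 • F.C.e i := lie_eq_smul_of_mem_rootSpace (F.e_mem i) h1
    have h4 := map_lie_eq ρ (h1 : L) (F.C.e i)
    rw [h3, h2, zero_smul, map_zero] at h4
    exact sub_eq_zero.1 h4.symm
  have hf : ρ (h1 : L) * ρ (F.C.f i) = ρ (F.C.f i) * ρ (h1 : L) := by
    have h3 : ⁅(h1 : L), F.C.f i⁆ = (rootSystem H).root (negRoot i) h1 • F.C.f i :=
      lie_eq_smul_of_mem_rootSpace (F.f_mem i) h1
    have h4 := map_lie_eq ρ (h1 : L) (F.C.f i)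
    rw [h3, root_negRoot, LinearMap.neg_apply, ← hα, h2, neg_zero, zero_smul, map_zero] at h4
    exact sub_eq_zero.1 h4.symm
  have hexp : ∀ {A : Mat n}, IsNilpotent A → ρ (h1 : L) * A = A * ρ (h1 : L) →
      SemiconjBy (IsNilpotent.exp A) (ρ (h1 : L)) (ρ (h1 : L)) := by
    intro A hA hc
    exact (semiconjBy_exp hA hA (show SemiconjBy (ρ (h1 : L)) A A from hc)).symm
  have hx : ∀ a : ℂ, SemiconjBy (F.x i a : Mat n) (ρ (h1 : L)) (ρ (h1 : L)) := by
    intro a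
    rw [coe_x]
    refine hexp (map_smul ρ a (F.C.e i) ▸ F.nilp_e i a) ?_
    rw [mul_smul_comm, he, smul_mul_assoc]
  have hy : ∀ a : ℂ, SemiconjBy (F.y i a : Mat n) (ρ (h1 : L)) (ρ (h1 : L)) := by
    intro a
    rw [coe_y]
    refine hexp (map_smul ρ a (F.C.f i) ▸ F.nilp_f i a) ?_
    rw [mul_smul_comm, hf, smul_mul_assoc]
  have hw : SemiconjBy (F.w i c : Mat n) (ρ (h1 : L)) (ρ (h1 : L)) := by
    rw [w, Units.val_mul, Units.val_mul]
    exact ((hx _).mul_left (hy _)).mul_left (hx _)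
  have hw2 := (F.sl2 i).weyl_h hc
  rw [← coe_w] at hw2
  have e1 : (h : L) = h1 + (α h / 2) • (hv : L) := by
    simp [h1]
  have e2 : (((rootSystem H).coreflection i h : H) : L) = h1 - (α h / 2) • (hv : L) := by
    have : (rootSystem H).coreflection i h = h - α h • hv :=
      RootPairing.coreflection_apply _ _ _
    rw [this]
    simp only [h1]
    push_cast
    module
  rw [e2, e1, map_add, map_sub, map_smul, mul_add, sub_mul, hw.eq, mul_smul_comm, hw2.eq,
    smul_mul_assoc, neg_mul, smul_neg, sub_eq_add_neg]

theorem s_acts (i : b.support) : Acts ρ (F.s i) ((rootSystem H).coreflection i) :=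
  F.w_acts i one_ne_zero

theorem coreflection_sq (i : H.root) :
    (rootSystem H).coreflection i * (rootSystem H).coreflection i = 1 := by
  ext h
  have := (rootSystem H).coreflection_same i h
  exact congrArg Subtype.val this

end Frame

end HOper

end

/-! ### The torus, lifts of Weyl group elements, and the exchange condition. -/

noncomputable section

set_option linter.unusedSectionVars false

namespace HOper

open LieAlgebra LieAlgebra.IsKilling
open scoped Classical

variable {n : ℕ} {L : Type*} [LieRing L] [LieAlgebra ℂ L] [FiniteDimensional ℂ L]
  [LieAlgebra.IsSimple ℂ L] {H : LieSubalgebra ℂ L} [H.IsCartanSubalgebra]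
  {b : (rootSystem H).Base} {ρ : L →ₗ⁅ℂ⁆ Mat n}

/-- The action of a simple reflection on the torus, in the coordinates given by the simple
coroots. -/
def reflTorus {G : Type*} [CommGroup G] (i : b.support) (c : b.support → G) : b.support → G :=
  c * Pi.mulSingle i (∏ k, c k ^ (-(b.cartanMatrix i k)))

/-- `w α_i` is a positive root. -/
def PosAt (b : (rootSystem H).Base) (w : H ≃ₗ[ℂ] H) (i : b.support) : Prop :=
  ∃ β : H.root, b.IsPos β ∧ ∀ h, (rootSystem H).root β (w h) = (rootSystem H).root i h

/-- `w α_i` is a negative root. -/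
def NegAt (b : (rootSystem H).Base) (w : H ≃ₗ[ℂ] H) (i : b.support) : Prop :=
  ∃ β : H.root, ¬ b.IsPos β ∧ ∀ h, (rootSystem H).root β (w h) = (rootSystem H).root i h

theorem root_ext {α β : H.root} (h : ∀ x, (rootSystem H).root α x = (rootSystem H).root β x) :
    α = β := (rootSystem H).root.injective (LinearMap.ext h)

theorem root_reflectionPerm_coreflection (α β : H.root) (x : H) :
    (rootSystem H).root ((rootSystem H).reflectionPerm α β) ((rootSystem H).coreflection α x) =
      (rootSystem H).root β x := by
  rw [RootPairing.root_reflectionPerm, RootPairing.reflection_apply]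
  have h : (rootSystem H).coreflection α x =
      x - (rootSystem H).root α x • (rootSystem H).coroot α := RootPairing.coreflection_apply _ _ _
  have h2 : (rootSystem H).root α ((rootSystem H).coroot α) = 2 :=
    (rootSystem H).root_coroot_two α
  have h3 : (rootSystem H).toLinearMap ((rootSystem H).root β) ((rootSystem H).coroot α) =
    (rootSystem H).root β ((rootSystem H).coroot α) := rfl
  rw [h, map_sub, map_smul, LinearMap.sub_apply, LinearMap.sub_apply, LinearMap.smul_apply,
    LinearMap.smul_apply, h2, LinearMap.flip_apply, h3]
  simp only [smul_eq_mul]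
  ring

theorem root_eq_of_acts {w : H ≃ₗ[ℂ] H} {α β γ : H.root}
    (h1 : ∀ h, (rootSystem H).root β (w h) = (rootSystem H).root α h)
    (h2 : ∀ h, (rootSystem H).root γ (w h) = (rootSystem H).root α h) : β = γ :=
  root_ext fun x => by
    have e1 := h1 (w.symm x)
    have e2 := h2 (w.symm x)
    rw [w.apply_symm_apply] at e1 e2
    rw [e1, e2]

theorem PosAt.not_negAt {w : H ≃ₗ[ℂ] H} {i : b.support} (h : PosAt b w i) : ¬ NegAt b w i := by
  rintro ⟨γ, hγ, h2⟩
  obtain ⟨β, hβ, h1⟩ := h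
  rw [root_eq_of_acts h1 h2] at hβ
  exact hγ hβ

namespace Frame

variable (F : Frame b ρ)

include F in
theorem posAt_or_negAt {u : GL (Fin n) ℂ} {w : H ≃ₗ[ℂ] H} (hu : Acts ρ u w)
    (hI : Intertwines ρ u) (i : b.support) : PosAt b w i ∨ NegAt b w i := by
  obtain ⟨β, h1, -⟩ := hu.exists_root F.inj hI i
  by_cases hβ : b.IsPos β
  · exact Or.inl ⟨β, hβ, h1⟩
  · exact Or.inr ⟨β, hβ, h1⟩

theorem isPos_neg_iff {α β : H.root} (h : (rootSystem H).root β = -(rootSystem H).root α) :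
    b.IsPos β ↔ ¬ b.IsPos α := by
  obtain ⟨Ω⟩ := exists_coweights b
  rw [Ω.isPos_iff, Ω.not_isPos_iff, h]
  constructor
  · rintro ⟨d, hd, e⟩
    exact ⟨-d, by omega, by rw [Int.cast_neg, ← e, LinearMap.neg_apply, neg_neg]⟩
  · rintro ⟨d, hd, e⟩
    exact ⟨-d, by omega, by rw [LinearMap.neg_apply, e, Int.cast_neg]⟩

include F in
theorem conj_mem_rootSubgroup {u : GL (Fin n) ℂ} {w : H ≃ₗ[ℂ] H} (hu : Acts ρ u w)
    (hI : Intertwines ρ u) {α β : H.root}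
    (hβ : ∀ h, (rootSystem H).root β (w h) = (rootSystem H).root α h) {S : Set H.root}
    (hS : β ∈ S) {x : L} (hx : x ∈ rootSpace H (α : LieModule.Weight ℂ H L)) :
    u * expU (ρ x) * u⁻¹ ∈ rootSubgroup H ρ S := by
  obtain ⟨γ, hγ, h⟩ := hu.exists_root F.inj hI α
  obtain ⟨x', hx', e⟩ := h x hx
  rw [← root_eq_of_acts hβ hγ] at hx'
  rw [conj_expU (isNilpotent_rootVector hx) (isNilpotent_rootVector hx') e, mul_inv_cancel_right]
  exact expU_mem_rootSubgroup hS hx'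

theorem neg_acts {w : H ≃ₗ[ℂ] H} {β : H.root} {i : b.support}
    (hβ : ∀ h, (rootSystem H).root β (w h) = (rootSystem H).root i h) :
    ∀ h, (rootSystem H).root ((rootSystem H).reflectionPerm β β) (w h) =
      (rootSystem H).root (negRoot i) h := by
  intro h
  rw [root_negRoot, RootPairing.root_reflectionPerm, RootPairing.reflection_apply_self,
    LinearMap.neg_apply, LinearMap.neg_apply, hβ]

theorem isPos_reflectionPerm_self {β : H.root} :
    b.IsPos ((rootSystem H).reflectionPerm β β) ↔ ¬ b.IsPos β :=
  isPos_neg_iff (by rw [RootPairing.root_reflectionPerm, RootPairing.reflection_apply_self])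

section Conj

variable {u : GL (Fin n) ℂ} {w : H ≃ₗ[ℂ] H} (hu : Acts ρ u w) (hI : Intertwines ρ u)
  {i : b.support} (a : ℂ)

include hu hI

theorem conj_x_of_posAt (h : PosAt b w i) : u * F.x i a * u⁻¹ ∈ Nplus ρ b := by
  obtain ⟨β, hβ, h⟩ := h
  exact F.conj_mem_rootSubgroup hu hI h hβ (F.smul_e_mem i a)

theorem conj_x_of_negAt (h : NegAt b w i) : u * F.x i a * u⁻¹ ∈ Nminus ρ b := by
  obtain ⟨β, hβ, h⟩ := h
  exact F.conj_mem_rootSubgroup hu hI h hβ (F.smul_e_mem i a)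

theorem conj_y_of_posAt (h : PosAt b w i) : u * F.y i a * u⁻¹ ∈ Nminus ρ b := by
  obtain ⟨β, hβ, h⟩ := h
  exact F.conj_mem_rootSubgroup hu hI (neg_acts h) (S := {α | ¬ b.IsPos α})
    (fun hc => isPos_reflectionPerm_self.1 hc hβ) (F.smul_f_mem i a)

theorem conj_y_of_negAt (h : NegAt b w i) : u * F.y i a * u⁻¹ ∈ Nplus ρ b := by
  obtain ⟨β, hβ, h⟩ := h
  exact F.conj_mem_rootSubgroup hu hI (neg_acts h) (S := {α | b.IsPos α})
    (isPos_reflectionPerm_self.2 hβ) (F.smul_f_mem i a)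

end Conj

theorem e_ne_zero (i : b.support) : F.C.e i ≠ 0 := by
  intro h
  have h1 := (F.C.sl2 i).lie_e_f
  rw [h, zero_lie] at h1
  exact (F.C.sl2 i).h_ne_zero h1.symm

theorem f_ne_zero (i : b.support) : F.C.f i ≠ 0 := by
  intro h
  have h1 := (F.C.sl2 i).lie_e_f
  rw [h, lie_zero] at h1
  exact (F.C.sl2 i).h_ne_zero h1.symm

theorem exists_smul_eq {α : H.root} {x y : L}
    (hx : x ∈ rootSpace H (α : LieModule.Weight ℂ H L)) (hx0 : x ≠ 0)
    (hy : y ∈ rootSpace H (α : LieModule.Weight ℂ H L)) : ∃ c : ℂ, y = c • x := by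
  have hα : (α : LieModule.Weight ℂ H L).IsNonZero := by
    exact LieSubalgebra.isNonZero_coe_root α
  have h1 := finrank_rootSpace_eq_one (H := H) (α : LieModule.Weight ℂ H L) hα
  obtain ⟨c, hc⟩ := (finrank_eq_one_iff_of_nonzero' (⟨x, hx⟩ : rootSpace H
    (α : LieModule.Weight ℂ H L)) (by simpa using hx0)).1 h1 ⟨y, hy⟩
  exact ⟨c, congrArg Subtype.val hc.symm⟩

/-- An element of the normalizer mapping `α_i` to `α_j` acts on the Chevalley generators by a
scalar. -/
theorem scale_of_acts {u : GL (Fin n) ℂ} {w : H ≃ₗ[ℂ] H} (hu : Acts ρ u w)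
    (hI : Intertwines ρ u) {i j : b.support}
    (hw : ∀ h, (rootSystem H).root j (w h) = (rootSystem H).root i h) :
    ∃ c : ℂ, c ≠ 0 ∧ (u : Mat n) * ρ (F.C.e i) = c • ρ (F.C.e j) * u ∧
      (u : Mat n) * ρ (F.C.f i) = c⁻¹ • ρ (F.C.f j) * u := by
  obtain ⟨β, h1, h2⟩ := hu.exists_root F.inj hI i
  obtain ⟨e', he', ee⟩ := h2 _ (F.e_mem i)
  rw [← root_eq_of_acts hw h1] at he'
  obtain ⟨c, rfl⟩ := exists_smul_eq (F.e_mem j) (F.e_ne_zero j) he'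
  obtain ⟨γ, h3, h4⟩ := hu.exists_root F.inj hI (negRoot i)
  obtain ⟨f', hf', ef⟩ := h4 _ (F.f_mem i)
  have hγ : negRoot j = γ := by
    refine root_eq_of_acts (w := w) (α := negRoot i) (fun h => ?_) h3
    rw [root_negRoot, root_negRoot, LinearMap.neg_apply, LinearMap.neg_apply, hw]
  rw [← hγ] at hf'
  obtain ⟨d, rfl⟩ := exists_smul_eq (F.f_mem j) (F.f_ne_zero j) hf'
  rw [map_smul] at ee ef
  -- The two scalars are inverse to each other: their product measures how the coroot is carried
  -- along, and the pairing with the root, which is 2 on both sides, is preserved.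
  have h5 : (u : Mat n) * ρ (((rootSystem H).coroot i : H) : L) =
      (c * d) • ρ (((rootSystem H).coroot j : H) : L) * u := by
    rw [← (F.sl2 i).ef, ← (F.sl2 j).ef, mul_sub, ← mul_assoc, ← mul_assoc, ee, ef,
      mul_assoc _ (u : Mat n), mul_assoc _ (u : Mat n), ee, ef, smul_sub, sub_mul]
    simp only [smul_mul_assoc, mul_smul_comm, smul_smul, mul_assoc]
    rw [mul_comm d c]
  have h6 : w ((rootSystem H).coroot i) = (c * d) • (rootSystem H).coroot j := by
    have h7 := (hu _).symm.trans h5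
    have h8 := u.isUnit.mul_left_injective h7
    rw [← map_smul] at h8
    have h9 := F.inj h8
    exact Subtype.ext h9
  have h10 : c * d = 1 := by
    have h11 := hw ((rootSystem H).coroot i)
    rw [h6, map_smul, show (rootSystem H).root j ((rootSystem H).coroot j) = 2 from
      (rootSystem H).root_coroot_two j, show (rootSystem H).root i ((rootSystem H).coroot i) = 2 from
      (rootSystem H).root_coroot_two i, smul_eq_mul] at h11
    linear_combination h11 / 2
  have hc : c ≠ 0 := left_ne_zero_of_mul_eq_one h10
  refine ⟨c, hc, ee, ?_⟩
  rw [ef, eq_inv_of_mul_eq_one_right h10]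

/-- The elements of the torus as matrices, parametrized by the simple coroots. -/
def torMat (c : b.support → ℂˣ) : Mat n :=
  F.W.unhat (Matrix.diagonal fun j => ∏ i, (c i : ℂ) ^ F.W.m F.C i j)

theorem hat_torMat (c : b.support → ℂˣ) :
    F.W.hat (F.torMat c) = Matrix.diagonal fun j => ∏ i, (c i : ℂ) ^ F.W.m F.C i j :=
  F.W.hat_unhat _

theorem torMat_one : F.torMat 1 = 1 := by
  apply F.W.hat_injective
  rw [hat_torMat, map_one, ← Matrix.diagonal_one]
  congr 1; ext j
  simp

theorem torMat_mul (c d : b.support → ℂˣ) : F.torMat (c * d) = F.torMat c * F.torMat d := by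
  apply F.W.hat_injective
  rw [map_mul, hat_torMat, hat_torMat, hat_torMat, Matrix.diagonal_mul_diagonal]
  congr 1; ext j
  rw [← Finset.prod_mul_distrib]
  refine Finset.prod_congr rfl fun i _ => ?_
  rw [Pi.mul_apply, Units.val_mul, mul_zpow]

/-- The elements of the torus, parametrized by the simple coroots. -/
def tor : (b.support → ℂˣ) →* GL (Fin n) ℂ :=
  MonoidHom.toHomUnits ⟨⟨F.torMat, F.torMat_one⟩, F.torMat_mul⟩

theorem coe_tor (c : b.support → ℂˣ) : (F.tor c : Mat n) = F.torMat c := rfl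

theorem hat_tor (c : b.support → ℂˣ) :
    F.W.hat (F.tor c) = Matrix.diagonal fun j => ∏ i, (c i : ℂ) ^ F.W.m F.C i j := by
  rw [coe_tor, hat_torMat]

theorem tor_mulSingle (i : b.support) (a : ℂˣ) : F.tor (Pi.mulSingle i a) = F.cp i a := by
  refine Units.ext (F.W.hat_injective ?_)
  rw [hat_tor, coe_cp, F.W.hat_corootMat F.C i a.ne_zero]
  congr 1; ext j
  rw [Finset.prod_eq_single i]
  · rw [Pi.mulSingle_eq_same]
  · intro k _ hk
    rw [Pi.mulSingle_eq_of_ne hk, Units.val_one, one_zpow]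
  · simp

theorem tor_mem (c : b.support → ℂˣ) : F.tor c ∈ torus ρ F.C := by
  have : c ∈ (torus ρ F.C).comap F.tor := Subgroup.pi_mem_of_mulSingle_mem c fun i => by
    rw [Subgroup.mem_comap, tor_mulSingle]
    exact Subgroup.subset_closure ⟨i, c i, F.coe_cp_units i (c i)⟩
  exact this

theorem mem_torus {t : GL (Fin n) ℂ} : t ∈ torus ρ F.C ↔ ∃ c, t = F.tor c := by
  refine ⟨fun ht => ?_, fun ⟨c, hc⟩ => hc ▸ F.tor_mem c⟩
  have : torus ρ F.C ≤ F.tor.range := by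
    refine (Subgroup.closure_le _).2 ?_
    rintro g ⟨i, a, h⟩
    refine ⟨Pi.mulSingle i a, ?_⟩
    rw [tor_mulSingle]
    exact Units.ext (by rw [h, coe_cp_units])
  obtain ⟨c, hc⟩ := this ht
  exact ⟨c, hc.symm⟩

theorem cp_mem_torus (i : b.support) {a : ℂ} (ha : a ≠ 0) : F.cp i a ∈ torus ρ F.C :=
  Subgroup.subset_closure ⟨i, Units.mk0 a ha, F.coe_cp_units i (Units.mk0 a ha)⟩

theorem tor_comm (c : b.support → ℂˣ) (h : H) :
    (F.tor c : Mat n) * ρ (h : L) = ρ (h : L) * F.tor c := by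
  apply F.W.hat_injective
  rw [map_mul, map_mul, hat_tor, F.W.hat_cartan, Matrix.diagonal_mul_diagonal,
    Matrix.diagonal_mul_diagonal]
  congr 1; ext j
  rw [mul_comm]

theorem torus_acts {t : GL (Fin n) ℂ} (ht : t ∈ torus ρ F.C) : Acts ρ t (1 : H ≃ₗ[ℂ] H) := by
  obtain ⟨c, rfl⟩ := F.mem_torus.1 ht
  exact fun h => F.tor_comm c h

theorem torus_le : torus ρ F.C ≤ chevalleyGroup H ρ := by
  refine (Subgroup.closure_le _).2 ?_
  rintro g ⟨i, a, h⟩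
  have : g = F.cp i a := Units.ext (by rw [h, coe_cp_units])
  rw [this]
  exact F.cp_mem i a

theorem torus_comm {t t' : GL (Fin n) ℂ} (ht : t ∈ torus ρ F.C) (ht' : t' ∈ torus ρ F.C) :
    t * t' = t' * t := by
  obtain ⟨c, rfl⟩ := F.mem_torus.1 ht
  obtain ⟨d, rfl⟩ := F.mem_torus.1 ht'
  rw [← map_mul, ← map_mul, mul_comm]

theorem intertwines {g : GL (Fin n) ℂ} (hg : g ∈ chevalleyGroup H ρ) : Intertwines ρ g :=
  intertwines_of_mem hg

/-- A lift of a simple reflection acts on the torus by the reflection. -/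
theorem refl_tor {u : GL (Fin n) ℂ} {i : b.support}
    (hu : Acts ρ u ((rootSystem H).coreflection i)) (c : b.support → ℂˣ) :
    u * F.tor c = F.tor (reflTorus i c) * u := by
  refine Units.ext (F.W.hat_injective ?_)
  rw [Units.val_mul, Units.val_mul, map_mul, map_mul, hat_tor, hat_tor]
  ext j l
  rw [Matrix.mul_diagonal, Matrix.diagonal_mul]
  by_cases h0 : F.W.hat u j l = 0
  · rw [h0, zero_mul, mul_zero]
  -- A non-zero entry links the weights of `l` and `j` by the reflection, so the exponents differ by
  -- a Cartan integer times the exponent for `i`.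
  · have key : ∀ k, F.W.m F.C k l = F.W.m F.C k j - b.cartanMatrix i k * F.W.m F.C i j := by
      intro k
      have h1 := F.W.hat_of_intertwine (hu ((rootSystem H).coroot k)) j l
      rw [mul_comm] at h1
      have h2 := mul_right_cancel₀ h0 h1
      have h3 : (rootSystem H).coreflection i ((rootSystem H).coroot k) =
        (rootSystem H).coroot k - ((b.cartanMatrix i k : ℤ) : ℂ) • (rootSystem H).coroot i := by
        refine (RootPairing.coreflection_apply _ _ _).trans ?_
        congr 2
        exact ((rootSystem H).root_coroot_eq_pairing i k).trans
          (b.algebraMap_cartanMatrixIn_apply ℤ i k).symm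
      rw [h3, map_sub, map_smul, F.W.wt_coroot F.C, F.W.wt_coroot F.C, F.W.wt_coroot F.C,
        smul_eq_mul] at h2
      exact_mod_cast h2
    rw [mul_comm]
    congr 1
    have e1 : ∏ k, ((reflTorus i c k : ℂˣ) : ℂ) ^ F.W.m F.C k j =
        (∏ k, (c k : ℂ) ^ F.W.m F.C k j) *
          (((∏ k, c k ^ (-(b.cartanMatrix i k)) : ℂˣ) : ℂ) ^ F.W.m F.C i j) := by
      rw [← Finset.mul_prod_erase _ _ (Finset.mem_univ i),
        ← Finset.mul_prod_erase Finset.univ (fun k => (c k : ℂ) ^ F.W.m F.C k j)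
          (Finset.mem_univ i)]
      have e2 : ∀ k ∈ Finset.univ.erase i, ((reflTorus i c k : ℂˣ) : ℂ) ^ F.W.m F.C k j =
          (c k : ℂ) ^ F.W.m F.C k j := by
        intro k hk
        rw [reflTorus, Pi.mul_apply, Pi.mulSingle_eq_of_ne (Finset.ne_of_mem_erase hk), mul_one]
      rw [Finset.prod_congr rfl e2, reflTorus, Pi.mul_apply, Pi.mulSingle_eq_same, Units.val_mul,
        mul_zpow]
      ring
    rw [e1, Units.coe_prod, ← Finset.prod_zpow, ← Finset.prod_mul_distrib]
    refine Finset.prod_congr rfl fun k _ => ?_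
    rw [Units.val_zpow_eq_zpow_val, ← zpow_mul, ← zpow_add₀ (c k).ne_zero, key]
    congr 1
    ring

theorem refl_torus {u : GL (Fin n) ℂ} {i : b.support}
    (hu : Acts ρ u ((rootSystem H).coreflection i)) {t : GL (Fin n) ℂ} (ht : t ∈ torus ρ F.C) :
    ∃ t' ∈ torus ρ F.C, u * t = t' * u := by
  obtain ⟨c, rfl⟩ := F.mem_torus.1 ht
  exact ⟨_, F.tor_mem _, F.refl_tor hu c⟩

theorem refl_torus' {u : GL (Fin n) ℂ} {i : b.support}
    (hu : Acts ρ u ((rootSystem H).coreflection i)) {t : GL (Fin n) ℂ} (ht : t ∈ torus ρ F.C) :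
    ∃ t' ∈ torus ρ F.C, t * u = u * t' := by
  have hinv : Acts ρ u⁻¹ ((rootSystem H).coreflection i) := by
    have := hu.inv
    rwa [inv_eq_of_mul_eq_one_right (coreflection_sq i.1)] at this
  obtain ⟨t', ht', e⟩ := F.refl_torus hinv ht
  refine ⟨t', ht', ?_⟩
  calc t * u = u * (u⁻¹ * t) * u := by rw [mul_inv_cancel_left]
    _ = u * t' := by rw [e, mul_assoc, inv_mul_cancel_right]

/-- A product of standard lifts of simple reflections. -/
def word (l : List b.support) : GL (Fin n) ℂ := (l.map F.s).prod

/-- The corresponding product of reflections of the Cartan subalgebra. -/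
def wact (l : List b.support) : H ≃ₗ[ℂ] H :=
  (l.map fun i => (rootSystem H).coreflection i.1).prod

theorem word_acts (l : List b.support) : Acts ρ (F.word l) (wact l) := by
  induction l with
  | nil => exact Acts.one
  | cons i l ih =>
    rw [word, wact, List.map_cons, List.map_cons, List.prod_cons, List.prod_cons]
    exact (F.s_acts i).mul ih

theorem word_mem (l : List b.support) : F.word l ∈ chevalleyGroup H ρ :=
  Subgroup.list_prod_mem _ (by
    intro g hg
    obtain ⟨i, -, rfl⟩ := List.mem_map.1 hg
    exact F.s_mem i)

theorem word_torus (l : List b.support) {t : GL (Fin n) ℂ} (ht : t ∈ torus ρ F.C) :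
    ∃ t' ∈ torus ρ F.C, t * F.word l = F.word l * t' := by
  induction l generalizing t with
  | nil => exact ⟨t, ht, by simp [word]⟩
  | cons i l ih =>
    obtain ⟨t1, ht1, e1⟩ := F.refl_torus' (F.s_acts i) ht
    obtain ⟨t2, ht2, e2⟩ := ih ht1
    refine ⟨t2, ht2, ?_⟩
    have : F.word (i :: l) = F.s i * F.word l := by simp [word]
    rw [this, ← mul_assoc, e1, mul_assoc, e2, mul_assoc]

/-- The lifts of elements of the Weyl group. -/
def IsWeyl (u : GL (Fin n) ℂ) : Prop := ∃ l, ∃ t ∈ torus ρ F.C, u = F.word l * t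

theorem IsWeyl.mem {u : GL (Fin n) ℂ} (hu : F.IsWeyl u) : u ∈ chevalleyGroup H ρ := by
  obtain ⟨l, t, ht, rfl⟩ := hu
  exact mul_mem (F.word_mem l) (F.torus_le ht)

theorem IsWeyl.acts {u : GL (Fin n) ℂ} (hu : F.IsWeyl u) : ∃ w, Acts ρ u (w : H ≃ₗ[ℂ] H) := by
  obtain ⟨l, t, ht, rfl⟩ := hu
  exact ⟨_, (F.word_acts l).mul (F.torus_acts ht)⟩

theorem isWeyl_of_torus {t : GL (Fin n) ℂ} (ht : t ∈ torus ρ F.C) : F.IsWeyl t :=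
  ⟨[], t, ht, by simp [word]⟩

theorem isWeyl_one : F.IsWeyl 1 := F.isWeyl_of_torus (one_mem _)

theorem isWeyl_s (i : b.support) : F.IsWeyl (F.s i) := ⟨[i], 1, one_mem _, by simp [word]⟩

theorem IsWeyl.mul {u v : GL (Fin n) ℂ} (hu : F.IsWeyl u) (hv : F.IsWeyl v) :
    F.IsWeyl (u * v) := by
  obtain ⟨l, t, ht, rfl⟩ := hu
  obtain ⟨l', t', ht', rfl⟩ := hv
  obtain ⟨t1, ht1, e⟩ := F.word_torus l' ht
  refine ⟨l ++ l', t1 * t', mul_mem ht1 ht', ?_⟩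
  have : F.word (l ++ l') = F.word l * F.word l' := by simp [word]
  rw [this, mul_assoc, ← mul_assoc t, e]
  simp only [mul_assoc]

theorem isWeyl_s_inv (i : b.support) : F.IsWeyl (F.s i)⁻¹ := by
  have h1 : (F.s i)⁻¹ = F.s i * (F.cp i (-1))⁻¹ := by
    rw [← s_mul_s, mul_inv_rev, mul_inv_cancel_left]
  rw [h1]
  exact IsWeyl.mul F (F.isWeyl_s i) (F.isWeyl_of_torus (inv_mem (F.cp_mem_torus i (by norm_num))))

theorem IsWeyl.inv {u : GL (Fin n) ℂ} (hu : F.IsWeyl u) : F.IsWeyl u⁻¹ := by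
  obtain ⟨l, t, ht, rfl⟩ := hu
  rw [mul_inv_rev]
  refine IsWeyl.mul F (F.isWeyl_of_torus (inv_mem ht)) ?_
  clear ht
  induction l with
  | nil => simpa [word] using F.isWeyl_one
  | cons i l ih =>
    have : F.word (i :: l) = F.s i * F.word l := by simp [word]
    rw [this, mul_inv_rev]
    exact IsWeyl.mul F ih (F.isWeyl_s_inv i)

include F in
-- Reading the word from the right, some letter `j` is the first to make the root negative. A simple
-- reflection sends no positive root but its own to a negative one, so the root was α_j just before.
theorem exists_split_of_negAt (l : List b.support) (k : b.support) (h : NegAt b (wact l) k) :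
    ∃ (l1 : List b.support) (j : b.support) (l2 : List b.support), l = l1 ++ j :: l2 ∧
      ∀ h, (rootSystem H).root j (wact l2 h) = (rootSystem H).root k h := by
  induction l with
  | nil =>
    exfalso
    refine PosAt.not_negAt ?_ h
    exact ⟨k, RootPairing.Base.isPos_of_mem_support k.2, fun h => rfl⟩
  | cons j l ih =>
    rcases F.posAt_or_negAt (F.word_acts l) (intertwines (F.word_mem l)) k with hp | hn
    · refine ⟨[], j, l, rfl, ?_⟩
      obtain ⟨β, hβ, h1⟩ := hp
      by_cases hj : β = j
      · rw [← hj]; exact h1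
      exfalso
      refine PosAt.not_negAt ⟨(rootSystem H).reflectionPerm j β,
        hβ.reflectionPerm j.2 hj, fun x => ?_⟩ h
      rw [← h1]
      have e1 : wact (j :: l) x = (rootSystem H).coreflection j (wact l x) := by
        simp [wact]
      rw [e1, root_reflectionPerm_coreflection]
    · obtain ⟨l1, j', l2, e, h2⟩ := ih hn
      exact ⟨j :: l1, j', l2, by rw [e]; rfl, h2⟩

end Frame

end HOper

end

/-! ### The Bruhat decomposition, and the centralizer of the torus. -/

noncomputable section

set_option linter.unusedSectionVars false

namespace HOper

open LieAlgebra LieAlgebra.IsKilling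
open scoped Classical

variable {n : ℕ} {L : Type*} [LieRing L] [LieAlgebra ℂ L] [FiniteDimensional ℂ L]
  [LieAlgebra.IsSimple ℂ L] {H : LieSubalgebra ℂ L} [H.IsCartanSubalgebra]
  {b : (rootSystem H).Base} {ρ : L →ₗ⁅ℂ⁆ Mat n}

namespace Frame

variable (F : Frame b ρ)

/-- Conjugation scales the two root vectors by inverse scalars, so it carries the standard lift for
`i` to some `w_j(c)`, which is the standard lift for `j` up to a coroot value. -/
theorem conj_s {u : GL (Fin n) ℂ} {w : H ≃ₗ[ℂ] H} (hu : Acts ρ u w)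
    (hI : Intertwines ρ u) {i j : b.support}
    (hw : ∀ h, (rootSystem H).root j (w h) = (rootSystem H).root i h) :
    ∃ t ∈ torus ρ F.C, u * F.s i = t * F.s j * u := by
  obtain ⟨c, hc, he, hf⟩ := F.scale_of_acts hu hI hw
  refine ⟨F.cp j c, F.cp_mem_torus j hc, ?_⟩
  have h1 := F.conj_x he 1
  have h2 := F.conj_y hf (-1)
  rw [cp_mul_s, s, Frame.w, Frame.w, inv_one, ← mul_assoc, ← mul_assoc, h1, mul_assoc (F.x j _) u, h2,
    mul_assoc, mul_assoc (F.y j _) u, h1]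
  simp only [mul_assoc, mul_one, mul_neg]

theorem wact_append (l l' : List b.support) : wact (l ++ l') = wact l * wact l' := by
  simp [wact]

theorem word_append (l l' : List b.support) : F.word (l ++ l') = F.word l * F.word l' := by
  simp [word]

/-- Deletion argument: if the word ends in `k` and makes no simple root negative, then without this
letter it sends α_k to a negative root. By exchange the part between a letter `j` and the final `k`
carries α_k to α_j, so both letters can be dropped at the cost of a torus element. -/
theorem word_mem_torus (l : List b.support) (hl : ∀ i, PosAt b (wact l) i) :
    F.word l ∈ torus ρ F.C := by
  induction hm : l.length using Nat.strong_induction_on generalizing l with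
  | _ m ih =>
  rcases List.eq_nil_or_concat l with rfl | ⟨l', k, hlk⟩
  · simp [word]
  rw [List.concat_eq_append] at hlk
  have hneg : NegAt b (wact l') k := by
    obtain ⟨β, hβ, h1⟩ := hl k
    refine ⟨(rootSystem H).reflectionPerm β β, fun hc => isPos_reflectionPerm_self.1 hc hβ,
      fun h => ?_⟩
    rw [RootPairing.root_reflectionPerm, RootPairing.reflection_apply_self, LinearMap.neg_apply]
    have e1 : wact l' h = wact l ((rootSystem H).coreflection k h) := by
      rw [hlk, wact_append, LinearEquiv.mul_apply]
      have : (wact [k] : H ≃ₗ[ℂ] H) = (rootSystem H).coreflection k.1 := by simp [wact]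
      rw [this]
      congr 1
      exact ((rootSystem H).coreflection_same k.1 h).symm
    rw [e1, h1]
    have h2 := root_reflectionPerm_coreflection k.1 k.1 h
    rw [RootPairing.root_reflectionPerm, RootPairing.reflection_apply_self,
      LinearMap.neg_apply] at h2
    exact h2
  obtain ⟨l1, j, l2, e, hj⟩ := F.exists_split_of_negAt l' k hneg
  obtain ⟨t, ht, hs⟩ := F.conj_s (F.word_acts l2) (intertwines (F.word_mem l2)) hj
  obtain ⟨t1, ht1, e1⟩ := F.refl_torus (F.s_acts j) ht
  have ht2 : t1 * F.cp j (-1) ∈ torus ρ F.C := mul_mem ht1 (F.cp_mem_torus j (by norm_num))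
  obtain ⟨t3, ht3, e3⟩ := F.word_torus l2 ht2
  have hword : F.word l = F.word (l1 ++ l2) * t3 := by
    have e4 : F.word l = F.word l1 * (F.s j * (F.word l2 * F.s k)) := by
      rw [hlk, e]
      simp [word]
    have e5 : F.s j * (F.word l2 * F.s k) = F.word l2 * t3 := by
      rw [hs, ← mul_assoc, ← mul_assoc, e1, mul_assoc t1, s_mul_s, e3]
    rw [e4, e5, word_append, mul_assoc]
  have hact : wact l = wact (l1 ++ l2) := by
    refine Acts.ext_of_injective F.inj (F.word_acts l) ?_
    rw [hword]
    simpa using (F.word_acts (l1 ++ l2)).mul (F.torus_acts ht3)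
  rw [hword]
  refine mul_mem (ih (l1 ++ l2).length ?_ (l1 ++ l2) (by rwa [← hact]) rfl) ht3
  rw [← hm, hlk, e]
  simp only [List.length_append, List.length_cons, List.length_nil]
  omega

theorem IsWeyl.mem_torus {u : GL (Fin n) ℂ} (hu : F.IsWeyl u) {w : H ≃ₗ[ℂ] H}
    (hw : Acts ρ u w) (h : ∀ i, PosAt b w i) : u ∈ torus ρ F.C := by
  obtain ⟨l, t, ht, rfl⟩ := hu
  refine mul_mem (F.word_mem_torus l ?_) ht
  have : w = wact l := by
    refine Acts.ext_of_injective F.inj hw ?_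
    simpa using (F.word_acts l).mul (F.torus_acts ht)
  rwa [← this]

theorem rootVector_comm {α : H.root} {z : L}
    (hz : z ∈ rootSpace H (α : LieModule.Weight ℂ H L)) {h : H}
    (h0 : (rootSystem H).root α h = 0) :
    (expU (ρ z) : Mat n) * ρ (h : L) = ρ (h : L) * expU (ρ z) := by
  have hn := isNilpotent_rootVector (ρ := ρ) hz
  rw [coe_expU hn]
  have h3 : ⁅(h : L), z⁆ = (rootSystem H).root α h • z := lie_eq_smul_of_mem_rootSpace hz h
  have h4 := map_lie_eq ρ (h : L) z
  rw [h3, h0, zero_smul, map_zero] at h4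
  exact (semiconjBy_exp hn hn (show SemiconjBy (ρ (h : L)) (ρ z) (ρ z) from
    sub_eq_zero.1 h4.symm)).symm

theorem root_h'_self (i : b.support) : (rootSystem H).root i (F.Ω.h' i) = 0 := by
  rw [F.Ω.simple_h', if_pos rfl]

theorem x_comm_h' (i : b.support) (a : ℂ) :
    (F.x i a : Mat n) * ρ ((F.Ω.h' i : H) : L) = ρ ((F.Ω.h' i : H) : L) * F.x i a :=
  rootVector_comm (F.smul_e_mem i a) (F.root_h'_self i)

theorem y_comm_h' (i : b.support) (a : ℂ) :
    (F.y i a : Mat n) * ρ ((F.Ω.h' i : H) : L) = ρ ((F.Ω.h' i : H) : L) * F.y i a :=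
  rootVector_comm (F.smul_f_mem i a) (by
    rw [root_negRoot, LinearMap.neg_apply, F.root_h'_self, neg_zero])

theorem coreflection_eq_self {i : H.root} {h : H} (h0 : (rootSystem H).root i h = 0) :
    (rootSystem H).coreflection i h = h := by
  have : (rootSystem H).coreflection i h =
      h - (rootSystem H).root i h • (rootSystem H).coroot i := RootPairing.coreflection_apply _ _ _
  rw [this, h0, zero_smul, sub_zero]

theorem refl_comm {u : GL (Fin n) ℂ} {i : b.support}
    (hu : Acts ρ u ((rootSystem H).coreflection i)) {h : H} (h0 : (rootSystem H).root i h = 0) :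
    (u : Mat n) * ρ (h : L) = ρ (h : L) * u := by
  have := hu h
  rwa [coreflection_eq_self h0] at this

theorem comm_neg {u : GL (Fin n) ℂ} {h : H} (hc : (u : Mat n) * ρ (h : L) = ρ (h : L) * u) :
    (u : Mat n) * ρ ((-h : H) : L) = ρ ((-h : H) : L) * u := by
  have : ((-h : H) : L) = -(h : L) := rfl
  rw [this, map_neg, mul_neg, hc, neg_mul]

theorem conj_Rminus {u : GL (Fin n) ℂ} (hu : u ∈ chevalleyGroup H ρ) {i : b.support}
    (hc : (u : Mat n) * ρ ((F.Ω.h' i : H) : L) = ρ ((F.Ω.h' i : H) : L) * u) {g : GL (Fin n) ℂ}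
    (hg : g ∈ negSubgroup ρ (F.Ω.h' i)) : u * g * u⁻¹ ∈ negSubgroup ρ (F.Ω.h' i) :=
  F.W.conj_mem_negSubgroup (F.wt_h' i) hg (intertwines hu) (intertwines (inv_mem hu)) hc

theorem conj_Rplus {u : GL (Fin n) ℂ} (hu : u ∈ chevalleyGroup H ρ) {i : b.support}
    (hc : (u : Mat n) * ρ ((F.Ω.h' i : H) : L) = ρ ((F.Ω.h' i : H) : L) * u) {g : GL (Fin n) ℂ}
    (hg : g ∈ negSubgroup ρ (-F.Ω.h' i)) : u * g * u⁻¹ ∈ negSubgroup ρ (-F.Ω.h' i) :=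
  F.W.conj_mem_negSubgroup (F.wt_neg_h' i) hg (intertwines hu) (intertwines (inv_mem hu))
    (comm_neg hc)

theorem Rminus_le (i : b.support) : negSubgroup ρ (F.Ω.h' i) ≤ Nminus ρ b := by
  refine rootSubgroup_mono ?_
  rintro α ⟨d, hd, hα⟩
  rcases F.Ω.root_h' α i with ⟨d', hd', h, -⟩ | ⟨-, -, -, h⟩ | ⟨h, -⟩ | ⟨-, h⟩
  · rw [hα] at h
    have : d = d' := by exact_mod_cast h
    omega
  · exact h
  · rw [h, F.root_h'_self] at hα
    have : d = 0 := by exact_mod_cast hα.symm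
    omega
  · exact h

theorem Rplus_le (i : b.support) : negSubgroup ρ (-F.Ω.h' i) ≤ Nplus ρ b := by
  refine rootSubgroup_mono ?_
  rintro α ⟨d, hd, hα⟩
  rw [map_neg] at hα
  rcases F.Ω.root_h' α i with ⟨-, -, -, h⟩ | ⟨d', hd', h, -⟩ | ⟨-, h⟩ | ⟨h, -⟩
  · exact h
  · rw [h] at hα
    have : -d' = d := by exact_mod_cast hα
    omega
  · exact h
  · rw [h, LinearMap.neg_apply, F.root_h'_self] at hα
    have : d = 0 := by simpa using hα.symm
    omega

/-- Every negative root other than -α_i is negative on `h' i`. Its root subgroup lies in a group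
normalized by the `y i a`, as these commute with `h' i`. -/
theorem Nminus_levi (i : b.support) {g : GL (Fin n) ℂ} (hg : g ∈ Nminus ρ b) :
    ∃ ν ∈ negSubgroup ρ (F.Ω.h' i), ∃ a, g = ν * F.y i a := by
  refine rootSubgroup_induction (p := fun g => ∃ ν ∈ negSubgroup ρ (F.Ω.h' i), ∃ a,
    g = ν * F.y i a) ⟨1, one_mem _, 0, by rw [y_zero, mul_one]⟩ ?_ ?_ hg
  · rintro _ _ ⟨ν, hν, a, rfl⟩ ⟨ν', hν', a', rfl⟩
    refine ⟨ν * (F.y i a * ν' * (F.y i a)⁻¹), mul_mem hν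
      (F.conj_Rminus (F.y_mem i a) (F.y_comm_h' i a) hν'), a + a', ?_⟩
    rw [y_add]
    group
  · intro α hα z hz
    rcases F.Ω.root_h' α i with ⟨-, -, -, h⟩ | ⟨d, hd, h, -⟩ | ⟨-, h⟩ | ⟨h, -⟩
    · exact absurd h hα
    · exact ⟨_, expU_mem_rootSubgroup (S := {α | ∃ d : ℤ, d < 0 ∧
        (rootSystem H).root α (F.Ω.h' i) = d}) ⟨d, hd, h⟩ hz, 0, by rw [y_zero, mul_one]⟩
    · exact absurd h hα
    · have : α = negRoot i := (rootSystem H).root.injective (by rw [h, root_negRoot])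
      subst this
      obtain ⟨c, rfl⟩ := exists_smul_eq (F.f_mem i) (F.f_ne_zero i) hz
      exact ⟨1, one_mem _, c, by rw [one_mul]; rfl⟩

theorem Nplus_levi (i : b.support) {g : GL (Fin n) ℂ} (hg : g ∈ Nplus ρ b) :
    ∃ ν ∈ negSubgroup ρ (-F.Ω.h' i), ∃ a, g = F.x i a * ν := by
  refine rootSubgroup_induction (p := fun g => ∃ ν ∈ negSubgroup ρ (-F.Ω.h' i), ∃ a,
    g = F.x i a * ν) ⟨1, one_mem _, 0, by rw [x_zero, mul_one]⟩ ?_ ?_ hg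
  · rintro _ _ ⟨ν, hν, a, rfl⟩ ⟨ν', hν', a', rfl⟩
    have hc := F.conj_Rplus (F.x_mem i (-a')) (F.x_comm_h' i _) hν
    refine ⟨_, mul_mem hc hν', a + a', ?_⟩
    rw [x_add, ← x_inv, inv_inv]
    group
  · intro α hα z hz
    rcases F.Ω.root_h' α i with ⟨d, hd, h, -⟩ | ⟨-, -, -, h⟩ | ⟨h, -⟩ | ⟨-, h⟩
    · refine ⟨_, expU_mem_rootSubgroup (S := {α | ∃ d : ℤ, d < 0 ∧
        (rootSystem H).root α (-F.Ω.h' i) = d}) ⟨-d, by omega, ?_⟩ hz, 0, by rw [x_zero, one_mul]⟩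
      rw [map_neg, h, Int.cast_neg]
    · exact absurd hα h
    · have : α = i := (rootSystem H).root.injective h
      subst this
      obtain ⟨c, rfl⟩ := exists_smul_eq (F.e_mem i) (F.e_ne_zero i) hz
      exact ⟨1, one_mem _, c, by rw [mul_one]; rfl⟩
    · exact absurd hα h

include F in
theorem torus_conj_Nminus {t g : GL (Fin n) ℂ} (ht : Acts ρ t (1 : H ≃ₗ[ℂ] H))
    (htG : t ∈ chevalleyGroup H ρ) (hg : g ∈ Nminus ρ b) : t * g * t⁻¹ ∈ Nminus ρ b := by
  rw [F.Nminus_eq] at hg ⊢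
  exact F.W.conj_mem_negSubgroup F.wt_h0 hg (intertwines htG) (intertwines (inv_mem htG)) (ht _)

include F in
theorem torus_conj_Nplus {t g : GL (Fin n) ℂ} (ht : Acts ρ t (1 : H ≃ₗ[ℂ] H))
    (htG : t ∈ chevalleyGroup H ρ) (hg : g ∈ Nplus ρ b) : t * g * t⁻¹ ∈ Nplus ρ b := by
  rw [F.Nplus_eq] at hg ⊢
  exact F.W.conj_mem_negSubgroup F.wt_neg_h0 hg (intertwines htG) (intertwines (inv_mem htG)) (ht _)

/-- The union of the Bruhat cells. -/
def InCell (g : GL (Fin n) ℂ) : Prop :=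
  ∃ m ∈ Nminus ρ b, ∃ u, F.IsWeyl u ∧ ∃ m' ∈ Nplus ρ b, g = m * u * m'

theorem InCell.mul_Nplus {g m : GL (Fin n) ℂ} (hg : F.InCell g) (hm : m ∈ Nplus ρ b) :
    F.InCell (g * m) := by
  obtain ⟨m1, h1, u, hu, m2, h2, rfl⟩ := hg
  exact ⟨m1, h1, u, hu, m2 * m, mul_mem h2 hm, by group⟩

theorem InCell.mul_torus {g t : GL (Fin n) ℂ} (hg : F.InCell g) (ht : t ∈ torus ρ F.C) :
    F.InCell (g * t) := by
  obtain ⟨m1, h1, u, hu, m2, h2, rfl⟩ := hg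
  refine ⟨m1, h1, u * t, IsWeyl.mul F hu (F.isWeyl_of_torus ht), t⁻¹ * m2 * t⁻¹⁻¹,
    F.torus_conj_Nplus (F.torus_acts (inv_mem ht)) (inv_mem (F.torus_le ht)) h2, by group⟩

/-- Only the factor `x i a` of the N₊ part matters; the rest is conjugated past the reflection. If
`a ≠ 0` and `u` makes α_i negative, `x i a` moves left through `u` into N₋. If `u` keeps α_i
positive, `x_mul_s_eq` is used and the resulting `y` moves left. -/
theorem InCell.mul_s {g : GL (Fin n) ℂ} (hg : F.InCell g) (i : b.support) :
    F.InCell (g * F.s i) := by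
  obtain ⟨m1, h1, u, hu, m2, h2, rfl⟩ := hg
  obtain ⟨ν, hν, a, rfl⟩ := F.Nplus_levi i h2
  have hc := F.conj_Rplus (inv_mem (F.s_mem i))
    (semiconj_inv (refl_comm (F.s_acts i) (F.root_h'_self i))) hν
  have key : F.InCell (m1 * u * F.x i a * F.s i) := by
    by_cases ha : a = 0
    · subst ha
      exact ⟨m1, h1, u * F.s i, IsWeyl.mul F hu (F.isWeyl_s i), 1, one_mem _, by
        rw [x_zero]; group⟩
    · obtain ⟨w, hw⟩ := IsWeyl.acts F hu
      have hI := intertwines (IsWeyl.mem F hu)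
      rcases F.posAt_or_negAt hw hI i with hp | hp
      · refine ⟨_, mul_mem h1 (F.conj_y_of_posAt hw hI (a⁻¹) hp), u * F.cp i (-a),
          IsWeyl.mul F hu (F.isWeyl_of_torus (F.cp_mem_torus i (neg_ne_zero.2 ha))),
          F.x i (-a⁻¹), F.x_mem_Nplus i _, ?_⟩
        rw [mul_assoc (m1 * u), F.x_mul_s_eq i ha]
        group
      · refine ⟨_, mul_mem h1 (F.conj_x_of_negAt hw hI a hp), u * F.s i,
          IsWeyl.mul F hu (F.isWeyl_s i), 1, one_mem _, ?_⟩
        group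
  have := InCell.mul_Nplus F key (F.Rplus_le i hc)
  convert this using 1
  group

/-- Negative root subgroups are reached by induction along simple reflections, from the case of
simple roots, where the standard lift conjugates `x` to `y`. -/
theorem expU_mem_of_closed {K : Subgroup (GL (Fin n) ℂ)} (hN : Nplus ρ b ≤ K)
    (hs : ∀ i, F.s i ∈ K) : chevalleyGroup H ρ ≤ K := by
  have hneg : ∀ α : H.root, b.IsPos α → ∀ z ∈ rootSpace H
      (((rootSystem H).reflectionPerm α α : H.root) : LieModule.Weight ℂ H L), expU (ρ z) ∈ K := by
    intro α hα
    refine hα.induction_on_reflect (p := fun α => ∀ z ∈ rootSpace H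
      (((rootSystem H).reflectionPerm α α : H.root) : LieModule.Weight ℂ H L), expU (ρ z) ∈ K) ?_ ?_
    · intro i hi z hz
      obtain ⟨c, rfl⟩ := exists_smul_eq (F.f_mem ⟨i, hi⟩) (F.f_ne_zero ⟨i, hi⟩) hz
      have h1 : F.y ⟨i, hi⟩ c = F.s ⟨i, hi⟩ * F.x ⟨i, hi⟩ (-c) * (F.s ⟨i, hi⟩)⁻¹ := by
        rw [s_mul_x, neg_neg, mul_inv_cancel_right]
      change F.y ⟨i, hi⟩ c ∈ K
      rw [h1]
      exact mul_mem (mul_mem (hs _) (hN (F.x_mem_Nplus _ _))) (inv_mem (hs _))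
    · intro α j ih hj z hz
      have hact : Acts ρ (F.s ⟨j, hj⟩)⁻¹ ((rootSystem H).coreflection j) := by
        have := (F.s_acts ⟨j, hj⟩).inv
        rwa [inv_eq_of_mul_eq_one_right (coreflection_sq j)] at this
      obtain ⟨γ, h1, h2⟩ := hact.exists_root F.inj (intertwines (inv_mem (F.s_mem _)))
        ((rootSystem H).reflectionPerm ((rootSystem H).reflectionPerm j α)
          ((rootSystem H).reflectionPerm j α))
      obtain ⟨z', hz', e⟩ := h2 z hz
      have hγ : (rootSystem H).reflectionPerm α α = γ := by
        refine root_eq_of_acts (w := (rootSystem H).coreflection j) (fun h => ?_) h1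
        have h3 := root_reflectionPerm_coreflection j ((rootSystem H).reflectionPerm j α) h
        rw [RootPairing.reflectionPerm_self] at h3
        rw [RootPairing.root_reflectionPerm, RootPairing.reflection_apply_self,
          RootPairing.root_reflectionPerm (rootSystem H) ((rootSystem H).reflectionPerm j α),
          RootPairing.reflection_apply_self, LinearMap.neg_apply, LinearMap.neg_apply, h3]
      rw [← hγ] at hz'
      have h4 := conj_expU (isNilpotent_rootVector hz) (isNilpotent_rootVector hz') e
      have h5 : expU (ρ z) = F.s ⟨j, hj⟩ * expU (ρ z') * (F.s ⟨j, hj⟩)⁻¹ := by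
        rw [mul_assoc, ← h4, mul_inv_cancel_left]
      rw [h5]
      exact mul_mem (mul_mem (hs _) (ih z' hz')) (inv_mem (hs _))
  intro g hg
  refine rootSubgroup_induction (p := fun g => g ∈ K) (one_mem _) (fun _ _ h h' => mul_mem h h')
    (fun α _ z hz => ?_) hg
  by_cases hα : b.IsPos α
  · exact hN (expU_mem_rootSubgroup hα hz)
  · have h1 := hneg _ ((isPos_reflectionPerm_self (b := b) (β := α)).2 hα)
    refine h1 z ?_
    have h2 : (rootSystem H).reflectionPerm ((rootSystem H).reflectionPerm α α)
        ((rootSystem H).reflectionPerm α α) = α := by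
      refine (rootSystem H).root.injective ?_
      rw [RootPairing.root_reflectionPerm, RootPairing.reflection_apply_self,
        RootPairing.root_reflectionPerm, RootPairing.reflection_apply_self, neg_neg]
    rwa [h2]

theorem bruhat {g : GL (Fin n) ℂ} (hg : g ∈ chevalleyGroup H ρ) : F.InCell g := by
  have hle := F.expU_mem_of_closed
    (K := Subgroup.closure ((Nplus ρ b : Set (GL (Fin n) ℂ)) ∪ Set.range F.s))
    (fun g hg => Subgroup.subset_closure (Or.inl hg))
    (fun i => Subgroup.subset_closure (Or.inr ⟨i, rfl⟩))
  refine Subgroup.closure_induction_right (p := fun g _ => F.InCell g)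
    ⟨1, one_mem _, 1, F.isWeyl_one, 1, one_mem _, by simp⟩ ?_ ?_ (hle hg)
  · rintro g _ q (hq | ⟨i, rfl⟩) ih
    · exact InCell.mul_Nplus F ih hq
    · exact InCell.mul_s F ih i
  · rintro g _ q (hq | ⟨i, rfl⟩) ih
    · exact InCell.mul_Nplus F ih (inv_mem hq)
    · have h1 : (F.s i)⁻¹ = F.s i * (F.cp i (-1))⁻¹ := by
        rw [← s_mul_s, mul_inv_rev, mul_inv_cancel_left]
      rw [h1, ← mul_assoc]
      exact InCell.mul_torus F (InCell.mul_s F ih i)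
        (inv_mem (F.cp_mem_torus i (by norm_num)))

theorem trace_hat_cartan (h : H) : Matrix.trace (ρ (h : L)) = ∑ j, F.W.wt j h := by
  have h1 := congrArg Matrix.trace (F.W.hat_cartan h)
  rw [Matrix.trace_diagonal, WeightBasis.hat_apply, Matrix.trace_mul_cycle, ← Units.val_mul,
    mul_inv_cancel, Units.val_one, one_mul] at h1
  exact h1

theorem trace_acts {u : GL (Fin n) ℂ} {w : H ≃ₗ[ℂ] H} (hu : Acts ρ u w) (h : H) :
    ∑ j, F.W.wt j (w h) = ∑ j, F.W.wt j h := by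
  rw [← trace_hat_cartan, ← trace_hat_cartan]
  have h1 : ρ ((w h : H) : L) = u * ρ (h : L) * ((u⁻¹ : GL (Fin n) ℂ) : Mat n) := by
    rw [hu h, mul_assoc, ← Units.val_mul, mul_inv_cancel, Units.val_one, mul_one]
  rw [h1, Matrix.trace_mul_cycle, ← Units.val_mul, inv_mul_cancel, Units.val_one, one_mul]

theorem hat_Nminus {g : GL (Fin n) ℂ} (hg : g ∈ Nminus ρ b) : F.W.hat g - 1 ∈ Fil F.d0 1 := by
  rw [F.Nminus_eq] at hg
  exact F.W.hat_sub_one_mem F.wt_h0 hg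

theorem hat_Nplus {g : GL (Fin n) ℂ} (hg : g ∈ Nplus ρ b) :
    F.W.hat g - 1 ∈ Fil (fun j => -F.d0 j) 1 := by
  rw [F.Nplus_eq] at hg
  exact F.W.hat_sub_one_mem F.wt_neg_h0 hg

theorem eq_of_hat_cartan {h h' : H} (e : ∀ j, F.W.wt j h = F.W.wt j h') : h = h' := by
  refine Subtype.ext (F.inj (F.W.hat_injective ?_))
  rw [F.W.hat_cartan, F.W.hat_cartan]
  congr 1; ext j
  exact e j

/-- An element of a Bruhat cell that centralizes the torus lies in the torus. -/
theorem eq_of_acts_one {g m u m' : GL (Fin n) ℂ} (hg : g ∈ chevalleyGroup H ρ)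
    (hact : Acts ρ g (1 : H ≃ₗ[ℂ] H)) (hm : m ∈ Nminus ρ b) (hu : F.IsWeyl u)
    (hm' : m' ∈ Nplus ρ b) (e : g = m * u * m') : u ∈ torus ρ F.C ∧ g = u := by
  obtain ⟨w, hw⟩ := IsWeyl.acts F hu
  -- As `g` centralizes the torus it normalizes N₊. The decomposition becomes `m * q = m2` with `m`
  -- lower and `m2` upper unipotent, while `q` acts on `H` as `u` does.
  set m2 := g * m'⁻¹ * g⁻¹ with hm2
  have h2 : m2 ∈ Nplus ρ b := F.torus_conj_Nplus hact hg (inv_mem hm')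
  set q := u * g⁻¹ with hq
  have hmq : m * q = m2 := by rw [hq, hm2]; nth_rewrite 2 [e]; group
  have hqa : Acts ρ q w := by simpa using hw.mul hact.inv
  have hmq' : F.W.hat m * F.W.hat q = F.W.hat m2 := by rw [← map_mul, ← Units.val_mul, hmq]
  have hqe : ∀ j l, F.W.hat q j l ≠ 0 → ∀ h, F.W.wt l (w.symm h) = F.W.wt j h := by
    intro j l hne h
    have := F.W.hat_of_intertwine (hqa (w.symm h)) j l
    rw [w.apply_symm_apply, mul_comm] at this
    exact mul_right_cancel₀ hne this
  have hM := F.hat_Nminus hm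
  have hM2 := F.hat_Nplus h2
  have hMe : ∀ i j, F.W.hat m i j ≠ 0 → F.d0 i ≤ F.d0 j := by
    intro i j hne
    by_contra hlt
    have h3 := hM i j (by omega)
    rw [Matrix.sub_apply, Matrix.one_apply_ne (by rintro rfl; omega), sub_zero] at h3
    exact hne h3
  -- The diagonal entry of `m * q` is 1, so some term `m l j * q j l` is non-zero: the first factor
  -- bounds the degree of `l` by that of `j`, the second identifies the degree of `j` with the
  -- weight of `l` on w⁻¹ h0.
  have hge : ∀ l, ∃ j, F.d0 l ≤ F.d0 j ∧ F.W.wt l (w.symm F.Ω.h0) = F.d0 j := by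
    intro l
    have h3 : (F.W.hat m * F.W.hat q) l l = 1 := by
      rw [hmq']
      have := hM2 l l (by simp)
      rw [Matrix.sub_apply, Matrix.one_apply_eq] at this
      exact sub_eq_zero.1 this
    rw [Matrix.mul_apply] at h3
    obtain ⟨j, -, hj⟩ := Finset.exists_ne_zero_of_sum_ne_zero (by rw [h3]; exact one_ne_zero)
    exact ⟨j, hMe l j (left_ne_zero_of_mul hj), by
      rw [hqe j l (right_ne_zero_of_mul hj), wt_h0]⟩
  choose σ hσ1 hσ2 using hge
  -- Conjugate matrices have the same trace, so all these inequalities are equalities and `w` fixes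
  -- `h0`.
  have hsum : ∑ l, F.d0 (σ l) = ∑ l, F.d0 l := by
    have h3 := F.trace_acts hw.inv F.Ω.h0
    have h4 : ∑ l, ((F.d0 (σ l) : ℤ) : ℂ) = ∑ l, ((F.d0 l : ℤ) : ℂ) := by
      rw [← Finset.sum_congr rfl fun l _ => hσ2 l, ← Finset.sum_congr rfl fun l _ => F.wt_h0 l]
      exact h3
    exact_mod_cast h4
  have heq : ∀ l, F.d0 (σ l) = F.d0 l := by
    have := (Finset.sum_eq_sum_iff_of_le fun l _ => hσ1 l).1 hsum.symm
    exact fun l => (this l (Finset.mem_univ l)).symm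
  have hfix : w.symm F.Ω.h0 = F.Ω.h0 := F.eq_of_hat_cartan fun l => by
    rw [hσ2, heq, wt_h0]
  have hfix' : w F.Ω.h0 = F.Ω.h0 := by
    conv_lhs => rw [← hfix]
    exact w.apply_symm_apply _
  have hut : u ∈ torus ρ F.C := by
    refine IsWeyl.mem_torus F hu hw fun i => ?_
    obtain ⟨β, h3, -⟩ := hw.exists_root F.inj (intertwines (IsWeyl.mem F hu)) i
    refine ⟨β, (F.Ω.isPos_iff β).2 ⟨F.Ω.D, F.Ω.D_pos, ?_⟩, h3⟩
    have := h3 F.Ω.h0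
    rwa [hfix', F.Ω.simple_h0] at this
  refine ⟨hut, ?_⟩
  have hq1 : F.W.hat q = 1 := by
    -- Now `q` preserves degrees, and in each degree `m` and `m2` are the identity, so `q` is too.
    have hqd : ∀ j l, F.W.hat q j l ≠ 0 → F.d0 l = F.d0 j := by
      intro j l hne
      have h3 := hqe j l hne F.Ω.h0
      rw [hfix, wt_h0, wt_h0] at h3
      exact_mod_cast h3
    ext i j
    by_cases hij : F.d0 i = F.d0 j
    · have h3 : (F.W.hat m2 - 1) i j = ((F.W.hat m - 1) * F.W.hat q) i j + F.W.hat q i j -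
          (1 : Mat n) i j := by
        rw [← hmq', sub_mul, one_mul, Matrix.sub_apply, Matrix.sub_apply]; ring
      rw [hM2 i j (by simp [hij]), Matrix.mul_apply, Finset.sum_eq_zero, zero_add] at h3
      · exact (sub_eq_zero.1 h3.symm)
      · intro k _
        by_cases h4 : F.W.hat q k j = 0
        · rw [h4, mul_zero]
        · rw [hM i k (by have := hqd k j h4; omega), zero_mul]
    · rw [Matrix.one_apply_ne (by rintro rfl; exact hij rfl)]
      by_contra h4
      exact hij (hqd i j h4).symm
  have hq2 : q = 1 := Units.ext (F.W.hat_injective (by rw [hq1, Units.val_one, map_one]))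
  exact (mul_inv_eq_one.1 hq2).symm

theorem mem_torus_of_acts_one {g : GL (Fin n) ℂ} (hg : g ∈ chevalleyGroup H ρ)
    (hact : Acts ρ g (1 : H ≃ₗ[ℂ] H)) : g ∈ torus ρ F.C := by
  obtain ⟨m, hm, u, hu, m', hm', e⟩ := F.bruhat hg
  obtain ⟨h1, h2⟩ := F.eq_of_acts_one hg hact hm hu hm' e
  rwa [h2]

end Frame

end HOper

end

/-! ### Ranks of blocks as invariants of relative position. -/

noncomputable section

set_option linter.unusedSectionVars false

namespace HOper

open LieAlgebra LieAlgebra.IsKilling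
open scoped Classical

section Combinatorics

variable {ι : Type*} [Fintype ι]

theorem sum_Ioc_indicator {B d : ℤ} (h1 : -B ≤ d) (h2 : d ≤ B) :
    ∑ p ∈ Finset.Ioc (-B) B, (if p ≤ d then (1 : ℤ) else 0) = d + B := by
  rw [Finset.sum_ite, Finset.sum_const_zero, add_zero, Finset.sum_const, nsmul_eq_mul, mul_one]
  have : (Finset.Ioc (-B) B).filter (fun p => p ≤ d) = Finset.Ioc (-B) d := by
    ext p; simp only [Finset.mem_filter, Finset.mem_Ioc]; omega
  rw [this, Int.card_Ioc]
  omega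

/-- After a shift by `B` both factors are non-negative and each product counts the pairs of
thresholds below them, so the sum over `l` is a sum of the given cardinalities. Equality of the
first moments removes the shift. -/
theorem sum_mul_eq_of_card {d e e' : ι → ℤ} (hs : ∑ l, e l = ∑ l, e' l)
    (h : ∀ q p : ℤ, (Finset.univ.filter fun l => q < e l ∧ p ≤ d l).card =
      (Finset.univ.filter fun l => q < e' l ∧ p ≤ d l).card) :
    ∑ l, d l * e l = ∑ l, d l * e' l := by
  obtain ⟨B, hB⟩ : ∃ B : ℤ, ∀ l, |d l| ≤ B ∧ |e l| ≤ B ∧ |e' l| ≤ B := by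
    refine ⟨∑ l, (|d l| + |e l| + |e' l|), fun l => ?_⟩
    have := Finset.single_le_sum (f := fun l => |d l| + |e l| + |e' l|)
      (fun l _ => by positivity) (Finset.mem_univ l)
    have h1 := abs_nonneg (d l)
    have h2 := abs_nonneg (e l)
    have h3 := abs_nonneg (e' l)
    exact ⟨by linarith, by linarith, by linarith⟩
  have key : ∀ f : ι → ℤ, (∀ l, |f l| ≤ B) → ∑ l, (d l + B) * (f l + B) =
      ∑ p ∈ Finset.Ioc (-B) B, ∑ q ∈ Finset.Ioc (-B) B,
        ((Finset.univ.filter fun l => q - 1 < f l ∧ p ≤ d l).card : ℤ) := by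
    intro f hf
    have h1 : ∀ l, (d l + B) * (f l + B) = ∑ p ∈ Finset.Ioc (-B) B, ∑ q ∈ Finset.Ioc (-B) B,
        (if q - 1 < f l ∧ p ≤ d l then (1 : ℤ) else 0) := by
      intro l
      rw [← sum_Ioc_indicator (abs_le.1 (hB l).1).1 (abs_le.1 (hB l).1).2,
        ← sum_Ioc_indicator (abs_le.1 (hf l)).1 (abs_le.1 (hf l)).2, Finset.sum_mul_sum]
      refine Finset.sum_congr rfl fun p _ => Finset.sum_congr rfl fun q _ => ?_
      by_cases h3 : p ≤ d l <;> by_cases h4 : q ≤ f l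
      · rw [if_pos h3, if_pos h4, if_pos ⟨by omega, h3⟩, mul_one]
      · rw [if_pos h3, if_neg h4, if_neg (fun hc => h4 (by omega)), mul_zero]
      · rw [if_neg h3, zero_mul, if_neg (fun hc => h3 hc.2)]
      · rw [if_neg h3, zero_mul, if_neg (fun hc => h3 hc.2)]
    rw [Finset.sum_congr rfl fun l _ => h1 l, Finset.sum_comm]
    refine Finset.sum_congr rfl fun p _ => ?_
    rw [Finset.sum_comm]
    refine Finset.sum_congr rfl fun q _ => ?_
    rw [Finset.sum_boole]
  have h1 := key e fun l => (hB l).2.1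
  have h2 := key e' fun l => (hB l).2.2
  simp only [h] at h1
  rw [← h2] at h1
  have h3 : ∀ f : ι → ℤ, ∑ l, (d l + B) * (f l + B) =
      ∑ l, d l * f l + B * ∑ l, f l + ∑ l, (d l * B + B * B) := by
    intro f
    rw [Finset.mul_sum, ← Finset.sum_add_distrib, ← Finset.sum_add_distrib]
    exact Finset.sum_congr rfl fun l _ => by ring
  rw [h3, h3, hs] at h1
  linarith

end Combinatorics

variable {n : ℕ}

/-- The projection on a set of coordinates. -/
def proj (p : Fin n → Prop) : Mat n := Matrix.diagonal fun j => if p j then 1 else 0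

theorem proj_mul (p q : Fin n → Prop) : proj p * proj q = proj fun j => p j ∧ q j := by
  rw [proj, proj, Matrix.diagonal_mul_diagonal, proj]
  congr 1; ext j
  by_cases h1 : p j <;> by_cases h2 : q j <;> simp [h1, h2]

theorem proj_mul_apply (p : Fin n → Prop) (M : Mat n) (i j : Fin n) :
    (proj p * M) i j = if p i then M i j else 0 := by
  rw [proj, Matrix.diagonal_mul]; split_ifs <;> simp

theorem mul_proj_apply (p : Fin n → Prop) (M : Mat n) (i j : Fin n) :
    (M * proj p) i j = if p j then M i j else 0 := by
  rw [proj, Matrix.mul_diagonal]; split_ifs <;> simp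

theorem rank_proj (p : Fin n → Prop) : (proj p).rank = (Finset.univ.filter p).card := by
  rw [proj, Matrix.rank_diagonal, Fintype.card_subtype]
  congr 1
  ext j
  simp

theorem proj_mul_of_Fil {a : Fin n → ℤ} {M : Mat n} (hM : M ∈ Fil a 0) (q : ℤ) :
    proj (fun j => q < a j) * M = proj (fun j => q < a j) * M * proj fun j => q < a j := by
  ext i j
  rw [mul_proj_apply, proj_mul_apply]
  by_cases h1 : q < a i <;> by_cases h2 : q < a j <;> simp only [h1, h2, if_true, if_false]
  exact hM i j (by omega)

theorem mul_proj_of_Fil {a : Fin n → ℤ} {M : Mat n} (hM : M ∈ Fil (fun j => -a j) 0) (p : ℤ) :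
    M * proj (fun j => p ≤ a j) = proj (fun j => p ≤ a j) * (M * proj fun j => p ≤ a j) := by
  ext i j
  rw [proj_mul_apply, mul_proj_apply]
  by_cases h1 : p ≤ a i <;> by_cases h2 : p ≤ a j <;> simp only [h1, h2, if_true, if_false]
  exact hM i j (by simp only; omega)

variable {L : Type*} [LieRing L] [LieAlgebra ℂ L] [FiniteDimensional ℂ L]
  [LieAlgebra.IsSimple ℂ L] {H : LieSubalgebra ℂ L} [H.IsCartanSubalgebra]
  {b : (rootSystem H).Base} {ρ : L →ₗ⁅ℂ⁆ Mat n}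

/-- The matrices that, with their inverses, are in the degree zero part of the filtration. -/
def filSubgroup (W : WeightBasis H ρ) (a : Fin n → ℤ) : Subgroup (GL (Fin n) ℂ) where
  carrier := {g | W.hat g ∈ Fil a 0 ∧ W.hat ((g⁻¹ : GL (Fin n) ℂ) : Mat n) ∈ Fil a 0}
  one_mem' := by
    simp only [Set.mem_ofPred_eq, inv_one, Units.val_one, map_one, and_self]
    exact one_mem_Fil
  mul_mem' := by
    rintro g q ⟨h1, h2⟩ ⟨h3, h4⟩
    refine ⟨?_, ?_⟩
    · rw [Units.val_mul, map_mul]; exact mul_mem_Fil_zero h1 h3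
    · rw [mul_inv_rev, Units.val_mul, map_mul]; exact mul_mem_Fil_zero h4 h2
  inv_mem' := by
    rintro g ⟨h1, h2⟩
    exact ⟨h2, by rwa [inv_inv]⟩

theorem mem_filSubgroup_of_sub_one {W : WeightBasis H ρ} {a : Fin n → ℤ} {g : GL (Fin n) ℂ}
    (h : W.hat g - 1 ∈ Fil a 1) : g ∈ filSubgroup W a :=
  ⟨mem_Fil_zero_of_sub_one h, mem_Fil_zero_of_sub_one (inv_sub_one_mem_Fil (W.hat_inv_mul g) h)⟩

theorem hat_mem_Fil_of_comm {W : WeightBasis H ρ} {a : Fin n → ℤ} {h : H}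
    (ha : ∀ j, W.wt j h = a j) {X : Mat n} (hc : X * ρ (h : L) = ρ (h : L) * X) :
    W.hat X ∈ Fil a 0 := by
  intro i j hij
  have := W.hat_of_intertwine hc i j
  rw [ha, ha] at this
  have h2 : ((a j - a i : ℤ) : ℂ) * W.hat X i j = 0 := by
    rw [Int.cast_sub]; linear_combination this
  refine (mul_eq_zero.1 h2).resolve_left ?_
  have : a j - a i ≠ 0 := by omega
  exact_mod_cast this

theorem mem_filSubgroup_of_comm {W : WeightBasis H ρ} {a : Fin n → ℤ} {h : H}
    (ha : ∀ j, W.wt j h = a j) {g : GL (Fin n) ℂ}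
    (hc : (g : Mat n) * ρ (h : L) = ρ (h : L) * g) : g ∈ filSubgroup W a :=
  ⟨hat_mem_Fil_of_comm ha hc, hat_mem_Fil_of_comm ha (semiconj_inv hc)⟩

namespace Frame

variable (F : Frame b ρ)

theorem root_ω_of_not_isPos {α : H.root} (hα : ¬ b.IsPos α) (k : b.support) :
    ∃ d : ℤ, 0 ≤ d ∧ (rootSystem H).root α (F.Ω.ω k) = -d := by
  obtain ⟨f, -, hs, hf⟩ := b.exists_root_eq_sum_int α
  have hv : (rootSystem H).root α (F.Ω.ω k) = ((f k * F.Ω.D : ℤ) : ℂ) := by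
    rw [hf, LinearMap.sum_apply, Finset.sum_eq_single_of_mem k.1 k.2, LinearMap.smul_apply,
      F.Ω.root_ω k k, if_pos rfl, zsmul_eq_mul, Int.cast_mul]
    intro j hj hjk
    rw [LinearMap.smul_apply, F.Ω.root_ω ⟨j, hj⟩ k, if_neg, smul_zero]
    intro h
    exact hjk (congrArg Subtype.val h)
  rw [RootPairing.Base.isPos_iff, RootPairing.Base.height_eq_sum hf] at hα
  have hle : f k ≤ 0 := by
    rcases hs with hs | hs
    · have h0 : ∑ j ∈ b.support, f j = 0 :=
        le_antisymm (not_lt.1 hα) (Finset.sum_nonneg fun j _ => hs.le j)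
      exact ((Finset.sum_eq_zero_iff_of_nonneg fun j _ => hs.le j).1 h0 k k.2).le
    · exact hs.le k
  refine ⟨-(f k * F.Ω.D), ?_, by rw [hv]; push_cast; ring⟩
  have := mul_nonpos_of_nonpos_of_nonneg hle F.Ω.D_pos.le
  omega

/-- The matrices preserving the filtration by the coweight `ω k`. -/
def lowerAt (k : b.support) : Subgroup (GL (Fin n) ℂ) := filSubgroup F.W (F.dω k)

/-- The matrices preserving the filtration opposite to that of `h0`. -/
def upper : Subgroup (GL (Fin n) ℂ) := filSubgroup F.W fun j => -F.d0 j

theorem Nminus_le_lowerAt (k : b.support) : Nminus ρ b ≤ F.lowerAt k := by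
  intro g hg
  refine rootSubgroup_induction (p := fun g => g ∈ F.lowerAt k) (one_mem _)
    (fun _ _ h h' => mul_mem h h') (fun α hα z hz => ?_) hg
  obtain ⟨d, hd, hv⟩ := F.root_ω_of_not_isPos hα k
  have key : ∀ z ∈ rootSpace H (α : LieModule.Weight ℂ H L),
      F.W.hat (expU (ρ z)) ∈ Fil (F.dω k) 0 := by
    intro z hz
    have hn := isNilpotent_rootVector (ρ := ρ) hz
    have hm : F.W.hat (ρ z) ∈ Fil (F.dω k) d := F.W.hat_rootVector_mem (F.wt_ω k) hz hv
    have e : F.W.hat (IsNilpotent.exp (ρ z)) = IsNilpotent.exp (F.W.hat (ρ z)) :=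
      IsNilpotent.map_exp hn (F.W.hat : Mat n →+* Mat n)
    rw [coe_expU hn, e]
    have h1 := Fil_mono hd (exp_sub_one_mem_Fil (hn.map F.W.hat) hm hd)
    have := (Fil (F.dω k) 0).add_mem h1 one_mem_Fil
    simpa using this
  refine ⟨key z hz, ?_⟩
  rw [inv_expU (isNilpotent_rootVector hz), ← map_neg]
  exact key _ (Submodule.neg_mem _ hz)

theorem torus_le_lowerAt (k : b.support) : torus ρ F.C ≤ F.lowerAt k := fun _ ht =>
  mem_filSubgroup_of_comm (F.wt_ω k) (F.torus_acts ht _)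

/-- For `i ≠ k` the reflection fixes `ω k`. The ranks attached to `k` are thus blind to all factors
of the Coxeter element but one. -/
theorem refl_mem_lowerAt {u : GL (Fin n) ℂ} {i k : b.support} (hik : i ≠ k)
    (hu : Acts ρ u ((rootSystem H).coreflection i)) : u ∈ F.lowerAt k :=
  mem_filSubgroup_of_comm (F.wt_ω k) (refl_comm hu (by rw [F.Ω.root_ω, if_neg hik]))

theorem Nplus_le_upper : Nplus ρ b ≤ F.upper := fun _ hg =>
  mem_filSubgroup_of_sub_one (F.hat_Nplus hg)

theorem torus_le_upper : torus ρ F.C ≤ F.upper := fun _ ht =>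
  mem_filSubgroup_of_comm F.wt_neg_h0 (F.torus_acts ht _)

theorem Bplus_le_upper : Bplus ρ F.C ≤ F.upper := sup_le F.torus_le_upper F.Nplus_le_upper

/-- The ranks of the blocks that separate the Bruhat cells. -/
def rk (k : b.support) (q p : ℤ) (g : GL (Fin n) ℂ) : ℕ :=
  (proj (fun j => q < F.dω k j) * F.W.hat g * proj fun j => p ≤ F.d0 j).rank

/-- The rows of degree above `q` of the product only involve the rows of degree above `q` of `x`, so
the block is a multiple of the block of `x`. -/
theorem rk_mul_le {k : b.support} {g : GL (Fin n) ℂ} (hg : g ∈ F.lowerAt k) (q p : ℤ)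
    (x : GL (Fin n) ℂ) : F.rk k q p (g * x) ≤ F.rk k q p x := by
  rw [rk, rk, Units.val_mul, map_mul, ← mul_assoc, proj_mul_of_Fil hg.1]
  have : proj (fun j => q < F.dω k j) * F.W.hat g * (proj fun j => q < F.dω k j) * F.W.hat x *
      (proj fun j => p ≤ F.d0 j) = (proj (fun j => q < F.dω k j) * F.W.hat g) *
        (proj (fun j => q < F.dω k j) * F.W.hat x * proj fun j => p ≤ F.d0 j) := by
    simp only [mul_assoc]
  rw [this]
  exact Matrix.rank_mul_le_right _ _

theorem rk_lowerAt_mul {k : b.support} {g : GL (Fin n) ℂ} (hg : g ∈ F.lowerAt k) (q p : ℤ)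
    (x : GL (Fin n) ℂ) : F.rk k q p (g * x) = F.rk k q p x := by
  refine le_antisymm (F.rk_mul_le hg q p x) ?_
  have := F.rk_mul_le (inv_mem hg) q p (g * x)
  rwa [inv_mul_cancel_left] at this

theorem rk_le_mul {g : GL (Fin n) ℂ} (hg : g ∈ F.upper) (k : b.support) (q p : ℤ)
    (x : GL (Fin n) ℂ) : F.rk k q p (x * g) ≤ F.rk k q p x := by
  rw [rk, rk, Units.val_mul, map_mul, mul_assoc, mul_assoc (F.W.hat x),
    mul_proj_of_Fil hg.1]
  have : proj (fun j => q < F.dω k j) * (F.W.hat x * ((proj fun j => p ≤ F.d0 j) * (F.W.hat g *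
      proj fun j => p ≤ F.d0 j))) = (proj (fun j => q < F.dω k j) * F.W.hat x *
        proj fun j => p ≤ F.d0 j) * (F.W.hat g * proj fun j => p ≤ F.d0 j) := by
    simp only [mul_assoc]
  rw [this]
  exact Matrix.rank_mul_le_left _ _

theorem rk_mul_upper {g : GL (Fin n) ℂ} (hg : g ∈ F.upper) (k : b.support) (q p : ℤ)
    (x : GL (Fin n) ℂ) : F.rk k q p (x * g) = F.rk k q p x := by
  refine le_antisymm (F.rk_le_mul hg k q p x) ?_
  have := F.rk_le_mul (inv_mem hg) k q p (x * g)
  rwa [mul_inv_cancel_right] at this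

/-- Non-zero entries occur only where the degree of the row is the weight of the column on w⁻¹ ω_k.
Selecting rows is therefore selecting columns, and as the matrix is invertible the rank is their
number. -/
theorem rk_of_acts {u : GL (Fin n) ℂ} {w : H ≃ₗ[ℂ] H} (hu : Acts ρ u w) (k : b.support) :
    ∃ e : Fin n → ℤ, (∀ l, F.W.wt l (w.symm (F.Ω.ω k)) = e l) ∧
      ∀ q p, F.rk k q p u = (Finset.univ.filter fun l => q < e l ∧ p ≤ F.d0 l).card := by
  have hX : ∀ j l, F.W.hat u j l ≠ 0 → F.W.wt l (w.symm (F.Ω.ω k)) = F.dω k j := by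
    intro j l hne
    have := F.W.hat_of_intertwine (hu (w.symm (F.Ω.ω k))) j l
    rw [w.apply_symm_apply, mul_comm, F.wt_ω] at this
    exact mul_right_cancel₀ hne this
  have hcol : ∀ l, ∃ j, F.W.hat u j l ≠ 0 := by
    intro l
    have h1 := congrFun (congrFun (F.W.hat_inv_mul u) l) l
    rw [Matrix.mul_apply, Matrix.one_apply_eq] at h1
    obtain ⟨j, -, hj⟩ := Finset.exists_ne_zero_of_sum_ne_zero (by rw [h1]; exact one_ne_zero)
    exact ⟨j, right_ne_zero_of_mul hj⟩
  choose σ hσ using hcol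
  refine ⟨fun l => F.dω k (σ l), fun l => hX _ _ (hσ l), fun q p => ?_⟩
  have h1 : proj (fun j => q < F.dω k j) * F.W.hat u =
      F.W.hat u * proj fun l => q < F.dω k (σ l) := by
    ext j l
    rw [proj_mul_apply, mul_proj_apply]
    by_cases h0 : F.W.hat u j l = 0
    · simp [h0]
    · have h2 := (hX j l h0).symm.trans (hX _ _ (hσ l))
      have h3 : F.dω k j = F.dω k (σ l) := by exact_mod_cast h2
      rw [h3]
  have hdet : IsUnit (F.W.hat u).det :=
    Matrix.isUnit_iff_isUnit_det _ |>.1 ((u.isUnit).map F.W.hat)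
  rw [rk, h1, mul_assoc, Matrix.rank_mul_eq_right_of_isUnit_det _ _ hdet, proj_mul]
  convert rank_proj _

/-- Invariance of the trace form, applied to the bracket of `h` with `e_i`. -/
theorem trace_coroot (i : b.support) (h : H) :
    Matrix.trace (ρ (h : L) * ρ (((rootSystem H).coroot i : H) : L)) =
      (rootSystem H).root i h * Matrix.trace (ρ (F.C.e i) * ρ (F.C.f i)) := by
  have h3 : ⁅(h : L), F.C.e i⁆ = (rootSystem H).root i h • F.C.e i :=
    lie_eq_smul_of_mem_rootSpace (F.e_mem i) h
  have h4 := map_lie_eq ρ (h : L) (F.C.e i)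
  rw [h3, map_smul] at h4
  have h5 := congrArg (fun M => Matrix.trace (M * ρ (F.C.f i))) h4
  simp only [smul_mul_assoc, Matrix.trace_smul, sub_mul, Matrix.trace_sub, smul_eq_mul] at h5
  rw [h5, ← (F.sl2 i).ef, mul_sub, Matrix.trace_sub, mul_assoc, mul_assoc,
    Matrix.trace_mul_comm (ρ (F.C.e i)), mul_assoc]

/-- Otherwise the square of the coroot would have trace zero, but this trace is a sum of squares of
integers that do not all vanish. -/
theorem trace_ef_ne_zero (i : b.support) :
    Matrix.trace (ρ (F.C.e i) * ρ (F.C.f i)) ≠ 0 := by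
  intro h0
  have h1 := F.trace_coroot i ((rootSystem H).coroot i)
  rw [h0, mul_zero] at h1
  have h2 : Matrix.trace (F.W.hat (ρ (((rootSystem H).coroot i : H) : L) *
      ρ (((rootSystem H).coroot i : H) : L))) = 0 := by
    rw [WeightBasis.hat_apply, Matrix.trace_mul_cycle, ← Units.val_mul, mul_inv_cancel,
      Units.val_one, one_mul, h1]
  rw [map_mul, F.W.hat_cartan, Matrix.diagonal_mul_diagonal, Matrix.trace_diagonal] at h2
  simp only [F.W.wt_coroot F.C] at h2
  have h3 : ∑ j, F.W.m F.C i j * F.W.m F.C i j = 0 := by exact_mod_cast h2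
  obtain ⟨j, hj⟩ := F.W.exists_m_ne_zero F.C F.hsc i
  rw [Finset.sum_eq_zero_iff_of_nonneg fun j _ => mul_self_nonneg _] at h3
  exact hj (mul_self_eq_zero.1 (h3 j (Finset.mem_univ j)))

/-- Multiplication by a lift of the `k`-th simple reflection changes the ranks. -/
theorem not_rk_eq {u s : GL (Fin n) ℂ} {w : H ≃ₗ[ℂ] H} (hu : Acts ρ u w) (hI : u ∈ chevalleyGroup H ρ)
    {k : b.support} (hs : Acts ρ s ((rootSystem H).coreflection k)) :
    ¬ ∀ q p, F.rk k q p (s * u) = F.rk k q p u := by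
  intro hrk
  obtain ⟨e, he, h1⟩ := F.rk_of_acts hu k
  obtain ⟨e', he', h2⟩ := F.rk_of_acts (hs.mul hu) k
  simp only [h1, h2] at hrk
  have hsum : ∑ l, e' l = ∑ l, e l := by
    have h3 := F.trace_acts hu.inv (F.Ω.ω k)
    have h4 := F.trace_acts (hs.mul hu).inv (F.Ω.ω k)
    rw [← h3] at h4
    have h5 : ∑ l, ((e' l : ℤ) : ℂ) = ∑ l, ((e l : ℤ) : ℂ) := by
      rw [← Finset.sum_congr rfl fun l _ => he l, ← Finset.sum_congr rfl fun l _ => he' l]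
      exact h4
    exact_mod_cast h5
  -- The ranks determine the sum of the products of the degrees for h0 with the weights on w⁻¹ ω_k.
  -- Replacing `u` by `s * u` changes these weights by multiples of those on w⁻¹ α̌_k, so h0 is
  -- orthogonal to w⁻¹ α̌_k for the trace form.
  have h3 := sum_mul_eq_of_card hsum hrk
  have hdiff : ∀ l, ((e l : ℤ) : ℂ) - e' l =
      F.Ω.D * F.W.wt l (w.symm ((rootSystem H).coroot k)) := by
    intro l
    have e1 : (((rootSystem H).coreflection k : H ≃ₗ[ℂ] H) * w).symm (F.Ω.ω k) =
        w.symm (((rootSystem H).coreflection k) (F.Ω.ω k)) := by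
      rw [LinearEquiv.symm_apply_eq, LinearEquiv.mul_apply, w.apply_symm_apply]
      exact ((rootSystem H).coreflection_same k (F.Ω.ω k)).symm
    have e2 : (rootSystem H).coreflection k (F.Ω.ω k) =
      F.Ω.ω k - (F.Ω.D : ℂ) • (rootSystem H).coroot k := by
      refine (RootPairing.coreflection_apply _ _ _).trans ?_
      have := F.Ω.root_ω k k
      rw [if_pos rfl] at this
      congr 2
    rw [← he, ← he', e1, e2, map_sub, map_sub, map_smul, map_smul, smul_eq_mul]
    ring
  have h4 : ∑ l, F.W.wt l F.Ω.h0 * F.W.wt l (w.symm ((rootSystem H).coroot k)) = 0 := by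
    have h5 : ∑ l, ((F.d0 l : ℤ) : ℂ) * ((e l : ℤ) - (e' l : ℤ)) = 0 := by
      simp only [mul_sub, Finset.sum_sub_distrib]
      rw [sub_eq_zero]
      exact_mod_cast h3.symm
    simp only [hdiff, ← F.wt_h0] at h5
    have h6 : (F.Ω.D : ℂ) * ∑ l, F.W.wt l F.Ω.h0 * F.W.wt l (w.symm ((rootSystem H).coroot k)) = 0 := by
      rw [Finset.mul_sum, ← h5]
      exact Finset.sum_congr rfl fun l _ => by ring
    exact (mul_eq_zero.1 h6).resolve_left (by exact_mod_cast F.Ω.D_pos.ne')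
  have h5 : Matrix.trace (ρ ((w F.Ω.h0 : H) : L) * ρ (((rootSystem H).coroot k : H) : L)) = 0 := by
    have e1 : ρ ((w F.Ω.h0 : H) : L) * ρ (((rootSystem H).coroot k : H) : L) * (u : Mat n) =
        u * (ρ ((F.Ω.h0 : H) : L) * ρ ((w.symm ((rootSystem H).coroot k) : H) : L)) := by
      have := hu (w.symm ((rootSystem H).coroot k))
      rw [w.apply_symm_apply] at this
      rw [mul_assoc, ← this, ← mul_assoc, ← hu, mul_assoc]
    have e2 : ρ ((w F.Ω.h0 : H) : L) * ρ (((rootSystem H).coroot k : H) : L) =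
        u * (ρ ((F.Ω.h0 : H) : L) * ρ ((w.symm ((rootSystem H).coroot k) : H) : L)) *
          ((u⁻¹ : GL (Fin n) ℂ) : Mat n) := by
      rw [← e1, mul_assoc, ← Units.val_mul, mul_inv_cancel, Units.val_one, mul_one]
    rw [e2, Matrix.trace_mul_cycle, ← Units.val_mul, inv_mul_cancel, Units.val_one, one_mul]
    have e3 : Matrix.trace (F.W.hat (ρ ((F.Ω.h0 : H) : L) *
        ρ ((w.symm ((rootSystem H).coroot k) : H) : L))) = 0 := by
      rw [map_mul, F.W.hat_cartan, F.W.hat_cartan, Matrix.diagonal_mul_diagonal,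
        Matrix.trace_diagonal, h4]
    rwa [WeightBasis.hat_apply, Matrix.trace_mul_cycle, ← Units.val_mul, mul_inv_cancel,
      Units.val_one, one_mul] at e3
  rw [F.trace_coroot] at h5
  -- Hence α_k vanishes on w h0, so the root w⁻¹ α_k vanishes on h0; but no root has height zero.
  have h6 := (mul_eq_zero.1 h5).resolve_right (F.trace_ef_ne_zero k)
  obtain ⟨β, h7, -⟩ := hu.inv.exists_root F.inj (intertwines (inv_mem hI)) k
  have h8 := h7 (w F.Ω.h0)
  rw [h6, show w⁻¹ (w F.Ω.h0) = F.Ω.h0 from w.symm_apply_apply _, F.Ω.root_h0] at h8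
  have h9 : F.Ω.D * b.height β = 0 := by exact_mod_cast h8
  exact mul_ne_zero F.Ω.D_pos.ne' (b.height_ne_zero β) h9

end Frame

end HOper

end

/-! ### Factorization in the Coxeter cell. -/

noncomputable section

set_option linter.unusedSectionVars false

namespace HOper

open LieAlgebra LieAlgebra.IsKilling
open scoped Classical

variable {n : ℕ} {L : Type*} [LieRing L] [LieAlgebra ℂ L] [FiniteDimensional ℂ L]
  [LieAlgebra.IsSimple ℂ L] {H : LieSubalgebra ℂ L} [H.IsCartanSubalgebra]
  {b : (rootSystem H).Base} {ρ : L →ₗ⁅ℂ⁆ Mat n}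

namespace Frame

variable (F : Frame b ρ)

/-- The difference of two lifts of a simple reflection. -/
def lift (s : b.support → GL (Fin n) ℂ) (i : b.support) : GL (Fin n) ℂ := (F.s i)⁻¹ * s i

variable {s : b.support → GL (Fin n) ℂ} (hs : ∀ i, IsReflectionLift ρ b i (s i))

theorem refl_acts (hs : ∀ i, IsReflectionLift ρ b i (s i)) (i : b.support) :
    Acts ρ (s i) ((rootSystem H).coreflection i) := (hs i).2

include hs

theorem lift_mem (i : b.support) : F.lift s i ∈ torus ρ F.C := by
  refine F.mem_torus_of_acts_one (mul_mem (inv_mem (F.s_mem i)) (hs i).1) ?_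
  have := (F.s_acts i).inv.mul (refl_acts hs i)
  rwa [inv_mul_cancel] at this

theorem s_mul_lift (i : b.support) : F.s i * F.lift s i = s i := by
  rw [lift, mul_inv_cancel_left]

omit hs

/-- The product of `φ_i^{α̌_i} s_i` over a list. -/
def coxProd (s : b.support → GL (Fin n) ℂ) (c : b.support → ℂ) (l : List b.support) :
    GL (Fin n) ℂ := (l.map fun i => F.cp i (c i) * s i).prod

/-- The product of `g_i^{α̌_i} exp((φ_i / g_i) e_i) τ_i` over a list. -/
def upProd (τ : b.support → GL (Fin n) ℂ) (c g : b.support → ℂ) (l : List b.support) :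
    GL (Fin n) ℂ := (l.map fun i => F.cp i (g i) * F.x i (c i / g i) * τ i).prod

theorem coxProd_append (s : b.support → GL (Fin n) ℂ) (c : b.support → ℂ) (l l' : List b.support) :
    F.coxProd s c (l ++ l') = F.coxProd s c l * F.coxProd s c l' := by
  simp [coxProd]

theorem upProd_append (τ : b.support → GL (Fin n) ℂ) (c g : b.support → ℂ)
    (l l' : List b.support) : F.upProd τ c g (l ++ l') = F.upProd τ c g l * F.upProd τ c g l' := by
  simp [upProd]

theorem upProd_update (τ : b.support → GL (Fin n) ℂ) (c g : b.support → ℂ) {l : List b.support}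
    {k : b.support} (hk : k ∉ l) (a : ℂ) :
    F.upProd τ c (Function.update g k a) l = F.upProd τ c g l := by
  have h : (l.map fun i => F.cp i (Function.update g k a i) *
      F.x i (c i / Function.update g k a i) * τ i) =
      l.map fun i => F.cp i (g i) * F.x i (c i / g i) * τ i := by
    refine List.map_congr_left fun i hi => ?_
    have : i ≠ k := fun h => hk (h ▸ hi)
    rw [Function.update_of_ne this]
  exact congrArg List.prod h

theorem coxProd_mem_lowerAt (hs : ∀ i, IsReflectionLift ρ b i (s i)) {c : b.support → ℂ}
    (hc : ∀ i, c i ≠ 0) {l : List b.support}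
    {k : b.support} (hk : k ∉ l) : F.coxProd s c l ∈ F.lowerAt k := by
  refine Subgroup.list_prod_mem _ fun g hg => ?_
  obtain ⟨i, hi, rfl⟩ := List.mem_map.1 hg
  have : i ≠ k := fun h => hk (h ▸ hi)
  exact mul_mem (F.torus_le_lowerAt k (F.cp_mem_torus i (hc i)))
    (F.refl_mem_lowerAt this (refl_acts hs i))

/-- If the ranks of a product of an element of the Coxeter cell and a Weyl group element are those
of the Weyl group element, the negative part of the product can be moved to the left. -/
theorem exists_upProd (hs : ∀ i, IsReflectionLift ρ b i (s i)) {c : b.support → ℂ}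
    (hc : ∀ i, c i ≠ 0) {u : GL (Fin n) ℂ} {w : H ≃ₗ[ℂ] H} (hu : F.IsWeyl u)
    (hw : Acts ρ u w) (l : List b.support) (hl : l.Nodup) {m : GL (Fin n) ℂ} (hm : m ∈ Nminus ρ b)
    (hrk : ∀ k ∈ l, ∀ q p, F.rk k q p (F.coxProd s c l * m * u) = F.rk k q p u) :
    (∀ k ∈ l, PosAt b w⁻¹ k) ∧ ∃ m' ∈ Nminus ρ b, ∃ g : b.support → ℂ, (∀ i, g i ≠ 0) ∧
      F.coxProd s c l * m = m' * F.upProd (F.lift s) c g l := by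
  -- The last factor is the one that meets `m`; what it leaves in N₋ becomes the `m` of the shorter
  -- product.
  induction l using List.reverseRecOn generalizing m with
  | nil => exact ⟨by simp, m, hm, fun _ => 1, by simp, by simp [coxProd, upProd]⟩
  | append_singleton l k ih =>
    have hkl : k ∉ l := by
      intro h
      have := List.nodup_append.1 hl
      exact this.2.2 k h k (by simp) rfl
    have hln : l.Nodup := (List.nodup_append.1 hl).1
    have hsa := refl_acts hs k
    have hsG := (hs k).1
    have huG := IsWeyl.mem F hu
    obtain ⟨ν, hν, a, rfl⟩ := F.Nminus_levi k hm
    have hcoh : F.cp k (c k) ∈ torus ρ F.C := F.cp_mem_torus k (hc k)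
    have hcs : F.cp k (c k) * s k ∈ chevalleyGroup H ρ := mul_mem (F.torus_le hcoh) hsG
    have hcsa : Acts ρ (F.cp k (c k) * s k) ((rootSystem H).coreflection k) := by
      simpa using (F.torus_acts hcoh).mul hsa
    set ν' := (F.cp k (c k) * s k) * ν * (F.cp k (c k) * s k)⁻¹ with hν'
    have hν'R : ν' ∈ negSubgroup ρ (F.Ω.h' k) :=
      F.conj_Rminus hcs (refl_comm hcsa (F.root_h'_self k)) hν
    have hν'N : ν' ∈ Nminus ρ b := F.Rminus_le k hν'R
    have e1 : F.coxProd s c (l ++ [k]) * (ν * F.y k a) =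
        F.coxProd s c l * ν' * (F.cp k (c k) * s k * F.y k a) := by
      rw [coxProd_append, hν']
      simp only [coxProd, List.map_cons, List.map_nil, List.prod_cons, List.prod_nil, mul_one]
      group
    have hrkk := hrk k (by simp)
    -- the ranks are unchanged by the factors in front
    have hpre : ∀ q p (x : GL (Fin n) ℂ), F.rk k q p (F.coxProd s c l * ν' * (F.cp k (c k) * x)) =
        F.rk k q p x := by
      intro q p x
      rw [← mul_assoc]
      exact F.rk_lowerAt_mul (mul_mem (mul_mem (F.coxProd_mem_lowerAt hs hc hkl)
        (F.Nminus_le_lowerAt k hν'N)) (F.torus_le_lowerAt k hcoh)) q p x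
    have hinvI := intertwines (inv_mem huG)
    -- If `y k a` could be moved through `u` into N₊, the ranks at `k` would be those of `s k * u`
    -- and, by assumption, also those of `u`. This rules out both `a = 0` and a negative w⁻¹ α_k.
    have hbad : ∀ m₁ ∈ Nplus ρ b, F.y k a * u = u * m₁ → False := by
      intro m₁ hm₁ e
      refine F.not_rk_eq hw huG hsa fun q p => ?_
      have := hrkk q p
      rw [e1, mul_assoc, show F.cp k (c k) * s k * F.y k a * u =
        F.cp k (c k) * (s k * u * m₁) by rw [mul_assoc, mul_assoc, e, mul_assoc], hpre,
        F.rk_mul_upper (F.Nplus_le_upper hm₁)] at this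
      exact this
    have hpos : PosAt b w⁻¹ k := by
      refine (F.posAt_or_negAt hw.inv hinvI k).resolve_right fun hn => ?_
      refine hbad _ (F.conj_y_of_negAt hw.inv hinvI a hn) ?_
      rw [inv_inv]; group
    have ha : a ≠ 0 := by
      rintro rfl
      exact hbad 1 (one_mem _) (by rw [y_zero, one_mul, mul_one])
    have hτ := F.lift_mem hs k
    obtain ⟨d, hd, -, hdf⟩ := F.scale_of_acts (F.torus_acts hτ)
      (intertwines (F.torus_le hτ)) (i := k) (j := k) (fun _ => rfl)
    -- The parameter of `y k` after it has passed the torus element by which `s k` differs from the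
    -- standard lift.
    set a' := d⁻¹ * a with ha'
    have ha'0 : a' ≠ 0 := mul_ne_zero (inv_ne_zero hd) ha
    have e2 : s k * F.y k a = F.y k (-a'⁻¹) * F.cp k a' * F.x k a'⁻¹ * F.lift s k := by
      rw [← F.s_mul_lift hs k, mul_assoc, F.conj_y hdf a, ← mul_assoc, ← ha', F.s_mul_y_eq k ha'0]
    obtain ⟨y', hy', e3⟩ : ∃ y' ∈ Nminus ρ b, F.cp k (c k) * F.y k (-a'⁻¹) = y' * F.cp k (c k) :=
      ⟨_, F.torus_conj_Nminus (F.torus_acts hcoh) (F.torus_le hcoh) (F.y_mem_Nminus k (-a'⁻¹)),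
        by group⟩
    have hg0 : c k * a' ≠ 0 := mul_ne_zero (hc k) ha'0
    have e4 : F.cp k (c k) * s k * F.y k a =
        y' * (F.cp k (c k * a') * F.x k a'⁻¹ * F.lift s k) := by
      rw [mul_assoc, e2, ← F.cp_mul k (hc k) ha'0]
      simp only [← mul_assoc]
      rw [e3]
    have hm2 : ν' * y' ∈ Nminus ρ b := mul_mem hν'N hy'
    -- As w⁻¹ α_k is positive, the factor that stays behind is conjugated by `u` into upper
    -- triangular matrices; it does not affect the ranks for the remaining letters.
    have hτw : ∃ v ∈ F.upper, F.cp k (c k * a') * F.x k a'⁻¹ * F.lift s k * u = u * v := by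
      refine ⟨u⁻¹ * (F.cp k (c k * a') * F.x k a'⁻¹ * F.lift s k) * u⁻¹⁻¹, ?_, by group⟩
      have ht : ∀ t ∈ torus ρ F.C, u⁻¹ * t * u⁻¹⁻¹ ∈ F.upper := by
        intro t ht
        refine F.torus_le_upper (F.mem_torus_of_acts_one (mul_mem (mul_mem (inv_mem huG)
          (F.torus_le ht)) (inv_mem (inv_mem huG))) ?_)
        have := (hw.inv.mul (F.torus_acts ht)).mul hw.inv.inv
        rwa [mul_one, mul_inv_cancel] at this
      have hx := F.Nplus_le_upper (F.conj_x_of_posAt hw.inv hinvI (a'⁻¹) hpos)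
      have := mul_mem (mul_mem (ht _ (F.cp_mem_torus k hg0)) hx) (ht _ hτ)
      convert this using 1
      group
    obtain ⟨v, hv, e5⟩ := hτw
    have hrk' : ∀ j ∈ l, ∀ q p, F.rk j q p (F.coxProd s c l * (ν' * y') * u) = F.rk j q p u := by
      intro j hj q p
      rw [← hrk j (by simp [hj]) q p, e1, e4]
      have e6 : F.coxProd s c l * ν' * (y' * (F.cp k (c k * a') * F.x k a'⁻¹ * F.lift s k)) * u =
          F.coxProd s c l * (ν' * y') * u * v := by
        rw [mul_assoc _ u v, ← e5]
        simp only [mul_assoc]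
      rw [e6, F.rk_mul_upper hv]
    obtain ⟨h1, m', hm', g, hg, e7⟩ := ih hln hm2 hrk'
    refine ⟨?_, m', hm', Function.update g k (c k * a'), ?_, ?_⟩
    · intro j hj
      rcases List.mem_append.1 hj with hj | hj
      · exact h1 j hj
      · rw [List.mem_singleton.1 hj]; exact hpos
    · intro i
      by_cases hik : i = k
      · subst hik; simpa using hg0
      · rw [Function.update_of_ne hik]; exact hg i
    · have e8 : c k / (c k * a') = a'⁻¹ := by
        field_simp
        exact div_self (hc k)
      rw [e1, e4, upProd_append, upProd_update _ _ _ _ hkl]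
      simp only [upProd, List.map_cons, List.map_nil, List.prod_cons, List.prod_nil, mul_one,
        Function.update_self]
      rw [e8, ← mul_assoc, mul_assoc _ ν' y', e7]
      simp only [upProd, mul_assoc]

theorem mem_Bminus {g : GL (Fin n) ℂ} :
    g ∈ Bminus ρ F.C ↔ ∃ t ∈ torus ρ F.C, ∃ m ∈ Nminus ρ b, g = t * m := by
  have hle : torus ρ F.C ≤ Subgroup.normalizer (Nminus ρ b : Set (GL (Fin n) ℂ)) := by
    intro t ht
    rw [Subgroup.mem_normalizer_iff]
    refine fun h => ⟨fun hh => F.torus_conj_Nminus (F.torus_acts ht) (F.torus_le ht) hh,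
      fun hh => ?_⟩
    have := F.torus_conj_Nminus (F.torus_acts (inv_mem ht)) (F.torus_le (inv_mem ht)) hh
    convert this using 1
    group
  rw [Bminus, ← SetLike.mem_coe, Subgroup.coe_mul_of_left_le_normalizer_right _ _ hle, Set.mem_mul]
  constructor
  · rintro ⟨t, ht, m, hm, rfl⟩; exact ⟨t, ht, m, hm, rfl⟩
  · rintro ⟨t, ht, m, hm, rfl⟩; exact ⟨t, ht, m, hm, rfl⟩

theorem Nminus_le_Bminus : Nminus ρ b ≤ Bminus ρ F.C := le_sup_right

theorem eq_one_of_Nminus_of_upper {g : GL (Fin n) ℂ} (h1 : g ∈ Nminus ρ b) (h2 : g ∈ F.upper) :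
    g = 1 := by
  refine Units.ext (F.W.hat_injective ?_)
  rw [Units.val_one, map_one]
  have h3 := F.hat_Nminus h1
  ext i j
  by_cases h : F.d0 j - F.d0 i < 1
  · have := h3 i j h
    rwa [Matrix.sub_apply, sub_eq_zero] at this
  · rw [h2.1 i j (by simp only; omega), Matrix.one_apply_ne]
    rintro rfl
    simp at h

/-- Relative position is generic if it is preserved by an element of the Coxeter cell. -/
theorem exists_factor (hs : ∀ i, IsReflectionLift ρ b i (s i)) {c : b.support → ℂ}
    (hc : ∀ i, c i ≠ 0) {l : List b.support} (hl : l.Nodup) (hall : ∀ i, i ∈ l)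
    {m₁ m₂ g g' β : GL (Fin n) ℂ} (hm₁ : m₁ ∈ Nminus ρ b) (hm₂ : m₂ ∈ Nminus ρ b)
    (hg : g ∈ chevalleyGroup H ρ) (hβ : β ∈ Bplus ρ F.C)
    (e : m₁ * F.coxProd s c l * m₂ * g = g' * β)
    (hrk : ∀ k q p, F.rk k q p g' = F.rk k q p g) :
    ∃ m ∈ Nminus ρ b, ∃ β' ∈ Bplus ρ F.C, g = m * β' := by
  obtain ⟨m, hm, u, hu, m', hm', rfl⟩ := F.bruhat hg
  obtain ⟨w, hw⟩ := IsWeyl.acts F hu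
  -- The ranks do not see the unipotent factors of the Bruhat decomposition, nor `m₁` and `β`, so
  -- the comparison of `g'` with `g` becomes one with the Weyl group element `u`.
  have hrk2 : ∀ k ∈ l, ∀ q p, F.rk k q p (F.coxProd s c l * (m₂ * m) * u) = F.rk k q p u := by
    intro k _ q p
    have h1 := hrk k q p
    rw [← F.rk_mul_upper (F.Bplus_le_upper hβ) k q p g', ← e,
      F.rk_mul_upper (F.Nplus_le_upper hm'), F.rk_lowerAt_mul (F.Nminus_le_lowerAt k hm)] at h1
    have e2 : m₁ * F.coxProd s c l * m₂ * (m * u * m') =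
        m₁ * (F.coxProd s c l * (m₂ * m) * u * m') := by group
    rw [e2, F.rk_lowerAt_mul (F.Nminus_le_lowerAt k hm₁),
      F.rk_mul_upper (F.Nplus_le_upper hm')] at h1
    exact h1
  obtain ⟨hpos, -⟩ := F.exists_upProd hs hc hu hw l hl (mul_mem hm₂ hm) hrk2
  have hut : u ∈ torus ρ F.C := by
    have := IsWeyl.mem_torus F (IsWeyl.inv F hu) hw.inv fun i => hpos i (hall i)
    simpa using inv_mem this
  exact ⟨m, hm, u * m', mul_mem (le_sup_left (a := torus ρ F.C) hut)
    (le_sup_right (b := Nplus ρ b) hm'), by rw [mul_assoc]⟩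

theorem upProd_mem_Bplus (hs : ∀ i, IsReflectionLift ρ b i (s i)) {c g : b.support → ℂ}
    (hg : ∀ i, g i ≠ 0) (l : List b.support) : F.upProd (F.lift s) c g l ∈ Bplus ρ F.C := by
  refine Subgroup.list_prod_mem _ fun x hx => ?_
  obtain ⟨i, -, rfl⟩ := List.mem_map.1 hx
  exact mul_mem (mul_mem (le_sup_left (a := torus ρ F.C) (F.cp_mem_torus i (hg i)))
    (le_sup_right (b := Nplus ρ b) (F.x_mem_Nplus i _))) (le_sup_left (a := torus ρ F.C)
      (F.lift_mem hs i))

/-- The elements of the Coxeter cell that are upper triangular. -/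
theorem eq_upProd (hs : ∀ i, IsReflectionLift ρ b i (s i)) {c : b.support → ℂ}
    (hc : ∀ i, c i ≠ 0) {l : List b.support} (hl : l.Nodup)
    {m₁ m₂ β : GL (Fin n) ℂ} (hm₁ : m₁ ∈ Nminus ρ b) (hm₂ : m₂ ∈ Nminus ρ b)
    (hβ : β ∈ F.upper) (e : m₁ * F.coxProd s c l * m₂ = β) :
    ∃ g : b.support → ℂ, (∀ i, g i ≠ 0) ∧ β = F.upProd (F.lift s) c g l := by
  have hrk : ∀ k ∈ l, ∀ q p, F.rk k q p (F.coxProd s c l * m₂ * 1) = F.rk k q p 1 := by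
    intro k _ q p
    have h1 : F.rk k q p β = F.rk k q p 1 := by
      rw [← one_mul β, F.rk_mul_upper hβ]
    rw [← e, mul_assoc, F.rk_lowerAt_mul (F.Nminus_le_lowerAt k hm₁)] at h1
    rw [mul_one, h1]
  obtain ⟨-, m', hm', g, hg, e2⟩ := F.exists_upProd hs hc F.isWeyl_one Acts.one l hl hm₂ hrk
  refine ⟨g, hg, ?_⟩
  have hU := F.Bplus_le_upper (F.upProd_mem_Bplus hs (c := c) hg l)
  have e3 : β = m₁ * m' * F.upProd (F.lift s) c g l := by
    rw [← e, mul_assoc, e2, mul_assoc]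
  -- This lower unipotent element is a quotient of two upper triangular ones.
  have e4 : m₁ * m' = 1 := by
    refine F.eq_one_of_Nminus_of_upper (mul_mem hm₁ hm') ?_
    have : m₁ * m' = β * (F.upProd (F.lift s) c g l)⁻¹ := by rw [e3, mul_inv_cancel_right]
    rw [this]
    exact mul_mem hβ (inv_mem hU)
  rw [e3, e4, one_mul]

end Frame

end HOper

end

/-! ### Torus coordinates, normal forms, and the constants attached to the lifts. -/

noncomputable section

set_option linter.unusedSectionVars false

namespace HOper

open LieAlgebra LieAlgebra.IsKilling
open scoped Classical

theorem prod_zpow_exponent {G ι : Type*} [CommGroup G] (c : G) (s : Finset ι) (f : ι → ℤ) :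
    ∏ x ∈ s, c ^ f x = c ^ ∑ x ∈ s, f x := by
  induction s using Finset.induction_on with
  | empty => simp
  | insert a s ha ih => rw [Finset.prod_insert ha, Finset.sum_insert ha, zpow_add, ih]

/-- The matrix is triangular with diagonal part `δ`. -/
def HasDiag {n : ℕ} (a : Fin n → ℤ) (M : Mat n) (δ : Fin n → ℂ) : Prop :=
  M - Matrix.diagonal δ ∈ Fil a 1

theorem HasDiag.apply {n : ℕ} {a : Fin n → ℤ} {M : Mat n} {δ : Fin n → ℂ} (h : HasDiag a M δ)
    (j : Fin n) : M j j = δ j := by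
  have := h j j (by simp)
  rwa [Matrix.sub_apply, Matrix.diagonal_apply_eq, sub_eq_zero] at this

theorem diagonal_mem_Fil {n : ℕ} (a : Fin n → ℤ) (δ : Fin n → ℂ) :
    Matrix.diagonal δ ∈ Fil a 0 := by
  intro i j h
  rw [Matrix.diagonal_apply_ne]
  rintro rfl
  simp at h

theorem hasDiag_diagonal {n : ℕ} (a : Fin n → ℤ) (δ : Fin n → ℂ) :
    HasDiag a (Matrix.diagonal δ) δ := by
  rw [HasDiag, sub_self]; exact Submodule.zero_mem _

theorem hasDiag_of_sub_one {n : ℕ} {a : Fin n → ℤ} {M : Mat n} (h : M - 1 ∈ Fil a 1) :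
    HasDiag a M fun _ => 1 := by
  rwa [HasDiag, Matrix.diagonal_one]

theorem HasDiag.mul {n : ℕ} {a : Fin n → ℤ} {M N : Mat n} {δ ε : Fin n → ℂ}
    (h1 : HasDiag a M δ) (h2 : HasDiag a N ε) : HasDiag a (M * N) fun j => δ j * ε j := by
  have hN : N ∈ Fil a 0 := by
    have := (Fil a 0).add_mem (Fil_mono (by norm_num) h2) (diagonal_mem_Fil a ε)
    simpa using this
  have e : M * N - Matrix.diagonal (fun j => δ j * ε j) =
      (M - Matrix.diagonal δ) * N + Matrix.diagonal δ * (N - Matrix.diagonal ε) := by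
    rw [← Matrix.diagonal_mul_diagonal]; noncomm_ring
  rw [HasDiag, e]
  refine Submodule.add_mem _ ?_ ?_
  · simpa using mul_mem_Fil h1 hN
  · simpa using mul_mem_Fil (diagonal_mem_Fil a δ) h2

variable {n : ℕ} {L : Type*} [LieRing L] [LieAlgebra ℂ L] [FiniteDimensional ℂ L]
  [LieAlgebra.IsSimple ℂ L] {H : LieSubalgebra ℂ L} [H.IsCartanSubalgebra]
  {b : (rootSystem H).Base} {ρ : L →ₗ⁅ℂ⁆ Mat n}

namespace Frame

variable (F : Frame b ρ)

/-- Integers expressing the fundamental weights by the weights of the representation. -/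
def fund (i : b.support) : Fin n → ℤ := (F.W.exists_fundamental F.C F.hsc i).choose

theorem sum_fund (i i' : b.support) :
    ∑ j, F.fund i j * F.W.m F.C i' j = if i' = i then 1 else 0 :=
  (F.W.exists_fundamental F.C F.hsc i).choose_spec i'

theorem prod_fund {G : Type*} [CommGroup G] (c : b.support → G) (i : b.support) :
    ∏ j, (∏ i', c i' ^ F.W.m F.C i' j) ^ F.fund i j = c i := by
  have h1 : ∀ j, (∏ i', c i' ^ F.W.m F.C i' j) ^ F.fund i j =
      ∏ i', c i' ^ (F.fund i j * F.W.m F.C i' j) := by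
    intro j
    rw [← Finset.prod_zpow]
    exact Finset.prod_congr rfl fun i' _ => by rw [← zpow_mul, mul_comm]
  rw [Finset.prod_congr rfl fun j _ => h1 j, Finset.prod_comm,
    Finset.prod_congr rfl fun i' _ => prod_zpow_exponent (c i') _ _]
  simp only [sum_fund]
  rw [Finset.prod_eq_single i]
  · simp
  · intro k _ hk; rw [if_neg hk, zpow_zero]
  · simp

theorem tor_coord (c : b.support → ℂˣ) (i : b.support) :
    (c i : ℂ) = ∏ j, (F.W.hat (F.tor c) j j) ^ F.fund i j := by
  conv_lhs => rw [← F.prod_fund c i]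
  rw [hat_tor, Units.coe_prod]
  refine Finset.prod_congr rfl fun j _ => ?_
  rw [Units.val_zpow_eq_zpow_val, Units.coe_prod, Matrix.diagonal_apply_eq]
  congr 1
  exact Finset.prod_congr rfl fun i' _ => by rw [Units.val_zpow_eq_zpow_val]

theorem hat_torus {t : GL (Fin n) ℂ} (ht : t ∈ torus ρ F.C) :
    F.W.hat t = Matrix.diagonal fun j => F.W.hat t j j := by
  obtain ⟨c, rfl⟩ := F.mem_torus.1 ht
  rw [hat_tor]
  congr 1; ext j
  rw [Matrix.diagonal_apply_eq]

theorem hasDiag_torus {t : GL (Fin n) ℂ} (ht : t ∈ torus ρ F.C) (a : Fin n → ℤ) :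
    HasDiag a (F.W.hat t) fun j => F.W.hat t j j := by
  nth_rewrite 1 [F.hat_torus ht]
  exact hasDiag_diagonal _ _

theorem hat_torus_ne_zero {t : GL (Fin n) ℂ} (ht : t ∈ torus ρ F.C) (j : Fin n) :
    F.W.hat t j j ≠ 0 := by
  obtain ⟨c, rfl⟩ := F.mem_torus.1 ht
  rw [hat_tor, Matrix.diagonal_apply_eq]
  exact Finset.prod_ne_zero_iff.2 fun i _ => zpow_ne_zero _ (c i).ne_zero

theorem hasDiag_Bminus {t m : GL (Fin n) ℂ} (ht : t ∈ torus ρ F.C) (hm : m ∈ Nminus ρ b) :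
    HasDiag F.d0 (F.W.hat ((t * m : GL (Fin n) ℂ) : Mat n)) fun j => F.W.hat t j j := by
  rw [Units.val_mul, map_mul]
  simpa using (F.hasDiag_torus ht F.d0).mul (hasDiag_of_sub_one (F.hat_Nminus hm))

variable {s : b.support → GL (Fin n) ℂ}

theorem hasDiag_upProd (hs : ∀ i, IsReflectionLift ρ b i (s i)) {c g : b.support → ℂ}
    (hg : ∀ i, g i ≠ 0) (l : List b.support) :
    HasDiag (fun j => -F.d0 j) (F.W.hat (F.upProd (F.lift s) c g l))
      fun j => (l.map fun i => g i ^ F.W.m F.C i j * F.W.hat (F.lift s i) j j).prod := by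
  induction l with
  | nil =>
    simp only [upProd, List.map_nil, List.prod_nil, Units.val_one, map_one]
    exact hasDiag_of_sub_one (by simp)
  | cons i l ih =>
    have e : F.upProd (F.lift s) c g (i :: l) =
        F.cp i (g i) * F.x i (c i / g i) * F.lift s i * F.upProd (F.lift s) c g l := by
      simp [upProd]
    have h1 : HasDiag (fun j => -F.d0 j) (F.W.hat (F.cp i (g i)))
        fun j => g i ^ F.W.m F.C i j := by
      rw [coe_cp, F.W.hat_corootMat F.C i (hg i)]
      exact hasDiag_diagonal _ _
    have h2 := hasDiag_of_sub_one (F.hat_Nplus (F.x_mem_Nplus i (c i / g i)))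
    have h3 := F.hasDiag_torus (F.lift_mem hs i) fun j => -F.d0 j
    have h4 := ((h1.mul h2).mul h3).mul ih
    simp only [← map_mul, ← Units.val_mul, mul_one] at h4
    rw [← e] at h4
    simpa only [List.map_cons, List.prod_cons] using h4

theorem toFinset_eq_univ {l : List b.support} (hall : ∀ i, i ∈ l) : l.toFinset = Finset.univ := by
  ext i; simp [hall i]

/-- The coordinates of an upper triangular element of the Coxeter cell are monomials in its
diagonal entries. -/
theorem upProd_coord (hs : ∀ i, IsReflectionLift ρ b i (s i)) {l : List b.support}
    (hl : l.Nodup) (hall : ∀ i, i ∈ l) :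
    ∃ κ : b.support → ℂ, (∀ i, κ i ≠ 0) ∧ ∀ c g : b.support → ℂ, (∀ i, g i ≠ 0) → ∀ i,
      g i = κ i * ∏ j, (F.W.hat (F.upProd (F.lift s) c g l) j j) ^ F.fund i j := by
  -- The lifts contribute a fixed factor to the diagonal entries; its monomials account for the
  -- constants.
  let τ : Fin n → ℂ := fun j => ∏ i, F.W.hat (F.lift s i) j j
  have hτ : ∀ j, τ j ≠ 0 := fun j =>
    Finset.prod_ne_zero_iff.2 fun i _ => F.hat_torus_ne_zero (F.lift_mem hs i) j
  have hτ' : ∀ i, ∏ j, τ j ^ F.fund i j ≠ 0 := fun i =>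
    Finset.prod_ne_zero_iff.2 fun j _ => zpow_ne_zero _ (hτ j)
  refine ⟨fun i => (∏ j, τ j ^ F.fund i j)⁻¹, fun i => inv_ne_zero (hτ' i), fun c g hg i => ?_⟩
  have h1 : ∀ j, F.W.hat (F.upProd (F.lift s) c g l) j j =
      (∏ i, g i ^ F.W.m F.C i j) * τ j := by
    intro j
    rw [(F.hasDiag_upProd hs hg l).apply j, ← List.prod_toFinset _ hl, toFinset_eq_univ hall,
      Finset.prod_mul_distrib]
  simp only [h1, mul_zpow]
  rw [Finset.prod_mul_distrib]
  have h2 := F.prod_fund (fun i => Units.mk0 (g i) (hg i)) i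
  have h3 := congrArg (Units.val) h2
  simp only [Units.coe_prod, Units.val_zpow_eq_zpow_val, Units.val_mk0] at h3
  rw [h3, mul_comm, mul_assoc, mul_inv_cancel₀ (hτ' i), mul_one]

/-- The product `∏ g_i^{α̌_i} exp(y_i e_i)` over a list. -/
def miuraProd (g y : b.support → ℂ) (l : List b.support) : GL (Fin n) ℂ :=
  (l.map fun i => F.cp i (g i) * F.x i (y i)).prod

theorem cp_mul_x (i : b.support) {c : ℂ} (hc : c ≠ 0) (a : ℂ) :
    F.cp i c * F.x i a = F.x i (c ^ 2 * a) * F.cp i c := F.conj_x (F.cp_e i hc) a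

/-- Torus elements can be moved to the right. -/
theorem exists_move {τ : b.support → GL (Fin n) ℂ} (hτ : ∀ i, τ i ∈ torus ρ F.C)
    (l : List b.support) (hl : l.Nodup) :
    ∃ a : b.support → ℂ, (∀ i, a i ≠ 0) ∧ ∀ g y : b.support → ℂ, (∀ i, g i ≠ 0) →
      (l.map fun i => F.cp i (g i) * F.x i (y i) * τ i).prod =
        F.miuraProd g (fun i => a i * y i) l * (l.map τ).prod := by
  induction l using List.reverseRecOn with
  | nil => exact ⟨fun _ => 1, by simp, by simp [miuraProd]⟩
  | append_singleton l k ih =>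
    have hkl : k ∉ l := by
      intro h
      exact (List.nodup_append.1 hl).2.2 k h k (by simp) rfl
    obtain ⟨a, ha, h⟩ := ih (List.nodup_append.1 hl).1
    have hQ : (l.map τ).prod ∈ torus ρ F.C := Subgroup.list_prod_mem _ fun g hg => by
      obtain ⟨i, -, rfl⟩ := List.mem_map.1 hg
      exact hτ i
    -- The torus elements collected so far scale the next root vector by `d`, which depends on
    -- neither `g` nor `y`.
    obtain ⟨d, hd, hde, -⟩ := F.scale_of_acts (F.torus_acts hQ)
      (intertwines (F.torus_le hQ)) (i := k) (j := k) (fun _ => rfl)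
    refine ⟨Function.update a k d, ?_, fun g y hg => ?_⟩
    · intro i
      by_cases hik : i = k
      · subst hik; simpa using hd
      · rw [Function.update_of_ne hik]; exact ha i
    · have e1 : F.miuraProd g (fun i => Function.update a k d i * y i) l =
          F.miuraProd g (fun i => a i * y i) l := by
        have h1 : (l.map fun i => F.cp i (g i) * F.x i (Function.update a k d i * y i)) =
            l.map fun i => F.cp i (g i) * F.x i (a i * y i) := by
          refine List.map_congr_left fun i hi => ?_
          have hik : i ≠ k := fun h => hkl (h ▸ hi)
          rw [Function.update_of_ne hik]
        exact congrArg List.prod h1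
      have e2 : F.miuraProd g (fun i => Function.update a k d i * y i) (l ++ [k]) =
          F.miuraProd g (fun i => a i * y i) l * (F.cp k (g k) * F.x k (d * y k)) := by
        rw [← e1]
        simp [miuraProd]
      have e3 := F.conj_x hde (y k)
      have e4 := F.torus_comm hQ (F.cp_mem_torus k (hg k))
      rw [e2, List.map_append, List.map_append, List.prod_append, List.prod_append, h g y hg]
      simp only [List.map_cons, List.map_nil, List.prod_cons, List.prod_nil, mul_one]
      calc _ = F.miuraProd g (fun i => a i * y i) l *
            (((l.map τ).prod * F.cp k (g k)) * F.x k (y k) * τ k) := by simp only [mul_assoc]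
        _ = F.miuraProd g (fun i => a i * y i) l *
            (F.cp k (g k) * ((l.map τ).prod * F.x k (y k)) * τ k) := by
              rw [e4]; simp only [mul_assoc]
        _ = _ := by rw [e3]; simp only [mul_assoc]

theorem prod_cp (c : b.support → ℂˣ) {l : List b.support} (hl : l.Nodup) (hall : ∀ i, i ∈ l) :
    (l.map fun i => F.cp i (c i)).prod = F.tor c := by
  have h1 : (l.map fun i => Pi.mulSingle i (c i)).prod = c := by
    rw [← List.prod_toFinset _ hl, toFinset_eq_univ hall, Finset.univ_prod_mulSingle]
  conv_rhs => rw [← h1, map_list_prod, List.map_map]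
  refine congrArg List.prod (List.map_congr_left fun i _ => ?_)
  rw [Function.comp_apply, tor_mulSingle]

theorem mul_cp_eq (i : b.support) {g c : ℂ} (hg : g ≠ 0) (hc : c ≠ 0) (y : ℂ) :
    F.cp i g * F.x i y * F.cp i c = F.cp i (g * c) * F.x i ((c ^ 2)⁻¹ * y) := by
  rw [← F.cp_mul i hg hc, mul_assoc, mul_assoc, F.cp_mul_x i hc, mul_inv_cancel_left₀
    (pow_ne_zero 2 hc)]

/-- The upper triangular elements of the Coxeter cell in normal form. -/
theorem exists_normalForm (hs : ∀ i, IsReflectionLift ρ b i (s i)) {l : List b.support}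
    (hl : l.Nodup) (hall : ∀ i, i ∈ l) :
    ∃ κ t : b.support → ℂ, (∀ i, κ i ≠ 0) ∧ (∀ i, t i ≠ 0) ∧
      ∀ c g : b.support → ℂ, (∀ i, g i ≠ 0) → F.upProd (F.lift s) c g l =
        F.miuraProd (fun i => g i * κ i) (fun i => t i * c i / (g i * κ i)) l := by
  obtain ⟨a, ha, h1⟩ := F.exists_move (F.lift_mem hs) l hl
  have hQ : (l.map (F.lift s)).prod ∈ torus ρ F.C := Subgroup.list_prod_mem _ fun g hg => by
    obtain ⟨i, -, rfl⟩ := List.mem_map.1 hg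
    exact F.lift_mem hs i
  -- Collected at the right end, the lifts form a single torus element. It is written in simple
  -- coroots and given back to the factors, reading `exists_move` in the other direction; the
  -- scalars `a` and `a'` of the two moves combine into the constants.
  obtain ⟨κ, hκ⟩ := F.mem_torus.1 hQ
  obtain ⟨a', ha', h2⟩ := F.exists_move (τ := fun i => F.cp i (κ i))
    (fun i => F.cp_mem_torus i (κ i).ne_zero) l hl
  refine ⟨fun i => κ i, fun i => a i / (a' i * κ i), fun i => (κ i).ne_zero,
    fun i => div_ne_zero (ha i) (mul_ne_zero (ha' i) (κ i).ne_zero), fun c g hg => ?_⟩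
  have e1 := h1 g (fun i => c i / g i) hg
  have e2 := h2 g (fun i => (a' i)⁻¹ * (a i * (c i / g i))) hg
  have e3 : (fun i => a' i * ((a' i)⁻¹ * (a i * (c i / g i)))) = fun i => a i * (c i / g i) := by
    ext i
    rw [mul_inv_cancel_left₀ (ha' i)]
  rw [F.prod_cp κ hl hall, ← hκ, e3, ← e1] at e2
  rw [upProd, ← e2, miuraProd]
  refine congrArg List.prod (List.map_congr_left fun i _ => ?_)
  rw [F.mul_cp_eq i (hg i) (κ i).ne_zero]
  congr 2
  have h3 := ha' i
  have h4 := (κ i).ne_zero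
  have h5 := hg i
  field_simp

/-- The normal form if the lifts are taken in the `SL₂`-subgroups. -/
theorem normalForm_of_cp {κ : b.support → ℂ} (hκ : ∀ i, κ i ≠ 0)
    (h : ∀ i, F.lift s i = F.cp i (κ i)) (l : List b.support) (c g : b.support → ℂ)
    (hg : ∀ i, g i ≠ 0) : F.upProd (F.lift s) c g l =
        F.miuraProd (fun i => g i * κ i) (fun i => (κ i)⁻¹ * c i / (g i * κ i)) l := by
  refine congrArg List.prod (List.map_congr_left fun i _ => ?_)
  rw [h i, F.mul_cp_eq i (hg i) (hκ i)]
  congr 2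
  have h4 := hκ i
  have h5 := hg i
  field_simp

/-- Torus elements can be absorbed in the Coxeter element, with monomial coordinates. -/
theorem exists_coxProd (hs : ∀ i, IsReflectionLift ρ b i (s i)) (l : List b.support)
    (hl : l.Nodup) : ∃ E : b.support → b.support → ℤ, ∀ γ : b.support → ℂˣ, (∀ i, i ∉ l → γ i = 1) →
      F.tor γ * (l.map s).prod = F.coxProd s (fun i => ((∏ k, γ k ^ E i k : ℂˣ) : ℂ)) l := by
  induction l with
  | nil =>
    refine ⟨0, fun γ hγ => ?_⟩
    have : γ = 1 := funext fun i => hγ i (by simp)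
    simp [this, coxProd]
  | cons i l ih =>
    have hil : i ∉ l := (List.nodup_cons.1 hl).1
    obtain ⟨E, hE⟩ := ih (List.nodup_cons.1 hl).2
    -- Row `i` of the exponents is dictated by the requirement that `tor γ * s i` be `φ^{α̌_i} * s
    -- i` times a torus element without `i`-th coordinate; the other coordinates are unchanged, so
    -- the remaining rows come from the shorter list.
    refine ⟨fun j k => if j = i then (if k = i then 1 else b.cartanMatrix i k) else
      if k = i then 0 else E j k, fun γ hγ => ?_⟩
    set γ' : b.support → ℂˣ := Function.update γ i 1 with hγ'
    have e1 := hE γ' (by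
      intro j hj
      by_cases hji : j = i
      · subst hji; simp [hγ']
      · rw [hγ', Function.update_of_ne hji]
        exact hγ j (by simp [hji, hj]))
    set φ : ℂˣ := γ i * ∏ k, γ' k ^ b.cartanMatrix i k with hφ
    have e2 : γ = Pi.mulSingle i φ * reflTorus i γ' := by
      ext1 j
      rw [Pi.mul_apply, reflTorus, Pi.mul_apply]
      by_cases hji : j = i
      · subst hji
        rw [Pi.mulSingle_eq_same, Pi.mulSingle_eq_same, hφ, hγ', Function.update_self, one_mul,
          mul_assoc, ← Finset.prod_mul_distrib, Finset.prod_eq_one, mul_one]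
        intro k _
        rw [zpow_neg, mul_inv_cancel]
      · rw [Pi.mulSingle_eq_of_ne hji, Pi.mulSingle_eq_of_ne hji, one_mul, mul_one, hγ',
          Function.update_of_ne hji]
    have e3 : F.tor γ * s i = F.cp i φ * s i * F.tor γ' := by
      rw [mul_assoc, F.refl_tor (refl_acts hs i), ← mul_assoc, ← tor_mulSingle, ← map_mul, ← e2]
    have e4 : (∏ k, γ k ^ (if i = i then (if k = i then 1 else b.cartanMatrix i k) else
      if k = i then 0 else E i k : ℤ)) = φ := by
      rw [hφ, ← Finset.mul_prod_erase _ _ (Finset.mem_univ i),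
        ← Finset.mul_prod_erase Finset.univ (fun k => γ' k ^ b.cartanMatrix i k)
          (Finset.mem_univ i)]
      simp only [if_true, zpow_one]
      rw [hγ', Function.update_self, one_zpow, one_mul]
      congr 1
      refine Finset.prod_congr rfl fun k hk => ?_
      rw [if_neg (Finset.ne_of_mem_erase hk), Function.update_of_ne (Finset.ne_of_mem_erase hk)]
    rw [List.map_cons, List.prod_cons, ← mul_assoc, e3, mul_assoc, e1, coxProd, coxProd,
      List.map_cons, List.prod_cons, e4]
    refine congrArg (fun z => F.cp i φ * s i * List.prod z) (List.map_congr_left fun j hj => ?_)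
    have hji : j ≠ i := fun h => hil (h ▸ hj)
    refine congrArg (fun z : ℂˣ => F.cp j (z : ℂ) * s j) (Finset.prod_congr rfl fun k _ => ?_)
    simp only [if_neg hji]
    by_cases hki : k = i
    · subst hki; rw [if_pos rfl, hγ', Function.update_self, one_zpow, zpow_zero]
    · rw [if_neg hki, hγ', Function.update_of_ne hki]

/-- The Bruhat cells of the `SL₂`-subgroup of a simple root. -/
def InSmallCell (i : b.support) (g : GL (Fin n) ℂ) : Prop :=
  ∃ (a c d : ℂ) (v : GL (Fin n) ℂ), c ≠ 0 ∧ (v = F.cp i c ∨ v = F.s i * F.cp i c) ∧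
    g = F.y i a * v * F.x i d

theorem InSmallCell.mul_x {i : b.support} {g : GL (Fin n) ℂ} (h : F.InSmallCell i g) (e : ℂ) :
    F.InSmallCell i (g * F.x i e) := by
  obtain ⟨a, c, d, v, hc, hv, rfl⟩ := h
  exact ⟨a, c, d + e, v, hc, hv, by rw [x_add]; group⟩

theorem InSmallCell.mul_cp {i : b.support} {g : GL (Fin n) ℂ} (h : F.InSmallCell i g) {e : ℂ}
    (he : e ≠ 0) : F.InSmallCell i (g * F.cp i e) := by
  obtain ⟨a, c, d, v, hc, hv, rfl⟩ := h
  have h1 := F.cp_mul_x i he ((e ^ 2)⁻¹ * d)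
  rw [mul_inv_cancel_left₀ (pow_ne_zero 2 he)] at h1
  refine ⟨a, c * e, (e ^ 2)⁻¹ * d, v * F.cp i e, mul_ne_zero hc he, ?_, ?_⟩
  · rcases hv with rfl | rfl
    · left; rw [F.cp_mul i hc he]
    · right; rw [mul_assoc, F.cp_mul i hc he]
  · rw [mul_assoc _ (F.x i d), ← h1]; group

theorem cp_mul_y (i : b.support) {c : ℂ} (hc : c ≠ 0) (a : ℂ) :
    F.cp i c * F.y i a = F.y i (c⁻¹ ^ 2 * a) * F.cp i c := F.conj_y (F.cp_f i hc) a

theorem InSmallCell.mul_s {i : b.support} {g : GL (Fin n) ℂ} (h : F.InSmallCell i g) :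
    F.InSmallCell i (g * F.s i) := by
  obtain ⟨a, c, d, v, hc, hv, rfl⟩ := h
  have hcs : F.cp i c * F.s i = F.s i * F.cp i c⁻¹ := by
    have h1 := F.s_mul_w i hc
    have h2 : F.w i c⁻¹ = F.cp i c⁻¹ * F.s i := (F.cp_mul_s i _).symm
    have h3 : F.w i c = F.cp i c * F.s i := (F.cp_mul_s i _).symm
    have h4 : F.s i * F.cp i c = F.cp i c⁻¹ * F.s i := by
      have h5 : F.s i * F.cp i c * F.s i = F.cp i c⁻¹ * F.s i * F.s i := by
        rw [mul_assoc, ← h3, h1, h2]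
      exact mul_right_cancel h5
    have h6 : F.cp i c * (F.s i * F.cp i c) * F.cp i c⁻¹ =
        F.cp i c * (F.cp i c⁻¹ * F.s i) * F.cp i c⁻¹ := by rw [h4]
    rw [mul_assoc, mul_assoc, F.cp_mul i hc (inv_ne_zero hc), mul_inv_cancel₀ hc, cp_one, mul_one,
      ← mul_assoc, F.cp_mul i hc (inv_ne_zero hc), mul_inv_cancel₀ hc, cp_one, one_mul] at h6
    exact h6
  by_cases hd : d = 0
  · subst hd
    rcases hv with rfl | rfl
    · exact ⟨a, c⁻¹, 0, _, inv_ne_zero hc, Or.inr rfl, by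
        rw [x_zero, mul_one, mul_one, mul_assoc, hcs]⟩
    · refine ⟨a, -1 * c⁻¹, 0, _, mul_ne_zero (by norm_num) (inv_ne_zero hc), Or.inl rfl, ?_⟩
      rw [x_zero, mul_one, mul_one, mul_assoc, mul_assoc, hcs, ← mul_assoc (F.s i), s_mul_s,
        F.cp_mul i (by norm_num) (inv_ne_zero hc)]
  · rcases hv with rfl | rfl
    · refine ⟨a + c⁻¹ ^ 2 * d⁻¹, c * -d, -d⁻¹, _, mul_ne_zero hc (neg_ne_zero.2 hd), Or.inl rfl, ?_⟩
      rw [mul_assoc _ (F.x i d), F.x_mul_s_eq i hd, y_add, ← F.cp_mul i hc (neg_ne_zero.2 hd)]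
      have := F.cp_mul_y i hc d⁻¹
      calc _ = F.y i a * (F.cp i c * F.y i d⁻¹) * F.cp i (-d) * F.x i (-d⁻¹) := by
            simp only [mul_assoc]
        _ = _ := by rw [this]; simp only [mul_assoc]
    · refine ⟨a + -(c ^ 2 * d), -1 * c⁻¹, 0, _, mul_ne_zero (by norm_num) (inv_ne_zero hc),
        Or.inl rfl, ?_⟩
      have h1 := F.cp_mul_x i hc d
      have h2 := F.s_mul_x i (c ^ 2 * d)
      rw [x_zero, mul_one, y_add, ← F.cp_mul i (by norm_num) (inv_ne_zero hc), ← s_mul_s,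
        mul_assoc (F.s i) (F.s i), ← hcs]
      calc _ = F.y i a * (F.s i * (F.cp i c * F.x i d)) * F.s i := by simp only [mul_assoc]
        _ = F.y i a * (F.s i * F.x i (c ^ 2 * d)) * F.cp i c * F.s i := by
          rw [h1]; simp only [mul_assoc]
        _ = _ := by rw [h2]; simp only [mul_assoc]

/-- The cells are stable under right multiplication by `x`, by coroot values and by the standard
lift, and `y` is a product of these. -/
theorem inSmallCell {i : b.support} {g : GL (Fin n) ℂ} (hg : g ∈ simpleSL2 ρ b i) :
    F.InSmallCell i g := by
  have key : ∀ q, F.InSmallCell i q → F.InSmallCell i (q * g) := by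
    rw [simpleSL2] at hg
    refine rootSubgroup_induction
      (p := fun g : GL (Fin n) ℂ => ∀ q, F.InSmallCell i q → F.InSmallCell i (q * g))
      (fun q hq => by rwa [mul_one]) (fun g g' h h' q hq => ?_) (fun α hα z hz => ?_) hg
    · have := h' _ (h _ hq)
      rwa [mul_assoc] at this
    · rcases hα with hα | hα
      · have : α = i := (rootSystem H).root.injective hα
        subst this
        obtain ⟨c, rfl⟩ := exists_smul_eq (F.e_mem i) (F.e_ne_zero i) hz
        intro q hq
        change F.InSmallCell i (q * F.x i c)
        exact InSmallCell.mul_x F hq c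
      · have : α = negRoot i := (rootSystem H).root.injective (by rw [hα, root_negRoot])
        subst this
        obtain ⟨c, rfl⟩ := exists_smul_eq (F.f_mem i) (F.f_ne_zero i) hz
        intro q hq
        have h1 : (F.s i)⁻¹ = F.s i * F.cp i (-1)⁻¹ := by
          rw [← F.cp_inv i (by norm_num), ← s_mul_s, mul_inv_rev, mul_inv_cancel_left]
        have h2 : F.y i c = F.s i * F.x i (-c) * (F.s i * F.cp i (-1)⁻¹) := by
          rw [← h1, s_mul_x, neg_neg, mul_inv_cancel_right]
        change F.InSmallCell i (q * F.y i c)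
        rw [h2, ← mul_assoc, ← mul_assoc, ← mul_assoc]
        exact InSmallCell.mul_cp F (InSmallCell.mul_s F (InSmallCell.mul_x F
          (InSmallCell.mul_s F hq) _)) (by norm_num)
  have := key 1 ⟨0, 1, 0, 1, one_ne_zero, Or.inl (F.cp_one i).symm, by simp [y_zero, x_zero]⟩
  rwa [one_mul] at this

theorem s_mem_simpleSL2 (i : b.support) : F.s i ∈ simpleSL2 ρ b i := by
  have hx : ∀ a, F.x i a ∈ simpleSL2 ρ b i := fun a =>
    expU_mem_rootSubgroup (S := {α | (rootSystem H).root α = (rootSystem H).root i ∨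
      (rootSystem H).root α = -(rootSystem H).root i}) (α := i.1) (Or.inl rfl) (F.smul_e_mem i a)
  have hy : ∀ a, F.y i a ∈ simpleSL2 ρ b i := fun a =>
    expU_mem_rootSubgroup (S := {α | (rootSystem H).root α = (rootSystem H).root i ∨
      (rootSystem H).root α = -(rootSystem H).root i}) (α := negRoot i)
      (Or.inr (root_negRoot i)) (F.smul_f_mem i a)
  exact mul_mem (mul_mem (hx _) (hy _)) (hx _)

theorem s_not_mem_torus (i : b.support) : F.s i ∉ torus ρ F.C := by
  intro h
  have h1 := Acts.ext_of_injective F.inj (F.s_acts i) (F.torus_acts h)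
  have h2 := LinearEquiv.congr_fun h1 F.Ω.h0
  have h3 : (rootSystem H).coreflection i F.Ω.h0 =
    F.Ω.h0 - (rootSystem H).root i F.Ω.h0 • (rootSystem H).coroot i :=
      RootPairing.coreflection_apply _ _ _
  rw [h3, F.Ω.simple_h0] at h2
  have h4 : (F.Ω.D : ℂ) • (rootSystem H).coroot i = 0 := by
    have h5 : F.Ω.h0 - (F.Ω.D : ℂ) • (rootSystem H).coroot i = F.Ω.h0 := h2
    simpa using h5
  have h6 := congrArg ((rootSystem H).root i) h4
  rw [map_smul, show (rootSystem H).root i ((rootSystem H).coroot i) = 2 from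
    (rootSystem H).root_coroot_two i, map_zero, smul_eq_mul] at h6
  have : (F.Ω.D : ℂ) ≠ 0 := by exact_mod_cast F.Ω.D_pos.ne'
  exact mul_ne_zero this two_ne_zero h6

/-- The lifts in the `SL₂`-subgroup of a simple root differ by values of the simple coroot. -/
theorem exists_cp_of_simpleSL2 {i : b.support} {g : GL (Fin n) ℂ} (hg : g ∈ simpleSL2 ρ b i)
    (hr : IsReflectionLift ρ b i g) : ∃ c : ℂˣ, (F.s i)⁻¹ * g = F.cp i c := by
  have hG : (F.s i)⁻¹ * g ∈ chevalleyGroup H ρ := mul_mem (inv_mem (F.s_mem i)) hr.1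
  have hact : Acts ρ ((F.s i)⁻¹ * g) (1 : H ≃ₗ[ℂ] H) := by
    have := (F.s_acts i).inv.mul hr.2
    rwa [inv_mul_cancel] at this
  obtain ⟨a, c, d, v, hc, hv, e⟩ := F.inSmallCell (mul_mem (inv_mem (F.s_mem_simpleSL2 i)) hg)
  have hcp := F.cp_mem_torus i hc
  have hvw : F.IsWeyl v := by
    rcases hv with rfl | rfl
    · exact F.isWeyl_of_torus hcp
    · exact IsWeyl.mul F (F.isWeyl_s i) (F.isWeyl_of_torus hcp)
  -- The quotient of two lifts centralizes the torus, so its unipotent factors drop out. What is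
  -- left is a coroot value, because the standard lift is not in the torus.
  obtain ⟨h1, h2⟩ := F.eq_of_acts_one hG hact (F.y_mem_Nminus i a) hvw (F.x_mem_Nplus i d) e
  refine ⟨Units.mk0 c hc, ?_⟩
  rw [h2, Units.val_mk0]
  rcases hv with rfl | rfl
  · rfl
  · exact absurd ((Subgroup.mul_mem_cancel_right _ hcp).1 h1) (F.s_not_mem_torus i)

end Frame

end HOper

end

/-! ### Values of rational functions and rational matrices at almost all points. -/

noncomputable section

set_option linter.unusedSectionVars false

namespace HOper

open scoped Classical
open Filter

/-- Polynomials as rational functions. -/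
abbrev toRat : ℂ[X] →+* RatFunc ℂ := algebraMap ℂ[X] (RatFunc ℂ)

theorem toRat_ne_zero {q : ℂ[X]} {z : ℂ} (h : q.eval z ≠ 0) : toRat q ≠ 0 := by
  rw [Ne, map_eq_zero_iff _ (RatFunc.algebraMap_injective ℂ)]
  rintro rfl
  simp at h

theorem hasValueAt_some {r : RatFunc ℂ} {z v : ℂ} : HasValueAt r (z : P1) v ↔
    ∃ p q : ℂ[X], q.eval z ≠ 0 ∧ r = toRat p / toRat q ∧ v = p.eval z / q.eval z := Iff.rfl

namespace HasValueAt

variable {r r' : RatFunc ℂ} {z v v' : ℂ}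

theorem unique (h : HasValueAt r (z : P1) v) (h' : HasValueAt r (z : P1) v') : v = v' := by
  obtain ⟨p, q, hq, e, rfl⟩ := hasValueAt_some.1 h
  obtain ⟨p', q', hq', e', rfl⟩ := hasValueAt_some.1 h'
  rw [e, div_eq_div_iff (toRat_ne_zero hq) (toRat_ne_zero hq'), ← map_mul, ← map_mul] at e'
  have := congrArg (Polynomial.eval z) (RatFunc.algebraMap_injective ℂ e')
  rw [Polynomial.eval_mul, Polynomial.eval_mul] at this
  rwa [div_eq_div_iff hq hq']

theorem add (h : HasValueAt r (z : P1) v) (h' : HasValueAt r' (z : P1) v') :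
    HasValueAt (r + r') (z : P1) (v + v') := by
  obtain ⟨p, q, hq, rfl, rfl⟩ := hasValueAt_some.1 h
  obtain ⟨p', q', hq', rfl, rfl⟩ := hasValueAt_some.1 h'
  refine hasValueAt_some.2 ⟨p * q' + q * p', q * q', by simp [hq, hq'], ?_, ?_⟩
  · rw [div_add_div _ _ (toRat_ne_zero hq) (toRat_ne_zero hq')]; simp
  · rw [div_add_div _ _ hq hq']; simp

theorem mul (h : HasValueAt r (z : P1) v) (h' : HasValueAt r' (z : P1) v') :
    HasValueAt (r * r') (z : P1) (v * v') := by
  obtain ⟨p, q, hq, rfl, rfl⟩ := hasValueAt_some.1 h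
  obtain ⟨p', q', hq', rfl, rfl⟩ := hasValueAt_some.1 h'
  refine hasValueAt_some.2 ⟨p * p', q * q', by simp [hq, hq'], ?_, ?_⟩
  · rw [div_mul_div_comm]; simp
  · rw [div_mul_div_comm]; simp

theorem const (c z : ℂ) : HasValueAt (algebraMap ℂ (RatFunc ℂ) c) (z : P1) c := by
  refine hasValueAt_some.2 ⟨Polynomial.C c, 1, by simp, ?_, by simp⟩
  rw [map_one, div_one, IsScalarTower.algebraMap_apply ℂ ℂ[X] (RatFunc ℂ),
    Polynomial.algebraMap_eq]

theorem zero (z : ℂ) : HasValueAt 0 (z : P1) 0 := by simpa using const 0 z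

theorem one (z : ℂ) : HasValueAt 1 (z : P1) 1 := by simpa using const 1 z

theorem neg (h : HasValueAt r (z : P1) v) : HasValueAt (-r) (z : P1) (-v) := by
  simpa using (const (-1) z).mul h

theorem sub (h : HasValueAt r (z : P1) v) (h' : HasValueAt r' (z : P1) v') :
    HasValueAt (r - r') (z : P1) (v - v') := by
  simpa [sub_eq_add_neg] using h.add h'.neg

theorem inv (h : HasValueAt r (z : P1) v) (hv : v ≠ 0) : HasValueAt r⁻¹ (z : P1) v⁻¹ := by
  obtain ⟨p, q, hq, rfl, rfl⟩ := hasValueAt_some.1 h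
  refine hasValueAt_some.2 ⟨q, p, ?_, by rw [inv_div], by rw [inv_div]⟩
  intro h0
  simp [h0] at hv

theorem div (h : HasValueAt r (z : P1) v) (h' : HasValueAt r' (z : P1) v') (hv : v' ≠ 0) :
    HasValueAt (r / r') (z : P1) (v / v') := by
  simpa [div_eq_mul_inv] using h.mul (h'.inv hv)

theorem pow (h : HasValueAt r (z : P1) v) (k : ℕ) : HasValueAt (r ^ k) (z : P1) (v ^ k) := by
  induction k with
  | zero => simpa using one z
  | succ k ih => simpa [pow_succ] using ih.mul h

theorem zpow (h : HasValueAt r (z : P1) v) (hv : v ≠ 0) (k : ℤ) :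
    HasValueAt (r ^ k) (z : P1) (v ^ k) := by
  cases k with
  | ofNat k => simpa using h.pow k
  | negSucc k => simpa [zpow_negSucc] using (h.pow (k + 1)).inv (pow_ne_zero _ hv)

theorem sum {ι : Type*} (s : Finset ι) {r : ι → RatFunc ℂ} {v : ι → ℂ}
    (h : ∀ i ∈ s, HasValueAt (r i) (z : P1) (v i)) :
    HasValueAt (∑ i ∈ s, r i) (z : P1) (∑ i ∈ s, v i) := by
  induction s using Finset.induction_on with
  | empty => simpa using zero z
  | insert a s ha ih =>
    rw [Finset.sum_insert ha, Finset.sum_insert ha]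
    exact (h a (by simp)).add (ih fun i hi => h i (by simp [hi]))

theorem prod {ι : Type*} (s : Finset ι) {r : ι → RatFunc ℂ} {v : ι → ℂ}
    (h : ∀ i ∈ s, HasValueAt (r i) (z : P1) (v i)) :
    HasValueAt (∏ i ∈ s, r i) (z : P1) (∏ i ∈ s, v i) := by
  induction s using Finset.induction_on with
  | empty => simpa using one z
  | insert a s ha ih =>
    rw [Finset.prod_insert ha, Finset.prod_insert ha]
    exact (h a (by simp)).mul (ih fun i hi => h i (by simp [hi]))

theorem aeval {σ : Type*} {f : σ → RatFunc ℂ} {v : σ → ℂ}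
    (h : ∀ i, HasValueAt (f i) (z : P1) (v i)) (p : MvPolynomial σ ℂ) :
    HasValueAt (MvPolynomial.aeval f p) (z : P1) (MvPolynomial.eval v p) := by
  induction p using MvPolynomial.induction_on with
  | C a => simpa using const a z
  | add p q hp hq => simpa using hp.add hq
  | mul_X p i hp => simpa using hp.mul (h i)

end HasValueAt

theorem eventually_eval_ne_zero {q : ℂ[X]} (hq : q ≠ 0) : ∀ᶠ z : ℂ in cofinite, q.eval z ≠ 0 := by
  rw [eventually_cofinite]
  refine (Polynomial.finite_setOfPred_isRoot hq).subset fun z hz => ?_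
  simpa using hz

theorem eventually_hasValueAt (r : RatFunc ℂ) :
    ∀ᶠ z : ℂ in cofinite, HasValueAt r (z : P1) (r.eval (RingHom.id ℂ) z) := by
  filter_upwards [eventually_eval_ne_zero r.denom_ne_zero] with z hz
  exact hasValueAt_some.2 ⟨r.num, r.denom, hz, (RatFunc.num_div_denom r).symm, by
    simp [RatFunc.eval, Polynomial.eval₂_id]⟩

/-- If `r` were not zero, `r⁻¹` would be regular at almost all points, and at a zero of `r` among
them one would get 0 = 1. -/
theorem eq_zero_of_frequently {r : RatFunc ℂ}
    (h : ∃ᶠ z : ℂ in cofinite, HasValueAt r (z : P1) 0) : r = 0 := by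
  by_contra hr
  refine h ?_
  filter_upwards [eventually_hasValueAt r⁻¹] with z hz h0
  have := (h0.mul hz).unique (by rw [mul_inv_cancel₀ hr]; exact HasValueAt.one z)
  simp at this

theorem eventually_ne_zero {r : RatFunc ℂ} (hr : r ≠ 0) :
    ∀ᶠ z : ℂ in cofinite, ∃ v, v ≠ 0 ∧ HasValueAt r (z : P1) v := by
  have h : ¬ ∃ᶠ z : ℂ in cofinite, HasValueAt r (z : P1) 0 := fun h => hr (eq_zero_of_frequently h)
  filter_upwards [eventually_hasValueAt r, not_frequently.1 h] with z h1 h2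
  exact ⟨_, fun h0 => h2 (h0 ▸ h1), h1⟩

/-- The rational function `r(ħz)`. -/
def scaleRat (ħ : ℂˣ) (r : RatFunc ℂ) : RatFunc ℂ :=
  toRat (r.num.comp (Polynomial.C (ħ : ℂ) * Polynomial.X)) /
    toRat (r.denom.comp (Polynomial.C (ħ : ℂ) * Polynomial.X))

theorem hasValueAt_scaleRat {ħ : ℂˣ} {r : RatFunc ℂ} {z v : ℂ}
    (h : HasValueAt r (((ħ : ℂ) * z : ℂ) : P1) v) : HasValueAt (scaleRat ħ r) (z : P1) v := by
  obtain ⟨p, q, hq, e, rfl⟩ := hasValueAt_some.1 h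
  have hX : (Polynomial.C (ħ : ℂ) * Polynomial.X : ℂ[X]).natDegree ≠ 0 := by
    rw [Polynomial.natDegree_C_mul_X _ ħ.ne_zero]; exact one_ne_zero
  have hd : toRat (r.denom.comp (Polynomial.C (ħ : ℂ) * Polynomial.X)) ≠ 0 := by
    rw [Ne, map_eq_zero_iff _ (RatFunc.algebraMap_injective ℂ), Polynomial.comp_eq_zero_iff]
    rintro (h0 | ⟨-, h0⟩)
    · exact r.denom_ne_zero h0
    · rw [h0] at hX; simp at hX
  have hq' : (q.comp (Polynomial.C (ħ : ℂ) * Polynomial.X)).eval z ≠ 0 := by simpa using hq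
  refine hasValueAt_some.2 ⟨p.comp (Polynomial.C (ħ : ℂ) * Polynomial.X),
    q.comp (Polynomial.C (ħ : ℂ) * Polynomial.X), hq', ?_, by simp⟩
  have h1 := RatFunc.num_div_denom r
  rw [← h1, div_eq_div_iff (by
    rw [Ne, map_eq_zero_iff _ (RatFunc.algebraMap_injective ℂ)]; exact r.denom_ne_zero)
    (toRat_ne_zero hq), ← map_mul, ← map_mul] at e
  have e' := RatFunc.algebraMap_injective ℂ e
  rw [scaleRat, div_eq_div_iff hd (toRat_ne_zero hq'), ← map_mul, ← map_mul,
    ← Polynomial.mul_comp, ← Polynomial.mul_comp]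
  rw [e']

variable {n : ℕ}

/-- Matrices of rational functions. -/
abbrev RMat (n : ℕ) : Type := Matrix (Fin n) (Fin n) (RatFunc ℂ)

/-- The matrix `M` of rational functions is regular at `z` with value `N`. -/
def MatVal (M : RMat n) (z : ℂ) (N : Mat n) : Prop :=
  ∀ i j, HasValueAt (M i j) (z : P1) (N i j)

/-- A constant matrix. -/
def constMat (N : Mat n) : RMat n := N.map (algebraMap ℂ (RatFunc ℂ))

namespace MatVal

variable {M M' : RMat n} {z : ℂ} {N N' : Mat n}

theorem unique (h : MatVal M z N) (h' : MatVal M z N') : N = N' := by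
  ext i j; exact (h i j).unique (h' i j)

theorem mul (h : MatVal M z N) (h' : MatVal M' z N') : MatVal (M * M') z (N * N') := by
  intro i j
  rw [Matrix.mul_apply, Matrix.mul_apply]
  exact HasValueAt.sum _ fun k _ => (h i k).mul (h' k j)

theorem const (N : Mat n) (z : ℂ) : MatVal (constMat N) z N := fun _ _ => HasValueAt.const _ z

theorem one (z : ℂ) : MatVal (1 : RMat n) z 1 := by
  have := const (1 : Mat n) z
  rwa [constMat, Matrix.map_one _ (map_zero _) (map_one _)] at this

theorem smul {r : RatFunc ℂ} {v : ℂ} (hr : HasValueAt r (z : P1) v) (h : MatVal M z N) :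
    MatVal (r • M) z (v • N) := fun i j => hr.mul (h i j)

theorem pow (h : MatVal M z N) (k : ℕ) : MatVal (M ^ k) z (N ^ k) := by
  induction k with
  | zero => simpa using one z
  | succ k ih => simpa [pow_succ] using ih.mul h

theorem sum {ι : Type*} (s : Finset ι) {M : ι → RMat n} {N : ι → Mat n}
    (h : ∀ i ∈ s, MatVal (M i) z (N i)) : MatVal (∑ i ∈ s, M i) z (∑ i ∈ s, N i) := by
  intro i j
  rw [Matrix.sum_apply, Matrix.sum_apply]
  exact HasValueAt.sum _ fun k hk => h k hk i j

theorem list_prod {ι : Type*} (l : List ι) {M : ι → RMat n} {N : ι → Mat n}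
    (h : ∀ i ∈ l, MatVal (M i) z (N i)) : MatVal (l.map M).prod z (l.map N).prod := by
  induction l with
  | nil => simpa using one z
  | cons i l ih =>
    simp only [List.map_cons, List.prod_cons]
    exact (h i (by simp)).mul (ih fun j hj => h j (by simp [hj]))

theorem aeval (h : MatVal M z N) (p : MvPolynomial (Fin n × Fin n) ℂ) :
    HasValueAt (MvPolynomial.aeval (fun ij => M ij.1 ij.2) p) (z : P1)
      (MvPolynomial.eval (fun ij => N ij.1 ij.2) p) := HasValueAt.aeval (fun _ => h _ _) p

theorem det (h : MatVal M z N) : HasValueAt M.det (z : P1) N.det := by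
  rw [Matrix.det_apply', Matrix.det_apply']
  refine HasValueAt.sum _ fun σ _ => HasValueAt.mul ?_ (HasValueAt.prod _ fun i _ => h _ _)
  simpa using HasValueAt.const ((Equiv.Perm.sign σ : ℤ) : ℂ) z

end MatVal

theorem eventually_matVal (M : RMat n) :
    ∀ᶠ z : ℂ in cofinite, ∃ N, MatVal M z N := by
  have : ∀ᶠ z : ℂ in cofinite, ∀ i j, HasValueAt (M i j) (z : P1)
      ((M i j).eval (RingHom.id ℂ) z) :=
    eventually_all.2 fun i => eventually_all.2 fun j => eventually_hasValueAt _
  exact this.mono fun z hz => ⟨fun i j => (M i j).eval (RingHom.id ℂ) z, hz⟩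

theorem matrix_eq_of_frequently {M M' : RMat n}
    (h : ∃ᶠ z : ℂ in cofinite, ∃ N, MatVal M z N ∧ MatVal M' z N) : M = M' := by
  ext i j
  refine sub_eq_zero.1 (eq_zero_of_frequently (h.mono fun z ⟨N, h1, h2⟩ => ?_))
  simpa using (h1 i j).sub (h2 i j)

theorem det_ne_zero_of_frequently {M : RMat n}
    (h : ∃ᶠ z : ℂ in cofinite, ∃ g : GL (Fin n) ℂ, MatVal M z g) : M.det ≠ 0 := by
  intro h0
  obtain ⟨z, g, hg⟩ := h.exists
  have h1 := hg.det
  rw [h0] at h1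
  exact ((Matrix.isUnit_iff_isUnit_det _).1 g.isUnit).ne_zero (h1.unique (HasValueAt.zero z))

theorem isUnit_of_frequently {M : RMat n}
    (h : ∃ᶠ z : ℂ in cofinite, ∃ g : GL (Fin n) ℂ, MatVal M z g) : IsUnit M :=
  (Matrix.isUnit_iff_isUnit_det _).2 (det_ne_zero_of_frequently h).isUnit

/-- An equation of `K` satisfied by the values at almost all points is satisfied by the rational
matrix. -/
theorem mem_points_of_frequently {M : RMat n} {K : Subgroup (GL (Fin n) ℂ)}
    (h : ∀ᶠ z : ℂ in cofinite, ∃ g ∈ K, MatVal M z g) : M ∈ points K (RatFunc ℂ) := by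
  refine ⟨isUnit_of_frequently (h.mono fun z ⟨g, _, hg⟩ => ⟨g, hg⟩).frequently, fun p hp =>
    eq_zero_of_frequently (h.mono fun z ⟨g, hgK, hg⟩ => ?_).frequently⟩
  have := hg.aeval p
  rwa [hp g hgK] at this

/-- The matrix satisfies the polynomial equations of `K`. -/
def InClosure (K : Subgroup (GL (Fin n) ℂ)) (N : Mat n) : Prop :=
  ∀ p : MvPolynomial (Fin n × Fin n) ℂ,
    (∀ g ∈ K, MvPolynomial.eval (fun ij => (g : Mat n) ij.1 ij.2) p = 0) →
      MvPolynomial.eval (fun ij => N ij.1 ij.2) p = 0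

theorem inClosure_of_points {K : Subgroup (GL (Fin n) ℂ)} {M : RMat n}
    (hM : M ∈ points K (RatFunc ℂ)) {z : ℂ} {N : Mat n} (h : MatVal M z N) : InClosure K N := by
  intro p hp
  have := h.aeval p
  rw [hM.2 p hp] at this
  exact this.unique (HasValueAt.zero z)

/-- Evaluation of a rational point only preserves the equations of `K`; to return to `K` itself one
needs `K` closed, which is shown below for N₋. -/
theorem eventually_unit_of_points {K : Subgroup (GL (Fin n) ℂ)} {M : RMat n}
    (hM : M ∈ points K (RatFunc ℂ)) :
    ∀ᶠ z : ℂ in cofinite, ∃ g : GL (Fin n) ℂ, MatVal M z g ∧ InClosure K g := by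
  have h1 := eventually_ne_zero ((Matrix.isUnit_iff_isUnit_det _).1 hM.1).ne_zero
  filter_upwards [h1, eventually_matVal M] with z ⟨v, hv, hz⟩ ⟨N, hN⟩
  have h2 : N.det ≠ 0 := by rwa [hN.det.unique hz]
  exact ⟨Matrix.GeneralLinearGroup.mkOfDetNeZero N h2, hN, inClosure_of_points hM hN⟩

/-- The generic matrix. -/
abbrev genMat (n : ℕ) : Matrix (Fin n) (Fin n) (MvPolynomial (Fin n × Fin n) ℂ) :=
  Matrix.mvPolynomialX (Fin n) (Fin n) ℂ

theorem genMat_eval (N : Mat n) :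
    (genMat n).map (MvPolynomial.eval fun ij => N ij.1 ij.2) = N := by
  ext i j
  simp [genMat]

/-- A matrix of polynomials whose entries satisfy a linear equation on `K` satisfies it on the
closure. -/
theorem InClosure.linear {K : Subgroup (GL (Fin n) ℂ)} {N : Mat n} (h : InClosure K N)
    (Q : Matrix (Fin n) (Fin n) (MvPolynomial (Fin n × Fin n) ℂ)) (φ : Mat n →ₗ[ℂ] ℂ) (c : ℂ)
    (hK : ∀ g ∈ K, φ (Q.map (MvPolynomial.eval fun ij => (g : Mat n) ij.1 ij.2)) = c) :
    φ (Q.map (MvPolynomial.eval fun ij => N ij.1 ij.2)) = c := by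
  have key : ∀ N : Mat n, MvPolynomial.eval (fun ij => N ij.1 ij.2)
      ((∑ i, ∑ j, MvPolynomial.C (φ (Matrix.single i j 1)) * Q i j) - MvPolynomial.C c) =
      φ (Q.map (MvPolynomial.eval fun ij => N ij.1 ij.2)) - c := by
    intro N
    conv_rhs => rw [Matrix.matrix_eq_sum_single (Q.map _)]
    simp only [map_sub, map_sum, map_mul, MvPolynomial.eval_C]
    congr 1
    refine Finset.sum_congr rfl fun i _ => Finset.sum_congr rfl fun j _ => ?_
    have : Matrix.single i j (Q.map (MvPolynomial.eval fun ij => N ij.1 ij.2) i j) =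
        (MvPolynomial.eval (fun ij => N ij.1 ij.2) (Q i j)) • Matrix.single i j (1 : ℂ) := by
      rw [Matrix.smul_single, smul_eq_mul, mul_one, Matrix.map_apply]
    rw [this, map_smul, smul_eq_mul, mul_comm]
  have := h _ fun g hg => by rw [key, hK g hg, sub_self]
  rwa [key, sub_eq_zero] at this

end HOper

end

/-! ### Evaluating the elements of the group, and closedness of N₋. -/

noncomputable section

set_option linter.unusedSectionVars false

namespace HOper

open LieAlgebra LieAlgebra.IsKilling
open scoped Classical
open Filter

theorem matVal_exp {n : ℕ} {M : RMat n} {z : ℂ} {N : Mat n} (h : MatVal M z N)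
    (hM : IsNilpotent M) (hN : IsNilpotent N) :
    MatVal (IsNilpotent.exp M) z (IsNilpotent.exp N) := by
  obtain ⟨k, hk⟩ := hM
  obtain ⟨l, hl⟩ := hN
  rw [IsNilpotent.exp_eq_sum (pow_eq_zero_of_le (le_max_left k l) hk),
    IsNilpotent.exp_eq_sum (pow_eq_zero_of_le (le_max_right k l) hl)]
  refine MatVal.sum _ fun i _ => ?_
  -- The exponential is formed with rational coefficients, here compared with the same coefficients
  -- in ℂ and in the field of rational functions.
  have h1 := MatVal.smul (HasValueAt.const ((i.factorial : ℂ)⁻¹) z) (h.pow i)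
  rw [map_inv₀, map_natCast] at h1
  convert h1 using 1
  · exact @inv_natCast_smul_eq (RMat n) ℚ (RatFunc ℂ) _ _ _ _ _ i.factorial (M ^ i)
  · exact @inv_natCast_smul_eq (Mat n) ℚ ℂ _ _ _ _ _ i.factorial (N ^ i)

theorem isNilpotent_constMat {n : ℕ} {N : Mat n} (h : IsNilpotent N) :
    IsNilpotent (constMat N) :=
  h.map (RingHom.mapMatrix (algebraMap ℂ (RatFunc ℂ)))

theorem matVal_expElt {n : ℕ} {L : Type*} [LieRing L] [LieAlgebra ℂ L] {ρ : L →ₗ⁅ℂ⁆ Mat n} {x : L}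
    (hx : IsNilpotent (ρ x)) {r : RatFunc ℂ} {z v : ℂ} (h : HasValueAt r (z : P1) v) :
    MatVal (expElt ρ (RatFunc ℂ) x r) z (IsNilpotent.exp (v • ρ x)) :=
  matVal_exp ((MatVal.const (ρ x) z).smul h) ((isNilpotent_constMat hx).smul r) (hx.smul v)

variable {n : ℕ} {L : Type*} [LieRing L] [LieAlgebra ℂ L] [FiniteDimensional ℂ L]
  [LieAlgebra.IsSimple ℂ L] {H : LieSubalgebra ℂ L} [H.IsCartanSubalgebra]
  {b : (rootSystem H).Base} {ρ : L →ₗ⁅ℂ⁆ Mat n}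

namespace Frame

variable (F : Frame b ρ)

theorem matVal_x (i : b.support) {r : RatFunc ℂ} {z v : ℂ} (h : HasValueAt r (z : P1) v) :
    MatVal (expElt ρ (RatFunc ℂ) (F.C.e i) r) z (F.x i v) := by
  rw [coe_x]
  exact matVal_expElt (isNilpotent_rootVector (F.e_mem i)) h

theorem matVal_y (i : b.support) {r : RatFunc ℂ} {z v : ℂ} (h : HasValueAt r (z : P1) v) :
    MatVal (expElt ρ (RatFunc ℂ) (F.C.f i) r) z (F.y i v) := by
  rw [coe_y]
  have hn : IsNilpotent (ρ (F.C.f i)) := by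
    have := F.nilp_f i 1
    rwa [one_smul] at this
  exact matVal_expElt hn h

theorem matVal_w (i : b.support) {r : (RatFunc ℂ)ˣ} {z v : ℂ} (hv : v ≠ 0)
    (h : HasValueAt r (z : P1) v) : MatVal (weylElt ρ F.C i r) z (F.w i v) := by
  rw [weylElt, w, Units.val_mul, Units.val_mul]
  exact ((F.matVal_x i h).mul (F.matVal_y i (h.inv hv).neg)).mul (F.matVal_x i h)

theorem matVal_cp (i : b.support) {r : (RatFunc ℂ)ˣ} {z v : ℂ} (hv : v ≠ 0)
    (h : HasValueAt r (z : P1) v) : MatVal (corootPow ρ F.C i r) z (F.cp i v) := by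
  rw [corootPow, cp, Units.val_mul]
  refine (F.matVal_w i hv h).mul (F.matVal_w i (by norm_num) ?_)
  simpa using (HasValueAt.one z).neg

theorem coe_list_prod {ι : Type*} (l : List ι) (g : ι → GL (Fin n) ℂ) :
    (((l.map g).prod : GL (Fin n) ℂ) : Mat n) = (l.map fun i => (g i : Mat n)).prod := by
  rw [← Units.coeHom_apply, map_list_prod, List.map_map]
  rfl

theorem matVal_coxProd (s : b.support → GL (Fin n) ℂ) (l : List b.support)
    {φ : b.support → (RatFunc ℂ)ˣ} {c : b.support → ℂ} {z : ℂ} (hc : ∀ i, c i ≠ 0)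
    (h : ∀ i, HasValueAt (φ i) (z : P1) (c i)) :
    MatVal (l.map fun i => corootPow ρ F.C i (φ i) * constMat (s i)).prod z
      (F.coxProd s c l) := by
  rw [coxProd, coe_list_prod]
  refine MatVal.list_prod l fun i _ => ?_
  rw [Units.val_mul]
  exact (F.matVal_cp i (hc i) (h i)).mul (MatVal.const _ _)

theorem matVal_miuraProd (l : List b.support) {φ : b.support → (RatFunc ℂ)ˣ}
    {y : b.support → RatFunc ℂ} {c d : b.support → ℂ} {z : ℂ} (hc : ∀ i, c i ≠ 0)
    (h : ∀ i, HasValueAt (φ i) (z : P1) (c i)) (h' : ∀ i, HasValueAt (y i) (z : P1) (d i)) :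
    MatVal (l.map fun i => corootPow ρ F.C i (φ i) * expElt ρ (RatFunc ℂ) (F.C.e i) (y i)).prod z
      (F.miuraProd c d l) := by
  rw [miuraProd, coe_list_prod]
  refine MatVal.list_prod l fun i _ => ?_
  rw [Units.val_mul]
  exact (F.matVal_cp i (hc i) (h i)).mul (F.matVal_x i (h' i))

/-- An entry of the matrix in the weight basis, as a linear functional. -/
def hatEntry (i j : Fin n) : Mat n →ₗ[ℂ] ℂ where
  toFun M := F.W.hat M i j
  map_add' M N := by rw [map_add, Matrix.add_apply]
  map_smul' c M := by rw [map_smul]; rfl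

theorem hatEntry_apply (i j : Fin n) (M : Mat n) : F.hatEntry i j M = F.W.hat M i j := rfl

theorem adjugate_eq (g : GL (Fin n) ℂ) :
    (g : Mat n).adjugate = (g : Mat n).det • ((g⁻¹ : GL (Fin n) ℂ) : Mat n) := by
  have h1 : ((g⁻¹ : GL (Fin n) ℂ) : Mat n) * ((g : Mat n) * (g : Mat n).adjugate) =
      (g : Mat n).adjugate := by
    rw [← mul_assoc, ← Units.val_mul, inv_mul_cancel, Units.val_one, one_mul]
  rw [← h1, Matrix.mul_adjugate, mul_smul_comm, mul_one]

theorem det_ne_zero (g : GL (Fin n) ℂ) : (g : Mat n).det ≠ 0 :=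
  ((Matrix.isUnit_iff_isUnit_det _).1 g.isUnit).ne_zero

theorem adj_genMat_eval (N : Mat n) :
    (genMat n).adjugate.map (MvPolynomial.eval fun ij => N ij.1 ij.2) = N.adjugate := by
  have h := RingHom.map_adjugate
    (MvPolynomial.eval (R := ℂ) (σ := Fin n × Fin n) fun ij => N ij.1 ij.2) (genMat n)
  rw [RingHom.mapMatrix_apply, RingHom.mapMatrix_apply, genMat_eval] at h
  exact h

/-- That g ρ(y) adj(g) lies in ρ(L) is a polynomial condition on g, tested by the linear functionals
that vanish on ρ(L). The adjugate replaces the inverse at the cost of a non-zero scalar. -/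
theorem intertwines_of_inClosure {K : Subgroup (GL (Fin n) ℂ)} (hK : K ≤ chevalleyGroup H ρ)
    {g : GL (Fin n) ℂ} (hg : InClosure K g) : Intertwines ρ g := by
  intro y
  have key : (g : Mat n) * ρ y * (g : Mat n).adjugate ∈ LinearMap.range (ρ : L →ₗ[ℂ] Mat n) := by
    by_contra hn
    obtain ⟨φ, h1, h2⟩ := Submodule.exists_le_ker_of_notMem hn
    refine h1 ?_
    have e : ∀ N : Mat n, (genMat n * (ρ y).map MvPolynomial.C * (genMat n).adjugate).map
        (MvPolynomial.eval fun ij : Fin n × Fin n => N ij.1 ij.2) = N * ρ y * N.adjugate := by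
      intro N
      rw [Matrix.map_mul, Matrix.map_mul, genMat_eval, adj_genMat_eval]
      congr 2
      ext i j; simp
    have := hg.linear (genMat n * (ρ y).map MvPolynomial.C * (genMat n).adjugate) φ 0 ?_
    · rwa [e] at this
    · intro q hq
      rw [e]
      obtain ⟨y', hy'⟩ := intertwines (hK hq) y
      rw [hy', adjugate_eq, mul_smul_comm, mul_assoc, ← Units.val_mul, mul_inv_cancel,
        Units.val_one, mul_one, map_smul]
      have h3 : φ (ρ y') = 0 := h2 ⟨y', rfl⟩
      rw [h3, smul_zero]
  obtain ⟨y', hy'⟩ := key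
  refine ⟨(g : Mat n).det⁻¹ • y', ?_⟩
  have h1 : ρ y' = (g : Mat n) * ρ y * (g : Mat n).adjugate := hy'
  rw [map_smul, h1, adjugate_eq, mul_smul_comm, smul_smul, inv_mul_cancel₀ (det_ne_zero g),
    one_smul, mul_assoc, mul_assoc, ← Units.val_mul, inv_mul_cancel, Units.val_one, mul_one]

include F in
/-- The subgroup `N₋` is closed. -/
theorem mem_Nminus_of_inClosure {g : GL (Fin n) ℂ} (hg : InClosure (Nminus ρ b) g) :
    g ∈ Nminus ρ b := by
  rw [F.Nminus_eq]
  refine F.W.mem_negSubgroup F.wt_h0 ?_ (intertwines_of_inClosure Nminus_le hg)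
  intro i j hij
  rw [Matrix.sub_apply, sub_eq_zero]
  have := hg.linear (genMat n) (F.hatEntry i j) ((1 : Mat n) i j) fun q hq => by
    rw [genMat_eval, hatEntry_apply]
    have := F.hat_Nminus hq i j hij
    rwa [Matrix.sub_apply, sub_eq_zero] at this
  rwa [genMat_eval] at this

/-- Triangularity suffices for the factorization, so closedness of B₊ need not be known. The inverse
is again treated through the adjugate. -/
theorem mem_upper_of_inClosure {g : GL (Fin n) ℂ} (hg : InClosure (Bplus ρ F.C) g) :
    g ∈ F.upper := by
  constructor
  · intro i j hij
    have := hg.linear (genMat n) (F.hatEntry i j) 0 fun q hq => by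
      rw [genMat_eval, hatEntry_apply]
      exact (F.Bplus_le_upper hq).1 i j hij
    rwa [genMat_eval] at this
  · intro i j hij
    have := hg.linear (genMat n).adjugate (F.hatEntry i j) 0 fun q hq => by
      rw [adj_genMat_eval, adjugate_eq, map_smul, hatEntry_apply,
        (F.Bplus_le_upper hq).2 i j hij, smul_zero]
    rw [adj_genMat_eval, adjugate_eq, map_smul, hatEntry_apply, smul_eq_mul] at this
    exact (mul_eq_zero.1 this).resolve_left (det_ne_zero g)

/-- The expression of `φ` in the definition of the cell, as a product over a list. -/
theorem ofFn_prod {r : ℕ} (ord : Fin r ≃ b.support) {A : Type*} [Monoid A] (f : b.support → A) :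
    (List.ofFn fun k => f (ord k)).prod = ((List.ofFn ord).map f).prod := by
  rw [List.map_ofFn]; rfl

theorem ofFn_nodup {r : ℕ} (ord : Fin r ≃ b.support) : (List.ofFn ord).Nodup :=
  List.nodup_ofFn.2 ord.injective

theorem mem_ofFn {r : ℕ} (ord : Fin r ≃ b.support) (i : b.support) : i ∈ List.ofFn ord :=
  List.mem_ofFn.2 ⟨ord.symm i, by simp⟩

theorem eventually_units (φ : b.support → (RatFunc ℂ)ˣ) :
    ∀ᶠ z : ℂ in cofinite, ∃ c : b.support → ℂ, (∀ i, c i ≠ 0) ∧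
      ∀ i, HasValueAt (φ i) (z : P1) (c i) := by
  have : ∀ᶠ z : ℂ in cofinite, ∀ i, ∃ v, v ≠ 0 ∧ HasValueAt (φ i : RatFunc ℂ) (z : P1) v :=
    eventually_all.2 fun i => eventually_ne_zero (φ i).ne_zero
  refine this.mono fun z hz => ?_
  choose c hc hc' using hz
  exact ⟨c, hc, hc'⟩

/-- Values of the elements of the cell. -/
theorem eventually_operCell {r : ℕ} {ord : Fin r ≃ b.support} {s : b.support → GL (Fin n) ℂ}
    {φ : b.support → (RatFunc ℂ)ˣ} {M : RMat n} (hM : M ∈ operCell ρ F.C ord s φ) :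
    ∀ᶠ z : ℂ in cofinite, ∃ c : b.support → ℂ, (∀ i, c i ≠ 0) ∧
      (∀ i, HasValueAt (φ i) (z : P1) (c i)) ∧ ∃ m₁ ∈ Nminus ρ b, ∃ m₂ ∈ Nminus ρ b,
        MatVal M z (m₁ * F.coxProd s c (List.ofFn ord) * m₂ : GL (Fin n) ℂ) := by
  obtain ⟨m', hm', m, hm, rfl⟩ := hM
  filter_upwards [eventually_units φ, eventually_unit_of_points hm', eventually_unit_of_points hm]
    with z ⟨c, hc, hcv⟩ ⟨g', hg', hgc'⟩ ⟨g, hg, hgc⟩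
  refine ⟨c, hc, hcv, g', F.mem_Nminus_of_inClosure hgc', g, F.mem_Nminus_of_inClosure hgc, ?_⟩
  rw [Units.val_mul, Units.val_mul]
  refine (hg'.mul ?_).mul hg
  have := F.matVal_coxProd s (List.ofFn ord) hc hcv
  rw [← ofFn_prod ord fun i => corootPow ρ F.C i (φ i) * constMat (s i : Mat n)] at this
  exact this

end Frame

end HOper

end

/-! ### The factorization over the field of rational functions. -/

noncomputable section

set_option linter.unusedSectionVars false

namespace HOper

open LieAlgebra LieAlgebra.IsKilling
open scoped Classical
open Filter

variable {n : ℕ} {L : Type*} [LieRing L] [LieAlgebra ℂ L] [FiniteDimensional ℂ L]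
  [LieAlgebra.IsSimple ℂ L] {H : LieSubalgebra ℂ L} [H.IsCartanSubalgebra]
  {b : (rootSystem H).Base} {ρ : L →ₗ⁅ℂ⁆ Mat n}

namespace Frame

variable (F : Frame b ρ)

/-- The matrix in the weight basis, over the rational functions. -/
def ratHat (M : RMat n) : RMat n := constMat ((F.W.P⁻¹ : GL (Fin n) ℂ) : Mat n) * M * constMat F.W.P

theorem matVal_ratHat {M : RMat n} {z : ℂ} {N : Mat n} (h : MatVal M z N) :
    MatVal (F.ratHat M) z (F.W.hat N) := by
  rw [WeightBasis.hat_apply]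
  exact ((MatVal.const _ z).mul h).mul (MatVal.const _ z)

/-- The elements of the intersection of the cell with `B₊(z)`, given a normal form. -/
theorem exists_miuraForm {r : ℕ} {ord : Fin r ≃ b.support} {s : b.support → GL (Fin n) ℂ}
    (hs : ∀ i, IsReflectionLift ρ b i (s i)) {κ : b.support → ℂ} {t : b.support → ℂˣ}
    (hκ : ∀ i, κ i ≠ 0)
    (hn : ∀ c g : b.support → ℂ, (∀ i, g i ≠ 0) → F.upProd (F.lift s) c g (List.ofFn ord) =
      F.miuraProd (fun i => g i * κ i) (fun i => t i * c i / (g i * κ i)) (List.ofFn ord))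
    {φ : b.support → (RatFunc ℂ)ˣ} {M : RMat n} (hM : M ∈ operCell ρ F.C ord s φ)
    (hB : M ∈ points (Bplus ρ F.C) (RatFunc ℂ)) :
    ∃ g : b.support → (RatFunc ℂ)ˣ, M = miuraForm ρ F.C ord t φ g := by
  obtain ⟨κ', hκ', hco⟩ := F.upProd_coord hs (ofFn_nodup ord) (mem_ofFn ord)
  -- At almost every point the coordinates of the factorization are monomials in the diagonal
  -- entries of `M`, up to constants; this is what makes the pointwise coordinates into rational
  -- functions.
  let γ : b.support → RatFunc ℂ := fun i => algebraMap ℂ (RatFunc ℂ) (κ' i) *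
    (∏ j, (F.ratHat M j j) ^ F.fund i j) * algebraMap ℂ (RatFunc ℂ) (κ i)
  have key : ∀ᶠ z : ℂ in cofinite, ∃ c g : b.support → ℂ, (∀ i, g i ≠ 0) ∧
      (∀ i, HasValueAt (φ i) (z : P1) (c i)) ∧ (∀ i, HasValueAt (γ i) (z : P1) (g i)) ∧
      MatVal M z (F.miuraProd g (fun i => t i * c i / g i) (List.ofFn ord)) := by
    filter_upwards [F.eventually_operCell hM, eventually_unit_of_points hB]
      with z ⟨c, hc, hcv, m₁, hm₁, m₂, hm₂, h1⟩ ⟨β, h2, h3⟩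
    have hβ := F.mem_upper_of_inClosure h3
    have e : m₁ * F.coxProd s c (List.ofFn ord) * m₂ = β := Units.ext (h1.unique h2)
    obtain ⟨g, hg, e'⟩ := F.eq_upProd hs hc (ofFn_nodup ord) hm₁ hm₂ hβ e
    have h4 := F.hasDiag_upProd hs (c := c) hg (List.ofFn ord)
    refine ⟨c, fun i => g i * κ i, fun i => mul_ne_zero (hg i) (hκ i), hcv, fun i => ?_, ?_⟩
    · change HasValueAt (γ i) (z : P1) (g i * κ i)
      rw [hco c g hg i, ← e']
      refine ((HasValueAt.const _ z).mul (HasValueAt.prod _ fun j _ => ?_)).mul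
        (HasValueAt.const _ z)
      refine (F.matVal_ratHat h2 j j).zpow ?_ _
      rw [e', h4.apply j]
      refine List.prod_ne_zero fun h0 => ?_
      obtain ⟨i, -, hi⟩ := List.mem_map.1 h0
      exact mul_ne_zero (zpow_ne_zero _ (hg i)) (F.hat_torus_ne_zero (F.lift_mem hs i) j) hi
    · rw [← hn c g hg, ← e']
      exact h2
  have hγ : ∀ i, γ i ≠ 0 := by
    intro i h0
    obtain ⟨z, c, g, hg, -, h1, -⟩ := key.exists
    exact hg i ((h1 i).unique (by rw [h0]; exact HasValueAt.zero z))
  refine ⟨fun i => Units.mk0 (γ i) (hγ i), ?_⟩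
  refine matrix_eq_of_frequently (key.mono ?_).frequently
  rintro z ⟨c, g, hg, hcv, hgv, h1⟩
  refine ⟨_, h1, ?_⟩
  have h2 := F.matVal_miuraProd (List.ofFn ord) (φ := fun i => Units.mk0 (γ i) (hγ i)) (z := z)
    (y := fun i => algebraMap ℂ (RatFunc ℂ) (t i) * (φ i : RatFunc ℂ) / γ i) (c := g)
    (d := fun i => t i * c i / g i) hg hgv
    fun i => ((HasValueAt.const _ z).mul (hcv i)).div (hgv i) (hg i)
  rw [← ofFn_prod ord fun i => corootPow ρ F.C i (Units.mk0 (γ i) (hγ i)) *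
    expElt ρ (RatFunc ℂ) (F.C.e i)
      (algebraMap ℂ (RatFunc ℂ) (t i) * (φ i : RatFunc ℂ) / γ i)] at h2
  exact h2

/-- The constant attached to a lift in the `SL₂`-subgroup. -/
def liftConst (i : b.support) (g : GL (Fin n) ℂ) : ℂˣ :=
  if h : ∃ c : ℂˣ, (F.s i)⁻¹ * g = F.cp i c then h.choose⁻¹ else 1

/-- The constants `t_i`, and the factorization of the elements of the intersection. -/
theorem exists_constants {r : ℕ} (ord : Fin r ≃ b.support) (s : b.support → GL (Fin n) ℂ)
    (hs : ∀ i, IsReflectionLift ρ b i (s i)) :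
    ∃ t : b.support → ℂˣ, ((∀ i, s i ∈ simpleSL2 ρ b i) → ∀ i, t i = F.liftConst i (s i)) ∧
      ∀ φ : b.support → (RatFunc ℂ)ˣ,
        ∀ M ∈ operCell ρ F.C ord s φ ∩ points (Bplus ρ F.C) (RatFunc ℂ),
          ∃ g : b.support → (RatFunc ℂ)ˣ, M = miuraForm ρ F.C ord t φ g := by
  -- In the first case the constants are read off lift by lift, so neither the order nor the other
  -- lifts enter; otherwise they come from the general normal form. The default value in `liftConst`
  -- does not occur in the first case.
  by_cases h : ∀ i, s i ∈ simpleSL2 ρ b i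
  · have h1 : ∀ i, ∃ c : ℂˣ, (F.s i)⁻¹ * s i = F.cp i c := fun i =>
      F.exists_cp_of_simpleSL2 (h i) (hs i)
    have h2 : ∀ i, F.lift s i = F.cp i (h1 i).choose := fun i => (h1 i).choose_spec
    refine ⟨fun i => F.liftConst i (s i), fun _ _ => rfl, fun φ M hM => ?_⟩
    refine F.exists_miuraForm hs (κ := fun i => (h1 i).choose) (fun i => Units.ne_zero _)
      (fun c g hg => ?_) hM.1 hM.2
    rw [F.normalForm_of_cp (fun i => Units.ne_zero _) h2 _ c g hg]
    have : (fun i => ((F.liftConst i (s i) : ℂˣ) : ℂ)) =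
        fun i => (((h1 i).choose : ℂˣ) : ℂ)⁻¹ := by
      ext i
      rw [liftConst, dif_pos (h1 i), Units.val_inv_eq_inv_val]
    have h3 := fun i => congrFun this i
    simp only [h3]
  · obtain ⟨κ, t, hκ, ht, h1⟩ := F.exists_normalForm hs (ofFn_nodup ord) (mem_ofFn ord)
    refine ⟨fun i => Units.mk0 (t i) (ht i), fun h' => absurd h' h, fun φ M hM => ?_⟩
    refine F.exists_miuraForm hs (κ := κ) hκ (fun c g hg => ?_) hM.1 hM.2
    simp only [Units.val_mk0]
    exact h1 c g hg

end Frame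

end HOper

end

/-! ### Generic constancy of ranks, and rationality of the lower triangular factor. -/

noncomputable section

set_option linter.unusedSectionVars false

namespace HOper

open LieAlgebra LieAlgebra.IsKilling
open scoped Classical
open Filter

section

variable {n : ℕ}

theorem MatVal.isUnit_of_inv {M : RMat n} {z : ℂ} {N N' : Mat n} (h : MatVal M z N)
    (h' : MatVal M⁻¹ z N') (hM : M.det ≠ 0) : N * N' = 1 :=
  (h.mul h').unique (by rw [Matrix.mul_nonsing_inv _ hM.isUnit]; exact MatVal.one z)

theorem eventually_matVal_inv (M : RMat n) :
    ∀ᶠ z : ℂ in cofinite, ∀ g : GL (Fin n) ℂ, MatVal M z g →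
      MatVal M⁻¹ z ((g⁻¹ : GL (Fin n) ℂ) : Mat n) := by
  filter_upwards [eventually_matVal M⁻¹] with z ⟨N, hN⟩ g hg
  by_cases hM : M.det = 0
  · exfalso
    have h1 := hg.det
    rw [hM] at h1
    exact Frame.det_ne_zero g (h1.unique (HasValueAt.zero z))
  · have h1 := hg.isUnit_of_inv hN hM
    have : N = ((g⁻¹ : GL (Fin n) ℂ) : Mat n) := by
      calc N = ((g⁻¹ : GL (Fin n) ℂ) : Mat n) * (g * N) := by
            rw [← mul_assoc, ← Units.val_mul, inv_mul_cancel, Units.val_one, one_mul]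
        _ = _ := by rw [h1, mul_one]
    rwa [← this]

theorem eventually_isUnit {M : RMat n} (hM : M.det ≠ 0) :
    ∀ᶠ z : ℂ in cofinite, ∀ N, MatVal M z N → IsUnit N.det := by
  filter_upwards [eventually_ne_zero hM] with z ⟨v, hv, hz⟩ N hN
  rw [hN.det.unique hz]
  exact hv.isUnit

/-- The rank of the value is generically constant. -/
theorem exists_eventually_rank (R : RMat n) :
    ∃ d : ℕ, ∀ᶠ z : ℂ in cofinite, ∀ N, MatVal R z N → N.rank = d := by
  -- Gaussian elimination over the rational functions: off finitely many points the transvections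
  -- remain invertible and the non-zero diagonal entries keep non-zero values.
  obtain ⟨l, l', D, e⟩ := Matrix.Pivot.exists_list_transvec_mul_diagonal_mul_list_transvec R
  set P := (l.map Matrix.TransvectionStruct.toMatrix).prod
  set Q := (l'.map Matrix.TransvectionStruct.toMatrix).prod
  have hP : P.det ≠ 0 := by
    rw [Matrix.TransvectionStruct.det_toMatrix_prod]; exact one_ne_zero
  have hQ : Q.det ≠ 0 := by
    rw [Matrix.TransvectionStruct.det_toMatrix_prod]; exact one_ne_zero
  have hD : ∀ᶠ z : ℂ in cofinite, ∀ i, ∃ v, (D i ≠ 0 ↔ v ≠ 0) ∧ HasValueAt (D i) (z : P1) v := by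
    refine eventually_all.2 fun i => ?_
    by_cases h : D i = 0
    · exact Eventually.of_forall fun z => ⟨0, by simp [h], by rw [h]; exact HasValueAt.zero z⟩
    · exact (eventually_ne_zero h).mono fun z ⟨v, hv, hz⟩ => ⟨v, by simp [h, hv], hz⟩
  refine ⟨Fintype.card {i // D i ≠ 0}, ?_⟩
  filter_upwards [eventually_isUnit hP, eventually_isUnit hQ, eventually_matVal P,
    eventually_matVal Q, hD] with z h1 h2 ⟨p, hp⟩ ⟨q, hq⟩ h3 N hN
  choose v hv hvz using h3
  have hDv : MatVal (Matrix.diagonal D) z (Matrix.diagonal v) := by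
    intro i j
    by_cases hij : i = j
    · subst hij
      rw [Matrix.diagonal_apply_eq, Matrix.diagonal_apply_eq]; exact hvz i
    · rw [Matrix.diagonal_apply_ne _ hij, Matrix.diagonal_apply_ne _ hij]
      exact HasValueAt.zero z
  have e2 : N = p * Matrix.diagonal v * q := by
    refine hN.unique ?_
    rw [e]
    exact (hp.mul hDv).mul hq
  rw [e2, Matrix.rank_mul_eq_left_of_isUnit_det _ _ (h2 q hq),
    Matrix.rank_mul_eq_right_of_isUnit_det _ _ (h1 p hp), Matrix.rank_diagonal]
  exact Fintype.card_congr (Equiv.subtypeEquivRight fun i => (hv i).symm)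

theorem eventually_mul {p : ℂ → Prop} (ħ : ℂˣ) (h : ∀ᶠ z in cofinite, p z) :
    ∀ᶠ z in cofinite, p ((ħ : ℂ) * z) :=
  (mul_right_injective₀ ħ.ne_zero).tendsto_cofinite.eventually h

end

variable {n : ℕ} {L : Type*} [LieRing L] [LieAlgebra ℂ L] [FiniteDimensional ℂ L]
  [LieAlgebra.IsSimple ℂ L] {H : LieSubalgebra ℂ L} [H.IsCartanSubalgebra]
  {b : (rootSystem H).Base} {ρ : L →ₗ⁅ℂ⁆ Mat n}

namespace Frame

variable (F : Frame b ρ)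

/-- There are infinitely many bounds `q` and `p`, but only finitely many sets of rows and columns,
so one finite set of exceptional points serves them all. -/
theorem eventually_rk (Gm : RMat n) : ∃ d : b.support → ℤ → ℤ → ℕ,
    ∀ᶠ z : ℂ in cofinite, ∀ g : GL (Fin n) ℂ, MatVal Gm z g → ∀ k q p, F.rk k q p g = d k q p := by
  have h1 : ∀ A B : Fin n → Prop, ∃ d : ℕ, ∀ᶠ z : ℂ in cofinite, ∀ g : GL (Fin n) ℂ,
      MatVal Gm z g → (proj A * F.W.hat g * proj B).rank = d := by
    intro A B
    obtain ⟨d, hd⟩ := exists_eventually_rank (constMat (proj A) * F.ratHat Gm * constMat (proj B))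
    exact ⟨d, hd.mono fun z hz g hg =>
      hz _ (((MatVal.const _ z).mul (F.matVal_ratHat hg)).mul (MatVal.const _ z))⟩
  choose d hd using h1
  refine ⟨fun k q p => d (fun j => q < F.dω k j) fun j => p ≤ F.d0 j, ?_⟩
  have h2 : ∀ᶠ z : ℂ in cofinite, ∀ A B : Fin n → Prop, ∀ g : GL (Fin n) ℂ,
      MatVal Gm z g → (proj A * F.W.hat g * proj B).rank = d A B :=
    eventually_all.2 fun A => eventually_all.2 fun B => hd A B
  exact h2.mono fun z hz g hg k q p => hz _ _ g hg

/-- The square linear system for the `i`-th row of the inverse of the lower triangular factor. -/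
def rowMat {R : Type*} [CommRing R] (a : Fin n → ℤ) (i : Fin n) (G : Matrix (Fin n) (Fin n) R) :
    Matrix (Fin n) (Fin n) R :=
  Matrix.of fun j l => if a j ≤ a i then (if j = l then 1 else 0) else G l j

theorem matVal_rowMat (a : Fin n → ℤ) (i : Fin n) {G : RMat n} {z : ℂ} {N : Mat n}
    (h : MatVal G z N) : MatVal (rowMat a i G) z (rowMat a i N) := by
  intro j l
  simp only [rowMat, Matrix.of_apply]
  by_cases h1 : a j ≤ a i
  · simp only [if_pos h1]
    by_cases h2 : j = l
    · simp only [if_pos h2]; exact HasValueAt.one z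
    · simp only [if_neg h2]; exact HasValueAt.zero z
  · simp only [if_neg h1]; exact h l j

theorem rowMat_mulVec_le {R : Type*} [CommRing R] {a : Fin n → ℤ} {i j : Fin n}
    {G : Matrix (Fin n) (Fin n) R} {x : Fin n → R} (h : a j ≤ a i) :
    (rowMat a i G).mulVec x j = x j := by
  simp [rowMat, Matrix.mulVec, dotProduct, h]

theorem rowMat_mulVec_lt {R : Type*} [CommRing R] {a : Fin n → ℤ} {i j : Fin n}
    {G : Matrix (Fin n) (Fin n) R} {x : Fin n → R} (h : ¬ a j ≤ a i) :
    (rowMat a i G).mulVec x j = Matrix.vecMul x G j := by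
  simp [rowMat, Matrix.mulVec, Matrix.vecMul, dotProduct, h, mul_comm]

/-- A kernel vector `x` lives in degrees above that of `i`, and so does `y`, the row `x` times the
matrix of `m`. Since y β vanishes in exactly these degrees and β is triangular the other way, `y`
vanishes. -/
theorem rowMat_det_ne_zero {m β : GL (Fin n) ℂ} (hm : m ∈ Nminus ρ b) (hβ : β ∈ F.upper)
    (i : Fin n) : (rowMat F.d0 i (F.W.hat ((m * β : GL (Fin n) ℂ) : Mat n))).det ≠ 0 := by
  intro h0
  obtain ⟨x, hx, e⟩ := Matrix.exists_mulVec_eq_zero_iff.2 h0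
  refine hx ?_
  have hle : ∀ j, F.d0 j ≤ F.d0 i → x j = 0 := fun j hj =>
    (rowMat_mulVec_le hj).symm.trans (congrFun e j)
  have hgt : ∀ j, ¬ F.d0 j ≤ F.d0 i →
      Matrix.vecMul x (F.W.hat ((m * β : GL (Fin n) ℂ) : Mat n)) j = 0 := fun j hj =>
    (rowMat_mulVec_lt hj).symm.trans (congrFun e j)
  set y := Matrix.vecMul x (F.W.hat (m : Mat n)) with hy
  have hm0 := mem_Fil_zero_of_sub_one (F.hat_Nminus hm)
  have hyle : ∀ j, F.d0 j ≤ F.d0 i → y j = 0 := by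
    intro j hj
    rw [hy]
    simp only [Matrix.vecMul, dotProduct]
    refine Finset.sum_eq_zero fun l _ => ?_
    by_cases hl : F.d0 l ≤ F.d0 i
    · rw [hle l hl, zero_mul]
    · rw [hm0 l j (by omega), mul_zero]
  have hyβ : y = Matrix.vecMul (Matrix.vecMul y (F.W.hat (β : Mat n)))
      (F.W.hat ((β⁻¹ : GL (Fin n) ℂ) : Mat n)) := by
    rw [Matrix.vecMul_vecMul, F.W.hat_mul_inv, Matrix.vecMul_one]
  have hyz : y = 0 := by
    ext j
    by_cases hj : F.d0 j ≤ F.d0 i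
    · exact hyle j hj
    · rw [hyβ, Matrix.vecMul, dotProduct, Pi.zero_apply]
      refine Finset.sum_eq_zero fun l _ => ?_
      by_cases hl : F.d0 l ≤ F.d0 i
      · rw [hβ.2 l j (by simp only; omega), mul_zero]
      · have := hgt l hl
        rw [Units.val_mul, map_mul, ← Matrix.vecMul_vecMul] at this
        rw [this, zero_mul]
  calc x = Matrix.vecMul y (F.W.hat ((m⁻¹ : GL (Fin n) ℂ) : Mat n)) := by
        rw [hy, Matrix.vecMul_vecMul, F.W.hat_mul_inv, Matrix.vecMul_one]
    _ = 0 := by rw [hyz, Matrix.zero_vecMul]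

/-- Row `i` of m⁻¹ is a unit vector in degrees up to that of `i`, and row `i` of β = m⁻¹ (m β)
vanishes in higher degrees; together these are the equations of the system. -/
theorem rowMat_mulVec_inv {m β : GL (Fin n) ℂ} (hm : m ∈ Nminus ρ b) (hβ : β ∈ F.upper)
    (i : Fin n) : (rowMat F.d0 i (F.W.hat ((m * β : GL (Fin n) ℂ) : Mat n))).mulVec
      (F.W.hat ((m⁻¹ : GL (Fin n) ℂ) : Mat n) i) = Pi.single i 1 := by
  ext j
  by_cases hj : F.d0 j ≤ F.d0 i
  · rw [rowMat_mulVec_le hj]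
    have := F.hat_Nminus (inv_mem hm) i j (by omega)
    rw [Matrix.sub_apply, sub_eq_zero] at this
    rw [this, Matrix.one_apply, Pi.single_apply]
    simp only [eq_comm]
  · rw [rowMat_mulVec_lt hj]
    have e : Matrix.vecMul (F.W.hat ((m⁻¹ : GL (Fin n) ℂ) : Mat n) i)
        (F.W.hat ((m * β : GL (Fin n) ℂ) : Mat n)) j = F.W.hat (β : Mat n) i j := by
      have h1 : F.W.hat (β : Mat n) = F.W.hat ((m⁻¹ : GL (Fin n) ℂ) : Mat n) *
          F.W.hat ((m * β : GL (Fin n) ℂ) : Mat n) := by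
        rw [← map_mul, ← Units.val_mul, inv_mul_cancel_left]
      rw [h1]; rfl
    rw [e, hβ.1 i j (by simp only; omega), Pi.single_eq_of_ne]
    rintro rfl
    exact hj le_rfl

/-- The lower triangular factor of a rational matrix is rational. -/
theorem exists_rat_factor {Gm : RMat n} {m : ℂ → GL (Fin n) ℂ}
    (h : ∀ᶠ z : ℂ in cofinite, m z ∈ Nminus ρ b ∧
      ∃ β ∈ Bplus ρ F.C, MatVal Gm z (m z * β : GL (Fin n) ℂ)) :
    ∃ X : RMat n, ∀ᶠ z : ℂ in cofinite, MatVal X z (((m z)⁻¹ : GL (Fin n) ℂ) : Mat n) := by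
  -- Row `i` of the inverse factor is column `i` of the inverse of the `i`-th system matrix, as the
  -- right side is a unit vector.
  let Y : RMat n := Matrix.of fun i l => (rowMat F.d0 i (F.ratHat Gm))⁻¹ l i
  refine ⟨constMat F.W.P * Y * constMat ((F.W.P⁻¹ : GL (Fin n) ℂ) : Mat n), ?_⟩
  have h2 : ∀ᶠ z : ℂ in cofinite, ∀ i, ∀ g : GL (Fin n) ℂ,
      MatVal (rowMat F.d0 i (F.ratHat Gm)) z g →
        MatVal (rowMat F.d0 i (F.ratHat Gm))⁻¹ z ((g⁻¹ : GL (Fin n) ℂ) : Mat n) :=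
    eventually_all.2 fun i => eventually_matVal_inv _
  filter_upwards [h, h2] with z ⟨hm, β, hβ, hz⟩ hinv
  have hY : MatVal Y z (F.W.hat (((m z)⁻¹ : GL (Fin n) ℂ) : Mat n)) := by
    intro i l
    have hβ' := F.Bplus_le_upper hβ
    have hdet := F.rowMat_det_ne_zero hm hβ' i
    let g := Matrix.GeneralLinearGroup.mkOfDetNeZero _ hdet
    have h3 := hinv i g (matVal_rowMat F.d0 i (F.matVal_ratHat hz)) l i
    have h4 : ((g⁻¹ : GL (Fin n) ℂ) : Mat n).mulVec (Pi.single i 1) =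
        F.W.hat (((m z)⁻¹ : GL (Fin n) ℂ) : Mat n) i := by
      rw [← F.rowMat_mulVec_inv hm hβ' i, Matrix.mulVec_mulVec]
      have : ((g⁻¹ : GL (Fin n) ℂ) : Mat n) *
          rowMat F.d0 i (F.W.hat ((m z * β : GL (Fin n) ℂ) : Mat n)) = 1 := by
        change ((g⁻¹ : GL (Fin n) ℂ) : Mat n) * (g : Mat n) = 1
        rw [← Units.val_mul, inv_mul_cancel, Units.val_one]
      rw [this, Matrix.one_mulVec]
    have h5 := congrFun h4 l
    rw [Matrix.mulVec_single_one] at h5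
    change ((g⁻¹ : GL (Fin n) ℂ) : Mat n) l i = _ at h5
    rw [← h5]
    exact h3
  have := ((MatVal.const (F.W.P : Mat n) z).mul hY).mul
    (MatVal.const ((F.W.P⁻¹ : GL (Fin n) ℂ) : Mat n) z)
  have e := F.W.unhat_hat (((m z)⁻¹ : GL (Fin n) ℂ) : Mat n)
  rw [WeightBasis.unhat] at e
  rwa [e] at this

end Frame

end HOper

end

/-! ### Sections, reductions and transition matrices over dense open sets. -/

noncomputable section

set_option linter.unusedSectionVars false

namespace HOper

open scoped Classical
open Filter

universe u

variable {n : ℕ} {G : Subgroup (GL (Fin n) ℂ)}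

theorem IsOpenDense.eventually {U : Set P1} (hU : IsOpenDense U) :
    ∀ᶠ z : ℂ in cofinite, (z : P1) ∈ U := by
  rw [eventually_cofinite]
  exact Set.Finite.preimage (OnePoint.coe_injective.injOn) hU

/-- The points of the affine line in a set. -/
def affine (p : ℂ → Prop) : Set P1 := {x | ∃ z : ℂ, x = (z : P1) ∧ p z}

theorem coe_mem_affine {p : ℂ → Prop} {z : ℂ} : (z : P1) ∈ affine p ↔ p z :=
  ⟨fun ⟨_, e, h⟩ => OnePoint.coe_injective e ▸ h, fun h => ⟨z, rfl, h⟩⟩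

theorem isOpenDense_affine {p : ℂ → Prop} (h : ∀ᶠ z in cofinite, p z) : IsOpenDense (affine p) := by
  rw [eventually_cofinite] at h
  refine ((h.image fun z : ℂ => (z : P1)).union (Set.finite_singleton (OnePoint.infty : P1))).subset
    fun x hx => ?_
  induction x using OnePoint.rec with
  | infty => exact Or.inr rfl
  | coe z => exact Or.inl ⟨z, fun hp => hx (coe_mem_affine.2 hp), rfl⟩

theorem mem_affine_scale {p : ℂ → Prop} {ħ : ℂˣ} {x : P1}
    (hx : x ∈ affine p ∩ scale ħ ⁻¹' affine p) : ∃ z : ℂ, x = (z : P1) ∧ p z ∧ p (ħ * z) := by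
  obtain ⟨⟨z, rfl, hz⟩, h⟩ := hx
  exact ⟨z, rfl, hz, coe_mem_affine.1 h⟩

theorem IsRegularMap.exists_matVal {K : Subgroup (GL (Fin n) ℂ)} {V : Set P1}
    {a : P1 → GL (Fin n) ℂ} (h : IsRegularMap K V a) :
    ∃ M : RMat n, ∀ z : ℂ, (z : P1) ∈ V → MatVal M z (a z) := by
  choose M hM using h.1
  exact ⟨Matrix.of M, fun z hz i j => hM i j z hz⟩

theorem IsRegularMap.mono {K : Subgroup (GL (Fin n) ℂ)} {V V' : Set P1}
    {a : P1 → GL (Fin n) ℂ} (h : IsRegularMap K V a) (hV : V' ⊆ V) : IsRegularMap K V' a :=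
  ⟨fun i j => (h.1 i j).imp fun _ hr x hx => hr x (hV hx), fun x hx => h.2 x (hV hx)⟩

theorem isRegularMap_of_matVal {K : Subgroup (GL (Fin n) ℂ)} {p : ℂ → Prop} {V : Set P1}
    (hV : V ⊆ affine p) {a : P1 → GL (Fin n) ℂ} {M : RMat n}
    (hM : ∀ z : ℂ, (z : P1) ∈ V → MatVal M z (a z)) (hK : ∀ x ∈ V, a x ∈ K) :
    IsRegularMap K V a := by
  refine ⟨fun i j => ⟨M i j, fun x hx => ?_⟩, hK⟩
  obtain ⟨z, rfl, -⟩ := hV hx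
  exact hM z hx i j

theorem PrincipalBundle.act_inj (F : PrincipalBundle.{u} G) {p : F.Total} {g h : G}
    (e : F.act p g = F.act p h) : g = h :=
  (F.torsor p (F.act p h) (F.proj_act p h).symm).unique e rfl

theorem PrincipalBundle.IsSection.mono {F : PrincipalBundle.{u} G} {V V' : Set P1}
    {s : P1 → F.Total} (h : F.IsSection V s) (hV : V' ⊆ V) : F.IsSection V' s :=
  ⟨fun x hx => h.1 x (hV hx), fun c hc => (h.2 c hc).imp fun _ ⟨h1, h2⟩ =>
    ⟨h1.mono (Set.inter_subset_inter_left _ hV), fun x hx => h2 x ⟨hV hx.1, hx.2⟩⟩⟩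

/-- A section can be changed by a regular map to the group. -/
theorem PrincipalBundle.IsSection.act {F : PrincipalBundle.{u} G} {V : Set P1}
    {s : P1 → F.Total} (h : F.IsSection V s) {p : ℂ → Prop} (hp : affine p ⊆ V) {a : P1 → G}
    {M : RMat n} (hM : ∀ z : ℂ, p z → MatVal M z ((a z : G) : GL (Fin n) ℂ)) :
    F.IsSection (affine p) fun x => F.act (s x) (a x) := by
  refine ⟨fun x hx => by rw [F.proj_act, h.1 x (hp hx)], fun c hc => ?_⟩
  obtain ⟨q, hq, e⟩ := h.2 c hc
  obtain ⟨Q, hQ⟩ := hq.exists_matVal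
  refine ⟨fun x => q x * a x, isRegularMap_of_matVal (M := Q * M)
    (Set.inter_subset_left) (fun z hz => ?_) (fun x _ => (q x * a x).2), fun x hx => ?_⟩
  · rw [Subgroup.coe_mul, Units.val_mul]
    exact (hQ z ⟨hp hz.1, hz.2⟩).mul (hM z (coe_mem_affine.1 hz.1))
  · beta_reduce
    rw [e x ⟨hp hx.1, hx.2⟩, F.act_mul]

/-- Two sections differ by a rational matrix. -/
theorem PrincipalBundle.exists_transition {F : PrincipalBundle.{u} G} {V V' : Set P1}
    (hV : IsOpenDense V) (hV' : IsOpenDense V') {s s' : P1 → F.Total}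
    (h : F.IsSection V s) (h' : F.IsSection V' s') :
    ∃ Q : RMat n, ∀ᶠ z : ℂ in cofinite, ∃ g : G, s' z = F.act (s z) g ∧
      MatVal Q z (g : GL (Fin n) ℂ) := by
  -- Any chart would do, since its domain is dense; the point at infinity only serves to name one.
  obtain ⟨c, hc, -⟩ := F.chart_cover OnePoint.infty
  obtain ⟨a, ha, e⟩ := h.2 c hc
  obtain ⟨a', ha', e'⟩ := h'.2 c hc
  obtain ⟨A, hA⟩ := ha.exists_matVal
  obtain ⟨A', hA'⟩ := ha'.exists_matVal
  refine ⟨A⁻¹ * A', ?_⟩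
  filter_upwards [hV.eventually, hV'.eventually, (F.chart_open c hc).eventually,
    eventually_matVal_inv A] with z h1 h2 h3 h4
  refine ⟨(a z)⁻¹ * a' z, ?_, ?_⟩
  · rw [e z ⟨h1, h3⟩, e' z ⟨h2, h3⟩, F.act_mul, mul_inv_cancel_left]
  · rw [Subgroup.coe_mul, Units.val_mul, Subgroup.coe_inv]
    exact (h4 _ (hA z ⟨h1, h3⟩)).mul (hA' z ⟨h2, h3⟩)

theorem Reduction.act_mem {F : PrincipalBundle.{u} G} {K : Subgroup (GL (Fin n) ℂ)}
    (E : Reduction F K) {p : F.Total} (hp : p ∈ E.carrier) {k : G} (hk : (k : GL (Fin n) ℂ) ∈ K) :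
    F.act p k ∈ E.carrier := by
  obtain ⟨V, -, hV, s, -, h⟩ := E.locally_trivial (F.proj p)
  obtain ⟨k', hk', e⟩ := (h p hV).1 hp
  refine (h _ (by rwa [F.proj_act])).2 ⟨k' * k, mul_mem hk' hk, ?_⟩
  rw [F.proj_act]
  conv_lhs => rw [e]
  rw [F.act_mul]

theorem Reduction.mem_of_act_mem {F : PrincipalBundle.{u} G} {K : Subgroup (GL (Fin n) ℂ)}
    (E : Reduction F K) {p : F.Total} {g : G} (hp : p ∈ E.carrier) (hg : F.act p g ∈ E.carrier) :
    (g : GL (Fin n) ℂ) ∈ K := by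
  obtain ⟨V, -, hV, s, -, h⟩ := E.locally_trivial (F.proj p)
  obtain ⟨k, hk, e⟩ := (h p hV).1 hp
  obtain ⟨k', hk', e'⟩ := (h _ (by rwa [F.proj_act])).1 hg
  rw [F.proj_act] at e'
  have h1 : F.act (s (F.proj p)) (k * g) = F.act (s (F.proj p)) k' := by
    rw [← F.act_mul, ← e, e']
  have h2 : g = k⁻¹ * k' := by rw [← F.act_inj h1, inv_mul_cancel_left]
  rw [h2]
  exact mul_mem (inv_mem hk) hk'

theorem Reduction.exists_section {F : PrincipalBundle.{u} G} {K : Subgroup (GL (Fin n) ℂ)}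
    (E : Reduction F K) : ∃ (V : Set P1) (s : P1 → F.Total), IsOpenDense V ∧ F.IsSection V s ∧
      (∀ x ∈ V, s x ∈ E.carrier) ∧ ∀ p ∈ E.carrier, F.proj p ∈ V →
        ∃ k : G, (k : GL (Fin n) ℂ) ∈ K ∧ p = F.act (s (F.proj p)) k := by
  obtain ⟨V, hV, -, s, hs, h⟩ := E.locally_trivial OnePoint.infty
  refine ⟨V, s, hV, hs, fun x hx => ?_, fun p hp hpV => (h p hpV).1 hp⟩
  have hx' := hs.1 x hx
  refine (h _ (by rwa [hx'])).2 ⟨1, one_mem _, ?_⟩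
  rw [hx', F.act_one]

theorem Reduction.IsTrivialization.mono {F : PrincipalBundle.{u} G} {K : Subgroup (GL (Fin n) ℂ)}
    {E : Reduction F K} {U U' : Set P1} {s : P1 → F.Total} (h : E.IsTrivialization U s)
    (hU : U' ⊆ U) : E.IsTrivialization U' s :=
  ⟨h.1.mono hU, fun x hx => h.2 x (hU hx)⟩

theorem scale_coe (ħ : ℂˣ) (z : ℂ) : scale ħ (z : P1) = (((ħ : ℂ) * z : ℂ) : P1) := rfl

/-- The matrix `M(ħz)`. -/
def scaleMat (ħ : ℂˣ) (M : RMat n) : RMat n := M.map (scaleRat ħ)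

theorem matVal_scaleMat {ħ : ℂˣ} {M : RMat n} {z : ℂ} {N : Mat n}
    (h : MatVal M ((ħ : ℂ) * z) N) : MatVal (scaleMat ħ M) z N :=
  fun i j => hasValueAt_scaleRat (h i j)

end HOper

end

/-! ### Trivializations of Miura opers, and the theorem. -/

noncomputable section

set_option linter.unusedSectionVars false

namespace HOper

open LieAlgebra LieAlgebra.IsKilling
open scoped Classical
open Filter

universe u

variable {n : ℕ} {L : Type*} [LieRing L] [LieAlgebra ℂ L] [FiniteDimensional ℂ L]
  [LieAlgebra.IsSimple ℂ L] {H : LieSubalgebra ℂ L} [H.IsCartanSubalgebra]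
  {b : (rootSystem H).Base} {ρ : L →ₗ⁅ℂ⁆ Mat n}

namespace Frame

variable (F : Frame b ρ)

/-- The torus part of a rational family in `B₋` is rational. -/
theorem exists_rat_torus {B : RMat n} {β : ℂ → GL (Fin n) ℂ}
    (h : ∀ᶠ z : ℂ in cofinite, β z ∈ Bminus ρ F.C ∧ MatVal B z (β z)) :
    ∃ T : RMat n, ∀ᶠ z : ℂ in cofinite, ∃ t ∈ torus ρ F.C, ∃ m ∈ Nminus ρ b,
      β z = t * m ∧ MatVal T z t := by
  refine ⟨constMat F.W.P * Matrix.diagonal (fun j => F.ratHat B j j) *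
    constMat ((F.W.P⁻¹ : GL (Fin n) ℂ) : Mat n), ?_⟩
  filter_upwards [h] with z ⟨hβ, hz⟩
  obtain ⟨t, ht, m, hm, e⟩ := F.mem_Bminus.1 hβ
  refine ⟨t, ht, m, hm, e, ?_⟩
  have h1 : MatVal (Matrix.diagonal fun j => F.ratHat B j j) z (F.W.hat t) := by
    rw [F.hat_torus ht]
    intro i j
    by_cases hij : i = j
    · subst hij
      rw [Matrix.diagonal_apply_eq, Matrix.diagonal_apply_eq,
        ← (F.hasDiag_Bminus ht hm).apply i, ← e]
      exact F.matVal_ratHat hz i i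
    · rw [Matrix.diagonal_apply_ne _ hij, Matrix.diagonal_apply_ne _ hij]
      exact HasValueAt.zero z
  have h2 := ((MatVal.const (F.W.P : Mat n) z).mul h1).mul
    (MatVal.const ((F.W.P⁻¹ : GL (Fin n) ℂ) : Mat n) z)
  have e2 := F.W.unhat_hat (t : Mat n)
  rw [WeightBasis.unhat] at e2
  rwa [e2] at h2

variable {s : b.support → GL (Fin n) ℂ}

theorem conj_torus (hs : ∀ i, IsReflectionLift ρ b i (s i)) (l : List b.support)
    {t : GL (Fin n) ℂ} (ht : t ∈ torus ρ F.C) :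
    (l.map s).prod * t * ((l.map s).prod)⁻¹ ∈ torus ρ F.C := by
  induction l with
  | nil => simpa using ht
  | cons i l ih =>
    obtain ⟨t', ht', e⟩ := F.refl_torus (refl_acts hs i) ih
    have : ((i :: l).map s).prod * t * (((i :: l).map s).prod)⁻¹ = t' := by
      rw [List.map_cons, List.prod_cons, mul_inv_rev]
      calc _ = s i * ((l.map s).prod * t * ((l.map s).prod)⁻¹) * (s i)⁻¹ := by
            simp only [mul_assoc]
        _ = t' := by rw [e, mul_inv_cancel_right]
    rwa [this]

theorem coxeterLift_eq {r : ℕ} (ord : Fin r ≃ b.support) :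
    coxeterLift ord s = ((List.ofFn ord).map s).prod := ofFn_prod ord s

theorem mem_operCell {r : ℕ} {ord : Fin r ≃ b.support} {φ : b.support → (RatFunc ℂ)ˣ}
    {M M₁ M₂ : RMat n}
    (h : ∀ᶠ z : ℂ in cofinite, ∃ c : b.support → ℂ, (∀ i, c i ≠ 0) ∧
      (∀ i, HasValueAt (φ i) (z : P1) (c i)) ∧ ∃ m₁ ∈ Nminus ρ b, ∃ m₂ ∈ Nminus ρ b,
        MatVal M₁ z m₁ ∧ MatVal M₂ z m₂ ∧
        MatVal M z (m₁ * F.coxProd s c (List.ofFn ord) * m₂ : GL (Fin n) ℂ)) :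
    M ∈ operCell ρ F.C ord s φ := by
  refine ⟨M₁, mem_points_of_frequently (h.mono ?_), M₂, mem_points_of_frequently (h.mono ?_), ?_⟩
  · rintro z ⟨c, -, -, m₁, hm₁, m₂, -, h1, -⟩
    exact ⟨m₁, hm₁, h1⟩
  · rintro z ⟨c, -, -, m₁, -, m₂, hm₂, -, h2, -⟩
    exact ⟨m₂, hm₂, h2⟩
  · refine matrix_eq_of_frequently (h.mono ?_).frequently
    rintro z ⟨c, hc, hcv, m₁, hm₁, m₂, hm₂, h1, h2, h3⟩
    refine ⟨_, h3, ?_⟩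
    rw [Units.val_mul, Units.val_mul]
    refine (h1.mul ?_).mul h2
    have := F.matVal_coxProd s (List.ofFn ord) hc hcv
    rw [← ofFn_prod ord fun i => corootPow ρ F.C i (φ i) * constMat (s i : Mat n)] at this
    exact this

/-- A double coset of `B₋` over the rational functions consists of elements of cells. -/
theorem exists_operCell_of_double_coset (hs : ∀ i, IsReflectionLift ρ b i (s i)) {r : ℕ}
    (ord : Fin r ≃ b.support) {B B' : RMat n} {β β' : ℂ → GL (Fin n) ℂ}
    (h : ∀ᶠ z : ℂ in cofinite, β z ∈ Bminus ρ F.C ∧ MatVal B z (β z))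
    (h' : ∀ᶠ z : ℂ in cofinite, β' z ∈ Bminus ρ F.C ∧ MatVal B' z (β' z)) :
    ∃ φ : b.support → (RatFunc ℂ)ˣ,
      B * constMat (coxeterLift ord s : GL (Fin n) ℂ) * B' ∈ operCell ρ F.C ord s φ := by
  obtain ⟨T, hT⟩ := F.exists_rat_torus h
  obtain ⟨T', hT'⟩ := F.exists_rat_torus h'
  obtain ⟨E, hE⟩ := F.exists_coxProd hs (List.ofFn ord) (ofFn_nodup ord)
  set c : GL (Fin n) ℂ := coxeterLift ord s with hc
  rw [coxeterLift_eq] at hc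
  -- The values of `W` are t c t' c⁻¹: the two torus parts, with the second moved to the left of the
  -- Coxeter element. The functions `Γ` are its coordinates.
  let W : RMat n := T * constMat c * T' * constMat ((c⁻¹ : GL (Fin n) ℂ) : Mat n)
  let Γ : b.support → RatFunc ℂ := fun i => ∏ j, (F.ratHat W j j) ^ F.fund i j
  have key : ∀ᶠ z : ℂ in cofinite, ∃ γ : b.support → ℂˣ,
      (∀ i, HasValueAt (Γ i) (z : P1) (γ i)) ∧ ∃ t t' m m' : GL (Fin n) ℂ, t ∈ torus ρ F.C ∧
        m ∈ Nminus ρ b ∧ m' ∈ Nminus ρ b ∧ β z = t * m ∧ β' z = t' * m' ∧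
        MatVal T z t ∧ MatVal T' z t' ∧ t * c * t' = F.tor γ * c := by
    filter_upwards [hT, hT'] with z ⟨t, ht, m, hm, e, hz⟩ ⟨t', ht', m', hm', e', hz'⟩
    have hw : t * (c * t' * c⁻¹) ∈ torus ρ F.C := by
      rw [hc]
      exact mul_mem ht (F.conj_torus hs _ ht')
    obtain ⟨γ, hγ⟩ := F.mem_torus.1 hw
    refine ⟨γ, fun i => ?_, t, t', m, m', ht, hm, hm', e, e', hz, hz', ?_⟩
    · rw [F.tor_coord γ i, ← hγ]
      refine HasValueAt.prod _ fun j _ => HasValueAt.zpow (F.matVal_ratHat ?_ j j)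
        (F.hat_torus_ne_zero hw j) _
      have := ((hz.mul (MatVal.const (c : Mat n) z)).mul hz').mul
        (MatVal.const ((c⁻¹ : GL (Fin n) ℂ) : Mat n) z)
      simpa only [W, ← Units.val_mul, mul_assoc] using this
    · rw [← hγ]; group
  have hΓ : ∀ᶠ z : ℂ in cofinite, ∀ γ : b.support → ℂˣ, (∀ i, HasValueAt (Γ i) (z : P1) (γ i)) →
      ∀ i, HasValueAt (∏ k, Γ k ^ E i k) (z : P1) ((∏ k, γ k ^ E i k : ℂˣ) : ℂ) := by
    refine Eventually.of_forall fun z γ hγ i => ?_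
    rw [Units.coe_prod]
    refine HasValueAt.prod _ fun k _ => ?_
    rw [Units.val_zpow_eq_zpow_val]
    exact (hγ k).zpow (γ k).ne_zero _
  have hne : ∀ i, ∏ k, Γ k ^ E i k ≠ 0 := by
    intro i h0
    obtain ⟨z, ⟨γ, h1, -⟩, h2⟩ := (key.and hΓ).exists
    have h3 := h2 γ h1 i
    rw [h0] at h3
    exact Units.ne_zero _ (h3.unique (HasValueAt.zero z))
  -- With β = t m and β' = t' m', the two unipotent factors t m t⁻¹ and m' are the values of these
  -- rational matrices.
  refine ⟨fun i => Units.mk0 _ (hne i), F.mem_operCell (M₁ := B * T⁻¹) (M₂ := T'⁻¹ * B') ?_⟩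
  filter_upwards [key, hΓ, h, h', eventually_matVal_inv T, eventually_matVal_inv T'] with
    z ⟨γ, h1, t, t', m, m', ht, hm, hm', e, e', hz, hz', e2⟩ h2 ⟨_, hB⟩ ⟨_, hB'⟩ h3 h4
  refine ⟨fun i => ((∏ k, γ k ^ E i k : ℂˣ) : ℂ), fun i => Units.ne_zero _, h2 γ h1,
    t * m * t⁻¹, F.torus_conj_Nminus (F.torus_acts ht) (F.torus_le ht) hm, m', hm', ?_, ?_, ?_⟩
  · rw [← e, Units.val_mul]
    exact hB.mul (h3 t hz)
  · have : m' = t'⁻¹ * β' z := by rw [e', inv_mul_cancel_left]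
    rw [this, Units.val_mul]
    exact (h4 t' hz').mul hB'
  · rw [← hE γ fun i hi => absurd (mem_ofFn ord i) hi, ← hc, ← e2]
    have : t * m * t⁻¹ * (t * c * t') * m' = β z * c * β' z := by rw [e, e']; group
    rw [this, Units.val_mul, Units.val_mul]
    exact (hB.mul (MatVal.const _ z)).mul hB'

variable {ħ : ℂˣ} {Fb : PrincipalBundle.{u} (chevalleyGroup H ρ)} (A : Connection ħ Fb)

/-- In a suitable trivialization the connection of an oper lies in a cell. -/
theorem exists_cell_trivialization (hs : ∀ i, IsReflectionLift ρ b i (s i)) {r : ℕ}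
    (ord : Fin r ≃ b.support) (E : Reduction Fb (Bminus ρ F.C))
    (h : IsOper A E (coxeterLift ord s)) :
    ∃ (φ : b.support → (RatFunc ℂ)ˣ) (U : Set P1) (σ : P1 → Fb.Total),
      IsOpenDense U ∧ E.IsTrivialization U σ ∧
        ∃ M ∈ operCell ρ F.C ord s φ, IsConnectionMatrix A U σ M := by
  obtain ⟨U, σ, hU, hσ, β, β', hβ, hβ', h1⟩ := h
  obtain ⟨B, hB⟩ := hβ.exists_matVal
  obtain ⟨B', hB'⟩ := hβ'.exists_matVal
  have hV : ∀ᶠ z : ℂ in cofinite, (z : P1) ∈ U ∩ scale ħ ⁻¹' U := by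
    filter_upwards [hU.eventually, eventually_mul ħ hU.eventually] with z h2 h3
    exact ⟨h2, h3⟩
  obtain ⟨φ, hφ⟩ := F.exists_operCell_of_double_coset hs ord (B := B) (B' := B')
    (β := fun z => β z) (β' := fun z => β' z) (hV.mono fun z hz => ⟨hβ.2 _ hz, hB z hz⟩)
    (hV.mono fun z hz => ⟨hβ'.2 _ hz, hB' z hz⟩)
  -- The section is kept; only the point at infinity is dropped, where values of matrices are not
  -- used.
  refine ⟨φ, affine fun z => (z : P1) ∈ U, σ, isOpenDense_affine hU.eventually,
    hσ.mono ?_, _, hφ, ?_⟩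
  · rintro x ⟨z, rfl, hz⟩
    exact hz
  · intro x hx
    obtain ⟨z, rfl, hz, hz'⟩ := mem_affine_scale hx
    obtain ⟨h2, g, h3, h4⟩ := h1 z ⟨hz, hz'⟩
    refine ⟨h2, g, h4, ?_⟩
    change MatVal _ z _
    rw [h3, Units.val_mul, Units.val_mul]
    exact ((hB z ⟨hz, hz'⟩).mul (MatVal.const _ z)).mul (hB' z ⟨hz, hz'⟩)

/-- The two reductions are in generic relative position. -/
theorem eventually_relative_position (hs : ∀ i, IsReflectionLift ρ b i (s i)) {r : ℕ}
    {ord : Fin r ≃ b.support} (E : Reduction Fb (Bplus ρ F.C))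
    (hE : ∀ p ∈ E.carrier, Fb.proj p ∈ A.dom → A.toFun p ∈ E.carrier)
    {φ : b.support → (RatFunc ℂ)ˣ} {U : Set P1} {σ : P1 → Fb.Total} (hU : IsOpenDense U)
    (hσ : Fb.IsSection U σ) {M : RMat n} (hM : M ∈ operCell ρ F.C ord s φ)
    (hA : IsConnectionMatrix A U σ M) {V : Set P1} {q : P1 → Fb.Total} (hV : IsOpenDense V)
    (hq : Fb.IsSection V q) (hqE : ∀ x ∈ V, q x ∈ E.carrier)
    (hEq : ∀ p ∈ E.carrier, Fb.proj p ∈ V →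
      ∃ k : chevalleyGroup H ρ, (k : GL (Fin n) ℂ) ∈ Bplus ρ F.C ∧
        p = Fb.act (q (Fb.proj p)) k) {Q : RMat n}
    (hQ : ∀ᶠ z : ℂ in cofinite, ∃ g : chevalleyGroup H ρ, q z = Fb.act (σ z) g ∧
      MatVal Q z (g : GL (Fin n) ℂ)) :
    ∀ᶠ z : ℂ in cofinite, ∃ m ∈ Nminus ρ b, ∃ β ∈ Bplus ρ F.C, ∃ g : chevalleyGroup H ρ,
      q z = Fb.act (σ z) g ∧ MatVal Q z (g : GL (Fin n) ℂ) ∧ (g : GL (Fin n) ℂ) = m * β := by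
  obtain ⟨d, hd⟩ := F.eventually_rk Q
  filter_upwards [hQ, eventually_mul ħ hQ, hd, eventually_mul ħ hd, hU.eventually,
    eventually_mul ħ hU.eventually, hV.eventually, eventually_mul ħ hV.eventually,
    F.eventually_operCell hM] with z ⟨g, hg, hgQ⟩ ⟨g', hg', hgQ'⟩ hr hr' h1 h2 h3 h4
    ⟨c, hc, _, m₁, hm₁, m₂, hm₂, h5⟩
  obtain ⟨hdom, a, ha, haM⟩ := hA z ⟨h1, h2⟩
  have ea : m₁ * F.coxProd s c (List.ofFn ord) * m₂ = (a : GL (Fin n) ℂ) :=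
    Units.ext (h5.unique haM)
  have hpq : Fb.proj (q z) ∈ A.dom := by rwa [hq.1 _ h3]
  have hpσ : Fb.proj (σ z) ∈ A.dom := by rwa [hσ.1 _ h1]
  have hproj : Fb.proj (A.toFun (q z)) = (((ħ : ℂ) * z : ℂ) : P1) := by
    rw [A.proj_toFun _ hpq, hq.1 _ h3, scale_coe]
  obtain ⟨k, hk, e⟩ := hEq _ (hE _ (hqE _ h3) hpq) (by rwa [hproj])
  -- Invariance of the B₊-reduction says that the connection matrix times g(z) is g(ħz) times an
  -- element of B₊.
  rw [hproj, hg', hg, A.equivariant _ _ hpσ, ha, scale_coe, Fb.act_mul, Fb.act_mul] at e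
  have e1 := congrArg (Subgroup.subtype _) (Fb.act_inj e)
  simp only [map_mul, Subgroup.subtype_apply] at e1
  rw [← ea] at e1
  -- The points z and ħz are both generic, so g(z) and g(ħz) share the generic ranks.
  obtain ⟨m, hm, β, hβ, e2⟩ := F.exists_factor hs hc (ofFn_nodup ord) (mem_ofFn ord) hm₁ hm₂ g.2
    hk e1 fun k q p => by rw [hr _ hgQ, hr' _ hgQ']
  exact ⟨m, hm, β, hβ, g, hg, hgQ, e2⟩

/-- A trivialization compatible with both reductions. -/
theorem exists_miura_trivialization (hs : ∀ i, IsReflectionLift ρ b i (s i)) {r : ℕ}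
    {ord : Fin r ≃ b.support} (E' : Reduction Fb (Bminus ρ F.C)) (E : Reduction Fb (Bplus ρ F.C))
    (hE : ∀ p ∈ E.carrier, Fb.proj p ∈ A.dom → A.toFun p ∈ E.carrier)
    {φ : b.support → (RatFunc ℂ)ˣ} {U : Set P1} {σ : P1 → Fb.Total} (hU : IsOpenDense U)
    (hσ : E'.IsTrivialization U σ) {M : RMat n} (hM : M ∈ operCell ρ F.C ord s φ)
    (hA : IsConnectionMatrix A U σ M) :
    ∃ (U : Set P1) (σ : P1 → Fb.Total), IsOpenDense U ∧
      E'.IsTrivialization U σ ∧ E.IsTrivialization U σ ∧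
        ∃ M ∈ operCell ρ F.C ord s φ ∩ points (Bplus ρ F.C) (RatFunc ℂ),
          IsConnectionMatrix A U σ M := by
  obtain ⟨V, q, hV, hq, hqE, hEq⟩ := E.exists_section
  obtain ⟨Q, hQ⟩ := PrincipalBundle.exists_transition hU hV hσ.1 hq
  -- The factor is chosen point by point; `exists_rat_factor` makes its inverse the value of a
  -- rational matrix for any such choice.
  obtain ⟨m, hm⟩ := (F.eventually_relative_position A hs E hE hU hσ.1 hM hA hV hq hqE hEq
    hQ).choice
  obtain ⟨X, hX⟩ := F.exists_rat_factor (Gm := Q) (m := m) (hm.mono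
    fun z ⟨h1, β, h2, g, _, h3, h4⟩ => ⟨h1, β, h2, by rwa [← h4]⟩)
  let p : ℂ → Prop := fun z => (z : P1) ∈ U ∧ (z : P1) ∈ V ∧ m z ∈ Nminus ρ b ∧
    (∃ β ∈ Bplus ρ F.C, ∃ g : chevalleyGroup H ρ,
      q z = Fb.act (σ z) g ∧ (g : GL (Fin n) ℂ) = m z * β) ∧
    MatVal X z (((m z)⁻¹ : GL (Fin n) ℂ) : Mat n) ∧ MatVal X⁻¹ z (m z)
  have hp : ∀ᶠ z in cofinite, p z := by
    filter_upwards [hU.eventually, hV.eventually, hm, hX, eventually_matVal_inv X]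
      with z h1 h2 ⟨h3, β, h4, g, h5, _, h6⟩ h7 h8
    refine ⟨h1, h2, h3, ⟨β, h4, g, h5, h6⟩, h7, ?_⟩
    have := h8 _ h7
    rwa [inv_inv] at this
  -- The values at infinity and off the good points are irrelevant and are set to 1 where no group
  -- element is available.
  let a : P1 → chevalleyGroup H ρ := Function.extend (fun z : ℂ => (z : P1))
    (fun z => if h : m z ∈ chevalleyGroup H ρ then ⟨m z, h⟩ else 1) 1
  have ha : ∀ z : ℂ, p z → (a z : GL (Fin n) ℂ) = m z := by
    intro z hz
    have h1 : a z = if h : m z ∈ chevalleyGroup H ρ then ⟨m z, h⟩ else 1 :=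
      OnePoint.coe_injective.extend_apply _ _ _
    rw [h1, dif_pos (Nminus_le hz.2.2.1)]
  have hUp : affine p ⊆ U := by
    rintro x ⟨z, rfl, hz⟩
    exact hz.1
  have hsec : Fb.IsSection (affine p) fun x => Fb.act (σ x) (a x) :=
    hσ.1.act hUp (M := X⁻¹) fun z hz => by rw [ha z hz]; exact hz.2.2.2.2.2
  have hE'σ : ∀ x ∈ affine p, Fb.act (σ x) (a x) ∈ E'.carrier := by
    rintro x ⟨z, rfl, hz⟩
    refine E'.act_mem (hσ.2 _ hz.1) ?_
    rw [ha z hz]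
    exact F.Nminus_le_Bminus hz.2.2.1
  have hEσ : ∀ x ∈ affine p, Fb.act (σ x) (a x) ∈ E.carrier := by
    rintro x ⟨z, rfl, hz⟩
    obtain ⟨β, hβ, g, hg, e⟩ := hz.2.2.2.1
    have h1 : Fb.act (σ z) (a z) = Fb.act (q z) (g⁻¹ * a z) := by
      rw [hg, Fb.act_mul, mul_inv_cancel_left]
    rw [h1]
    refine E.act_mem (hqE _ hz.2.1) ?_
    rw [Subgroup.coe_mul, Subgroup.coe_inv, ha z hz, e, mul_inv_rev, inv_mul_cancel_right]
    exact inv_mem hβ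
  -- The gauge change by m replaces M by m(ħz)⁻¹ M m(z), which keeps the element between the same
  -- copies of N₋; `X` stands for m⁻¹.
  have hcon : ∀ z, p z → p (ħ * z) → (z : P1) ∈ A.dom ∧ ∃ g : chevalleyGroup H ρ,
      A.toFun (Fb.act (σ z) (a z)) = Fb.act (Fb.act (σ (scale ħ z)) (a (scale ħ z))) g ∧
        MatVal (scaleMat ħ X * M * X⁻¹) z (g : GL (Fin n) ℂ) := by
    intro z hz hz'
    obtain ⟨hdom, g, hg, hgM⟩ := hA z ⟨hz.1, hz'.1⟩
    refine ⟨hdom, (a (scale ħ z))⁻¹ * g * a z, ?_, ?_⟩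
    · rw [A.equivariant _ _ (by rwa [hσ.1.1 _ hz.1]), hg, Fb.act_mul, Fb.act_mul, mul_assoc,
        mul_inv_cancel_left]
    · rw [Subgroup.coe_mul, Subgroup.coe_mul, Subgroup.coe_inv, scale_coe, ha z hz, ha _ hz',
        Units.val_mul, Units.val_mul]
      exact ((matVal_scaleMat hz'.2.2.2.2.1).mul hgM).mul hz.2.2.2.2.2
  have hpp : ∀ᶠ z in cofinite, p z ∧ p (ħ * z) := hp.and (eventually_mul ħ hp)
  refine ⟨affine p, fun x => Fb.act (σ x) (a x), isOpenDense_affine hp, ⟨hsec, hE'σ⟩,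
    ⟨hsec, hEσ⟩, scaleMat ħ X * M * X⁻¹, ⟨?_, ?_⟩, ?_⟩
  · obtain ⟨m₁, hm₁, m₂, hm₂, rfl⟩ := hM
    refine ⟨scaleMat ħ X * m₁, mem_points_of_frequently ?_, m₂ * X⁻¹,
      mem_points_of_frequently ?_, by simp only [mul_assoc]⟩
    · filter_upwards [hpp, eventually_unit_of_points hm₁] with z hz ⟨g, h1, h2⟩
      refine ⟨(m (ħ * z))⁻¹ * g, mul_mem (inv_mem hz.2.2.2.1) (mem_Nminus_of_inClosure F h2), ?_⟩
      rw [Units.val_mul]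
      exact (matVal_scaleMat hz.2.2.2.2.2.1).mul h1
    · filter_upwards [hpp, eventually_unit_of_points hm₂] with z hz ⟨g, h1, h2⟩
      refine ⟨g * m z, mul_mem (mem_Nminus_of_inClosure F h2) hz.1.2.2.1, ?_⟩
      rw [Units.val_mul]
      exact h1.mul hz.1.2.2.2.2.2
  · refine mem_points_of_frequently (hpp.mono fun z hz => ?_)
    obtain ⟨hdom, g, hg, hgM⟩ := hcon z hz.1 hz.2
    refine ⟨g, ?_, hgM⟩
    refine E.mem_of_act_mem (hEσ _ (coe_mem_affine.2 hz.2)) (p := _) (g := g) ?_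
    have h1 := hE _ (hEσ _ (coe_mem_affine.2 hz.1))
      (by rwa [Fb.proj_act, hσ.1.1 _ hz.1.1])
    rwa [hg, scale_coe] at h1
  · intro x hx
    obtain ⟨z, rfl, hz, hz'⟩ := mem_affine_scale hx
    exact hcon z hz hz'

end Frame

end HOper

end

theorem mainTheorem5 {n : ℕ} {L : Type*} [LieRing L] [LieAlgebra ℂ L] [FiniteDimensional ℂ L]
    [LieAlgebra.IsSimple ℂ L] (H : LieSubalgebra ℂ L) [H.IsCartanSubalgebra]
    (b : (LieAlgebra.IsKilling.rootSystem H).Base) (C : HOper.ChevalleyGenerators b)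
    (ρ : L →ₗ⁅ℂ⁆ Matrix (Fin n) (Fin n) ℂ) (hsc : HOper.IsSimplyConnected H ρ) :
    -- (i)
    (∀ (ħ : ℂˣ) {r : ℕ} (ord : Fin r ≃ b.support) (s : b.support → GL (Fin n) ℂ),
      (∀ i, HOper.IsReflectionLift ρ b i (s i)) →
      ∀ O : HOper.MiuraOper ħ (HOper.chevalleyGroup H ρ) (HOper.Bminus ρ C) (HOper.Bplus ρ C)
          (HOper.coxeterLift ord s),
        (∃ (φ : b.support → (RatFunc ℂ)ˣ) (U : Set HOper.P1) (σ : HOper.P1 → O.bundle.Total),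
          HOper.IsOpenDense U ∧ O.minus.IsTrivialization U σ ∧
          ∃ M ∈ HOper.operCell ρ C ord s φ, HOper.IsConnectionMatrix O.conn U σ M) ∧
        ∀ φ : b.support → (RatFunc ℂ)ˣ,
          (∃ (U : Set HOper.P1) (σ : HOper.P1 → O.bundle.Total),
            HOper.IsOpenDense U ∧ O.minus.IsTrivialization U σ ∧
            ∃ M ∈ HOper.operCell ρ C ord s φ, HOper.IsConnectionMatrix O.conn U σ M) →
          ∃ (U : Set HOper.P1) (σ : HOper.P1 → O.bundle.Total),
            HOper.IsOpenDense U ∧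
            O.minus.IsTrivialization U σ ∧ O.plus.IsTrivialization U σ ∧
            ∃ M ∈ HOper.operCell ρ C ord s φ ∩ HOper.points (HOper.Bplus ρ C) (RatFunc ℂ),
              HOper.IsConnectionMatrix O.conn U σ M) ∧
    -- (ii)
    ∃ τ : b.support → GL (Fin n) ℂ → ℂˣ,
      ∀ {r : ℕ} (ord : Fin r ≃ b.support) (s : b.support → GL (Fin n) ℂ),
        (∀ i, HOper.IsReflectionLift ρ b i (s i)) →
        ∃ t : b.support → ℂˣ,
          ((∀ i, s i ∈ HOper.simpleSL2 ρ b i) → ∀ i, t i = τ i (s i)) ∧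
          ∀ φ : b.support → (RatFunc ℂ)ˣ,
            ∀ M ∈ HOper.operCell ρ C ord s φ ∩ HOper.points (HOper.Bplus ρ C) (RatFunc ℂ),
              ∃ g : b.support → (RatFunc ℂ)ˣ, M = HOper.miuraForm ρ C ord t φ g := by
  -- The weight basis and the coweights are chosen once, before the order and the lifts, so the
  -- constants in the `SL₂` case come from a single function.
  obtain ⟨F, rfl⟩ := HOper.Frame.nonempty C hsc
  refine ⟨fun ħ r ord s hs O => ⟨F.exists_cell_trivialization O.conn hs ord O.minus O.oper, ?_⟩,
    F.liftConst, fun ord s hs => F.exists_constants ord s hs⟩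
  rintro φ ⟨U, σ, hU, hσ, M, hM, hA⟩
  exact F.exists_miura_trivialization O.conn hs O.minus O.plus O.preserved hU hσ hM hA
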